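/- Let $M$ be a smooth manifold and $n\ge 0$. For a smooth family of cartesian spaces $\hat c\to c$ (a smooth fibre bundle over a cartesian space with cartesian fibre; up to isomorphism, $\mathbb R^m\times\mathbb R^j\to\mathbb R^m$) and $0\le k\le n+1$, let $\mathrm{D}_k(\hat c\to c)$ be the chain complex $$\mathrm{U}(1)\xrightarrow{d^v\log}\Omega^{1,v}\xrightarrow{d^v}\cdots\xrightarrow{d^v}\Omega^{k,v}$$ of smooth $\mathrm U(1)$-valued functions and vertical differential forms on $\hat c$, with $\mathrm U(1)$ in degree $n+1$ and $\Omega^{p,v}$ in degree $n+1-p$, and let $\Gamma \mathrm{D}_k$ be the simplicial presheaf obtained from it by the Dold--Kan correspondence. Let $\mathrm B\mathscr D$ be the category whose objects are the cartesian spaces $c$ (manifolds diffeomorphic to some $\mathbb R^m$) and whose morphisms $c\to d$ are pairs $(f,\varphi)$ of a smooth map $f:c\to d$ and a smooth family $\varphi$ of diffeomorphisms of $M$ parametrised by $c$. Let $\mathrm{GCov}^{\mathscr D}$ be the category whose objects $X=(c,\{\hat U_a\to U_a\}_{a\in\Lambda})$ consist of a cartesian space $c$ and good open coverings $\{\hat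 U_a\}$ of $c\times M$ and $\{U_a\}$ of $c$ such that every $\hat U_a$ lies over $U_a$, each $\hat U_a\to U_a$ is a smooth family of cartesian spaces, and so is each finite intersection $\hat U_{a_0\cdots a_l}\to U_{a_0\cdots a_l}$ unless $\hat U_{a_0\cdots a_l}=\emptyset$; its morphisms are pairs of a morphism $(f,\varphi)$ in $\mathrm B\mathscr D$ and a map $\lambda$ of index sets such that $(x,z)\mapsto(f(x),\varphi_x(z))$ sends $\hat U_a$ to $\hat V_{\lambda(a)}$ and $f$ sends $U_a$ to $V_{\lambda(a)}$. Let $\check{C}X$ denote the Čech nerve of $X$, a simplicial presheaf on families of cartesian spaces. Put $$\widetilde{\mathrm{Grb}}{}^{n,\mathscr D}_{\nabla|k}(X)=\underline{\mathrm{Map}}(\check{C}X,\Gamma \mathrm{D}_k)$$ (the simplicial mapping space), and let $\mathrm{Grb}^{n,\mathscr D}_{\nabla|k}$ be the simplicial presheaf on $\mathrm B\mathscr D$ given by the left Kan extension of $\widetilde{\mathrm{Grb}}{}^{n,\mathscr D}_{\nabla|k}$ along the functor $\mathrm{GCov}^{\mathscr D}\to\mathrm B\mathscr D$ forgetting the coverings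 (the presheaf of $n$-gerbes on $M$ with $k$-connection). For $l\le k$ let $p^k_l:\mathrm{Grb}^{n,\mathscr D}_{\nabla|k}\to\mathrm{Grb}^{n,\mathscr D}_{\nabla|l}$ be the map which forgets the forms of degree greater than $l$. 1. For all $0\le l\le k\le n$, $\mathrm{Grb}^{n,\mathscr D}_{\nabla|k}$ and $\mathrm{Grb}^{n,\mathscr D}_{\nabla|l}$ are projectively fibrant (objectwise Kan complexes), and $p^k_l$ is a projective fibration (objectwise a Kan fibration) which is $0$-connected: for every cartesian space $c$ it induces a bijection $\pi_0\,\mathrm{Grb}^{n,\mathscr D}_{\nabla|k}(c)\to\pi_0\,\mathrm{Grb}^{n,\mathscr D}_{\nabla|l}(c)$. 2. If $M\ne\emptyset$, there are bijections $\theta_k:\pi_0\,\mathrm{Grb}^{n,\mathscr D}_{\nabla|k}(c)\cong \mathrm H^{n+2}(M;\mathbb Z)$ for all $k\le n$ and all cartesian spaces $c$, where the right-hand side is Čech cohomology, with $\theta_l\circ\pi_0(p^k_l)=\theta_k$ for $l\le k\le n$. For every $X$ over $c$ as above, $\theta_k$ composed with the canonical map $\pi_0\,\widetilde{\mathrm{Grb}}{}^{n,\mathscr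 D}_{\nabla|k}(X)\to\pi_0\,\mathrm{Grb}^{n,\mathscr D}_{\nabla|k}(c)$ is an isomorphism of abelian groups $\pi_0\,\widetilde{\mathrm{Grb}}{}^{n,\mathscr D}_{\nabla|k}(X)\cong\mathrm H^{n+2}(M;\mathbb Z)$. It is given as follows: let $g=(g_{a_0\cdots a_{n+1}}:\hat U_{a_0\cdots a_{n+1}}\to \mathrm U(1))$ be the transition functions of a vertex $v$ of $\widetilde{\mathrm{Grb}}{}^{n,\mathscr D}_{\nabla|k}(X)$. There are continuous functions $h_{a_0\cdots a_{n+1}}$ on $\hat U_{a_0\cdots a_{n+1}}$ with $\exp(2\pi i\,h)=g$ for which the Čech differential $\delta h$ is an integral Čech cocycle, and for every such choice the pullback of $\theta_k[v]$ along the projection $\mathrm{pr}_M:c\times M\to M$ is the class of $\delta h$ in $\mathrm H^{n+2}(c\times M;\mathbb Z)$. 3. The $0$-connectedness fails in general for $k=n+1$: for $M=\mathbb R^{n+2}$, every $l\le n$ and every cartesian space $c$, the map $\pi_0\,\mathrm{Grb}^{n,\mathscr D}_{\nabla|n+1}(c)\to\pi_0\,\mathrm{Grb}^{n,\mathscr D}_{\nabla|l}(c)$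 induced by $p^{n+1}_l$ is not bijective. -/

import Mathlib

open CategoryTheory Opposite
open scoped Manifold ContDiff

namespace HigherGerbe

/-! ### Smooth families of cartesian spaces -/

/-- The cartesian space `ℝᵐ`. -/
abbrev E (m : ℕ) : Type := EuclideanSpace ℝ (Fin m)

/-- The category of smooth families of cartesian spaces: the object `⟨m, j⟩` is the
(trivial) bundle `ℝᵐ × ℝʲ → ℝᵐ`.  Smooth fibre bundles over a cartesian space with cartesian
fibre are globally trivial, so this is the category of all of them, up to equivalence. -/
structure CartFam where
  baseDim : ℕ
  fibDim : ℕ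

namespace CartFam

/-- The total space of a family of cartesian spaces. -/
abbrev Total (T : CartFam) : Type := E T.baseDim × E T.fibDim

/-- Morphisms are commutative squares of smooth maps. -/
@[ext]
structure Hom (S T : CartFam) where
  total : S.Total → T.Total
  base : E S.baseDim → E T.baseDim
  contDiff_total : ContDiff ℝ ∞ total
  contDiff_base : ContDiff ℝ ∞ base
  comm : ∀ p, (total p).1 = base p.1

instance : Category CartFam where
  Hom := Hom
  id T := ⟨id, id, contDiff_id, contDiff_id, fun _ => rfl⟩
  comp f g := ⟨g.total ∘ f.total, g.base ∘ f.base, g.contDiff_total.comp f.contDiff_total,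
    g.contDiff_base.comp f.contDiff_base, fun p => by
      simp [g.comm, f.comm]⟩

/-- The map induced by a morphism on the fibres over `x`. -/
def Hom.fib {S T : CartFam} (f : S ⟶ T) (x : E S.baseDim) (y : E S.fibDim) : E T.fibDim :=
  (f.total (x, y)).2

lemma Hom.total_eq {S T : CartFam} (f : S ⟶ T) (x : E S.baseDim) (y : E S.fibDim) :
    f.total (x, y) = (f.base x, Hom.fib f x y) := Prod.ext (f.comm _) rfl

lemma Hom.contDiff_fib {S T : CartFam} (f : S ⟶ T) (x : E S.baseDim) :
    ContDiff ℝ ∞ (Hom.fib f x) :=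
  contDiff_snd.comp (f.contDiff_total.comp (contDiff_prodMk_right x))

end CartFam

/-! ### Vertical differential forms -/

/-- The derivative along the fibre direction. -/
noncomputable def vderiv {T : CartFam} {F : Type*} [NormedAddCommGroup F] [NormedSpace ℝ F]
    (u : T.Total → F) (p : T.Total) : E T.fibDim →L[ℝ] F :=
  fderiv ℝ (fun y => u (p.1, y)) p.2

lemma vderiv_eq {T : CartFam} {F : Type*} [NormedAddCommGroup F] [NormedSpace ℝ F]
    {u : T.Total → F} (hu : ContDiff ℝ ∞ u) (p : T.Total) :
    vderiv u p = (fderiv ℝ u p).comp (ContinuousLinearMap.inr ℝ _ _) := by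
  have h1 : HasFDerivAt u (fderiv ℝ u (p.1, p.2)) (p.1, p.2) :=
    (hu.differentiable (by simp) _).hasFDerivAt
  exact (h1.comp p.2 (hasFDerivAt_prodMk_right p.1 p.2)).fderiv

lemma contDiff_vderiv {T : CartFam} {F : Type*} [NormedAddCommGroup F] [NormedSpace ℝ F]
    {u : T.Total → F} (hu : ContDiff ℝ ∞ u) : ContDiff ℝ ∞ (vderiv u) := by
  have : vderiv u = fun p => (fderiv ℝ u p).comp (ContinuousLinearMap.inr ℝ _ _) :=
    funext (vderiv_eq hu)
  rw [this]
  exact (hu.fderiv_right (m := ∞) (by simp)).clm_comp contDiff_const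

/-- Vertical differential `k`-forms on a family of cartesian spaces: smooth sections of the
`k`-th exterior power of the dual of the vertical tangent bundle. -/
def vForm (T : CartFam) (k : ℕ) : AddSubgroup (T.Total → E T.fibDim [⋀^Fin k]→L[ℝ] ℝ) where
  carrier := {α | ContDiff ℝ ∞ α}
  add_mem' := fun {a b} h1 h2 =>
    (show ContDiff ℝ ∞ a from h1).add (show ContDiff ℝ ∞ b from h2)
  zero_mem' := show ContDiff ℝ ∞ _ from contDiff_const
  neg_mem' := fun {a} h => (show ContDiff ℝ ∞ a from h).neg

lemma vForm.contDiff {T : CartFam} {k : ℕ} (α : vForm T k) : ContDiff ℝ ∞ α.1 := α.2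

lemma minSmoothness_two_le : minSmoothness ℝ 2 ≤ (∞ : WithTop ℕ∞) := by
  simp only [minSmoothness_of_isRCLikeNormedField]
  exact WithTop.coe_le_coe.2 (le_top (a := (2 : ℕ∞)))

lemma slice {T : CartFam} {F : Type*} [NormedAddCommGroup F] [NormedSpace ℝ F]
    {u : T.Total → F} (hu : ContDiff ℝ ∞ u) (x : E T.baseDim) :
    ContDiff ℝ ∞ (fun y => u (x, y)) := hu.comp (contDiff_prodMk_right x)

/-- The vertical de Rham differential: the exterior derivative along each fibre. -/
noncomputable def vExtDeriv (T : CartFam) (k : ℕ) : vForm T k →+ vForm T (k + 1) where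
  toFun α := ⟨fun p => extDeriv (fun y => α.1 (p.1, y)) p.2,
    show ContDiff ℝ ∞ _ from
      ContDiff.comp (g := ContinuousAlternatingMap.alternatizeUncurryFinCLM ℝ (E T.fibDim) ℝ)
        (ContinuousLinearMap.contDiff _) (contDiff_vderiv (T := T) (vForm.contDiff α))⟩
  map_zero' := by
    ext p : 2
    change extDeriv (fun _ => (0 : E T.fibDim [⋀^Fin k]→L[ℝ] ℝ)) p.2 = 0
    rw [extDeriv, fderiv_fun_const]
    exact (ContinuousAlternatingMap.alternatizeUncurryFinCLM ℝ (E T.fibDim) ℝ).map_zero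
  map_add' α β := by
    ext p : 2
    exact extDeriv_fun_add ((slice (vForm.contDiff α) _).differentiable (by simp) _)
      ((slice (vForm.contDiff β) _).differentiable (by simp) _)

lemma vExtDeriv_vExtDeriv (T : CartFam) (k : ℕ) (α : vForm T k) :
    vExtDeriv T (k + 1) (vExtDeriv T k α) = 0 := by
  ext p : 2
  exact extDeriv_extDeriv_apply (r := ∞) (slice (vForm.contDiff α) p.1).contDiffAt minSmoothness_two_le

lemma contDiff_of_toCMM {D V : Type*} [NormedAddCommGroup D] [NormedSpace ℝ D]
    [NormedAddCommGroup V] [NormedSpace ℝ V] {k : ℕ} {u : D → V [⋀^Fin k]→L[ℝ] ℝ}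
    (hu : ContDiff ℝ ∞ (fun p => (u p).toContinuousMultilinearMap)) : ContDiff ℝ ∞ u := by
  let A : ContinuousMultilinearMap ℝ (fun _ : Fin k => V) ℝ →L[ℝ] V [⋀^Fin k]→L[ℝ] ℝ :=
    { toFun := fun f => ContinuousMultilinearMap.alternatization f
      map_add' := fun f g => map_add _ f g
      map_smul' := fun c f => by
        ext v
        simp [ContinuousMultilinearMap.alternatization_apply_apply, Finset.mul_sum,
          Units.smul_def, mul_left_comm]
      cont := by
        rw [ContinuousAlternatingMap.isEmbedding_toContinuousMultilinearMap.continuous_iff]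
        have : (ContinuousAlternatingMap.toContinuousMultilinearMap ∘
            fun f : ContinuousMultilinearMap ℝ (fun _ : Fin k => V) ℝ =>
              ContinuousMultilinearMap.alternatization f) = fun f =>
            ∑ σ : Equiv.Perm (Fin k), Equiv.Perm.sign σ •
              ContinuousMultilinearMap.domDomCongrₗᵢ ℝ V ℝ σ f := by
          funext f
          rfl
        change Continuous (ContinuousAlternatingMap.toContinuousMultilinearMap ∘
            fun f : ContinuousMultilinearMap ℝ (fun _ : Fin k => V) ℝ =>
              ContinuousMultilinearMap.alternatization f)
        rw [this]
        refine continuous_finsetSum _ fun σ _ => ?_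
        exact (LinearIsometryEquiv.continuous _).const_smul _ }
  have key : u = fun p => ((k.factorial : ℝ)⁻¹ • A) ((u p).toContinuousMultilinearMap) := by
    funext p
    ext v
    have : ∀ σ : Equiv.Perm (Fin k), (u p) (v ∘ σ) = Equiv.Perm.sign σ • u p v :=
      fun σ => (u p).map_perm v σ
    simp only [A, smul_apply, ContinuousAlternatingMap.smul_apply,
      ContinuousLinearMap.coe_mk', LinearMap.coe_mk, AddHom.coe_mk,
      ContinuousMultilinearMap.alternatization_apply_apply,
      ContinuousAlternatingMap.coe_toContinuousMultilinearMap, this, smul_smul]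
    simp [Fintype.card_perm]
    field_simp
  rw [key]
  exact (ContinuousLinearMap.contDiff _).comp hu

lemma contDiff_compCLM {D V W : Type*} [NormedAddCommGroup D] [NormedSpace ℝ D]
    [NormedAddCommGroup V] [NormedSpace ℝ V] [NormedAddCommGroup W] [NormedSpace ℝ W] {k : ℕ}
    {u : D → W [⋀^Fin k]→L[ℝ] ℝ} {f : D → V →L[ℝ] W} (hu : ContDiff ℝ ∞ u)
    (hf : ContDiff ℝ ∞ f) : ContDiff ℝ ∞ (fun p => (u p).compContinuousLinearMap (f p)) := by
  apply contDiff_of_toCMM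
  have h1 : ContDiff ℝ ∞ (fun p => (u p).toContinuousMultilinearMap) :=
    ContDiff.comp
      (g := ContinuousAlternatingMap.toContinuousMultilinearMapCLM ℝ (E := W) (F := ℝ)
        (ι := Fin k) (𝕜 := ℝ)) (ContinuousLinearMap.contDiff _) hu
  have h2 : ContDiff ℝ ∞ (fun p =>
      ContinuousMultilinearMap.compContinuousLinearMapContinuousMultilinear ℝ
        (fun _ : Fin k => V) (fun _ : Fin k => W) ℝ (fun _ => f p)) :=
    (ContinuousMultilinearMap.contDiff _).comp (contDiff_pi.2 fun _ => hf)
  exact h2.clm_apply h1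

/-- Pullback of vertical forms along a morphism of families. -/
noncomputable def vForm.pullback {S T : CartFam} (f : S ⟶ T) (k : ℕ) :
    vForm T k →+ vForm S k where
  toFun α := ⟨fun p => (α.1 (f.total p)).compContinuousLinearMap
      (fderiv ℝ (CartFam.Hom.fib f p.1) p.2),
    contDiff_compCLM (ContDiff.comp (vForm.contDiff α) f.contDiff_total)
      (contDiff_vderiv (T := S) (contDiff_snd.comp f.contDiff_total))⟩
  map_zero' := by
    ext p : 2
    rfl
  map_add' α β := by
    ext p : 2
    rfl

lemma vForm.pullback_id (T : CartFam) (k : ℕ) (α : vForm T k) :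
    vForm.pullback (𝟙 T) k α = α := by
  ext p v
  have : fderiv ℝ (CartFam.Hom.fib (𝟙 T) p.1) p.2 = ContinuousLinearMap.id ℝ _ := fderiv_id
  simp only [vForm.pullback, AddMonoidHom.coe_mk, ZeroHom.coe_mk, this]
  rfl

lemma vForm.pullback_comp {R S T : CartFam} (f : R ⟶ S) (g : S ⟶ T) (k : ℕ) (α : vForm T k) :
    vForm.pullback (f ≫ g) k α = vForm.pullback f k (vForm.pullback g k α) := by
  ext p v
  have h : CartFam.Hom.fib (f ≫ g) p.1 =
      CartFam.Hom.fib g (f.base p.1) ∘ CartFam.Hom.fib f p.1 := by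
    funext y
    change (g.total (f.total (p.1, y))).2 = _
    rw [CartFam.Hom.total_eq f]
    rfl
  have h2 : fderiv ℝ (CartFam.Hom.fib (f ≫ g) p.1) p.2 =
      (fderiv ℝ (CartFam.Hom.fib g (f.total p).1) (f.total p).2).comp
        (fderiv ℝ (CartFam.Hom.fib f p.1) p.2) := by
    rw [h, f.comm]
    exact fderiv_comp _ ((CartFam.Hom.contDiff_fib g _).differentiable (by simp) _)
      ((CartFam.Hom.contDiff_fib f _).differentiable (by simp) _)
  simp only [vForm.pullback, AddMonoidHom.coe_mk, ZeroHom.coe_mk, h2]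
  rfl

lemma vForm.pullback_vExtDeriv {S T : CartFam} (f : S ⟶ T) (k : ℕ) (α : vForm T k) :
    vExtDeriv S k (vForm.pullback f k α) = vForm.pullback f (k + 1) (vExtDeriv T k α) := by
  ext p : 2
  have := extDeriv_pullback (r := ∞) (f := CartFam.Hom.fib f p.1) (x := p.2)
    ((slice (vForm.contDiff α) (f.base p.1)).differentiable (by simp) _)
    (CartFam.Hom.contDiff_fib f p.1).contDiffAt minSmoothness_two_le
  have h : ∀ y, f.total (p.1, y) = (f.base p.1, CartFam.Hom.fib f p.1 y) :=
    CartFam.Hom.total_eq f p.1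
  have h' : f.total p = (f.base p.1, CartFam.Hom.fib f p.1 p.2) := h p.2
  simp only [vForm.pullback, vExtDeriv, AddMonoidHom.coe_mk, ZeroHom.coe_mk, h]
  exact this

/-! ### Smooth functions with values in the circle group -/

/-- Smooth functions with values in `U(1)`. -/
def u1Fun (T : CartFam) : Subgroup (T.Total → Circle) where
  carrier := {g | ContDiff ℝ ∞ (fun p => (g p : ℂ))}
  mul_mem' := fun {g h} h1 h2 => by
    simp only [Set.mem_ofPred_eq, Pi.mul_apply, Circle.coe_mul] at *
    exact h1.mul h2
  one_mem' := by
    simpa using contDiff_const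
  inv_mem' := fun {g} h => by
    simp only [Set.mem_ofPred_eq, Pi.inv_apply, Circle.coe_inv_eq_conj] at *
    exact Complex.conjCLE.contDiff.comp h

/-- The real `1`-form `(2πi)⁻¹ g⁻¹ dg` along the fibres, written as `(2π)⁻¹ Im (conj g · dg)`. -/
noncomputable def dlogFun {T : CartFam} (g : u1Fun T) (p : T.Total) : E T.fibDim →L[ℝ] ℝ :=
  (2 * Real.pi)⁻¹ • Complex.imCLM.comp
    (((starRingEnd ℂ) (g.1 p : ℂ)) • vderiv (T := T) (fun q => (g.1 q : ℂ)) p)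

lemma contDiff_dlogFun {T : CartFam} (g : u1Fun T) : ContDiff ℝ ∞ (dlogFun g) := by
  have h : ContDiff ℝ ∞ (fun p => (g.1 p : ℂ)) := g.2
  have h1 : ContDiff ℝ ∞ (fun p => (starRingEnd ℂ) (g.1 p : ℂ)) := Complex.conjCLE.contDiff.comp h
  exact (contDiff_const.clm_comp (h1.smul (contDiff_vderiv h))).const_smul _

/-- The map `d log` from smooth `U(1)`-valued functions to vertical `1`-forms. -/
noncomputable def vdlog (T : CartFam) : Additive (u1Fun T) →+ vForm T 1 where
  toFun g := ⟨fun p => ContinuousAlternatingMap.ofSubsingleton ℝ (E T.fibDim) ℝ (0 : Fin 1)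
      (dlogFun g.toMul p),
    (ContinuousAlternatingMap.ofSubsingletonLIE (𝕜 := ℝ) (E := E T.fibDim) (F := ℝ)
      (0 : Fin 1)).contDiff.comp
      (contDiff_dlogFun _)⟩
  map_zero' := by
    ext p v
    simp [dlogFun, vderiv]
  map_add' g h := by
    ext p v
    have hg : ContDiff ℝ ∞ (fun p => (g.toMul.1 p : ℂ)) := g.toMul.2
    have hh : ContDiff ℝ ∞ (fun p => (h.toMul.1 p : ℂ)) := h.toMul.2
    have e1 : ∀ z : Circle, (starRingEnd ℂ) (z : ℂ) * (z : ℂ) = 1 := fun z => by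
      rw [← Circle.coe_inv_eq_conj, ← Circle.coe_mul, inv_mul_cancel, Circle.coe_one]
    have key : vderiv (T := T) (fun q => (g.toMul.1 q : ℂ) * (h.toMul.1 q : ℂ)) p =
        (g.toMul.1 p : ℂ) • vderiv (T := T) (fun q => (h.toMul.1 q : ℂ)) p +
        (h.toMul.1 p : ℂ) • vderiv (T := T) (fun q => (g.toMul.1 q : ℂ)) p :=
      fderiv_fun_mul ((slice hg p.1).differentiable (by simp) p.2)
        ((slice hh p.1).differentiable (by simp) p.2)
    have key2 : (starRingEnd ℂ) ((g.toMul.1 p : ℂ) * (h.toMul.1 p : ℂ)) •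
        vderiv (T := T) (fun q => (g.toMul.1 q : ℂ) * (h.toMul.1 q : ℂ)) p =
        (starRingEnd ℂ) (g.toMul.1 p : ℂ) • vderiv (T := T) (fun q => (g.toMul.1 q : ℂ)) p +
        (starRingEnd ℂ) (h.toMul.1 p : ℂ) • vderiv (T := T) (fun q => (h.toMul.1 q : ℂ)) p := by
      rw [key, map_mul, smul_add, smul_smul, smul_smul, add_comm]
      congr 2
      · linear_combination (starRingEnd ℂ) (g.toMul.1 p : ℂ) * e1 (h.toMul.1 p)
      · linear_combination (starRingEnd ℂ) (h.toMul.1 p : ℂ) * e1 (g.toMul.1 p)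
    have key3 : dlogFun (g + h).toMul p = dlogFun g.toMul p + dlogFun h.toMul p := by
      simp only [dlogFun, toMul_add, Subgroup.coe_mul, Pi.mul_apply, Circle.coe_mul]
      rw [key2, ContinuousLinearMap.comp_add, smul_add]
    change dlogFun (g + h).toMul p (v 0) = _
    rw [key3]
    rfl

/-- Locally along the fibre, `d log g` is the differential of a real function. -/
lemma dlogFun_eventually {T : CartFam} (g : u1Fun T) (p : T.Total) :
    ∃ h : E T.fibDim → ℝ, ContDiffAt ℝ ∞ h p.2 ∧
      (fun y => ContinuousAlternatingMap.ofSubsingleton ℝ (E T.fibDim) ℝ (0 : Fin 1)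
        (dlogFun g (p.1, y))) =ᶠ[nhds p.2]
      extDeriv (fun y => ContinuousAlternatingMap.constOfIsEmpty ℝ (E T.fibDim) (Fin 0) (h y)) := by
  have hg : ContDiff ℝ ∞ (fun y => (g.1 (p.1, y) : ℂ)) := slice (T := T) g.2 p.1
  set c : ℂ := (starRingEnd ℂ) (g.1 p : ℂ) with hc
  have e1 : ∀ z : Circle, (starRingEnd ℂ) (z : ℂ) * (z : ℂ) = 1 := fun z => by
    rw [← Circle.coe_inv_eq_conj, ← Circle.coe_mul, inv_mul_cancel, Circle.coe_one]
  have hs : ∀ᶠ y in nhds p.2, c * (g.1 (p.1, y) : ℂ) ∈ Complex.slitPlane := by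
    have hcont : Continuous (fun y => c * (g.1 (p.1, y) : ℂ)) :=
      continuous_const.mul hg.continuous
    apply hcont.continuousAt.eventually_mem
    apply Complex.isOpen_slitPlane.mem_nhds
    have : c * (g.1 (p.1, p.2) : ℂ) = 1 := e1 (g.1 p)
    rw [this]
    exact Complex.one_mem_slitPlane
  refine ⟨fun y => (2 * Real.pi)⁻¹ * (Complex.log (c * (g.1 (p.1, y) : ℂ))).im, ?_, ?_⟩
  · have h1 : ContDiffAt ℝ ∞ (fun y => c * (g.1 (p.1, y) : ℂ)) p.2 :=
      contDiffAt_const.mul hg.contDiffAt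
    have h2 : ContDiffAt ℝ ∞ Complex.log (c * (g.1 (p.1, p.2) : ℂ)) :=
      (Complex.contDiffAt_log (n := ∞) hs.self_of_nhds).restrict_scalars ℝ
    exact contDiffAt_const.mul (Complex.imCLM.contDiff.contDiffAt.comp p.2
      (ContDiffAt.comp (f := fun y => c * (g.1 (p.1, y) : ℂ)) p.2 h2 h1))
  · filter_upwards [hs] with y hy
    rw [extDeriv_constOfIsEmpty]
    congr 1
    have hd : HasFDerivAt (fun y => (g.1 (p.1, y) : ℂ))
        (vderiv (T := T) (fun q => (g.1 q : ℂ)) (p.1, y)) y :=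
      (hg.differentiable (by simp) y).hasFDerivAt
    have hl : HasFDerivAt (fun y => Complex.log (c * (g.1 (p.1, y) : ℂ)))
        ((c * (g.1 (p.1, y) : ℂ))⁻¹ • (c • vderiv (T := T) (fun q => (g.1 q : ℂ)) (p.1, y))) y := by
      have h3 := ((Complex.hasStrictDerivAt_log hy).hasDerivAt.hasFDerivAt.restrictScalars ℝ).comp y
        (hd.const_mul c)
      refine h3.congr_fderiv ?_
      ext v
      simp
      ring
    have hi : HasFDerivAt (fun y => (2 * Real.pi)⁻¹ * (Complex.log (c * (g.1 (p.1, y) : ℂ))).im)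
        ((2 * Real.pi)⁻¹ • Complex.imCLM.comp ((c * (g.1 (p.1, y) : ℂ))⁻¹ •
          (c • vderiv (T := T) (fun q => (g.1 q : ℂ)) (p.1, y)))) y :=
      (Complex.imCLM.hasFDerivAt.comp y hl).const_mul _
    refine Eq.trans ?_ hi.fderiv.symm
    rw [dlogFun, smul_smul]
    congr 3
    have h0 : (g.1 (p.1, y) : ℂ) ≠ 0 := Circle.coe_ne_zero _
    have hc0 : c ≠ 0 := by
      rw [hc]
      simp
    have h1 := e1 (g.1 (p.1, y))
    field_simp
    exact h1

lemma vExtDeriv_vdlog (T : CartFam) (g : Additive (u1Fun T)) :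
    vExtDeriv T 1 (vdlog T g) = 0 := by
  ext p : 2
  obtain ⟨h, hh, he⟩ := dlogFun_eventually g.toMul p
  change extDeriv (fun y => ContinuousAlternatingMap.ofSubsingleton ℝ (E T.fibDim) ℝ (0 : Fin 1)
        (dlogFun g.toMul (p.1, y))) p.2 = 0
  rw [he.extDeriv_eq]
  refine extDeriv_extDeriv_apply (r := ∞) ?_ minSmoothness_two_le
  exact (ContinuousAlternatingMap.constOfIsEmptyLIE ℝ (E T.fibDim) ℝ (Fin 0)).contDiff.contDiffAt.comp
    p.2 hh

/-- Pullback of `U(1)`-valued functions. -/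
def u1Fun.pullback {S T : CartFam} (f : S ⟶ T) : Additive (u1Fun T) →+ Additive (u1Fun S) where
  toFun g := Additive.ofMul ⟨fun p => g.toMul.1 (f.total p),
    (show ContDiff ℝ ∞ (fun p => (g.toMul.1 p : ℂ)) from g.toMul.2).comp f.contDiff_total⟩
  map_zero' := rfl
  map_add' _ _ := rfl

lemma vForm.pullback_vdlog {S T : CartFam} (f : S ⟶ T) (g : Additive (u1Fun T)) :
    vdlog S (u1Fun.pullback f g) = vForm.pullback f 1 (vdlog T g) := by
  ext p v
  have hg : ContDiff ℝ ∞ (fun p => (g.toMul.1 p : ℂ)) := g.toMul.2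
  have h : ∀ y, f.total (p.1, y) = (f.base p.1, CartFam.Hom.fib f p.1 y) :=
    CartFam.Hom.total_eq f p.1
  have h' : f.total p = (f.base p.1, CartFam.Hom.fib f p.1 p.2) := h p.2
  have key : vderiv (T := S) (fun q => (g.toMul.1 (f.total q) : ℂ)) p =
      (vderiv (T := T) (fun q => (g.toMul.1 q : ℂ)) (f.total p)).comp
        (fderiv ℝ (CartFam.Hom.fib f p.1) p.2) := by
    unfold vderiv
    simp only [h]
    exact fderiv_comp p.2 ((slice hg _).differentiable (by simp) _)
      ((CartFam.Hom.contDiff_fib f p.1).differentiable (by simp) p.2)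
  have key2 : dlogFun (u1Fun.pullback f g).toMul p =
      (dlogFun g.toMul (f.total p)).comp (fderiv ℝ (CartFam.Hom.fib f p.1) p.2) := by
    change (2 * Real.pi)⁻¹ • Complex.imCLM.comp
      (((starRingEnd ℂ) (g.toMul.1 (f.total p) : ℂ)) •
        vderiv (T := S) (fun q => (g.toMul.1 (f.total q) : ℂ)) p) = _
    rw [key]
    rfl
  change dlogFun (u1Fun.pullback f g).toMul p (v 0) = _
  rw [key2]
  rfl

lemma u1Fun.pullback_comp {R S T : CartFam} (f : R ⟶ S) (g : S ⟶ T) (u : Additive (u1Fun T)) :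
    u1Fun.pullback (f ≫ g) u = u1Fun.pullback f (u1Fun.pullback g u) := rfl

/-! ### The vertical Deligne complex -/

/-- The sheaf of groups in form degree `p`: smooth `U(1)`-valued functions for `p = 0`, and
vertical `p`-forms for `p > 0`. -/
noncomputable def Coeff (T : CartFam) : ℕ → AddCommGrpCat.{0}
  | 0 => AddCommGrpCat.of (Additive (u1Fun T))
  | p + 1 => AddCommGrpCat.of (vForm T (p + 1))

/-- The differential `d log` or `d` of the vertical Deligne complex. -/
noncomputable def Coeff.d (T : CartFam) : ∀ p, Coeff T p →+ Coeff T (p + 1)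
  | 0 => vdlog T
  | p + 1 => vExtDeriv T (p + 1)

lemma Coeff.d_d (T : CartFam) : ∀ (p : ℕ) (u : Coeff T p), Coeff.d T (p + 1) (Coeff.d T p u) = 0
  | 0, u => vExtDeriv_vdlog T u
  | p + 1, u => vExtDeriv_vExtDeriv T (p + 1) u

/-- Restriction of the coefficients along a morphism of families. -/
noncomputable def Coeff.pullback {S T : CartFam} (f : S ⟶ T) : ∀ p, Coeff T p →+ Coeff S p
  | 0 => u1Fun.pullback f
  | p + 1 => vForm.pullback f (p + 1)

lemma Coeff.pullback_d {S T : CartFam} (f : S ⟶ T) : ∀ (p : ℕ) (u : Coeff T p),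
    Coeff.d S p (Coeff.pullback f p u) = Coeff.pullback f (p + 1) (Coeff.d T p u)
  | 0, u => vForm.pullback_vdlog f u
  | p + 1, u => vForm.pullback_vExtDeriv f (p + 1) u

lemma Coeff.pullback_id (T : CartFam) : ∀ (p : ℕ) (u : Coeff T p), Coeff.pullback (𝟙 T) p u = u
  | 0, _ => rfl
  | p + 1, u => vForm.pullback_id T (p + 1) u

lemma Coeff.pullback_comp {R S T : CartFam} (f : R ⟶ S) (g : S ⟶ T) : ∀ (p : ℕ) (u : Coeff T p),
    Coeff.pullback (f ≫ g) p u = Coeff.pullback f p (Coeff.pullback g p u)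
  | 0, _ => rfl
  | p + 1, u => vForm.pullback_comp f g (p + 1) u

/-- The group in homological degree `q` of the complex
`U(1) → Ω¹ → ⋯ → Ωᵏ` with `U(1)` placed in degree `n + 1`.  So this group is the coefficient group
of form degree `p` if `p + q = n + 1` and `p ≤ k`, and it is trivial if there is no such `p`. -/
def delGroup (n k : ℕ) (T : CartFam) (q : ℕ) : AddSubgroup (∀ p, Coeff T p) where
  carrier := {u | ∀ p, ¬ (p + q = n + 1 ∧ p ≤ k) → u p = 0}
  add_mem' := fun {a b} ha hb p hp => by
    change a p + b p = 0
    rw [ha p hp, hb p hp, add_zero]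
  zero_mem' := fun _ _ => rfl
  neg_mem' := fun {a} ha p hp => by
    change - a p = 0
    rw [ha p hp, neg_zero]

/-- The differential on families of coefficients, truncated above form degree `k`. -/
noncomputable def delDiff (k : ℕ) (T : CartFam) (u : ∀ p, Coeff T p) : ∀ p, Coeff T p
  | 0 => 0
  | p + 1 => if p + 1 ≤ k then Coeff.d T p (u p) else 0

lemma delDiff_add (k : ℕ) (T : CartFam) (u v : ∀ p, Coeff T p) :
    delDiff k T (u + v) = delDiff k T u + delDiff k T v := by
  funext p
  cases p with
  | zero => exact (add_zero _).symm
  | succ p =>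
    simp only [delDiff, Pi.add_apply]
    split_ifs
    · exact map_add _ _ _
    · exact (add_zero _).symm

/-- The differential of the vertical Deligne complex. -/
noncomputable def delD (n k : ℕ) (T : CartFam) (q : ℕ) :
    delGroup n k T (q + 1) →+ delGroup n k T q :=
  AddMonoidHom.mk' (fun u => ⟨delDiff k T u.1, fun p hp => by
    cases p with
    | zero => rfl
    | succ p =>
      simp only [delDiff]
      split_ifs with h
      · rw [u.2 p (fun h' => hp ⟨by omega, h⟩), map_zero]
      · rfl⟩) fun u v => Subtype.ext (delDiff_add k T u.1 v.1)

lemma delD_delD (n k : ℕ) (T : CartFam) (q : ℕ) (u : delGroup n k T (q + 1 + 1)) :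
    delD n k T q (delD n k T (q + 1) u) = 0 := by
  apply Subtype.ext
  funext p
  change delDiff k T (delDiff k T u.1) p = 0
  match p with
  | 0 => rfl
  | 1 =>
    simp only [delDiff]
    split_ifs
    · exact map_zero _
    · rfl
  | p + 2 =>
    simp only [delDiff]
    split_ifs
    · exact Coeff.d_d T _ _
    · exact map_zero _
    · rfl

/-- The vertical Deligne complex
`U(1) → Ω¹ → ⋯ → Ωᵏ` over a family of cartesian spaces, with `U(1)` in degree `n + 1`. -/
noncomputable def delComplex (n k : ℕ) (T : CartFam) : ChainComplex AddCommGrpCat.{0} ℕ :=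
  ChainComplex.of (fun q => AddCommGrpCat.of (delGroup n k T q))
    (fun q => AddCommGrpCat.ofHom (delD n k T q)) fun q => by
      refine AddCommGrpCat.hom_ext (AddMonoidHom.ext fun u => ?_)
      exact delD_delD n k T q u

/-- Restriction of the groups of the vertical Deligne complex. -/
noncomputable def delRes (n k : ℕ) {S T : CartFam} (f : S ⟶ T) (q : ℕ) :
    delGroup n k T q →+ delGroup n k S q :=
  AddMonoidHom.mk' (fun u => ⟨fun p => Coeff.pullback f p (u.1 p), fun p hp => by
    change Coeff.pullback f p (u.1 p) = 0
    rw [u.2 p hp, map_zero]⟩) fun u v => Subtype.ext (funext fun p => map_add _ (u.1 p) (v.1 p))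

lemma delRes_delD (n k : ℕ) {S T : CartFam} (f : S ⟶ T) (q : ℕ) (u : delGroup n k T (q + 1)) :
    delD n k S q (delRes n k f (q + 1) u) = delRes n k f q (delD n k T q u) := by
  apply Subtype.ext
  funext p
  change delDiff k S (fun p => Coeff.pullback f p (u.1 p)) p =
    Coeff.pullback f p (delDiff k T u.1 p)
  cases p with
  | zero => exact (map_zero _).symm
  | succ p =>
    simp only [delDiff]
    split_ifs
    · exact Coeff.pullback_d f p _
    · exact (map_zero _).symm

/-- The vertical Deligne complex as a presheaf of chain complexes. -/
noncomputable def deligne (n k : ℕ) : CartFamᵒᵖ ⥤ ChainComplex AddCommGrpCat.{0} ℕ where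
  obj T := delComplex n k T.unop
  map f := ChainComplex.ofHom (fun q => AddCommGrpCat.ofHom (delRes n k f.unop q)) fun q => by
    simp only [delComplex, ChainComplex.of_d]
    refine AddCommGrpCat.hom_ext (AddMonoidHom.ext fun u => ?_)
    exact delRes_delD n k f.unop q u
  map_id T := by
    ext q u
    exact Subtype.ext (funext fun p => Coeff.pullback_id _ p _)
  map_comp f g := by
    ext q u
    exact Subtype.ext (funext fun p => Coeff.pullback_comp _ _ p _)

/-- Forgetting the forms of degree greater than `l`. -/
noncomputable def delTrunc (l : ℕ) (T : CartFam) (u : ∀ p, Coeff T p) (p : ℕ) : Coeff T p :=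
  if p ≤ l then u p else 0

/-- The projection of Deligne complexes which forgets the forms of degree greater than `l`. -/
noncomputable def delProjHom (n : ℕ) {l k : ℕ} (_h : l ≤ k) (T : CartFam) (q : ℕ) :
    delGroup n k T q →+ delGroup n l T q :=
  AddMonoidHom.mk' (fun u => ⟨delTrunc l T u.1, fun p hp => by
    simp only [delTrunc]
    split_ifs with h'
    · exact u.2 p fun h'' => hp ⟨h''.1, h'⟩
    · rfl⟩) fun u v => Subtype.ext (funext fun p => by
      change delTrunc l T (u.1 + v.1) p = delTrunc l T u.1 p + delTrunc l T v.1 p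
      simp only [delTrunc, Pi.add_apply]
      split_ifs
      · rfl
      · exact (add_zero _).symm)

lemma delProjHom_delD (n : ℕ) {l k : ℕ} (h : l ≤ k) (T : CartFam) (q : ℕ)
    (u : delGroup n k T (q + 1)) :
    delD n l T q (delProjHom n h T (q + 1) u) = delProjHom n h T q (delD n k T q u) := by
  apply Subtype.ext
  funext p
  change delDiff l T (delTrunc l T u.1) p = delTrunc l T (delDiff k T u.1) p
  cases p with
  | zero => simp [delTrunc, delDiff]
  | succ p =>
    simp only [delTrunc, delDiff]
    split_ifs <;> first | rfl | omega

/-- The projection of presheaves of Deligne complexes which forgets the forms of degree greater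
than `l`. -/
noncomputable def deligneProj (n : ℕ) {l k : ℕ} (h : l ≤ k) : deligne n k ⟶ deligne n l where
  app T := ChainComplex.ofHom (fun q => AddCommGrpCat.ofHom (delProjHom n h T.unop q)) fun q => by
    simp only [deligne, delComplex, ChainComplex.of_d]
    refine AddCommGrpCat.hom_ext (AddMonoidHom.ext fun u => ?_)
    exact delProjHom_delD n h T.unop q u
  naturality S T f := by
    ext q u
    refine Subtype.ext (funext fun p => ?_)
    change delTrunc l T.unop (fun p => Coeff.pullback f.unop p (u.1 p)) p =
      Coeff.pullback f.unop p (delTrunc l S.unop u.1 p)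
    simp only [delTrunc]
    split_ifs
    · rfl
    · exact (map_zero _).symm

/-- The presheaf of simplicial abelian groups associated with the vertical Deligne complex by the
Dold--Kan correspondence. -/
noncomputable def delSAb (n k : ℕ) : CartFamᵒᵖ ⥤ SimplicialObject AddCommGrpCat.{0} :=
  deligne n k ⋙ AlgebraicTopology.DoldKan.Γ₀

/-- The underlying simplicial set of a simplicial abelian group. -/
abbrev sAbToSSet : SimplicialObject AddCommGrpCat.{0} ⥤ SSet.{0} :=
  (SimplicialObject.whiskering _ _).obj (forget AddCommGrpCat.{0})

/-- The simplicial presheaf of `n`-gerbes with `k`-connection data on families of cartesian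
spaces: the underlying simplicial sets of `delSAb`. -/
noncomputable def delSSet (n k : ℕ) : CartFamᵒᵖ ⥤ SSet.{0} := delSAb n k ⋙ sAbToSSet

/-- The projection which forgets the forms of degree greater than `l`. -/
noncomputable def delSSetProj (n : ℕ) {l k : ℕ} (h : l ≤ k) : delSSet n k ⟶ delSSet n l :=
  Functor.whiskerRight (Functor.whiskerRight (deligneProj n h) AlgebraicTopology.DoldKan.Γ₀)
    sAbToSSet

/-! ### Cartesian spaces, families of diffeomorphisms and families of good coverings -/

/-- Smooth manifolds (Hausdorff, second countable, finite-dimensional, without boundary). -/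
structure Mfd : Type 1 where
  carrier : Type
  dim : ℕ
  [top : TopologicalSpace carrier]
  [charts : ChartedSpace (E dim) carrier]
  [smooth : IsManifold (𝓡 dim) ∞ carrier]
  [t2 : T2Space carrier]
  [secondCountable : SecondCountableTopology carrier]

namespace Mfd

instance : CoeSort Mfd Type := ⟨Mfd.carrier⟩

attribute [instance] Mfd.top Mfd.charts Mfd.smooth Mfd.t2 Mfd.secondCountable

/-- The cartesian space `ℝᵐ` as a manifold. -/
noncomputable def euclidean (m : ℕ) : Mfd := ⟨E m, m⟩

end Mfd

/-- Cartesian spaces: manifolds diffeomorphic to some `ℝᵐ`. -/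
structure Cart : Type 1 extends Mfd where
  cartesian : Nonempty (Diffeomorph (𝓡 dim) (𝓡 dim) carrier (E dim) ∞)

instance : CoeSort Cart Type := ⟨fun c => c.carrier⟩

/-- The model with corners of a product of two manifolds. -/
noncomputable abbrev prodModel (c : Cart) (M : Mfd) :=
  (𝓡 c.dim).prod (𝓡 M.dim)

/-- The category with objects the cartesian spaces, and with morphisms the pairs of a smooth map of
cartesian spaces and a smooth family of diffeomorphisms of `M` parametrised by the source. -/
structure BD (M : Mfd) : Type 1 where
  cart : Cart

namespace BD

variable {M : Mfd}

/-- A morphism: a smooth map `f : c → d`, and a smooth family `φ : c → Diff(M)`, i.e. a smooth map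
`(x, z) ↦ φ x z` which is invertible for each `x` such that `(x, z) ↦ (φ x)⁻¹ z` is smooth. -/
@[ext]
structure Hom (c d : BD M) : Type where
  base : c.cart → d.cart
  fam : c.cart × M → M
  smooth_base : ContMDiff (𝓡 c.cart.dim) (𝓡 d.cart.dim) ∞ base
  smooth_fam : ContMDiff (prodModel c.cart M) (𝓡 M.dim) ∞ fam
  exists_inv : ∃ inv : c.cart × M → M, ContMDiff (prodModel c.cart M) (𝓡 M.dim) ∞ inv ∧
    ∀ x z, inv (x, fam (x, z)) = z ∧ fam (x, inv (x, z)) = z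

/-- The map `c × M → d × M`, `(x, z) ↦ (f x, φ x z)`. -/
def Hom.total {c d : BD M} (f : Hom c d) (p : c.cart × M) : d.cart × M := (f.base p.1, f.fam p)

lemma Hom.contMDiff_total {c d : BD M} (f : Hom c d) :
    ContMDiff (prodModel c.cart M) (prodModel d.cart M) ∞ f.total :=
  (f.smooth_base.comp contMDiff_fst).prodMk f.smooth_fam

instance : Category (BD M) where
  Hom := Hom
  id c := ⟨id, Prod.snd, contMDiff_id, contMDiff_snd, Prod.snd, contMDiff_snd,
    fun _ _ => ⟨rfl, rfl⟩⟩
  comp {b c d} f g :=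
    { base := g.base ∘ f.base
      fam := g.fam ∘ f.total
      smooth_base := g.smooth_base.comp f.smooth_base
      smooth_fam := g.smooth_fam.comp f.contMDiff_total
      exists_inv := by
        obtain ⟨i, hi, hi'⟩ := f.exists_inv
        obtain ⟨j, hj, hj'⟩ := g.exists_inv
        refine ⟨fun p => i (p.1, j (f.base p.1, p.2)),
          hi.comp (contMDiff_fst.prodMk (hj.comp
            ((f.smooth_base.comp contMDiff_fst).prodMk contMDiff_snd))), fun x z => ⟨?_, ?_⟩⟩
        · simp [Hom.total, (hj' _ _).1, (hi' _ _).1]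
        · simp [Hom.total, (hj' _ _).2, (hi' _ _).2] }

end BD

open TopologicalSpace (Opens)

/-- An open subset of a cartesian space is cartesian. -/
def IsCartesian {c : Cart} (U : Opens c) : Prop :=
  Nonempty (Diffeomorph (𝓡 c.dim) (𝓡 c.dim) U (E c.dim) ∞)

/-- For open sets `V ⊆ c × M` and `U ⊆ c`, the projection restricts to a map `V → U` which is a
smooth family of cartesian spaces, i.e. `V → U` is isomorphic to a projection
`ℝᵐ × ℝʲ → ℝᵐ`. -/
def IsCartFam {c : Cart} {M : Mfd} (V : Opens (c × M)) (U : Opens c) : Prop :=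
  (∀ p ∈ V, p.1 ∈ U) ∧
  ∃ (j : ℕ) (Φ : Diffeomorph (prodModel c M) 𝓘(ℝ, E c.dim × E j) V (E c.dim × E j) ∞)
    (φ : Diffeomorph (𝓡 c.dim) (𝓡 c.dim) U (E c.dim) ∞),
    ∀ (p : V) (hp : p.1.1 ∈ U), (Φ p).1 = φ ⟨p.1.1, hp⟩

/-- Families of good open coverings of `M` parametrised by a cartesian space. -/
structure GCov (M : Mfd) : Type 1 where
  base : BD M
  Λ : Type
  total : Λ → Opens (base.cart × M)
  down : Λ → Opens base.cart
  total_cover : ∀ p, ∃ a, p ∈ total a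
  down_cover : ∀ x, ∃ a, x ∈ down a
  isCartFam : ∀ a, IsCartFam (total a) (down a)
  inter_total : ∀ s : Finset Λ, s.Nonempty →
    s.inf total = ⊥ ∨ IsCartFam (s.inf total) (s.inf down)
  inter_down : ∀ s : Finset Λ, s.Nonempty → s.inf down = ⊥ ∨ IsCartesian (s.inf down)

namespace GCov

variable {M : Mfd}

/-- A morphism of families of good open coverings: a morphism of `BD M` with a map of index sets
along which it restricts to the patches. -/
@[ext]
structure Hom (X Y : GCov M) : Type where
  hom : X.base ⟶ Y.base
  idx : X.Λ → Y.Λ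
  total_mem : ∀ a, ∀ p ∈ X.total a, BD.Hom.total hom p ∈ Y.total (idx a)
  down_mem : ∀ a, ∀ x ∈ X.down a, BD.Hom.base hom x ∈ Y.down (idx a)

instance : Category (GCov M) where
  Hom := Hom
  id X := ⟨𝟙 _, id, fun _ _ hp => hp, fun _ _ hx => hx⟩
  comp f g := ⟨f.hom ≫ g.hom, g.idx ∘ f.idx, fun _ _ hp => g.total_mem _ _ (f.total_mem _ _ hp),
    fun _ _ hx => g.down_mem _ _ (f.down_mem _ _ hx)⟩

variable (M) in
/-- The functor which forgets the covering. -/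
def forgetCover : GCov M ⥤ BD M where
  obj X := X.base
  map f := Hom.hom f

end GCov

/-! ### The Čech nerve -/

/-- The `l`-simplices over `T` (for `Δ = [l]`) of the Čech nerve of a family of good open coverings:
morphisms from the family `T` to the family `c × M → c` together with indices
`a₀, …, aₗ` such that the morphism takes values in the intersection of the corresponding
patches. -/
@[ext]
structure CechSimplex {M : Mfd} (X : GCov M) (T : CartFam) (Δ : SimplexCategory) : Type where
  total : T.Total → X.base.cart × M
  down : E T.baseDim → X.base.cart
  contMDiff_total : ContMDiff 𝓘(ℝ, T.Total) (prodModel X.base.cart M) ∞ total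
  contMDiff_down : ContMDiff (𝓡 T.baseDim) (𝓡 X.base.cart.dim) ∞ down
  comm : ∀ p, (total p).1 = down p.1
  idx : Fin (Δ.len + 1) → X.Λ
  total_mem : ∀ i p, total p ∈ X.total (idx i)
  down_mem : ∀ i x, down x ∈ X.down (idx i)

namespace CechSimplex

variable {M : Mfd}

/-- Restriction along a morphism of families of cartesian spaces. -/
def res {X : GCov M} {S T : CartFam} (f : S ⟶ T) {Δ : SimplexCategory}
    (s : CechSimplex X T Δ) : CechSimplex X S Δ where
  total := s.total ∘ CartFam.Hom.total f
  down := s.down ∘ CartFam.Hom.base f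
  contMDiff_total := s.contMDiff_total.comp f.contDiff_total.contMDiff
  contMDiff_down := s.contMDiff_down.comp f.contDiff_base.contMDiff
  comm p := (s.comm _).trans (congrArg s.down (f.comm p))
  idx := s.idx
  total_mem i _ := s.total_mem i _
  down_mem i _ := s.down_mem i _

/-- The simplicial structure maps. -/
def act {X : GCov M} {T : CartFam} {Δ Δ' : SimplexCategory} (θ : Δ' ⟶ Δ)
    (s : CechSimplex X T Δ) : CechSimplex X T Δ' where
  total := s.total
  down := s.down
  contMDiff_total := s.contMDiff_total
  contMDiff_down := s.contMDiff_down
  comm := s.comm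
  idx := s.idx ∘ θ.toOrderHom
  total_mem _ p := s.total_mem _ p
  down_mem _ x := s.down_mem _ x

/-- Functoriality in the covering. -/
def push {X Y : GCov M} (f : X ⟶ Y) {T : CartFam} {Δ : SimplexCategory}
    (s : CechSimplex X T Δ) : CechSimplex Y T Δ where
  total := BD.Hom.total (GCov.Hom.hom f) ∘ s.total
  down := BD.Hom.base (GCov.Hom.hom f) ∘ s.down
  contMDiff_total := (BD.Hom.contMDiff_total _).comp s.contMDiff_total
  contMDiff_down := (BD.Hom.smooth_base _).comp s.contMDiff_down
  comm p := congrArg (BD.Hom.base (GCov.Hom.hom f)) (s.comm p)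
  idx := GCov.Hom.idx f ∘ s.idx
  total_mem i p := GCov.Hom.total_mem f _ _ (s.total_mem i p)
  down_mem i x := GCov.Hom.down_mem f _ _ (s.down_mem i x)

end CechSimplex

/-- The Čech nerve of a family of good open coverings, a simplicial presheaf on the category of
families of cartesian spaces. -/
def cech {M : Mfd} (X : GCov M) : CartFamᵒᵖ ⥤ SSet.{0} where
  obj T :=
    { obj := fun Δ => CechSimplex X T.unop Δ.unop
      map := fun θ => ↾(fun s => s.act θ.unop) }
  map f := { app := fun Δ => ↾(fun s => s.res f.unop) }

/-- The Čech nerve as a functor. -/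
def cechFunctor (M : Mfd) : GCov M ⥤ (CartFamᵒᵖ ⥤ SSet.{0}) where
  obj X := cech X
  map f := { app := fun T => { app := fun Δ => ↾(fun s => s.push f) } }

/-! ### Mapping spaces of simplicial presheaves -/

open MonoidalCategory

/-- The constant simplicial presheaves `Δ[m]`. -/
def constSimplex : SimplexCategory ⥤ (CartFamᵒᵖ ⥤ SSet.{0}) :=
  Functor.comp SSet.stdSimplex (Functor.const CartFamᵒᵖ)

/-- The simplicial set of maps from `X` to `Y`: its `m`-simplices are the
morphisms `X × Δ[m] ⟶ Y`. -/
def mapSpace (X Y : CartFamᵒᵖ ⥤ SSet.{0}) : SSet.{0} where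
  obj Δ := X ⊗ constSimplex.obj Δ.unop ⟶ Y
  map θ := ↾(fun f => (X ◁ constSimplex.map θ.unop) ≫ f)
  map_id Δ := by
    refine ConcreteCategory.hom_ext _ _ fun f => ?_
    change (X ◁ constSimplex.map (𝟙 Δ.unop)) ≫ f = f
    rw [CategoryTheory.Functor.map_id, whiskerLeft_id, Category.id_comp]
  map_comp θ η := by
    refine ConcreteCategory.hom_ext _ _ fun f => ?_
    change (X ◁ constSimplex.map (η.unop ≫ θ.unop)) ≫ f =
      (X ◁ constSimplex.map η.unop) ≫ (X ◁ constSimplex.map θ.unop) ≫ f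
    rw [CategoryTheory.Functor.map_comp, whiskerLeft_comp, Category.assoc]

/-- Precomposition. -/
def mapSpace.pre {X X' : CartFamᵒᵖ ⥤ SSet.{0}} (g : X' ⟶ X) (Y : CartFamᵒᵖ ⥤ SSet.{0}) :
    mapSpace X Y ⟶ mapSpace X' Y where
  app Δ := ↾(fun f => (g ▷ _) ≫ f)

/-- Postcomposition. -/
def mapSpace.post (X : CartFamᵒᵖ ⥤ SSet.{0}) {Y Y' : CartFamᵒᵖ ⥤ SSet.{0}} (g : Y ⟶ Y') :
    mapSpace X Y ⟶ mapSpace X Y' where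
  app Δ := ↾(fun f => f ≫ g)

/-! ### The simplicial presheaves of gerbes with connection data -/

/-- Gerbes with connection data presented with respect to a family of good open coverings. -/
noncomputable def grbCov (M : Mfd) (n k : ℕ) : (GCov M)ᵒᵖ ⥤ SSet.{0} where
  obj X := mapSpace (cech X.unop) (delSSet n k)
  map f := mapSpace.pre ((cechFunctor M).map f.unop) (delSSet n k)

/-- The map which forgets the forms of degree greater than `l`. -/
noncomputable def grbCovProj (M : Mfd) (n : ℕ) {l k : ℕ} (h : l ≤ k) :
    grbCov M n k ⟶ grbCov M n l where
  app X := mapSpace.post (cech X.unop) (delSSetProj n h)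

/-- The simplicial presheaf on `BD M` of `n`-gerbes on `M` with `k`-connection data: the left Kan
extension of `grbCov M n k` along the functor which forgets the covering. -/
noncomputable def grb (M : Mfd) (n k : ℕ) : (BD M)ᵒᵖ ⥤ SSet.{1} :=
  (GCov.forgetCover M).op.lan.obj (grbCov M n k ⋙ SSet.uliftFunctor.{1, 0})

/-- The map `p^k_l` which forgets the forms of degree greater than `l`. -/
noncomputable def grbProj (M : Mfd) (n : ℕ) {l k : ℕ} (h : l ≤ k) : grb M n k ⟶ grb M n l :=
  (GCov.forgetCover M).op.lan.map (Functor.whiskerRight (grbCovProj M n h) SSet.uliftFunctor.{1, 0})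

/-- The universal map from gerbes presented over a family of coverings `X` to gerbes. -/
noncomputable def grbUnit {M : Mfd} (n k : ℕ) (X : GCov M) :
    SSet.uliftFunctor.{1, 0}.obj ((grbCov M n k).obj (op X)) ⟶ (grb M n k).obj (op X.base) :=
  ((GCov.forgetCover M).op.lanUnit.app (grbCov M n k ⋙ SSet.uliftFunctor.{1, 0})).app (op X)

/-! ### Integral Čech cohomology of a topological space -/

/-- Open coverings of a topological space, indexed by a type. -/
structure OpenCover (Y : Type) [TopologicalSpace Y] : Type 1 where
  ι : Type
  U : ι → Opens Y
  cover : ∀ y, ∃ a, y ∈ U a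

namespace OpenCover

variable {Y Y' Y'' : Type} [TopologicalSpace Y] [TopologicalSpace Y'] [TopologicalSpace Y'']

/-- The intersection of the members `U (a 0), …, U (a (m - 1))` of an open covering. -/
abbrev Inter (W : OpenCover Y) {m : ℕ} (a : Fin m → W.ι) : Type := {y : Y // ∀ i, y ∈ W.U (a i)}

/-- Reindexing gives an inclusion of intersections. -/
def restrict (W : OpenCover Y) {m m' : ℕ} (a : Fin m → W.ι) (r : Fin m' → Fin m) :
    C(W.Inter a, W.Inter (a ∘ r)) :=
  ⟨fun y => ⟨y.1, fun i => y.2 (r i)⟩, by fun_prop⟩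

/-- Čech `q`-cochains with integer coefficients: families of locally constant functions on the
`(q + 1)`-fold intersections. -/
abbrev Cochain (W : OpenCover Y) (q : ℕ) : Type :=
  ∀ a : Fin (q + 1) → W.ι, LocallyConstant (W.Inter a) ℤ

/-- The Čech differential. -/
def delta (W : OpenCover Y) (q : ℕ) : W.Cochain q →+ W.Cochain (q + 1) :=
  AddMonoidHom.mk' (fun x a => ∑ i : Fin (q + 2),
    (-1 : ℤ) ^ (i : ℕ) • (x (a ∘ i.succAbove)).comap (W.restrict a i.succAbove)) fun x y => by
      funext a
      refine (Finset.sum_congr rfl fun i _ => ?_).trans Finset.sum_add_distrib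
      rw [← smul_add]
      rfl

/-- Čech cocycles. -/
abbrev Cocycle (W : OpenCover Y) (q : ℕ) : AddSubgroup (W.Cochain q) := (W.delta q).ker

/-- The Čech cohomology group `H^{q+1}(W; ℤ)` of an open covering. -/
abbrev HSucc (W : OpenCover Y) (q : ℕ) : Type :=
  W.Cocycle (q + 1) ⧸ (W.delta q).range.addSubgroupOf (W.Cocycle (q + 1))

/-- A map of spaces with coverings. -/
structure Map (W : OpenCover Y) (W' : OpenCover Y') : Type where
  map : C(Y, Y')
  idx : W.ι → W'.ι
  mem : ∀ a, ∀ y ∈ W.U a, map y ∈ W'.U (idx a)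

/-- The induced map on intersections. -/
def Map.inter {W : OpenCover Y} {W' : OpenCover Y'} (f : Map W W') {m : ℕ} (a : Fin m → W.ι) :
    C(W.Inter a, W'.Inter (f.idx ∘ a)) :=
  ⟨fun y => ⟨f.map y.1, fun i => f.mem _ _ (y.2 i)⟩, by fun_prop⟩

/-- Pullback of cochains. -/
def Map.cochain {W : OpenCover Y} {W' : OpenCover Y'} (f : Map W W') (q : ℕ) :
    W'.Cochain q →+ W.Cochain q :=
  AddMonoidHom.mk' (fun x a => (x (f.idx ∘ a)).comap (f.inter a)) fun x y => by
    funext a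
    ext p
    simp

lemma Map.cochain_delta {W : OpenCover Y} {W' : OpenCover Y'} (f : Map W W') (q : ℕ)
    (x : W'.Cochain q) : W.delta q (f.cochain q x) = f.cochain (q + 1) (W'.delta q x) := by
  funext a
  ext p
  simp only [delta, cochain, AddMonoidHom.mk'_apply, LocallyConstant.coe_comap,
    Function.comp_apply]
  rw [← LocallyConstant.evalAddMonoidHom_apply, ← LocallyConstant.evalAddMonoidHom_apply,
    map_sum, map_sum]
  rfl

/-- Pullback of cocycles. -/
def Map.cocycle {W : OpenCover Y} {W' : OpenCover Y'} (f : Map W W') (q : ℕ) :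
    W'.Cocycle q →+ W.Cocycle q :=
  ((f.cochain q).comp (W'.Cocycle q).subtype).codRestrict (W.Cocycle q) fun x => by
    have : W'.delta q x.1 = 0 := x.2
    rw [AddMonoidHom.mem_ker]
    change W.delta q (f.cochain q x.1) = 0
    rw [f.cochain_delta, this, map_zero]

/-- Pullback of Čech cohomology classes. -/
def Map.coh {W : OpenCover Y} {W' : OpenCover Y'} (f : Map W W') (q : ℕ) :
    W'.HSucc q →+ W.HSucc q :=
  QuotientAddGroup.map _ _ (f.cocycle (q + 1)) (by
    rintro x ⟨y, hy⟩
    refine ⟨f.cochain q y, ?_⟩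
    rw [f.cochain_delta, hy]
    rfl)

/-- Composition of maps of spaces with coverings. -/
def Map.comp {W : OpenCover Y} {W' : OpenCover Y'} {W'' : OpenCover Y''} (g : Map W' W'')
    (f : Map W W') : Map W W'' :=
  ⟨g.map.comp f.map, g.idx ∘ f.idx, fun a y hy => g.mem _ _ (f.mem a y hy)⟩

lemma Map.coh_comp {W : OpenCover Y} {W' : OpenCover Y'} {W'' : OpenCover Y''} (g : Map W' W'')
    (f : Map W W') (q : ℕ) (x : W''.HSucc q) : (g.comp f).coh q x = f.coh q (g.coh q x) := by
  induction x using QuotientAddGroup.induction_on with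
  | H x => rfl

/-- Refinements of open coverings. -/
@[ext]
structure Refine (W W' : OpenCover Y) : Type where
  idx : W.ι → W'.ι
  le : ∀ a, W.U a ≤ W'.U (idx a)

instance : Category (OpenCover Y) where
  Hom := Refine
  id W := ⟨id, fun _ => le_rfl⟩
  comp f g := ⟨g.idx ∘ f.idx, fun a => (f.le a).trans (g.le _)⟩

/-- A refinement is a map of coverings over the identity. -/
def Refine.toMap {W W' : OpenCover Y} (f : W ⟶ W') : Map W W' :=
  ⟨ContinuousMap.id Y, Refine.idx f, fun a _ hy => Refine.le f a hy⟩

/-- The Čech cohomology group `H^{q+1}` as a functor of the open covering. -/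
def HSuccFunctor (Y : Type) [TopologicalSpace Y] (q : ℕ) :
    (OpenCover Y)ᵒᵖ ⥤ AddCommGrpCat.{0} where
  obj W := AddCommGrpCat.of (W.unop.HSucc q)
  map f := AddCommGrpCat.ofHom ((Refine.toMap f.unop).coh q)
  map_id W := by
    refine AddCommGrpCat.hom_ext (AddMonoidHom.ext fun x => ?_)
    induction x using QuotientAddGroup.induction_on with
    | H x => rfl
  map_comp f g := by
    refine AddCommGrpCat.hom_ext (AddMonoidHom.ext fun x => ?_)
    exact Map.coh_comp (Refine.toMap f.unop) (Refine.toMap g.unop) q x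

/-- The preimage of an open covering under a continuous map. -/
def preimage (f : C(Y, Y')) (W : OpenCover Y') : OpenCover Y :=
  ⟨W.ι, fun a => (W.U a).comap f, fun y => W.cover (f y)⟩

/-- The preimage of an open covering maps to the open covering. -/
def preimageMap (f : C(Y, Y')) (W : OpenCover Y') : Map (W.preimage f) W :=
  ⟨f, id, fun _ _ hy => hy⟩

/-- The preimage of open coverings as a functor. -/
def preimageFunctor (f : C(Y, Y')) : OpenCover Y' ⥤ OpenCover Y where
  obj W := W.preimage f
  map {W W'} g := (⟨Refine.idx (W := W) (W' := W') g, fun a _ hy => Refine.le (W := W) (W' := W') g a hy⟩ :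
    Refine (W.preimage f) (W'.preimage f))

/-- Pullback of cohomology classes of coverings as a natural transformation. -/
def preimageNatTrans (f : C(Y, Y')) (q : ℕ) :
    HSuccFunctor Y' q ⟶ (preimageFunctor f).op ⋙ HSuccFunctor Y q where
  app W := AddCommGrpCat.ofHom ((W.unop.preimageMap f).coh q)
  naturality W W' g := by
    refine AddCommGrpCat.hom_ext (AddMonoidHom.ext fun x => ?_)
    induction x using QuotientAddGroup.induction_on with
    | H x => rfl

end OpenCover

open Limits in
/-- The Čech cohomology group `H^{q+1}(Y; ℤ)` of a space: the colimit over all open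
coverings. -/
noncomputable def cechHSucc (Y : Type) [TopologicalSpace Y] (q : ℕ) : AddCommGrpCat.{1} :=
  colimit (OpenCover.HSuccFunctor Y q ⋙ AddCommGrpCat.uliftFunctor.{1, 0})

open Limits in
/-- The class in `H^{q+1}(Y; ℤ)` of a Čech cocycle on an open covering. -/
noncomputable def cechClass {Y : Type} [TopologicalSpace Y] {q : ℕ} (W : OpenCover Y)
    (x : W.Cocycle (q + 1)) : cechHSucc Y q :=
  colimit.ι (OpenCover.HSuccFunctor Y q ⋙ AddCommGrpCat.uliftFunctor.{1, 0}) (op W)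
    (ULift.up (QuotientAddGroup.mk x))

open Limits in
/-- The pullback `H^{q+1}(Y'; ℤ) → H^{q+1}(Y; ℤ)` along a continuous map. -/
noncomputable def cechPullback {Y Y' : Type} [TopologicalSpace Y] [TopologicalSpace Y']
    (f : C(Y, Y')) (q : ℕ) : cechHSucc Y' q ⟶ cechHSucc Y q :=
  colimMap (Functor.whiskerRight (OpenCover.preimageNatTrans f q)
      AddCommGrpCat.uliftFunctor.{1, 0}) ≫
    colimit.pre (OpenCover.HSuccFunctor Y q ⋙ AddCommGrpCat.uliftFunctor.{1, 0})
      (OpenCover.preimageFunctor f).op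

/-! ### Transition functions of gerbes -/

section Transition

variable {M : Mfd} {n k : ℕ} {X : GCov M}

/-- The underlying open covering of `c × M`. -/
def GCov.openCover (X : GCov M) : OpenCover (X.base.cart × M) := ⟨X.Λ, X.total, X.total_cover⟩

/-- The projection `c × M → M`. -/
def projM (c : Cart) (M : Mfd) : C(c × M, M) := ⟨Prod.snd, continuous_snd⟩

/-- A vertex of the simplicial set of gerbes presented over a family of coverings is a morphism from
the Čech nerve; this is its value on a simplex of the Čech nerve. -/
noncomputable def vertexEval (v : ((grbCov M n k).obj (op X)).obj (op (SimplexCategory.mk 0)))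
    {T : CartFam} {Δ : SimplexCategory} (s : CechSimplex X T Δ) :
    ((delSAb n k).obj (op T)).obj (op Δ) :=
  ((show cech X ⊗ constSimplex.obj (SimplexCategory.mk 0) ⟶ delSSet n k from v).app (op T)).app
    (op Δ) (s, SSet.stdSimplex.objEquiv.symm (SimplexCategory.const Δ (SimplexCategory.mk 0) 0))

/-- The vertex `w` is the sum of the vertices `u` and `v`. -/
def IsVertexSum (u v w : ((grbCov M n k).obj (op X)).obj (op (SimplexCategory.mk 0))) : Prop :=
  ∀ (T : CartFam) (Δ : SimplexCategory) (s : CechSimplex X T Δ),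
    vertexEval w s = vertexEval u s + vertexEval v s

/-- The simplex of the Čech nerve over the one-point family given by a point of an
intersection of patches. -/
def pointSimplex {m : ℕ} (a : Fin (m + 1) → X.Λ) (p : X.openCover.Inter a) :
    CechSimplex X ⟨0, 0⟩ (SimplexCategory.mk m) where
  total _ := p.1
  down _ := p.1.1
  contMDiff_total := contMDiff_const
  contMDiff_down := contMDiff_const
  comm _ := rfl
  idx := a
  total_mem i _ := p.2 i
  down_mem i _ := (X.isCartFam (a i)).1 p.1 (p.2 i)

/-- The projection from the `q`-simplices of the simplicial abelian group associated with the Deligne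
complex to the direct summand given by the chain group in degree `q`, followed by the projection to
the coefficients of form degree `p`. -/
noncomputable def topComponent (T : CartFam) (q p : ℕ)
    (s : ((delSAb n k).obj (op T)).obj (op (SimplexCategory.mk q))) : Coeff T p :=
  (show delGroup n k T q from
    (AlgebraicTopology.DoldKan.Γ₀.splitting (delComplex n k T)).πSummand
      (SimplicialObject.Splitting.IndexSet.id (op (SimplexCategory.mk q))) s).1 p

/-- The transition functions of a gerbe presented over a family of coverings: the
`U(1)`-valued functions on the `(n + 2)`-fold intersections of patches. -/
noncomputable def transition (v : ((grbCov M n k).obj (op X)).obj (op (SimplexCategory.mk 0)))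
    (a : Fin (n + 2) → X.Λ) (p : X.openCover.Inter a) : Circle :=
  (Additive.toMul (show Additive (u1Fun ⟨0, 0⟩) from
    topComponent ⟨0, 0⟩ (n + 1) 0 (vertexEval v (pointSimplex a p)))).1 (0, 0)

/-- The integral Čech cocycle `x` is obtained from the transition functions of `v` by choosing
continuous logarithms on all `(n + 2)`-fold intersections and taking their Čech differential. -/
def IsBockstein (v : ((grbCov M n k).obj (op X)).obj (op (SimplexCategory.mk 0)))
    (x : X.openCover.Cocycle (n + 2)) : Prop :=
  ∃ h : ∀ a : Fin (n + 2) → X.Λ, C(X.openCover.Inter a, ℝ),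
    (∀ a p, Circle.exp (2 * Real.pi * h a p) = transition v a p) ∧
    ∀ a p, ((x.1 a p : ℤ) : ℝ) = ∑ i : Fin (n + 3),
      (-1 : ℝ) ^ (i : ℕ) * h (a ∘ i.succAbove) (X.openCover.restrict a i.succAbove p)

/-- The class in `π₀` of the gerbe presented by a vertex `v`. -/
noncomputable def gerbeClass (v : ((grbCov M n k).obj (op X)).obj (op (SimplexCategory.mk 0))) :
    SSet.π₀ ((grb M n k).obj (op X.base)) :=
  SSet.mapπ₀ (grbUnit n k X) (SSet.π₀.mk (ULift.up v))

end Transition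

/-! ### Projective fibrations and `0`-connected morphisms of simplicial presheaves -/

section Presheaves

variable {C : Type 1} [Category.{0} C] {F G : Cᵒᵖ ⥤ SSet.{1}}

/-- A simplicial presheaf is projectively fibrant if all its values are Kan complexes. -/
def IsProjFibrant (F : Cᵒᵖ ⥤ SSet.{1}) : Prop := ∀ c : C, SSet.KanComplex (F.obj (op c))

open SSet.modelCategoryQuillen in
/-- A morphism of simplicial presheaves is a projective fibration if it is objectwise a Kan
fibration. -/
def IsProjFibration (p : F ⟶ G) : Prop := ∀ c : C, HomotopicalAlgebra.Fibration (p.app (op c))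

/-- A morphism of simplicial presheaves is `0`-connected if it is objectwise a bijection on
connected components. -/
def IsZeroConnected (p : F ⟶ G) : Prop :=
  ∀ c : C, Function.Bijective (SSet.mapπ₀ (p.app (op c)))

end Presheaves

end HigherGerbe

open HigherGerbe

/-! ### Simplicial abelian groups and the Dold–Kan correspondence. -/

namespace HigherGerbe

open Simplicial

universe u

/-! ### Simplicial abelian groups are Kan complexes -/

/-! Everything is linear. By Dold–Kan, maps from the Čech nerve times `Δ[m]` to the Deligne
coefficients are total cocycles of a Čech–Deligne double complex (`cocycleEquiv`), so every
presented mapping space is a simplicial abelian group. Any two presentations have a common good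
refinement, and two refinements over the same map of spaces are restrictions of a single one on a
doubled covering, so the left Kan extension inherits the group structure (`grbGroup`). Simplicial
abelian groups are Kan complexes, and degreewise surjective homomorphisms between them are Kan
fibrations. Surjectivity of the forgetful maps amounts to extending a cocycle by a form of the next
degree, which is possible because vertical forms are acyclic on the Čech nerve by partitions of
unity (`FormFam.acyclic`, `IsCocycle.exists_extend`).

The same acyclicity shows for `k ≤ n` that a cocycle is a coboundary as soon as its `U(1)`-component
is (`IsCocycle.exists_totD`): in form degree `p ≤ k` the error sits in Čech degree `n + 1 - p ≥ 1`.
So components only see transition functions, and these are classified by the exponential sequence: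
logarithms `h` give an integral cocycle `δ h`, every integral class arises (`exists_fam_hasClass`),
and functions of trivial class are coboundaries (`HasClass.exists_famDelta`).

Different coverings, and the spaces `M` and `c × M`, are compared through one group that involves no
covering, `GodCoh`: the cohomology of germs along the diagonal of integer functions of several
points, a form of Alexander–Spanier cohomology. In the double complex `leray` the rows are exact for
every covering, and the columns are exact if all intersections are empty or cartesian, because `ℝᵈ`
is acyclic (`exactOn_univ`, a Mayer–Vietoris argument on boxes). Good coverings are cofinal
(`Mfd.exists_isGoodBasis`): finite intersections of small chart balls are convex in one chart and
carry a convex exhaustion function, which makes them diffeomorphic to `ℝᵈ`. The factor `c`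
contributes nothing, since locally constant functions are constant along it.

For `k = n + 1` the descent stops in form degree `n + 1` and Čech degree `0`, where the curvature is
an invariant of components. On `ℝⁿ⁺²` the trivial gerbe with a global form `β`, `dβ ≠ 0`, has the
class of the flat one but lies in another component (`not_bijective_grbProj_euclidean`). -/

/-- The structure of a simplicial abelian group on a simplicial set. -/
class AddStr (Y : SSet.{u}) where
  grp : ∀ Δ : SimplexCategoryᵒᵖ, AddCommGroup (Y.obj Δ)
  map_add : ∀ {Δ Δ' : SimplexCategoryᵒᵖ} (θ : Δ ⟶ Δ') (x y : Y.obj Δ),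
    Y.map θ (x + y) = Y.map θ x + Y.map θ y

attribute [reducible, instance] AddStr.grp

section AddStr

variable {Y : SSet.{u}} [AddStr Y]

/-- The structure maps of a simplicial abelian group as homomorphisms. -/
def AddStr.mapHom {Δ Δ' : SimplexCategoryᵒᵖ} (θ : Δ ⟶ Δ') : Y.obj Δ →+ Y.obj Δ' :=
  AddMonoidHom.mk' (fun x => Y.map θ x) (AddStr.map_add θ)

lemma AddStr.δ_add {n : ℕ} (i : Fin (n + 2)) (x y : Y _⦋n + 1⦌) :
    Y.δ i (x + y) = Y.δ i x + Y.δ i y := AddStr.map_add _ x y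

lemma AddStr.δ_sub {n : ℕ} (i : Fin (n + 2)) (x y : Y _⦋n + 1⦌) :
    Y.δ i (x - y) = Y.δ i x - Y.δ i y := (AddStr.mapHom _).map_sub x y

lemma AddStr.σ_zero {n : ℕ} (i : Fin (n + 1)) :
    Y.σ i (0 : Y _⦋n⦌) = 0 := (AddStr.mapHom _).map_zero

/-- Correction terms of the filling algorithm: if one face of `w` is already right, the horn
relations make the error at another face vanish on the corresponding face, so repairing the second
face can leave the first alone. -/
lemma AddStr.δ_sub_δ_of_lt {m : ℕ} {x : Fin (m + 3) → Y _⦋m + 1⦌} {k : Fin (m + 3)}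
    (hx : ∀ a b : Fin (m + 2), a ≤ b → a.castSucc ≠ k → b.succ ≠ k →
      Y.δ b (x a.castSucc) = Y.δ a (x b.succ))
    {w : Y _⦋m + 2⦌} {a b : Fin (m + 2)} (hab : a ≤ b) (ha : a.castSucc ≠ k) (hb : b.succ ≠ k)
    (hw : Y.δ a.castSucc w = x a.castSucc) : Y.δ a (x b.succ - Y.δ b.succ w) = 0 := by
  rw [AddStr.δ_sub, ← hx a b hab ha hb, SSet.δ_comp_δ_apply hab, hw, sub_self]

lemma AddStr.δ_sub_δ_of_gt {m : ℕ} {x : Fin (m + 3) → Y _⦋m + 1⦌} {k : Fin (m + 3)}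
    (hx : ∀ a b : Fin (m + 2), a ≤ b → a.castSucc ≠ k → b.succ ≠ k →
      Y.δ b (x a.castSucc) = Y.δ a (x b.succ))
    {w : Y _⦋m + 2⦌} {a b : Fin (m + 2)} (hab : a ≤ b) (ha : a.castSucc ≠ k) (hb : b.succ ≠ k)
    (hw : Y.δ b.succ w = x b.succ) : Y.δ b (x a.castSucc - Y.δ a.castSucc w) = 0 := by
  rw [AddStr.δ_sub, hx a b hab ha hb, ← SSet.δ_comp_δ_apply hab, hw, sub_self]

/-- The simplicial identity moves the degeneracy past the face map. So adding `σ_b r` does not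
change a face away from `b` once `r` has the matching zero face. -/
lemma AddStr.δ_σ_of_lt {m : ℕ} {r : Y _⦋m + 1⦌} {a b : Fin (m + 2)} (hab : a < b)
    (h : Y.δ a r = 0) : Y.δ a.castSucc (Y.σ b r) = 0 := by
  obtain ⟨c, rfl⟩ := b.eq_succ_of_ne_zero (Fin.ne_zero_of_lt hab)
  rw [SSet.δ_comp_σ_of_le_apply (by rw [Fin.le_castSucc_iff]; exact hab), h, AddStr.σ_zero]

lemma AddStr.δ_σ_of_gt {m : ℕ} {r : Y _⦋m + 1⦌} {a b : Fin (m + 2)} (hab : b < a)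
    (h : Y.δ a r = 0) : Y.δ a.succ (Y.σ b r) = 0 := by
  obtain ⟨c, rfl⟩ := b.eq_castSucc_of_ne_last (Fin.ne_last_of_lt hab)
  rw [SSet.δ_comp_σ_of_gt_apply hab, h, AddStr.σ_zero]

/-- Horns in simplicial abelian groups have fillers, which may be chosen in any simplicial subgroup
which contains the horn. -/
theorem AddStr.exists_filler (S : ∀ n : ℕ, AddSubgroup (Y _⦋n⦌))
    (hδ : ∀ (n : ℕ) (i : Fin (n + 2)), ∀ x ∈ S (n + 1), Y.δ i x ∈ S n)
    (hσ : ∀ (n : ℕ) (i : Fin (n + 1)), ∀ x ∈ S n, Y.σ i x ∈ S (n + 1))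
    {m : ℕ} (k : Fin (m + 3)) (x : Fin (m + 3) → Y _⦋m + 1⦌) (hS : ∀ j, j ≠ k → x j ∈ S (m + 1))
    (hx : ∀ a b : Fin (m + 2), a ≤ b → a.castSucc ≠ k → b.succ ≠ k →
      Y.δ b (x a.castSucc) = Y.δ a (x b.succ)) :
    ∃ w ∈ S (m + 2), ∀ j, j ≠ k → Y.δ j w = x j := by
  -- Moore's algorithm. Faces below `k` are repaired in increasing order: since `d_j σ_j = id`,
  -- adding `σ_j (x_j - d_j w)` makes face `j` right and disturbs no earlier face.
  have h1 : ∀ t : ℕ, t ≤ k → ∃ w ∈ S (m + 2), ∀ j : Fin (m + 3), (j : ℕ) < t → Y.δ j w = x j := by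
    intro t
    induction t with
    | zero => exact fun _ => ⟨0, zero_mem _, fun j hj => absurd hj (Nat.not_lt_zero _)⟩
    | succ t ih =>
      intro ht
      obtain ⟨w, hwS, hw⟩ := ih (by omega)
      obtain ⟨j, hj⟩ : ∃ j : Fin (m + 2), (j : ℕ) = t := ⟨⟨t, by omega⟩, rfl⟩
      have hjk : j.castSucc ≠ k := fun h => by
        have := congrArg Fin.val h
        simp at this
        omega
      refine ⟨w + Y.σ j (x j.castSucc - Y.δ j.castSucc w),
        add_mem hwS (hσ _ _ _ (sub_mem (hS _ hjk) (hδ _ _ _ hwS))), fun i hi => ?_⟩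
      rw [AddStr.δ_add]
      rcases Nat.lt_or_ge i t with hi' | hi'
      · rw [hw i hi', add_eq_left]
        obtain ⟨a, rfl⟩ := i.eq_castSucc_of_ne_last (fun h => by
          have := congrArg Fin.val h
          simp at this
          omega)
        have haj : a < j := Fin.lt_def.2 (by simpa [hj] using hi')
        apply AddStr.δ_σ_of_lt haj
        obtain ⟨b, hb⟩ := j.castSucc.eq_succ_of_ne_zero (fun h => by
          have h' := congrArg Fin.val h
          have := Fin.lt_def.1 haj
          rw [Fin.val_zero, Fin.val_castSucc] at h'
          omega)
        have hb' := congrArg Fin.val hb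
        simp at hb'
        have := Fin.lt_def.1 haj
        rw [hb]
        refine AddStr.δ_sub_δ_of_lt hx (Fin.le_def.2 (by omega)) (fun h => ?_) (hb ▸ hjk) (hw _ hi')
        have := congrArg Fin.val h
        simp at this
        omega
      · obtain rfl : i = j.castSucc := Fin.ext (by simp; omega)
        rw [SSet.δ_comp_σ_self_apply]
        abel
  -- Faces above `k` are repaired from the top downwards, now by `d_{j+1} σ_j = id`; `t` counts the
  -- faces treated from the top.
  have h2 : ∀ t : ℕ, ∃ w ∈ S (m + 2), ∀ j : Fin (m + 3), j ≠ k → ((j : ℕ) < k ∨ m + 3 ≤ j + t) →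
      Y.δ j w = x j := by
    intro t
    induction t with
    | zero =>
      obtain ⟨w, hwS, hw⟩ := h1 k le_rfl
      exact ⟨w, hwS, fun j _ hj => hw j (by omega)⟩
    | succ t ih =>
      obtain ⟨w, hwS, hw⟩ := ih
      by_cases hk : (k : ℕ) + t + 1 < m + 3
      swap
      · refine ⟨w, hwS, fun j hj hj' => hw j hj ?_⟩
        have : (j : ℕ) ≠ k := fun h => hj (Fin.ext h)
        omega
      obtain ⟨j, hj⟩ : ∃ j : Fin (m + 2), (j : ℕ) + 1 + t + 1 = m + 3 := ⟨⟨m + 1 - t, by omega⟩, by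
        simp; omega⟩
      have hjk : j.succ ≠ k := fun h => by
        have := congrArg Fin.val h
        simp at this
        omega
      refine ⟨w + Y.σ j (x j.succ - Y.δ j.succ w),
        add_mem hwS (hσ _ _ _ (sub_mem (hS _ hjk) (hδ _ _ _ hwS))), fun i hik hi => ?_⟩
      rw [AddStr.δ_add]
      by_cases hi' : (i : ℕ) < k
      · rw [hw i hik (Or.inl hi'), add_eq_left]
        obtain ⟨a, rfl⟩ := i.eq_castSucc_of_ne_last (fun h => by
          have := congrArg Fin.val h
          simp at this
          omega)
        have haj : a < j := Fin.lt_def.2 (by simp at hi'; omega)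
        exact AddStr.δ_σ_of_lt haj (AddStr.δ_sub_δ_of_lt hx haj.le hik hjk (hw _ hik (Or.inl hi')))
      · by_cases hi2 : m + 3 ≤ (i : ℕ) + t
        · rw [hw i hik (Or.inr hi2), add_eq_left]
          obtain ⟨a, rfl⟩ := i.eq_succ_of_ne_zero (fun h => by
            have h' := congrArg Fin.val h
            rw [Fin.val_zero] at h'
            omega)
          have haj : j < a := Fin.lt_def.2 (by simp at hi2; omega)
          apply AddStr.δ_σ_of_gt haj
          obtain ⟨b, hb⟩ := j.succ.eq_castSucc_of_ne_last (fun h => by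
            have h' := congrArg Fin.val h
            have := Fin.lt_def.1 haj
            rw [Fin.val_last, Fin.val_succ] at h'
            omega)
          have hb' := congrArg Fin.val hb
          simp at hb'
          have := Fin.lt_def.1 haj
          rw [← hb] at hjk ⊢
          exact AddStr.δ_sub_δ_of_gt hx (Fin.le_def.2 (by omega)) hjk hik (hw _ hik (Or.inr hi2))
        · obtain rfl : i = j.succ := Fin.ext (by simp; omega)
          rw [SSet.δ_comp_σ_succ_apply]
          abel
  obtain ⟨w, hwS, hw⟩ := h2 (m + 3)
  exact ⟨w, hwS, fun j hj => hw j hj (Or.inr (by omega))⟩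

open SSet

/-- Fillers for horns, as a statement on faces. -/
lemma AddStr.exists_filler_of_isCompatible (S : ∀ n : ℕ, AddSubgroup (Y _⦋n⦌))
    (hδ : ∀ (n : ℕ) (i : Fin (n + 2)), ∀ x ∈ S (n + 1), Y.δ i x ∈ S n)
    (hσ : ∀ (n : ℕ) (i : Fin (n + 1)), ∀ x ∈ S n, Y.σ i x ∈ S (n + 1)) {n : ℕ} {k : Fin (n + 2)}
    (f : ∀ (j : Fin (n + 2)) (_ : j ≠ k), Δ[n] ⟶ Y) (hf : horn.IsCompatible f)
    (hS : ∀ j hj, SSet.yonedaEquiv (f j hj) ∈ S n) :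
    ∃ w ∈ S (n + 1), ∀ (j : Fin (n + 2)) (hj : j ≠ k), Y.δ j w = SSet.yonedaEquiv (f j hj) := by
  cases n with
  -- A one-dimensional horn is a single vertex, and its degeneracy fills it.
  | zero =>
    obtain ⟨j, hj⟩ : ∃ j, j ≠ k := exists_ne k
    refine ⟨Y.σ 0 (SSet.yonedaEquiv (f j hj)), hσ _ _ _ (hS j hj), fun i hi => ?_⟩
    obtain rfl : i = j := by omega
    fin_cases i
    · exact SSet.δ_comp_σ_self_apply (S := Y) (0 : Fin 1) _
    · exact SSet.δ_comp_σ_succ_apply (S := Y) (0 : Fin 1) _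
  | succ m =>
    classical
    obtain ⟨w, hwS, hw⟩ := AddStr.exists_filler S hδ hσ k
      (fun j => if hj : j = k then 0 else SSet.yonedaEquiv (f j hj))
      (fun j hj => by
        rw [dif_neg hj]
        exact hS j hj)
      (fun a b hab ha hb => by
        rw [dif_neg ha, dif_neg hb, ← stdSimplex.yonedaEquiv_δ_comp, ← stdSimplex.yonedaEquiv_δ_comp]
        congr 1
        exact hf a.castSucc b.succ ha hb (Fin.castSucc_lt_succ_iff.2 hab))
    exact ⟨w, hwS, fun j hj => by rw [hw j hj, dif_neg hj]⟩

/-- A simplicial abelian group is a Kan complex. -/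
theorem AddStr.kanComplex (Y : SSet.{u}) [AddStr Y] : SSet.KanComplex Y := by
  rw [KanComplex.iff]
  intro n k f hf
  obtain ⟨w, -, hw⟩ := AddStr.exists_filler_of_isCompatible (fun _ => ⊤) (fun _ _ _ _ => trivial)
    (fun _ _ _ _ => trivial) f hf (fun _ _ => trivial)
  refine ⟨SSet.yonedaEquiv.symm w, fun j hj => SSet.yonedaEquiv.injective ?_⟩
  rw [stdSimplex.yonedaEquiv_δ_comp, Equiv.apply_symm_apply, hw j hj]

open SSet.modelCategoryQuillen in
/-- A surjective homomorphism of simplicial abelian groups is a Kan fibration. -/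
theorem AddStr.fibration {Z W : SSet.{u}} [AddStr Z] [AddStr W] (p : Z ⟶ W)
    (hp : ∀ (n : ℕ) (x y : Z _⦋n⦌), p.app (op ⦋n⦌) (x + y) = p.app _ x + p.app _ y)
    (hs : ∀ n : ℕ, Function.Surjective (p.app (op ⦋n⦌))) : HomotopicalAlgebra.Fibration p := by
  rw [fibration_iff]
  intro A B g hf
  simp only [J, MorphismProperty.iSup_iff] at hf
  obtain ⟨n, ⟨k⟩⟩ := hf
  refine ⟨fun {t b} sq => ?_⟩
  let P (n : ℕ) : Z _⦋n⦌ →+ W _⦋n⦌ := AddMonoidHom.mk' (fun x => p.app _ x) (hp n)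
  have hPδ : ∀ (n : ℕ) (i : Fin (n + 2)) (x : Z _⦋n + 1⦌), P n (Z.δ i x) = W.δ i (P (n + 1) x) :=
    fun n i x => SSet.δ_naturality_apply p i x
  have hPσ : ∀ (n : ℕ) (i : Fin (n + 1)) (x : Z _⦋n⦌), P (n + 1) (Z.σ i x) = W.σ i (P n x) :=
    fun n i x => SSet.σ_naturality_apply p i x
  -- Fill the horn in `Z` without regard to `b`. The mistake `b - p w` is lifted to `v`, whose faces
  -- away from `k` lie in the kernel; with a filler `v'` of that horn inside the kernel, `w + v -
  -- v'` is the desired lift.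
  obtain ⟨w, -, hw⟩ := AddStr.exists_filler_of_isCompatible (fun _ => ⊤) (fun _ _ _ _ => trivial)
    (fun _ _ _ _ => trivial) _ (horn.IsCompatible.of_hom t) (fun _ _ => trivial)
  have hb : ∀ j, j ≠ k → P n (Z.δ j w) = W.δ j (SSet.yonedaEquiv b) := fun j hj => by
    rw [hw j hj, ← stdSimplex.yonedaEquiv_δ_comp, ← horn.ι_ι_assoc k j hj, ← sq.w, ← Category.assoc]
    rfl
  obtain ⟨v, hv⟩ := hs (n + 1) (SSet.yonedaEquiv b - P (n + 1) w)
  have hv' : P (n + 1) v = SSet.yonedaEquiv b - P (n + 1) w := hv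
  obtain ⟨v', hv'S, hv'w⟩ := AddStr.exists_filler_of_isCompatible (fun n => (P n).ker)
    (fun n i x hx => by
      rw [AddMonoidHom.mem_ker] at hx ⊢
      rw [hPδ, hx]
      exact (AddStr.mapHom _).map_zero)
    (fun n i x hx => by
      rw [AddMonoidHom.mem_ker] at hx ⊢
      rw [hPσ, hx]
      exact (AddStr.mapHom _).map_zero)
    _ (horn.IsCompatible.of_hom (i := k) (Λ[n + 1, k].ι ≫ SSet.yonedaEquiv.symm v)) (fun j hj => by
      rw [AddMonoidHom.mem_ker, horn.ι_ι_assoc, stdSimplex.yonedaEquiv_δ_comp, Equiv.apply_symm_apply, hPδ,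
        hv', AddStr.δ_sub, ← hPδ, hb j hj, sub_self])
  refine ⟨⟨{ l := SSet.yonedaEquiv.symm (w + (v - v'))
             fac_left := horn.hom_ext' fun j hj => ?_
             fac_right := ?_ }⟩⟩
  · apply SSet.yonedaEquiv.injective
    rw [horn.ι_ι_assoc, stdSimplex.yonedaEquiv_δ_comp, Equiv.apply_symm_apply, AddStr.δ_add, AddStr.δ_sub,
      hv'w j hj, hw j hj, horn.ι_ι_assoc, stdSimplex.yonedaEquiv_δ_comp, Equiv.apply_symm_apply, sub_self,
      add_zero]
  · apply SSet.yonedaEquiv.injective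
    have h0 : P (n + 1) v' = 0 := hv'S
    have : P (n + 1) (w + (v - v')) = SSet.yonedaEquiv b := by
      rw [(P (n + 1)).map_add, (P (n + 1)).map_sub, hv', h0]
      abel
    rw [← this, SSet.yonedaEquiv_symm_comp, Equiv.apply_symm_apply]
    rfl

end AddStr

end HigherGerbe

namespace HigherGerbe

open Simplicial AlgebraicTopology.DoldKan SimplicialObject

instance sAbAddStr (A : SimplicialObject AddCommGrpCat.{0}) : AddStr (sAbToSSet.obj A) where
  grp Δ := inferInstanceAs (AddCommGroup (A.obj Δ))
  map_add θ x y := (A.map θ).hom.map_add x y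

lemma AddCommGrpCat.sum_zsmul_hom_apply {A B : AddCommGrpCat.{0}} {ι : Type*} (s : Finset ι)
    (c : ι → ℤ) (f : ι → (A ⟶ B)) (x : A) :
    (∑ i ∈ s, c i • f i : A ⟶ B).hom x = ∑ i ∈ s, c i • (f i).hom x := by
  classical
  induction s using Finset.induction_on with
  | empty => rfl
  | insert a s ha ih =>
    rw [Finset.sum_insert ha, Finset.sum_insert ha, AddCommGrpCat.hom_add, AddMonoidHom.add_apply,
      ih, AddCommGrpCat.hom_zsmul, AddMonoidHom.smul_apply]

/-- Results on the Dold–Kan splitting concern morphisms into the groups of simplices. A morphism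
from `ℤ` makes them applicable to a single element. -/
lemma AddCommGrpCat.exists_hom_of_int {A : AddCommGrpCat.{0}} (s : A) :
    ∃ f : AddCommGrpCat.of ℤ ⟶ A,
      (∀ (B : AddCommGrpCat.{0}) (g : A ⟶ B), g s = 0 → f ≫ g = 0) ∧ (f = 0 → s = 0) := by
  refine ⟨AddCommGrpCat.ofHom (zmultiplesHom _ s), fun B g hg => ?_, fun h => ?_⟩
  · ext
    simp [hg]
  · simpa using ConcreteCategory.congr_hom h (1 : ℤ)

lemma simplicialObject_map_id (A : SimplicialObject AddCommGrpCat.{0}) (m : ℕ) (s : A _⦋m⦌) :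
    A.map (𝟙 ⦋m⦌).op s = s :=
  ConcreteCategory.congr_hom (A.map_id (op ⦋m⦌)) s

/-! ### The simplices of the simplicial abelian group of a chain complex -/

section Gamma

variable (K : ChainComplex AddCommGrpCat.{0} ℕ)

/-- The projection to the summand of top degree. -/
noncomputable def topProj (q : ℕ) : (Γ₀.obj K).obj (op ⦋q⦌) ⟶ K.X q :=
  (Γ₀.splitting K).πSummand (Splitting.IndexSet.id (op ⦋q⦌))

/-- The inclusion of the summand of top degree. -/
noncomputable def topIncl (q : ℕ) : K.X q ⟶ (Γ₀.obj K).obj (op ⦋q⦌) :=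
  ((Γ₀.splitting K).cofan (op ⦋q⦌)).inj (Splitting.IndexSet.id (op ⦋q⦌))

lemma topProj_topIncl (q : ℕ) (y : K.X q) : topProj K q (topIncl K q y) = y := by
  have : topIncl K q ≫ topProj K q = 𝟙 _ :=
    (Γ₀.splitting K).cofan_inj_πSummand_eq_id (Splitting.IndexSet.id (op ⦋q⦌))
  exact ConcreteCategory.congr_hom this y

lemma δ_topIncl (q : ℕ) (j : Fin (q + 1)) (y : K.X (q + 1)) :
    (Γ₀.obj K).δ j.succ (topIncl K (q + 1) y) = 0 := by
  have : topIncl K (q + 1) ≫ (Γ₀.obj K).δ j.succ = 0 :=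
    HigherFacesVanish.on_Γ₀_summand_id K q j (by omega)
  exact ConcreteCategory.congr_hom this y

lemma topProj_σ (q : ℕ) (i : Fin (q + 1)) (s : (Γ₀.obj K) _⦋q⦌) :
    topProj K (q + 1) ((Γ₀.obj K).σ i s) = 0 :=
  ConcreteCategory.congr_hom ((Γ₀.splitting K).σ_comp_πSummand_id_eq_zero i) s

/-- The splitting identifies `K` with the nondegenerate complex of `Γ₀ K`, a quotient of the
alternating face map complex. The top projections are the components of the quotient map, hence form
a chain map. -/
lemma d_topProj (q : ℕ) (s : (Γ₀.obj K) _⦋q + 1⦌) :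
    K.d (q + 1) q (topProj K (q + 1) s) =
      ∑ i : Fin (q + 2), (-1 : ℤ) ^ (i : ℕ) • topProj K q ((Γ₀.obj K).δ i s) := by
  have h1 := (Γ₀.splitting K).toKaroubiNondegComplexIsoN₁.inv.f.comm (q + 1) q
  have h2 := (Γ₀NondegComplexIso K).hom.comm (q + 1) q
  have h3 : topProj K (q + 1) ≫ K.d (q + 1) q =
      (AlgebraicTopology.AlternatingFaceMapComplex.obj (Γ₀.obj K)).d (q + 1) q ≫ topProj K q := by
    refine Eq.trans ?_ h1
    have h2' : K.d (q + 1) q = (Γ₀.splitting K).nondegComplex.d (q + 1) q :=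
      ((Category.id_comp _).symm.trans (h2.trans (Category.comp_id _)))
    rw [h2']
    rfl
  have h4 := ConcreteCategory.congr_hom h3 s
  rw [AlgebraicTopology.AlternatingFaceMapComplex.obj_d_eq] at h4
  refine h4.trans ?_
  change (topProj K q).hom ((∑ i : Fin (q + 2), (-1 : ℤ) ^ (i : ℕ) • (Γ₀.obj K).δ i :
    (Γ₀.obj K) _⦋q + 1⦌ ⟶ (Γ₀.obj K) _⦋q⦌).hom s) = _
  rw [AddCommGrpCat.sum_zsmul_hom_apply, map_sum]
  refine Finset.sum_congr rfl fun i _ => ?_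
  rw [map_zsmul]

/-- `Γ₀.map φ` acts as `φ` summand by summand, so only the top summand survives the projection. -/
lemma topProj_naturality {K K' : ChainComplex AddCommGrpCat.{0} ℕ} (φ : K ⟶ K') (q : ℕ)
    (s : (Γ₀.obj K) _⦋q⦌) :
    topProj K' q ((Γ₀.map φ).app (op ⦋q⦌) s) = φ.f q (topProj K q s) := by
  have : (Γ₀.map φ).app (op ⦋q⦌) ≫ topProj K' q = topProj K q ≫ φ.f q := by
    apply (Γ₀.splitting K).hom_ext'
    intro A
    change _ ≫ (Γ₀.splitting K).desc _ _ ≫ _ = _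
    rw [Splitting.ι_desc_assoc]
    by_cases hA : A = Splitting.IndexSet.id (op ⦋q⦌)
    · subst hA
      have h1 := (Γ₀.splitting K).cofan_inj_πSummand_eq_id (Splitting.IndexSet.id (op ⦋q⦌))
      have h2 := (Γ₀.splitting K').cofan_inj_πSummand_eq_id (Splitting.IndexSet.id (op ⦋q⦌))
      refine (Category.assoc _ _ _).trans ?_
      erw [h2, reassoc_of% h1]
      exact Category.comp_id _
    · have h1 := (Γ₀.splitting K).cofan_inj_πSummand_eq_zero A
        (Splitting.IndexSet.id (op ⦋q⦌)) (Ne.symm hA)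
      have h2 := (Γ₀.splitting K').cofan_inj_πSummand_eq_zero A
        (Splitting.IndexSet.id (op ⦋q⦌)) (Ne.symm hA)
      refine (Category.assoc _ _ _).trans ?_
      erw [h2, reassoc_of% h1]
      exact Limits.comp_zero.trans Limits.zero_comp.symm
  exact ConcreteCategory.congr_hom this s

/-- Vanishing of the faces of positive index puts `s` in the Moore complex, where `PInfty` is the
identity. On the other hand `PInfty` annihilates everything whose top component is zero. -/
lemma eq_zero_of_δ_of_topProj (m : ℕ) (s : (Γ₀.obj K) _⦋m + 1⦌)
    (h1 : ∀ j : Fin (m + 1), (Γ₀.obj K).δ j.succ s = 0) (h2 : topProj K (m + 1) s = 0) :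
    s = 0 := by
  obtain ⟨f, hf, hf'⟩ := AddCommGrpCat.exists_hom_of_int (A := (Γ₀.obj K) _⦋m + 1⦌) s
  have h3 : f ≫ (AlgebraicTopology.DoldKan.PInfty (X := Γ₀.obj K)).f (m + 1) = f :=
    HigherFacesVanish.comp_P_eq_self (q := m + 1) fun j _ => hf _ _ (h1 j)
  refine hf' ?_
  rw [← h3]
  exact ((Γ₀.splitting K).comp_PInfty_eq_zero_iff f).2 (hf _ _ h2)

lemma eq_zero_of_topProj_zero (s : (Γ₀.obj K) _⦋0⦌) (h : topProj K 0 s = 0) : s = 0 := by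
  obtain ⟨f, hf, hf'⟩ := AddCommGrpCat.exists_hom_of_int (A := (Γ₀.obj K) _⦋0⦌) s
  have h3 := ((Γ₀.splitting K).comp_PInfty_eq_zero_iff f).2 (hf _ _ h)
  exact hf' (by simpa using h3)

/-- A simplex is determined by the top components of all of its faces. -/
lemma eq_zero_of_topProj (m : ℕ) (s : (Γ₀.obj K) _⦋m⦌)
    (h : ∀ (q : ℕ) (θ : ⦋q⦌ ⟶ ⦋m⦌), topProj K q ((Γ₀.obj K).map θ.op s) = 0) : s = 0 := by
  have h0 : topProj K m s = 0 := by
    have := h m (𝟙 _)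
    rwa [simplicialObject_map_id] at this
  induction m with
  | zero => exact eq_zero_of_topProj_zero K s h0
  | succ m ih =>
    refine eq_zero_of_δ_of_topProj K m s (fun j => ?_) h0
    have h' : ∀ (q : ℕ) (θ : ⦋q⦌ ⟶ ⦋m⦌),
        topProj K q ((Γ₀.obj K).map θ.op ((Γ₀.obj K).δ j.succ s)) = 0 := fun q θ => by
      have := h q (θ ≫ SimplexCategory.δ j.succ)
      rwa [op_comp, Functor.map_comp] at this
    refine ih _ h' ?_
    have := h' m (𝟙 _)
    rwa [simplicialObject_map_id] at this

variable {K}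

/-- Compatible families of elements of a chain complex, indexed by the simplices of `Δ[m]`. -/
structure IsFamily {m : ℕ} (x : ∀ q : ℕ, (⦋q⦌ ⟶ ⦋m⦌) → K.X q) : Prop where
  degenerate : ∀ (q : ℕ) (i : Fin (q + 1)) (θ : ⦋q⦌ ⟶ ⦋m⦌), x (q + 1) (SimplexCategory.σ i ≫ θ) = 0
  d : ∀ (q : ℕ) (θ : ⦋q + 1⦌ ⟶ ⦋m⦌), K.d (q + 1) q (x (q + 1) θ) =
    ∑ i : Fin (q + 2), (-1 : ℤ) ^ (i : ℕ) • x q (SimplexCategory.δ i ≫ θ)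

lemma isFamily_topProj {m : ℕ} (s : (Γ₀.obj K) _⦋m⦌) :
    IsFamily (fun q (θ : ⦋q⦌ ⟶ ⦋m⦌) => topProj K q ((Γ₀.obj K).map θ.op s)) where
  degenerate q i θ := by
    have := topProj_σ K q i ((Γ₀.obj K).map θ.op s)
    rw [op_comp, Functor.map_comp]
    exact this
  d q θ := by
    have := d_topProj K q ((Γ₀.obj K).map θ.op s)
    rw [this]
    refine Finset.sum_congr rfl fun i _ => ?_
    rw [op_comp, Functor.map_comp]
    rfl

lemma IsFamily.sub {m : ℕ} {x y : ∀ q : ℕ, (⦋q⦌ ⟶ ⦋m⦌) → K.X q} (hx : IsFamily x)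
    (hy : IsFamily y) : IsFamily (fun q θ => x q θ - y q θ) where
  degenerate q i θ := by rw [hx.degenerate, hy.degenerate, sub_zero]
  d q θ := by
    rw [map_sub, hx.d, hy.d, ← Finset.sum_sub_distrib]
    exact Finset.sum_congr rfl fun i _ => (smul_sub _ _ _).symm

lemma IsFamily.face {m : ℕ} {x : ∀ q : ℕ, (⦋q⦌ ⟶ ⦋m + 1⦌) → K.X q} (hx : IsFamily x)
    (i : Fin (m + 2)) : IsFamily (fun q (θ : ⦋q⦌ ⟶ ⦋m⦌) => x q (θ ≫ SimplexCategory.δ i)) where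
  degenerate q j θ := by
    rw [Category.assoc, hx.degenerate]
  d q θ := by
    rw [hx.d]
    simp only [Category.assoc]

/-- Every `θ` is the identity, or factors through a coface, or through a codegeneracy. Having `m = l
+ 1` as a hypothesis lets the statement cover `m = 0` as well. -/
lemma IsFamily.eq_zero {m : ℕ} {x : ∀ q : ℕ, (⦋q⦌ ⟶ ⦋m⦌) → K.X q} (hx : IsFamily x)
    (h0 : x m (𝟙 _) = 0)
    (h : ∀ (l : ℕ) (hl : m = l + 1) (i : Fin (l + 2)) (q : ℕ) (θ : ⦋q⦌ ⟶ ⦋l⦌),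
      x q (θ ≫ SimplexCategory.δ i ≫ eqToHom (by rw [hl])) = 0) (q : ℕ) (θ : ⦋q⦌ ⟶ ⦋m⦌) :
    x q θ = 0 := by
  by_cases hθ : Function.Injective θ.toOrderHom
  · by_cases hθ' : Function.Surjective θ.toOrderHom
    · have : q = m := by
        have := Fintype.card_congr (Equiv.ofBijective _ ⟨hθ, hθ'⟩)
        simpa using this
      subst this
      have : Mono θ := SimplexCategory.mono_iff_injective.2 hθ
      rw [SimplexCategory.eq_id_of_mono θ, h0]
    · cases m with
      | zero => exact absurd (fun y => ⟨0, Subsingleton.elim (α := Fin 1) _ _⟩) hθ'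
      | succ m =>
        obtain ⟨i, θ', rfl⟩ := SimplexCategory.eq_comp_δ_of_not_surjective θ hθ'
        simpa using h m rfl i q θ'
  · cases q with
    | zero => exact absurd (fun a b _ => Subsingleton.elim (α := Fin 1) a b) hθ
    | succ q =>
      obtain ⟨i, θ', rfl⟩ := SimplexCategory.eq_σ_comp_of_not_injective θ hθ
      exact hx.degenerate q i θ'

/-- The face opposite the vertex `0` need not be assumed to vanish: the formula for `d` expresses
its top component by the other faces, and its own faces are faces of those. -/
lemma IsFamily.eq_zero_succ {m : ℕ} {x : ∀ q : ℕ, (⦋q⦌ ⟶ ⦋m + 1⦌) → K.X q} (hx : IsFamily x)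
    (h0 : x (m + 1) (𝟙 _) = 0)
    (h : ∀ (i : Fin (m + 1)) (q : ℕ) (θ : ⦋q⦌ ⟶ ⦋m⦌), x q (θ ≫ SimplexCategory.δ i.succ) = 0)
    (q : ℕ) (θ : ⦋q⦌ ⟶ ⦋m + 1⦌) : x q θ = 0 := by
  refine hx.eq_zero h0 (fun l hl i q θ => ?_) q θ
  obtain rfl : m = l := by omega
  simp only [eqToHom_refl, Category.comp_id]
  induction i using Fin.cases with
  | succ i => exact h i q θ
  | zero =>
    refine (hx.face 0).eq_zero ?_ (fun l hl i q' θ' => ?_) q θ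
    · have := hx.d m (𝟙 _)
      rw [h0, map_zero, Fin.sum_univ_succ] at this
      simp only [Category.comp_id] at this
      rw [Finset.sum_eq_zero, add_zero] at this
      · simpa using this.symm
      · intro i _
        have := h i m (𝟙 _)
        rw [Category.id_comp] at this
        rw [this, smul_zero]
    · subst hl
      have := h i q' (θ' ≫ SimplexCategory.δ 0)
      simp only [eqToHom_refl, Category.comp_id, Category.assoc] at this ⊢
      rw [SimplexCategory.δ_comp_δ (Fin.zero_le i)] at this
      exact this

/-- Every compatible family comes from a simplex. -/
lemma IsFamily.exists_simplex {m : ℕ} {x : ∀ q : ℕ, (⦋q⦌ ⟶ ⦋m⦌) → K.X q} (hx : IsFamily x) :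
    ∃ s : (Γ₀.obj K) _⦋m⦌, ∀ (q : ℕ) (θ : ⦋q⦌ ⟶ ⦋m⦌),
      topProj K q ((Γ₀.obj K).map θ.op s) = x q θ := by
  induction m with
  | zero =>
    refine ⟨topIncl K 0 (x 0 (𝟙 _)), fun q θ => sub_eq_zero.1 ?_⟩
    refine ((isFamily_topProj _).sub hx).eq_zero ?_ (fun l hl => by omega) q θ
    rw [simplicialObject_map_id, topProj_topIncl, sub_self]
  | succ m ih =>
    -- By induction the faces of the family come from simplices. Those of positive index form a horn
    -- at `0`, filled by `w`. The error `z` vanishes on these faces, hence is determined by its top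
    -- component, which is added through `topIncl` without changing them.
    choose s hs using fun i => ih (hx.face i)
    obtain ⟨w, hw⟩ : ∃ w : (Γ₀.obj K) _⦋m + 1⦌, ∀ j : Fin (m + 1),
        (Γ₀.obj K).δ j.succ w = s j.succ := by
      cases m with
      | zero =>
        refine ⟨(Γ₀.obj K).σ 0 (s 1), fun j => ?_⟩
        obtain rfl : j = 0 := Subsingleton.elim (α := Fin 1) _ _
        exact SSet.δ_comp_σ_succ_apply (S := sAbToSSet.obj (Γ₀.obj K)) (0 : Fin 1) _
      | succ m =>
        obtain ⟨w, -, hw⟩ := AddStr.exists_filler (Y := sAbToSSet.obj (Γ₀.obj K)) (fun _ => ⊤)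
          (fun _ _ _ _ => trivial) (fun _ _ _ _ => trivial) 0 s (fun _ _ => trivial)
          (fun a b hab ha hb => by
            have : ((Γ₀.obj K).δ b (s a.castSucc) - (Γ₀.obj K).δ a (s b.succ) :
                (Γ₀.obj K) _⦋m⦌) = 0 := by
              apply eq_zero_of_topProj
              intro q θ
              rw [map_sub, map_sub]
              have h1 := hs a.castSucc q (θ ≫ SimplexCategory.δ b)
              have h2 := hs b.succ q (θ ≫ SimplexCategory.δ a)
              rw [op_comp, Functor.map_comp] at h1 h2
              have h3 : (θ ≫ SimplexCategory.δ b) ≫ SimplexCategory.δ a.castSucc =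
                  (θ ≫ SimplexCategory.δ a) ≫ SimplexCategory.δ b.succ := by
                rw [Category.assoc, Category.assoc, SimplexCategory.δ_comp_δ hab]
              rw [h3] at h1
              exact sub_eq_zero.2 (h1.trans h2.symm)
            exact sub_eq_zero.1 this)
        exact ⟨w, fun j => hw j.succ (Fin.succ_ne_zero j)⟩
    let z : ∀ q : ℕ, (⦋q⦌ ⟶ ⦋m + 1⦌) → K.X q :=
      fun q θ => x q θ - topProj K q ((Γ₀.obj K).map θ.op w)
    have hz : IsFamily z := hx.sub (isFamily_topProj w)
    have hzf : ∀ (i : Fin (m + 1)) (q : ℕ) (θ : ⦋q⦌ ⟶ ⦋m⦌),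
        z q (θ ≫ SimplexCategory.δ i.succ) = 0 := fun i q θ => by
      have h1 := hs i.succ q θ
      rw [← hw i] at h1
      refine sub_eq_zero.2 (h1.symm.trans ?_)
      rw [op_comp, Functor.map_comp]
      rfl
    refine ⟨topIncl K (m + 1) (z _ (𝟙 _)) + w, fun q θ => ?_⟩
    have h := (isFamily_topProj (topIncl K (m + 1) (z _ (𝟙 _)))).sub hz
    have := h.eq_zero_succ (by
      rw [simplicialObject_map_id, topProj_topIncl, sub_self]) (fun i q θ => by
      rw [hzf, sub_zero, op_comp, Functor.map_comp]
      have h0 : (Γ₀.obj K).map (SimplexCategory.δ i.succ).op (topIncl K (m + 1) (z _ (𝟙 _))) = 0 :=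
        δ_topIncl K m i _
      rw [ConcreteCategory.comp_apply, h0, map_zero, map_zero]) q θ
    rw [map_add, map_add, sub_eq_zero.1 this]
    exact sub_add_cancel _ _

end Gamma

end HigherGerbe

/-! ### Mapping spaces out of the Čech nerve. -/

namespace HigherGerbe

open Simplicial AlgebraicTopology.DoldKan SimplicialObject MonoidalCategory

/-! ### Simplices of the mapping spaces as Čech cocycles -/

section Cocycles

variable {M : Mfd} {n k m : ℕ} {X : GCov M}

/-- Families of coefficients of form degree `p` indexed by the `q`-simplices of the product of
the Čech nerve with `Δ[m]`. -/
abbrev Fam (X : GCov M) (m q p : ℕ) : Type :=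
  ∀ T : CartFam, CechSimplex X T ⦋q⦌ → (⦋q⦌ ⟶ ⦋m⦌) → Coeff T p

/-- The families which constitute a morphism from the product of the Čech nerve with `Δ[m]` to
the simplicial presheaf associated with the Deligne complex. -/
structure IsCocycle (n k : ℕ) (x : ∀ q p, Fam X m q p) : Prop where
  nat : ∀ (q p : ℕ) {S T : CartFam} (f : S ⟶ T) (s : CechSimplex X T ⦋q⦌) (θ : ⦋q⦌ ⟶ ⦋m⦌),
    x q p S (s.res f) θ = Coeff.pullback f p (x q p T s θ)
  degenerate : ∀ (q p : ℕ) (T : CartFam) (i : Fin (q + 1)) (s : CechSimplex X T ⦋q⦌)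
    (θ : ⦋q⦌ ⟶ ⦋m⦌),
    x (q + 1) p T (s.act (SimplexCategory.σ i)) (SimplexCategory.σ i ≫ θ) = 0
  supp : ∀ (q p : ℕ) (T : CartFam) (s : CechSimplex X T ⦋q⦌) (θ : ⦋q⦌ ⟶ ⦋m⦌),
    ¬ (p + q = n + 1 ∧ p ≤ k) → x q p T s θ = 0
  diff : ∀ (q p : ℕ) (T : CartFam) (s : CechSimplex X T ⦋q + 1⦌) (θ : ⦋q + 1⦌ ⟶ ⦋m⦌),
    delDiff k T (fun p => x (q + 1) p T s θ) p = ∑ i : Fin (q + 2), (-1 : ℤ) ^ (i : ℕ) •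
      x q p T (s.act (SimplexCategory.δ i)) (SimplexCategory.δ i ≫ θ)

/-- The projection of the simplicial abelian group of the Deligne complex to the chain group. -/
noncomputable def delTop (n k : ℕ) (T : CartFam) (q : ℕ) :
    ((delSAb n k).obj (op T)).obj (op ⦋q⦌) →+ delGroup n k T q :=
  (topProj (delComplex n k T) q).hom

lemma delTop_σ {T : CartFam} (q : ℕ) (i : Fin (q + 1))
    (s : ((delSAb n k).obj (op T)).obj (op ⦋q⦌)) :
    delTop n k T (q + 1) (((delSAb n k).obj (op T)).map (SimplexCategory.σ i).op s) = 0 :=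
  topProj_σ (delComplex n k T) q i s

lemma delComplex_d (n k : ℕ) (T : CartFam) (q : ℕ) (u : delGroup n k T (q + 1)) :
    (delComplex n k T).d (q + 1) q u = delD n k T q u := by
  have : (delComplex n k T).d (q + 1) q = AddCommGrpCat.ofHom (delD n k T q) := by
    simp only [delComplex, ChainComplex.of_d]
  rw [this]
  rfl

lemma delGroup_sum {T : CartFam} {q : ℕ} {ι : Type*} (s : Finset ι) (c : ι → ℤ)
    (u : ι → delGroup n k T q) (p : ℕ) :
    (∑ i ∈ s, c i • u i).1 p = ∑ i ∈ s, c i • (u i).1 p := by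
  have : (∑ i ∈ s, c i • u i).1 = ∑ i ∈ s, c i • (u i).1 := by
    simp
  rw [this, Finset.sum_apply]
  rfl

lemma delDiff_delTop {T : CartFam} (q p : ℕ)
    (s : ((delSAb n k).obj (op T)).obj (op ⦋q + 1⦌)) :
    delDiff k T (delTop n k T (q + 1) s).1 p = ∑ i : Fin (q + 2), (-1 : ℤ) ^ (i : ℕ) •
      (delTop n k T q (((delSAb n k).obj (op T)).map (SimplexCategory.δ i).op s)).1 p := by
  have h := (delComplex_d n k T q _).symm.trans (d_topProj (delComplex n k T) q s)
  exact (congrFun (congrArg Subtype.val h) p).trans (delGroup_sum _ _ _ _)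

lemma delTop_naturality {S T : CartFam} (g : S ⟶ T) (q : ℕ)
    (s : ((delSAb n k).obj (op T)).obj (op ⦋q⦌)) :
    delTop n k S q (((delSAb n k).map g.op).app (op ⦋q⦌) s) =
      delRes n k g q (delTop n k T q s) :=
  topProj_naturality ((deligne n k).map g.op) q s

lemma delTop_proj {l : ℕ} (h : l ≤ k) {T : CartFam} (q : ℕ)
    (s : ((delSAb n k).obj (op T)).obj (op ⦋q⦌)) :
    delTop n l T q ((Γ₀.map ((deligneProj n h).app (op T))).app (op ⦋q⦌) s) =
      delProjHom n h T q (delTop n k T q s) :=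
  topProj_naturality ((deligneProj n h).app (op T)) q s

lemma delSAb_ext {T : CartFam} {Δ : SimplexCategory}
    {s t : ((delSAb n k).obj (op T)).obj (op Δ)}
    (h : ∀ (q : ℕ) (η : ⦋q⦌ ⟶ Δ), delTop n k T q (((delSAb n k).obj (op T)).map η.op s) =
      delTop n k T q (((delSAb n k).obj (op T)).map η.op t)) : s = t := by
  refine sub_eq_zero.1 (eq_zero_of_topProj (delComplex n k T) Δ.len _ fun q η => ?_)
  refine Eq.trans ?_ (sub_eq_zero.2 (h q η))
  refine Eq.trans ?_ (map_sub (delTop n k T q) _ _)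
  exact congrArg (delTop n k T q) (map_sub (((delSAb n k).obj (op T)).map η.op).hom s t)

/-- A simplex of the product of the Čech nerve with `Δ[m]`. -/
def cechProd {T : CartFam} {Δ : SimplexCategory} (s : CechSimplex X T Δ) (θ : Δ ⟶ ⦋m⦌) :
    ((cech X ⊗ constSimplex.obj (SimplexCategory.mk m)).obj (op T)).obj (op Δ) :=
  (s, SSet.stdSimplex.objEquiv.symm θ)

/-- A simplex of the mapping space as a morphism. -/
def simplexHom (f : (mapSpace (cech X) (delSSet n k)) _⦋m⦌) :
    cech X ⊗ constSimplex.obj (SimplexCategory.mk m) ⟶ delSSet n k := f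

/-- The value of a simplex of the mapping space. -/
noncomputable def simplexEval (f : (mapSpace (cech X) (delSSet n k)) _⦋m⦌) {T : CartFam}
    {Δ : SimplexCategory} (s : CechSimplex X T Δ) (θ : Δ ⟶ ⦋m⦌) :
    ((delSAb n k).obj (op T)).obj (op Δ) :=
  ((simplexHom f).app (op T)).app (op Δ) (cechProd s θ)

lemma simplexEval_act (f : (mapSpace (cech X) (delSSet n k)) _⦋m⦌) {T : CartFam}
    {Δ Δ' : SimplexCategory} (s : CechSimplex X T Δ) (θ : Δ ⟶ ⦋m⦌) (η : Δ' ⟶ Δ) :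
    simplexEval f (s.act η) (η ≫ θ) =
      ((delSAb n k).obj (op T)).map η.op (simplexEval f s θ) :=
  ConcreteCategory.congr_hom (((simplexHom f).app (op T)).naturality η.op) (cechProd s θ)

lemma simplexEval_res (f : (mapSpace (cech X) (delSSet n k)) _⦋m⦌) {S T : CartFam} (g : S ⟶ T)
    {Δ : SimplexCategory} (s : CechSimplex X T Δ) (θ : Δ ⟶ ⦋m⦌) :
    simplexEval f (s.res g) θ = ((delSAb n k).map g.op).app (op Δ) (simplexEval f s θ) :=
  ConcreteCategory.congr_hom (NatTrans.congr_app ((simplexHom f).naturality g.op) (op Δ))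
    (cechProd s θ)

lemma simplex_ext {f g : (mapSpace (cech X) (delSSet n k)) _⦋m⦌}
    (h : ∀ (T : CartFam) (Δ : SimplexCategory) (s : CechSimplex X T Δ) (θ : Δ ⟶ ⦋m⦌),
      simplexEval f s θ = simplexEval g s θ) : f = g :=
  NatTrans.ext (funext fun T => NatTrans.ext (funext fun Δ =>
    ConcreteCategory.hom_ext _ _ fun p => h T.unop Δ.unop p.1 (SSet.stdSimplex.objEquiv p.2)))

/-- The components of a simplex of the mapping space. -/
noncomputable def simplexFam (f : (mapSpace (cech X) (delSSet n k)) _⦋m⦌) (q p : ℕ) :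
    Fam X m q p :=
  fun T s θ => (delTop n k T q (simplexEval f s θ)).1 p

lemma isCocycle_simplexFam (f : (mapSpace (cech X) (delSSet n k)) _⦋m⦌) :
    IsCocycle n k (simplexFam f) where
  nat q p S T g s θ := by
    unfold simplexFam
    rw [simplexEval_res, delTop_naturality]
    rfl
  degenerate q p T i s θ := by
    unfold simplexFam
    rw [simplexEval_act, delTop_σ]
    rfl
  supp q p T s θ h := (delTop n k T q (simplexEval f s θ)).2 p h
  diff q p T s θ := by
    unfold simplexFam
    simp_rw [simplexEval_act]
    exact delDiff_delTop q p (simplexEval f s θ)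

lemma simplexFam_injective {f g : (mapSpace (cech X) (delSSet n k)) _⦋m⦌}
    (h : simplexFam f = simplexFam g) : f = g := by
  refine simplex_ext fun T Δ s θ => delSAb_ext fun q η => ?_
  rw [← simplexEval_act, ← simplexEval_act]
  exact Subtype.ext (funext fun p =>
    congrFun (congrFun (congrFun (congrFun (congrFun h q) p) T) (s.act η)) (η ≫ θ))

/-- The family of elements of the Deligne complex given by a cocycle. -/
def IsCocycle.elem {x : ∀ q p, Fam X m q p} (hx : IsCocycle n k x) {T : CartFam} {q : ℕ}
    (s : CechSimplex X T ⦋q⦌) (θ : ⦋q⦌ ⟶ ⦋m⦌) : delGroup n k T q :=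
  ⟨fun p => x q p T s θ, fun p hp => hx.supp q p T s θ hp⟩

lemma IsCocycle.isFamily {x : ∀ q p, Fam X m q p} (hx : IsCocycle n k x) {T : CartFam} {l : ℕ}
    (s : CechSimplex X T ⦋l⦌) (θ : ⦋l⦌ ⟶ ⦋m⦌) :
    IsFamily (K := delComplex n k T) (m := l)
      (fun q (η : ⦋q⦌ ⟶ ⦋l⦌) => hx.elem (s.act η) (η ≫ θ)) where
  degenerate q i η := by
    refine Subtype.ext (funext fun p => ?_)
    have := hx.degenerate q p T i (s.act η) (η ≫ θ)
    rw [← Category.assoc] at this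
    exact this
  d q η := by
    rw [delComplex_d]
    refine Subtype.ext (funext fun p => ?_)
    refine (hx.diff q p T (s.act η) (η ≫ θ)).trans ?_
    refine Eq.trans ?_ (delGroup_sum _ _ _ _).symm
    refine Finset.sum_congr rfl fun i _ => ?_
    rw [← Category.assoc]
    rfl

/-- The simplex of the simplicial abelian group determined by a cocycle. -/
noncomputable def IsCocycle.simplex {x : ∀ q p, Fam X m q p} (hx : IsCocycle n k x)
    {T : CartFam} {Δ : SimplexCategory} (s : CechSimplex X T Δ) (θ : Δ ⟶ ⦋m⦌) :
    ((delSAb n k).obj (op T)).obj (op Δ) :=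
  (hx.isFamily (l := Δ.len) s θ).exists_simplex.choose

lemma IsCocycle.delTop_simplex {x : ∀ q p, Fam X m q p} (hx : IsCocycle n k x) {T : CartFam}
    {Δ : SimplexCategory} (s : CechSimplex X T Δ) (θ : Δ ⟶ ⦋m⦌) (q : ℕ) (η : ⦋q⦌ ⟶ Δ) :
    delTop n k T q (((delSAb n k).obj (op T)).map η.op (hx.simplex s θ)) =
      hx.elem (s.act η) (η ≫ θ) :=
  (hx.isFamily (l := Δ.len) s θ).exists_simplex.choose_spec q η

/-- The simplices are chosen one at a time, but their top components determine them, so the choices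
automatically respect the simplicial operators. `IsCocycle.simplex_res` holds for the same reason.
-/
lemma IsCocycle.simplex_act {x : ∀ q p, Fam X m q p} (hx : IsCocycle n k x) {T : CartFam}
    {Δ Δ' : SimplexCategory} (s : CechSimplex X T Δ) (θ : Δ ⟶ ⦋m⦌) (ζ : Δ' ⟶ Δ) :
    hx.simplex (s.act ζ) (ζ ≫ θ) = ((delSAb n k).obj (op T)).map ζ.op (hx.simplex s θ) := by
  refine delSAb_ext fun q η => ?_
  have h := hx.delTop_simplex s θ q (η ≫ ζ)
  rw [op_comp, Functor.map_comp, Category.assoc] at h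
  rw [hx.delTop_simplex]
  exact h.symm

lemma IsCocycle.simplex_res {x : ∀ q p, Fam X m q p} (hx : IsCocycle n k x) {S T : CartFam}
    (g : S ⟶ T) {Δ : SimplexCategory} (s : CechSimplex X T Δ) (θ : Δ ⟶ ⦋m⦌) :
    hx.simplex (s.res g) θ = ((delSAb n k).map g.op).app (op Δ) (hx.simplex s θ) := by
  refine delSAb_ext fun q η => ?_
  have h := ConcreteCategory.congr_hom (((delSAb n k).map g.op).naturality η.op)
    (hx.simplex s θ)
  refine Eq.trans ?_ (congrArg (delTop n k S q) h)
  refine Eq.trans ?_ (delTop_naturality g q _).symm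
  rw [hx.delTop_simplex]
  refine Eq.trans ?_ (congrArg (delRes n k g q) (hx.delTop_simplex s θ q η)).symm
  exact Subtype.ext (funext fun p => hx.nat q p g (s.act η) (η ≫ θ))

/-- The simplex of the mapping space determined by a cocycle. -/
noncomputable def IsCocycle.toMap {x : ∀ q p, Fam X m q p} (hx : IsCocycle n k x) :
    (mapSpace (cech X) (delSSet n k)) _⦋m⦌ :=
  show cech X ⊗ constSimplex.obj (SimplexCategory.mk m) ⟶ delSSet n k from
  { app := fun _ =>
      { app := fun _ => ↾(fun p => hx.simplex p.1 (SSet.stdSimplex.objEquiv p.2))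
        naturality := fun _ _ ζ => ConcreteCategory.hom_ext _ _ fun p =>
          hx.simplex_act p.1 (SSet.stdSimplex.objEquiv p.2) ζ.unop }
    naturality := fun _ _ g => NatTrans.ext (funext fun _ => ConcreteCategory.hom_ext _ _ fun p =>
      hx.simplex_res g.unop p.1 (SSet.stdSimplex.objEquiv p.2)) }

lemma IsCocycle.simplexFam_toMap {x : ∀ q p, Fam X m q p} (hx : IsCocycle n k x) :
    simplexFam hx.toMap = x := by
  funext q p T s θ
  have h := hx.delTop_simplex s θ q (𝟙 _)
  rw [simplicialObject_map_id, Category.id_comp] at h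
  exact congrFun (congrArg Subtype.val h) p

/-- Simplices of the mapping space are cocycles. -/
noncomputable def cocycleEquiv (X : GCov M) (n k m : ℕ) :
    (mapSpace (cech X) (delSSet n k)) _⦋m⦌ ≃ {x : ∀ q p, Fam X m q p // IsCocycle n k x} where
  toFun f := ⟨simplexFam f, isCocycle_simplexFam f⟩
  invFun x := x.2.toMap
  left_inv f := simplexFam_injective (isCocycle_simplexFam f).simplexFam_toMap
  right_inv x := Subtype.ext x.2.simplexFam_toMap

end Cocycles

end HigherGerbe

namespace HigherGerbe

open Simplicial AlgebraicTopology.DoldKan SimplicialObject MonoidalCategory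

/-! ### The group structure on the mapping spaces -/

section Cocycles

variable {M : Mfd} {n k m : ℕ} {X : GCov M}

lemma delDiff_zero (k : ℕ) (T : CartFam) : delDiff k T 0 = 0 := by
  have := delDiff_add k T 0 0
  rwa [add_zero, left_eq_add] at this

lemma delDiff_neg (k : ℕ) (T : CartFam) (u : ∀ p, Coeff T p) :
    delDiff k T (-u) = - delDiff k T u := by
  have := delDiff_add k T u (-u)
  rw [add_neg_cancel, delDiff_zero] at this
  exact (neg_eq_of_add_eq_zero_right this.symm).symm

/-- The group of cocycles. -/
def cocycles (X : GCov M) (n k m : ℕ) : AddSubgroup (∀ q p, Fam X m q p) where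
  carrier := {x | IsCocycle n k x}
  zero_mem' :=
    { nat := fun q p S T f s θ => (map_zero (Coeff.pullback f p)).symm
      degenerate := fun _ _ _ _ _ _ => rfl
      supp := fun _ _ _ _ _ _ => rfl
      diff := fun q p T s θ => by
        refine (congrFun (delDiff_zero k T) p).trans (Eq.symm ?_)
        exact Finset.sum_eq_zero fun i _ => smul_zero _ }
  add_mem' := fun {x y} hx hy =>
    { nat := fun q p S T f s θ => by
        change x q p S (s.res f) θ + y q p S (s.res f) θ = Coeff.pullback f p (x q p T s θ + y q p T s θ)
        rw [hx.nat, hy.nat, map_add]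
      degenerate := fun q p T i s θ => by
        change x _ _ _ _ _ + y _ _ _ _ _ = 0
        rw [hx.degenerate, hy.degenerate, add_zero]
      supp := fun q p T s θ h => by
        change x _ _ _ _ _ + y _ _ _ _ _ = 0
        rw [hx.supp q p T s θ h, hy.supp q p T s θ h, add_zero]
      diff := fun q p T s θ => by
        refine (congrFun (delDiff_add k T (fun p => x (q + 1) p T s θ)
          (fun p => y (q + 1) p T s θ)) p).trans ?_
        rw [Pi.add_apply, hx.diff, hy.diff, ← Finset.sum_add_distrib]
        exact Finset.sum_congr rfl fun i _ => (smul_add _ _ _).symm }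
  neg_mem' := fun {x} hx =>
    { nat := fun q p S T f s θ => by
        change - x q p S (s.res f) θ = Coeff.pullback f p (- x q p T s θ)
        rw [hx.nat, map_neg]
      degenerate := fun q p T i s θ => by
        change - x _ _ _ _ _ = 0
        rw [hx.degenerate, neg_zero]
      supp := fun q p T s θ h => by
        change - x _ _ _ _ _ = 0
        rw [hx.supp q p T s θ h, neg_zero]
      diff := fun q p T s θ => by
        refine (congrFun (delDiff_neg k T (fun p => x (q + 1) p T s θ)) p).trans ?_
        rw [Pi.neg_apply, hx.diff, ← Finset.sum_neg_distrib]
        exact Finset.sum_congr rfl fun i _ => (smul_neg _ _).symm }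

lemma simplexFam_map {m' : ℕ} (θ : ⦋m'⦌ ⟶ ⦋m⦌) (f : (mapSpace (cech X) (delSSet n k)) _⦋m⦌)
    (q p : ℕ) (T : CartFam) (s : CechSimplex X T ⦋q⦌) (η : ⦋q⦌ ⟶ ⦋m'⦌) :
    simplexFam ((mapSpace (cech X) (delSSet n k)).map θ.op f) q p T s η =
      simplexFam f q p T s (η ≫ θ) := rfl

lemma simplexFam_pre {Y : GCov M} (g : X ⟶ Y) (f : (mapSpace (cech Y) (delSSet n k)) _⦋m⦌)
    (q p : ℕ) (T : CartFam) (s : CechSimplex X T ⦋q⦌) (η : ⦋q⦌ ⟶ ⦋m⦌) :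
    simplexFam ((mapSpace.pre ((cechFunctor M).map g) (delSSet n k)).app (op ⦋m⦌) f) q p T s η =
      simplexFam f q p T (s.push g) η := rfl

lemma simplexFam_post {l : ℕ} (h : l ≤ k) (f : (mapSpace (cech X) (delSSet n k)) _⦋m⦌)
    (q p : ℕ) (T : CartFam) (s : CechSimplex X T ⦋q⦌) (η : ⦋q⦌ ⟶ ⦋m⦌) :
    simplexFam ((mapSpace.post (cech X) (delSSetProj n h)).app (op ⦋m⦌) f) q p T s η =
      delTrunc l T (fun p => simplexFam f q p T s η) p :=
  congrFun (congrArg Subtype.val (delTop_proj (n := n) h q (simplexEval f s η))) p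

/-- The simplices of the mapping space as the group of cocycles. -/
noncomputable def cocyclesEquiv (X : GCov M) (n k : ℕ) (Δ : SimplexCategoryᵒᵖ) :
    (mapSpace (cech X) (delSSet n k)).obj Δ ≃ cocycles X n k Δ.unop.len :=
  cocycleEquiv X n k Δ.unop.len

/-- The group law is transported from cocycles, so it is componentwise, and the structure maps are
additive because they only reindex components. -/
noncomputable instance mapSpaceAddStr (X : GCov M) (n k : ℕ) :
    AddStr (mapSpace (cech X) (delSSet n k)) where
  grp Δ := (cocyclesEquiv X n k Δ).addCommGroup
  map_add {Δ Δ'} θ f g := by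
    apply (cocyclesEquiv X n k Δ').injective
    let : AddCommGroup ((mapSpace (cech X) (delSSet n k)).obj Δ) :=
      (cocyclesEquiv X n k Δ).addCommGroup
    let : AddCommGroup ((mapSpace (cech X) (delSSet n k)).obj Δ') :=
      (cocyclesEquiv X n k Δ').addCommGroup
    refine Eq.trans ?_ ((cocyclesEquiv X n k Δ').addEquiv.map_add _ _).symm
    have h := (cocyclesEquiv X n k Δ).addEquiv.map_add f g
    refine Subtype.ext ?_
    funext q p T s η
    have h' := congrFun (congrFun (congrFun (congrFun (congrFun (congrArg Subtype.val h) q) p)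
      T) s) (η ≫ θ.unop)
    exact h'

lemma simplexFam_add (f g : (mapSpace (cech X) (delSSet n k)) _⦋m⦌) :
    simplexFam (f + g) = simplexFam f + simplexFam g :=
  congrArg Subtype.val ((cocyclesEquiv X n k (op ⦋m⦌)).addEquiv.map_add f g)

lemma simplexFam_sub (f g : (mapSpace (cech X) (delSSet n k)) _⦋m⦌) :
    simplexFam (f - g) = simplexFam f - simplexFam g :=
  congrArg Subtype.val ((cocyclesEquiv X n k (op ⦋m⦌)).addEquiv.map_sub f g)

end Cocycles

end HigherGerbe

/-! ### Combinatorics of faces, degeneracies and cones. -/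

namespace HigherGerbe

open Simplicial

/-! ### Alternating sums over faces -/

/-- The involution `(i, j) ↦ (j, i - 1)` for `j < i`, and back, pairs terms that agree by `h` and
carry opposite signs. The identities `δ ∘ δ = 0` below are instances. -/
lemma alternating_double_sum_eq_zero {A : Type*} [AddCommGroup A] {n : ℕ}
    (F : Fin (n + 1) → Fin n → A)
    (h : ∀ i j : Fin n, j ≤ i → F i.succ j = F j.castSucc i) :
    ∑ i : Fin (n + 1), (-1 : ℤ) ^ (i : ℕ) • ∑ j : Fin n, (-1 : ℤ) ^ (j : ℕ) • F i j = 0 := by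
  have : ∑ p : Fin (n + 1) × Fin n, (-1 : ℤ) ^ ((p.1 : ℕ) + (p.2 : ℕ)) • F p.1 p.2 = 0 := by
    refine Finset.sum_involution (fun p _ =>
      if hp : p.2.castSucc < p.1 then (p.2.castSucc, p.1.pred (Fin.ne_zero_of_lt hp))
      else (p.2.succ, p.1.castPred (fun h' => hp (h' ▸ p.2.castSucc_lt_last))))
      (fun p _ => ?_) (fun p _ _ => ?_) (fun _ _ => Finset.mem_univ _) (fun p _ => ?_)
    · obtain ⟨i, j⟩ := p
      dsimp only
      split_ifs with hp
      · obtain ⟨i, rfl⟩ := Fin.exists_succ_eq.2 (Fin.ne_zero_of_lt hp)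
        rw [Fin.pred_succ, h i j (Fin.castSucc_lt_succ_iff.1 hp)]
        simp only [Fin.val_succ, Fin.val_castSucc]
        rw [show (i : ℕ) + 1 + j = (j + i : ℕ) + 1 by ring, pow_succ]
        simp
      · obtain ⟨i, rfl⟩ := Fin.exists_castSucc_eq.2
          (fun h' : i = Fin.last n => hp (h' ▸ j.castSucc_lt_last))
        rw [Fin.castPred_castSucc, h j i (by simpa using hp)]
        simp only [Fin.val_succ, Fin.val_castSucc]
        rw [show (j : ℕ) + 1 + i = (i + j : ℕ) + 1 by ring, pow_succ]
        simp
    · obtain ⟨i, j⟩ := p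
      dsimp only
      split_ifs with hp
      · exact fun h' => hp.ne (congrArg Prod.fst h')
      · intro h'
        have := congrArg Prod.fst h'
        dsimp only at this
        subst this
        exact hp (Fin.castSucc_lt_succ)
    · obtain ⟨i, j⟩ := p
      dsimp only
      by_cases hp : j.castSucc < i
      · obtain ⟨i, rfl⟩ := Fin.exists_succ_eq.2 (Fin.ne_zero_of_lt hp)
        have : ¬ i.castSucc < j.castSucc := by
          simpa using Fin.castSucc_lt_succ_iff.1 hp
        simp [hp, this]
      · obtain ⟨i, rfl⟩ := Fin.exists_castSucc_eq.2
          (fun h' : i = Fin.last n => hp (h' ▸ j.castSucc_lt_last))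
        have h2 : i.castSucc < j.succ := by
          rw [Fin.castSucc_lt_succ_iff]
          simpa using hp
        simp only [hp, dite_false]
        simp [h2]
  rw [Fintype.sum_prod_type] at this
  refine Eq.trans (Finset.sum_congr rfl fun i _ => ?_) this
  rw [Finset.smul_sum]
  exact Finset.sum_congr rfl fun j _ => by rw [smul_smul, pow_add]

section Families

variable {M : Mfd} {m q : ℕ} {X : GCov M} {A : CartFam → Type} [∀ T, AddCommGroup (A T)]

/-- Families of elements indexed by the `q`-simplices of the product of the Čech nerve with
`Δ[m]`. -/
abbrev GFam (A : CartFam → Type) (X : GCov M) (m q : ℕ) : Type :=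
  ∀ T : CartFam, CechSimplex X T ⦋q⦌ → (⦋q⦌ ⟶ ⦋m⦌) → A T

/-- The alternating sum over the faces. -/
def famDelta (x : GFam A X m q) : GFam A X m (q + 1) := fun T s θ =>
  ∑ i : Fin (q + 2), (-1 : ℤ) ^ (i : ℕ) •
    x T (s.act (SimplexCategory.δ i)) (SimplexCategory.δ i ≫ θ)

lemma famDelta_famDelta (x : GFam A X m q) : famDelta (famDelta x) = 0 := by
  funext T s θ
  refine alternating_double_sum_eq_zero (fun i j => x T ((s.act (SimplexCategory.δ i)).act
    (SimplexCategory.δ j)) (SimplexCategory.δ j ≫ SimplexCategory.δ i ≫ θ)) fun i j hij => ?_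
  have h := SimplexCategory.δ_comp_δ hij
  have h1 : (s.act (SimplexCategory.δ i.succ)).act (SimplexCategory.δ j) =
      (s.act (SimplexCategory.δ j.castSucc)).act (SimplexCategory.δ i) := by
    change s.act (SimplexCategory.δ j ≫ SimplexCategory.δ i.succ) =
      s.act (SimplexCategory.δ i ≫ SimplexCategory.δ j.castSucc)
    rw [h]
  rw [h1, ← Category.assoc, h, Category.assoc]

lemma famDelta_add (x y : GFam A X m q) : famDelta (x + y) = famDelta x + famDelta y := by
  funext T s θ
  refine Eq.trans ?_ Finset.sum_add_distrib
  exact Finset.sum_congr rfl fun i _ => smul_add _ _ _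

lemma famDelta_neg (x : GFam A X m q) : famDelta (-x) = -famDelta x := by
  funext T s θ
  refine Eq.trans ?_ (Finset.sum_neg_distrib _)
  exact Finset.sum_congr rfl fun i _ => smul_neg _ _

lemma famDelta_sub (x y : GFam A X m q) : famDelta (x - y) = famDelta x - famDelta y := by
  rw [sub_eq_add_neg, famDelta_add, famDelta_neg, sub_eq_add_neg]

/-- Families which vanish on degenerate simplices. -/
def FamNormalized (x : GFam A X m q) : Prop :=
  ∀ (T : CartFam) (s : CechSimplex X T ⦋q⦌) (θ : ⦋q⦌ ⟶ ⦋m⦌) (i : Fin q),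
    s.idx i.castSucc = s.idx i.succ → θ.toOrderHom i.castSucc = θ.toOrderHom i.succ → x T s θ = 0

/-- The operator fixes every index except `i + 1`, which it sends to `i`. So a tuple with equal
entries at `i` and `i + 1` is a degeneracy of its own face, which translates between the two forms
of normalization. -/
lemma apply_σ_δ {B : Type*} (f : Fin (q + 2) → B) (i : Fin (q + 1)) (h : f i.castSucc = f i.succ)
    (j : Fin (q + 2)) : f ((SimplexCategory.σ i ≫ SimplexCategory.δ i.succ).toOrderHom j) = f j := by
  change f (i.succ.succAbove (i.predAbove j)) = f j
  rcases lt_or_ge i.castSucc j with hj | hj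
  · rw [Fin.predAbove_of_castSucc_lt _ _ hj]
    obtain ⟨j, rfl⟩ := Fin.exists_succ_eq.2 (Fin.ne_zero_of_lt hj)
    rw [Fin.pred_succ]
    rcases eq_or_lt_of_le (Fin.castSucc_lt_succ_iff.1 hj) with rfl | hj'
    · rw [Fin.succAbove_of_castSucc_lt _ _ Fin.castSucc_lt_succ, h]
    · rw [Fin.succAbove_of_le_castSucc]
      rwa [Fin.succ_le_castSucc_iff]
  · rw [Fin.predAbove_of_le_castSucc _ _ hj]
    rw [Fin.succAbove_of_castSucc_lt]
    · simp
    · simpa using lt_of_le_of_lt hj Fin.castSucc_lt_succ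

lemma famNormalized_succ_iff (x : GFam A X m (q + 1)) : FamNormalized x ↔
    ∀ (T : CartFam) (i : Fin (q + 1)) (s : CechSimplex X T ⦋q⦌) (θ : ⦋q⦌ ⟶ ⦋m⦌),
      x T (s.act (SimplexCategory.σ i)) (SimplexCategory.σ i ≫ θ) = 0 := by
  have key (i : Fin (q + 1)) : (SimplexCategory.σ i).toOrderHom i.castSucc =
      (SimplexCategory.σ i).toOrderHom i.succ :=
    (Fin.predAbove_castSucc_self i).trans (Fin.predAbove_succ_self i).symm
  constructor
  · intro h T i s θ
    exact h T _ _ i (congrArg s.idx (key i)) (congrArg θ.toOrderHom (key i))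
  · intro h T s θ i h1 h2
    have hs : (s.act (SimplexCategory.δ i.succ)).act (SimplexCategory.σ i) = s :=
      CechSimplex.ext rfl rfl (funext fun j => apply_σ_δ s.idx i h1 j)
    have hθ : SimplexCategory.σ i ≫ SimplexCategory.δ i.succ ≫ θ = θ :=
      SimplexCategory.Hom.ext _ _ (OrderHom.ext _ _ (funext fun j =>
        apply_σ_δ θ.toOrderHom i h2 j))
    rw [← hs, ← hθ]
    exact h _ _ _ _

end Families

/-! ### Cones -/

section Cones

variable {M : Mfd} {m q : ℕ} {X : GCov M}

/-- Adding a vertex to a simplex of the Čech nerve. -/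
def CechSimplex.cons {T : CartFam} (s : CechSimplex X T ⦋q⦌) (b : X.Λ)
    (h : ∀ x, s.total x ∈ X.total b) : CechSimplex X T ⦋q + 1⦌ where
  total := s.total
  down := s.down
  contMDiff_total := s.contMDiff_total
  contMDiff_down := s.contMDiff_down
  comm := s.comm
  idx := Fin.cons b s.idx
  total_mem i x := by
    induction i using Fin.cases with
    | zero => exact h x
    | succ i => exact s.total_mem i x
  down_mem i x := by
    induction i using Fin.cases with
    | zero =>
      rw [← s.comm (x, 0)]
      exact (X.isCartFam b).1 _ (h _)
    | succ i => exact s.down_mem i x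

/-- Adding the vertex `0` to a simplex of `Δ[m]`. -/
def consZero (θ : ⦋q⦌ ⟶ ⦋m⦌) : ⦋q + 1⦌ ⟶ ⦋m⦌ :=
  SimplexCategory.mkHom ⟨Fin.cons 0 θ.toOrderHom, fun i j hij => by
    induction i using Fin.cases with
    | zero => exact Fin.zero_le _
    | succ i =>
      induction j using Fin.cases with
      | zero => exact absurd hij (by simp)
      | succ j => exact θ.toOrderHom.monotone (Fin.succ_le_succ_iff.1 hij)⟩

lemma δ_zero_consZero (θ : ⦋q⦌ ⟶ ⦋m⦌) : SimplexCategory.δ 0 ≫ consZero θ = θ :=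
  SimplexCategory.Hom.ext _ _ (OrderHom.ext _ _ rfl)

lemma δ_succ_consZero (θ : ⦋q + 1⦌ ⟶ ⦋m⦌) (i : Fin (q + 2)) :
    SimplexCategory.δ i.succ ≫ consZero θ = consZero (SimplexCategory.δ i ≫ θ) := by
  refine SimplexCategory.Hom.ext _ _ (OrderHom.ext _ _ (funext fun j => ?_))
  change (consZero θ).toOrderHom (i.succ.succAbove j) = _
  induction j using Fin.cases with
  | zero => rfl
  | succ j =>
    rw [Fin.succ_succAbove_succ]
    rfl

lemma CechSimplex.cons_act_δ_zero {T : CartFam} (s : CechSimplex X T ⦋q⦌) (b : X.Λ)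
    (h : ∀ x, s.total x ∈ X.total b) : (s.cons b h).act (SimplexCategory.δ 0) = s := rfl

lemma CechSimplex.cons_act_δ_succ {T : CartFam} (s : CechSimplex X T ⦋q + 1⦌) (b : X.Λ)
    (h : ∀ x, s.total x ∈ X.total b) (i : Fin (q + 2)) :
    (s.cons b h).act (SimplexCategory.δ i.succ) = (s.act (SimplexCategory.δ i)).cons b h := by
  refine CechSimplex.ext rfl rfl (funext fun j => ?_)
  change (Fin.cons b s.idx : Fin (q + 3) → X.Λ) (i.succ.succAbove j) = _
  induction j using Fin.cases with
  | zero => rfl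
  | succ j =>
    rw [Fin.succ_succAbove_succ]
    rfl

end Cones

end HigherGerbe

/-! ### Vertical forms are acyclic: localization to boxes, gluing, partitions of unity. -/

namespace HigherGerbe

open Metric OpenPartialHomeomorph

/-! ### Small boxes -/

section Ball

variable {V : Type*} [NormedAddCommGroup V] [InnerProductSpace ℝ V]

lemma hasFDerivAt_univBall (c : V) (r : ℝ) (x : V) :
    HasFDerivAt (univBall c r) (fderiv ℝ (univBall c r) x) x :=
  ((contDiff_univBall (n := 1)).differentiable (by simp) x).hasFDerivAt

lemma contDiffAt_univBall_symm {c : V} {r : ℝ} {n : ℕ∞} {y : V} (hy : y ∈ ball c r) :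
    ContDiffAt ℝ n (univBall c r).symm y :=
  contDiffOn_univBall_symm.contDiffAt (isOpen_ball.mem_nhds hy)

lemma univBall_right_inv {c : V} {r : ℝ} {y : V} (hy : y ∈ ball c r) :
    univBall c r ((univBall c r).symm y) = y :=
  (univBall c r).right_inv (ball_subset_univBall_target c r hy)

lemma univBall_mem_ball (c : V) {r : ℝ} (hr : 0 < r) (x : V) : univBall c r x ∈ ball c r := by
  rw [← univBall_target c hr]
  exact (univBall c r).map_source (by simp)

lemma fderiv_univBall_comp_symm {c : V} {r : ℝ} {y : V} (hy : y ∈ ball c r) :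
    (fderiv ℝ (univBall c r) ((univBall c r).symm y)).comp (fderiv ℝ (univBall c r).symm y) =
      ContinuousLinearMap.id ℝ V := by
  have h1 := ((contDiffAt_univBall_symm (n := 1) hy).differentiableAt (by simp)).hasFDerivAt
  have h2 := (hasFDerivAt_univBall c r ((univBall c r).symm y)).comp y h1
  have h3 : (univBall c r) ∘ (univBall c r).symm =ᶠ[nhds y] id := by
    filter_upwards [isOpen_ball.mem_nhds hy] with z hz using univBall_right_inv hz
  exact h2.unique ((hasFDerivAt_id y).congr_of_eventuallyEq h3)

end Ball

/-- The embedding of a family of cartesian spaces onto a small box in itself. -/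
noncomputable def CartFam.box (T : CartFam) (c : T.Total) (r : ℝ) : T ⟶ T :=
  (⟨fun p => (univBall c.1 r p.1, univBall c.2 r p.2), univBall c.1 r,
    (contDiff_univBall.comp contDiff_fst).prodMk (contDiff_univBall.comp contDiff_snd),
    contDiff_univBall, fun _ => rfl⟩ : CartFam.Hom T T)

lemma CartFam.box_zero (T : CartFam) (c : T.Total) (r : ℝ) :
    CartFam.Hom.total (T.box c r) 0 = c :=
  Prod.ext (univBall_apply_zero c.1 r) (univBall_apply_zero c.2 r)

lemma CartFam.box_mem_ball (T : CartFam) (c : T.Total) {r : ℝ} (hr : 0 < r) (p : T.Total) :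
    CartFam.Hom.total (T.box c r) p ∈ ball c r := by
  rw [← ball_prod_same]
  exact ⟨univBall_mem_ball c.1 hr p.1, univBall_mem_ball c.2 hr p.2⟩

lemma CartFam.fib_box (T : CartFam) (c : T.Total) (r : ℝ) (x : E T.baseDim) :
    CartFam.Hom.fib (T.box c r) x = univBall c.2 r := rfl

lemma CartFam.exists_box {T : CartFam} {W : Set T.Total} (hW : IsOpen W) {c : T.Total}
    (hc : c ∈ W) : ∃ r > 0, ∀ p, CartFam.Hom.total (T.box c r) p ∈ W := by
  obtain ⟨r, hr, h⟩ := Metric.isOpen_iff.1 hW c hc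
  exact ⟨r, hr, fun p => h (T.box_mem_ball c hr p)⟩

lemma fderiv_comp₃ {U V W Z : Type*} [NormedAddCommGroup U] [NormedSpace ℝ U]
    [NormedAddCommGroup V] [NormedSpace ℝ V] [NormedAddCommGroup W] [NormedSpace ℝ W]
    [NormedAddCommGroup Z] [NormedSpace ℝ Z] {f : U → V} {g : V → W} {h : W → Z}
    {f' : U →L[ℝ] V} {g' : V →L[ℝ] W} {h' : W →L[ℝ] Z} {x : U} {y : V} {z : W}
    (hf : HasFDerivAt f f' x) (hg : HasFDerivAt g g' y) (hh : HasFDerivAt h h' z)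
    (hx : f x = y) (hy : g y = z) : fderiv ℝ (h ∘ g ∘ f) x = (h'.comp g').comp f' := by
  subst hx hy
  exact (hh.comp x (hg.comp x hf)).fderiv

/-- A morphism factors locally through every box. -/
lemma CartFam.exists_box_factor {S T : CartFam} (e : S ⟶ T) (x : S.Total) {r : ℝ} (hr : 0 < r) :
    ∃ r' > 0, ∃ h : S ⟶ T, h ≫ T.box (CartFam.Hom.total e x) r = S.box x r' ≫ e ∧
      CartFam.Hom.total h 0 = 0 ∧
      fderiv ℝ (CartFam.Hom.fib h 0) 0 =
        ((fderiv ℝ (univBall (CartFam.Hom.total e x).2 r).symm (CartFam.Hom.total e x).2).comp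
          (fderiv ℝ (CartFam.Hom.fib e x.1) x.2)).comp (fderiv ℝ (univBall x.2 r') 0) := by
  set c := CartFam.Hom.total e x with hc
  obtain ⟨r', hr', hb⟩ := CartFam.exists_box (T := S)
    (W := CartFam.Hom.total e ⁻¹' ball c r) (isOpen_ball.preimage e.contDiff_total.continuous)
    (c := x) (mem_ball_self hr)
  have hb' : ∀ p, (CartFam.Hom.total e (CartFam.Hom.total (S.box x r') p)).1 ∈ ball c.1 r ∧
      (CartFam.Hom.total e (CartFam.Hom.total (S.box x r') p)).2 ∈ ball c.2 r := fun p => by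
    have := hb p
    rw [Set.mem_preimage, ← ball_prod_same] at this
    exact this
  -- The base map is read off from the total map at fibre coordinate `0`.
  have hb1 : ∀ p, CartFam.Hom.base e (univBall x.1 r' p) ∈ ball c.1 r := fun p => by
    have h3 : CartFam.Hom.base e (univBall x.1 r' p) =
      (CartFam.Hom.total e (CartFam.Hom.total (S.box x r') (p, 0))).1 :=
      (e.comm (CartFam.Hom.total (S.box x r') (p, 0))).symm
    rw [h3]
    exact (hb' (p, 0)).1
  let g : S ⟶ T := S.box x r' ≫ e
  have hg : ContDiff ℝ ∞ (CartFam.Hom.total g) := g.contDiff_total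
  let h : CartFam.Hom S T :=
    ⟨fun p => ((univBall c.1 r).symm (CartFam.Hom.total g p).1,
        (univBall c.2 r).symm (CartFam.Hom.total g p).2),
      fun p => (univBall c.1 r).symm (CartFam.Hom.base g p),
      (contDiffOn_univBall_symm.comp_contDiff (contDiff_fst.comp hg) fun p => (hb' p).1).prodMk
        (contDiffOn_univBall_symm.comp_contDiff (contDiff_snd.comp hg) fun p => (hb' p).2),
      contDiffOn_univBall_symm.comp_contDiff g.contDiff_base hb1,
      fun p => by rw [g.comm]⟩
  refine ⟨r', hr', h, ?_, ?_, ?_⟩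
  · refine CartFam.Hom.ext (funext fun p => ?_) (funext fun p => ?_)
    · exact Prod.ext (univBall_right_inv (hb' p).1) (univBall_right_inv (hb' p).2)
    · exact univBall_right_inv (hb1 p)
  · have h0 : CartFam.Hom.total g 0 = c := by
      change CartFam.Hom.total e (CartFam.Hom.total (S.box x r') 0) = c
      rw [S.box_zero]
    change ((univBall c.1 r).symm (CartFam.Hom.total g 0).1,
        (univBall c.2 r).symm (CartFam.Hom.total g 0).2) = 0
    rw [h0, univBall_symm_apply_center, univBall_symm_apply_center]
    rfl
  · have h1 : CartFam.Hom.fib h 0 =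
        (univBall c.2 r).symm ∘ CartFam.Hom.fib e x.1 ∘ univBall x.2 r' := by
      funext y
      change (univBall c.2 r).symm (CartFam.Hom.total e (univBall x.1 r' 0, univBall x.2 r' y)).2 = _
      rw [univBall_apply_zero]
      rfl
    rw [h1]
    exact fderiv_comp₃ (hasFDerivAt_univBall x.2 r' 0)
      ((CartFam.Hom.contDiff_fib e x.1).differentiable (by simp) x.2).hasFDerivAt
      ((contDiffAt_univBall_symm (n := 1) (mem_ball_self hr)).differentiableAt
        (by simp)).hasFDerivAt (univBall_apply_zero x.2 r') rfl

/-! ### Gluing of vertical forms -/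

lemma contDiffAt_compCLM {D V W : Type*} [NormedAddCommGroup D] [NormedSpace ℝ D]
    [NormedAddCommGroup V] [NormedSpace ℝ V] [NormedAddCommGroup W] [NormedSpace ℝ W] {k : ℕ}
    {u : D → W [⋀^Fin k]→L[ℝ] ℝ} {f : D → V →L[ℝ] W} {x : D} (hu : ContDiffAt ℝ ∞ u x)
    (hf : ContDiffAt ℝ ∞ f x) :
    ContDiffAt ℝ ∞ (fun p => (u p).compContinuousLinearMap (f p)) x :=
  (contDiff_compCLM (D := (W [⋀^Fin k]→L[ℝ] ℝ) × (V →L[ℝ] W)) contDiff_fst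
    contDiff_snd).contDiffAt.comp x (hu.prodMk hf)

lemma compCLM_injective {V W : Type*} [NormedAddCommGroup V] [NormedSpace ℝ V]
    [NormedAddCommGroup W] [NormedSpace ℝ W] {k : ℕ} {f : V →L[ℝ] W}
    (hf : Function.Surjective f) {α β : W [⋀^Fin k]→L[ℝ] ℝ}
    (h : α.compContinuousLinearMap f = β.compContinuousLinearMap f) : α = β := by
  ext v
  choose u hu using fun i => hf (v i)
  have := congrArg (fun γ => γ u) h
  simp only [ContinuousAlternatingMap.compContinuousLinearMap_apply] at this
  rwa [show f ∘ u = v from funext hu] at this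

lemma compCLM_comp {U V W : Type*} [NormedAddCommGroup U] [NormedSpace ℝ U]
    [NormedAddCommGroup V] [NormedSpace ℝ V]
    [NormedAddCommGroup W] [NormedSpace ℝ W] {k : ℕ} (α : W [⋀^Fin k]→L[ℝ] ℝ) (g : V →L[ℝ] W)
    (f : U →L[ℝ] V) : (α.compContinuousLinearMap g).compContinuousLinearMap f =
      α.compContinuousLinearMap (g.comp f) := rfl

/-- The derivative of the inverse embedding is a right inverse. Hence pulling forms back along a box
loses nothing at its centre. -/
lemma surjective_fderiv_univBall {V : Type*} [NormedAddCommGroup V] [InnerProductSpace ℝ V]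
    (c : V) {r : ℝ} (hr : 0 < r) : Function.Surjective (fderiv ℝ (univBall c r) 0) := by
  have h := fderiv_univBall_comp_symm (mem_ball_self (x := c) hr)
  rw [univBall_symm_apply_center] at h
  exact fun v => ⟨_, DFunLike.congr_fun h v⟩

/-- Compatible vertical forms on all families which map to an open subset of `T`. -/
structure LocalForm (T : CartFam) (W : Set T.Total) (k : ℕ) where
  form : ∀ {S : CartFam} (e : S ⟶ T), (∀ x, CartFam.Hom.total e x ∈ W) → vForm S k
  nat : ∀ {R S : CartFam} (h : R ⟶ S) (e : S ⟶ T) (he : ∀ x, CartFam.Hom.total e x ∈ W)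
    (he' : ∀ x, CartFam.Hom.total (h ≫ e) x ∈ W), form (h ≫ e) he' = vForm.pullback h k (form e he)

open Classical in
/-- The form on `T` which is given by a local form on `W`, extended by zero. -/
noncomputable def LocalForm.val {T : CartFam} {W : Set T.Total} {k : ℕ} (w : LocalForm T W k)
    (c : T.Total) : E T.fibDim [⋀^Fin k]→L[ℝ] ℝ :=
  if h : ∃ r > 0, ∀ p, CartFam.Hom.total (T.box c r) p ∈ W then
    -- The value at the centre of an arbitrary small box, carried back by the inverse of the box.
    -- That the radius does not matter is part of `LocalForm.val_comp`.
    ((w.form (T.box c h.choose) h.choose_spec.2).1 0).compContinuousLinearMap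
      (fderiv ℝ (univBall c.2 h.choose).symm c.2)
  else 0

variable {T : CartFam} {W : Set T.Total} {k : ℕ}

/-- A sufficiently small box at `x` is mapped by `e` into the box that defines the value at `e x`.
Naturality along both factorizations gives the same form, and the derivative of the box at `x` is
onto, so it may be cancelled. -/
lemma LocalForm.val_comp (hW : IsOpen W) (w : LocalForm T W k) {S : CartFam} (e : S ⟶ T)
    (he : ∀ x, CartFam.Hom.total e x ∈ W) (x : S.Total) :
    (w.val (CartFam.Hom.total e x)).compContinuousLinearMap
      (fderiv ℝ (CartFam.Hom.fib e x.1) x.2) = (w.form e he).1 x := by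
  have h := CartFam.exists_box hW (he x)
  unfold LocalForm.val
  rw [dif_pos h]
  obtain ⟨r', hr', g, hg, hg0, hgd⟩ := CartFam.exists_box_factor e x h.choose_spec.1
  set r := h.choose
  have h1 : ∀ z, CartFam.Hom.total (g ≫ T.box (CartFam.Hom.total e x) r) z ∈ W :=
    fun z => h.choose_spec.2 _
  have h2 := w.nat g _ h.choose_spec.2 h1
  have h3 : ∀ z, CartFam.Hom.total (S.box x r' ≫ e) z ∈ W := fun z => he _
  have h4 := w.nat (S.box x r') e he h3
  have h5 : w.form (g ≫ T.box (CartFam.Hom.total e x) r) h1 =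
      w.form (S.box x r' ≫ e) h3 := by
    simp only [hg]
  rw [h2, h4] at h5
  have h6 := congrFun (congrArg Subtype.val h5) 0
  apply compCLM_injective (surjective_fderiv_univBall x.2 hr')
  have h7 : (vForm.pullback g k (w.form _ h.choose_spec.2)).1 0 =
      ((w.form _ h.choose_spec.2).1 (CartFam.Hom.total g 0)).compContinuousLinearMap
        (fderiv ℝ (CartFam.Hom.fib g 0) 0) := rfl
  have h8 : (vForm.pullback (S.box x r') k (w.form e he)).1 0 =
      ((w.form e he).1 (CartFam.Hom.total (S.box x r') 0)).compContinuousLinearMap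
        (fderiv ℝ (univBall x.2 r') 0) := rfl
  rw [h7, h8, hg0, hgd, S.box_zero] at h6
  exact h6

/-- The defining radius varies with the point, yet by `LocalForm.val_comp` the values near `c` are
the pullback of one smooth form along the inverse of one fixed box. -/
lemma LocalForm.contDiffAt_val (hW : IsOpen W) (w : LocalForm T W k) {c : T.Total} (hc : c ∈ W) :
    ContDiffAt ℝ ∞ w.val c := by
  obtain ⟨r, hr, hb⟩ := CartFam.exists_box hW hc
  have h1 : w.val =ᶠ[nhds c] fun p => ((w.form (T.box c r) hb).1 ((univBall c.1 r).symm p.1,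
      (univBall c.2 r).symm p.2)).compContinuousLinearMap
        (fderiv ℝ (univBall c.2 r).symm p.2) := by
    filter_upwards [ball_mem_nhds c hr] with p hp
    rw [← ball_prod_same] at hp
    have h := w.val_comp hW (T.box c r) hb ((univBall c.1 r).symm p.1, (univBall c.2 r).symm p.2)
    have h2 : CartFam.Hom.total (T.box c r) ((univBall c.1 r).symm p.1,
        (univBall c.2 r).symm p.2) = p :=
      Prod.ext (univBall_right_inv hp.1) (univBall_right_inv hp.2)
    rw [h2, T.fib_box] at h
    rw [← h, compCLM_comp, fderiv_univBall_comp_symm hp.2]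
    rfl
  refine ContDiffAt.congr_of_eventuallyEq ?_ h1
  have hs1 : ContDiffAt ℝ ∞ (univBall c.1 r).symm c.1 := contDiffAt_univBall_symm (mem_ball_self hr)
  have hs2 : ContDiffAt ℝ ∞ (univBall c.2 r).symm c.2 := contDiffAt_univBall_symm (mem_ball_self hr)
  refine contDiffAt_compCLM ?_ ?_
  · exact (vForm.contDiff (w.form (T.box c r) hb)).contDiffAt.comp c
      ((hs1.comp c contDiffAt_fst).prodMk (hs2.comp c contDiffAt_snd))
  · exact (hs2.fderiv_right (m := ∞) (by simp)).comp c contDiffAt_snd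

/-- Forms are determined by their pullbacks along small boxes. -/
lemma eq_of_box {c : T.Total} {α β : E T.fibDim [⋀^Fin k]→L[ℝ] ℝ} {r : ℝ} (hr : 0 < r)
    (h : α.compContinuousLinearMap (fderiv ℝ (CartFam.Hom.fib (T.box c r) 0) 0) =
      β.compContinuousLinearMap (fderiv ℝ (CartFam.Hom.fib (T.box c r) 0) 0)) : α = β :=
  compCLM_injective (surjective_fderiv_univBall c.2 hr) h

end HigherGerbe

namespace HigherGerbe

open Simplicial

/-! ### Acyclicity of the sheaves of vertical forms on the Čech nerve -/

lemma CartFam.Hom.fderiv_fib_comp {R S T : CartFam} (f : R ⟶ S) (g : S ⟶ T) (p : R.Total) :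
    fderiv ℝ (CartFam.Hom.fib (f ≫ g) p.1) p.2 =
      (fderiv ℝ (CartFam.Hom.fib g (CartFam.Hom.total f p).1) (CartFam.Hom.total f p).2).comp
        (fderiv ℝ (CartFam.Hom.fib f p.1) p.2) := by
  have h : CartFam.Hom.fib (f ≫ g) p.1 =
      CartFam.Hom.fib g (f.base p.1) ∘ CartFam.Hom.fib f p.1 := by
    funext y
    change (g.total (f.total (p.1, y))).2 = _
    rw [CartFam.Hom.total_eq f]
    rfl
  rw [h, f.comm]
  exact fderiv_comp _ ((CartFam.Hom.contDiff_fib g _).differentiable (by simp) _)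
    ((CartFam.Hom.contDiff_fib f _).differentiable (by simp) _)

/-- The value of a local form is determined by its pullbacks along small boxes. -/
lemma LocalForm.val_eq {T : CartFam} {W : Set T.Total} {k : ℕ} (hW : IsOpen W)
    (w : LocalForm T W k) {c : T.Total} (hc : c ∈ W) {α : E T.fibDim [⋀^Fin k]→L[ℝ] ℝ}
    (h : ∀ (e : T ⟶ T) (he : ∀ x, CartFam.Hom.total e x ∈ W), CartFam.Hom.total e 0 = c →
      α.compContinuousLinearMap (fderiv ℝ (CartFam.Hom.fib e 0) 0) = (w.form e he).1 0) :
    w.val c = α := by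
  obtain ⟨r, hr, he⟩ := CartFam.exists_box hW hc
  refine eq_of_box hr (Eq.trans ?_ (h _ he (T.box_zero c r)).symm)
  have := w.val_comp hW _ he 0
  rw [T.box_zero] at this
  exact this

/-- The cocycle condition on the cone from `b` over `s`, solved for the face opposite to `b`. This
is a contraction available wherever `s` lies in the patch `b`. -/
lemma GFam.eq_sum_cons {M : Mfd} {m q : ℕ} {X : GCov M} {A : CartFam → Type}
    [∀ T, AddCommGroup (A T)] (w : GFam A X m (q + 1)) (hd : famDelta w = 0) {T : CartFam}
    (s : CechSimplex X T ⦋q + 1⦌) (θ : ⦋q + 1⦌ ⟶ ⦋m⦌) (b : X.Λ)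
    (hb : ∀ x, s.total x ∈ X.total b) :
    w T s θ = ∑ i : Fin (q + 2), (-1 : ℤ) ^ (i : ℕ) •
      w T ((s.act (SimplexCategory.δ i)).cons b hb) (consZero (SimplexCategory.δ i ≫ θ)) := by
  have h := congrFun (congrFun (congrFun hd T) (s.cons b hb)) (consZero θ)
  rw [famDelta, Fin.sum_univ_succ, s.cons_act_δ_zero, δ_zero_consZero, Fin.val_zero, pow_zero,
    one_smul] at h
  rw [eq_neg_of_add_eq_zero_left h, ← Finset.sum_neg_distrib]
  refine Finset.sum_congr rfl fun i _ => ?_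
  rw [s.cons_act_δ_succ, δ_succ_consZero, Fin.val_succ, pow_succ, mul_neg_one, neg_smul, neg_neg]

section Acyclic

variable {M : Mfd} {m q k : ℕ} {X : GCov M}

/-- Families of vertical forms. -/
abbrev FormFam (X : GCov M) (m q k : ℕ) : Type := GFam (fun T => vForm T k) X m q

/-- Families of vertical forms which are compatible with restriction. -/
def FormFam.Natural (w : FormFam X m q k) : Prop :=
  ∀ {S T : CartFam} (f : S ⟶ T) (s : CechSimplex X T ⦋q⦌) (θ : ⦋q⦌ ⟶ ⦋m⦌),
    w S (s.res f) θ = vForm.pullback f k (w T s θ)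

/-- The values of a family on the cones over the restrictions of a simplex. -/
def FormFam.cone (w : FormFam X m (q + 1) k) (hw : w.Natural) {T : CartFam}
    (s : CechSimplex X T ⦋q⦌) (θ : ⦋q⦌ ⟶ ⦋m⦌) (b : X.Λ) :
    LocalForm T (s.total ⁻¹' (X.total b : Set (X.base.cart × M))) k where
  form e he := w _ ((s.res e).cons b he) (consZero θ)
  nat h e he _ := hw h ((s.res e).cons b he) (consZero θ)

lemma CechSimplex.isOpen_preimage {T : CartFam} (s : CechSimplex X T ⦋q⦌) (b : X.Λ) :
    IsOpen (s.total ⁻¹' (X.total b : Set (X.base.cart × M))) :=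
  (X.total b).isOpen.preimage s.contMDiff_total.continuous

lemma FormFam.cone_val_res (w : FormFam X m (q + 1) k) (hw : w.Natural) {S T : CartFam} (f : S ⟶ T)
    (s : CechSimplex X T ⦋q⦌) (θ : ⦋q⦌ ⟶ ⦋m⦌) (b : X.Λ) {x : S.Total}
    (hx : s.total (CartFam.Hom.total f x) ∈ X.total b) :
    (w.cone hw (s.res f) θ b).val x =
      ((w.cone hw s θ b).val (CartFam.Hom.total f x)).compContinuousLinearMap
        (fderiv ℝ (CartFam.Hom.fib f x.1) x.2) := by
  refine LocalForm.val_eq ((s.res f).isOpen_preimage b) _ hx fun e he h0 => ?_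
  have h := (w.cone hw s θ b).val_comp (s.isOpen_preimage b) (e ≫ f) he 0
  refine Eq.trans ?_ h
  have hd := CartFam.Hom.fderiv_fib_comp e f 0
  have h0' : CartFam.Hom.total (e ≫ f) 0 = CartFam.Hom.total f x := congrArg _ h0
  rw [h0', hd, h0]
  rfl

/-- The contraction `GFam.eq_sum_cons` requires the whole simplex to lie in the patch `b`;
restricting to a small box around `x` gives it pointwise. -/
lemma FormFam.sum_cone_val (w : FormFam X m (q + 1) k) (hw : w.Natural) (hd : famDelta w = 0)
    {T : CartFam} (s : CechSimplex X T ⦋q + 1⦌) (θ : ⦋q + 1⦌ ⟶ ⦋m⦌) (b : X.Λ) {x : T.Total}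
    (hx : s.total x ∈ X.total b) :
    ∑ i : Fin (q + 2), (-1 : ℤ) ^ (i : ℕ) • (w.cone hw (s.act (SimplexCategory.δ i))
      (SimplexCategory.δ i ≫ θ) b).val x = (w T s θ).1 x := by
  obtain ⟨r, hr, he⟩ := CartFam.exists_box (s.isOpen_preimage b) hx
  refine eq_of_box (c := x) hr ?_
  set e := T.box x r
  have h0 : CartFam.Hom.total e 0 = x := T.box_zero x r
  let L : (E T.fibDim [⋀^Fin k]→L[ℝ] ℝ) →+ (E T.fibDim [⋀^Fin k]→L[ℝ] ℝ) :=
    AddMonoidHom.mk' (fun α => α.compContinuousLinearMap (fderiv ℝ (CartFam.Hom.fib e 0) 0))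
      fun _ _ => rfl
  change L _ = L _
  rw [map_sum]
  have h1 : L ((w T s θ).1 x) = (w T (s.res e) θ).1 0 := by
    rw [hw e s θ]
    change _ = L ((w T s θ).1 (CartFam.Hom.total e 0))
    rw [h0]
  have hw' := congrFun (congrArg Subtype.val (GFam.eq_sum_cons w hd (s.res e) θ b he)) 0
  rw [h1, hw', AddSubgroup.val_finsetSum, Finset.sum_apply]
  refine Finset.sum_congr rfl fun i _ => ?_
  have h5 := (w.cone hw (s.act (SimplexCategory.δ i)) (SimplexCategory.δ i ≫ θ) b).val_comp
    ((s.act (SimplexCategory.δ i)).isOpen_preimage b) e he 0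
  rw [h0] at h5
  rw [map_zsmul]
  exact congrArg (fun t => (-1 : ℤ) ^ (i : ℕ) • t) h5

instance Mfd.locallyCompactSpace (M : Mfd) : LocallyCompactSpace M :=
  ChartedSpace.locallyCompactSpace (E M.dim) M

/-- A partition of unity subordinate to the covering. -/
lemma GCov.exists_partition (X : GCov M) :
    ∃ ρ : SmoothPartitionOfUnity X.Λ (prodModel X.base.cart M) (X.base.cart × M) Set.univ,
      ρ.IsSubordinate fun b => (X.total b : Set (X.base.cart × M)) :=
  SmoothPartitionOfUnity.exists_isSubordinate _ isClosed_univ _ (fun b => (X.total b).isOpen)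
    fun p _ => Set.mem_iUnion.2 (X.total_cover p)

/-- The contracting homotopy of a fine sheaf: `y s = ∑ ρ_b • w (b * s)`, where `b * s` is the cone;
the form on it is only defined over the patch `b` and is extended by zero. Normalization survives
because the cone over a degenerate simplex is degenerate. -/
theorem FormFam.acyclic (w : FormFam X m (q + 1) k) (hw : w.Natural) (hn : FamNormalized w)
    (hd : famDelta w = 0) :
    ∃ y : FormFam X m q k, y.Natural ∧ FamNormalized y ∧ famDelta y = w := by
  obtain ⟨ρ, hρ⟩ := X.exists_partition
  let v : ∀ {T : CartFam} (_ : CechSimplex X T ⦋q⦌) (_ : ⦋q⦌ ⟶ ⦋m⦌) (_ : T.Total),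
      E T.fibDim [⋀^Fin k]→L[ℝ] ℝ := fun s θ x =>
    ∑ b ∈ ρ.finsupport (s.total x), ρ b (s.total x) • (w.cone hw s θ b).val x
  have hmem : ∀ {b p}, b ∈ ρ.finsupport p → p ∈ X.total b := fun {b p} hb => by
    refine hρ b (subset_closure ?_)
    exact (ρ.mem_finsupport p).1 hb
  have hsm : ∀ {T : CartFam} (s : CechSimplex X T ⦋q⦌) (θ : ⦋q⦌ ⟶ ⦋m⦌), ContDiff ℝ ∞ (v s θ) := by
    intro T s θ
    have : v s θ = fun x => ∑ᶠ b, ρ b (s.total x) • (w.cone hw s θ b).val x := funext fun x =>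
      ρ.sum_finsupport_smul_eq_finsum _ (fun b _ => (w.cone hw s θ b).val x)
    rw [this, ← contMDiff_iff_contDiff]
    refine contMDiff_finsum (fun b => ?_) ?_
    · rw [contMDiff_iff_contDiff, contDiff_iff_contDiffAt]
      intro x
      have hr : ContDiff ℝ ∞ fun x => ρ b (s.total x) :=
        ((ρ b).contMDiff.comp s.contMDiff_total).contDiff
      by_cases hx : s.total x ∈ tsupport (ρ b)
      · exact hr.contDiffAt.smul ((w.cone hw s θ b).contDiffAt_val (s.isOpen_preimage b)
          (hρ b hx))
      -- Off the support of `ρ b` the summand vanishes near `x`, so the possibly discontinuous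
      -- extension by zero does no harm.
      · refine contDiffAt_const (c := 0) |>.congr_of_eventuallyEq ?_
        have := ((isClosed_tsupport (ρ b)).isOpen_compl.preimage
          s.contMDiff_total.continuous).mem_nhds hx
        filter_upwards [this] with z hz
        have : ρ b (s.total z) = 0 := image_eq_zero_of_notMem_tsupport hz
        rw [this, zero_smul]
    · refine (ρ.locallyFinite.preimage_continuous s.contMDiff_total.continuous).subset fun b x hx =>
        ?_
      intro h0
      exact hx (by
        change ρ b (s.total x) • _ = _
        rw [show ρ b (s.total x) = 0 from h0, zero_smul])
  refine ⟨fun T s θ => ⟨v s θ, hsm s θ⟩, fun {S T} f s θ => ?_, fun T s θ i h1 h2 => ?_, ?_⟩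
  · ext x : 2
    let L : (E T.fibDim [⋀^Fin k]→L[ℝ] ℝ) →ₗ[ℝ] (E S.fibDim [⋀^Fin k]→L[ℝ] ℝ) :=
      { toFun := fun α => α.compContinuousLinearMap (fderiv ℝ (CartFam.Hom.fib f x.1) x.2)
        map_add' := fun _ _ => rfl
        map_smul' := fun _ _ => rfl }
    change v (s.res f) θ x = L (v s θ (CartFam.Hom.total f x))
    simp only [v]
    rw [map_sum]
    refine Finset.sum_congr rfl fun b hb => ?_
    rw [map_smul, w.cone_val_res hw f s θ b (hmem hb)]
    rfl
  · ext x : 2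
    refine Finset.sum_eq_zero fun b hb => ?_
    have : (w.cone hw s θ b).val x = 0 := by
      refine LocalForm.val_eq (s.isOpen_preimage b) _ (hmem hb) fun e he h0 => ?_
      have := hn _ ((s.res e).cons b he) (consZero θ) i.succ h1 h2
      exact (congrFun (congrArg Subtype.val this) 0).symm
    rw [this, smul_zero]
  · funext T s θ
    ext x : 2
    have h1 : (famDelta (A := fun T => vForm T k) (fun T s θ => ⟨v s θ, hsm s θ⟩ : FormFam X m q k)
        T s θ).1 x = ∑ i : Fin (q + 2), (-1 : ℤ) ^ (i : ℕ) •
          v (s.act (SimplexCategory.δ i)) (SimplexCategory.δ i ≫ θ) x := by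
      rw [famDelta, AddSubgroup.val_finsetSum, Finset.sum_apply]
      rfl
    rw [h1]
    simp only [v, Finset.smul_sum]
    -- A simplex and its faces have the same underlying map, hence the same finite set of active
    -- patches, so the two sums may be interchanged.
    rw [Finset.sum_comm' (s' := fun _ => Finset.univ) (t' := ρ.finsupport (s.total x))
      (by simp [CechSimplex.act])]
    rw [← one_smul ℝ ((w T s θ).1 x), ← ρ.sum_finsupport _ (Set.mem_univ (s.total x)),
      Finset.sum_smul]
    refine Finset.sum_congr rfl fun b hb => ?_
    rw [← w.sum_cone_val hw hd s θ b (hmem hb), Finset.smul_sum]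
    exact Finset.sum_congr rfl fun i _ => smul_comm _ _ _

end Acyclic

end HigherGerbe

/-! ### The Čech–Deligne total complex: lifting cocycles and splitting coboundaries. -/

namespace HigherGerbe

open Simplicial

section Total

variable {M : Mfd} {n k m : ℕ} {X : GCov M}

/-- If neither of two neighbours is deleted, they remain neighbours. So a face of a degenerate
simplex other than the two middle ones is still degenerate, and alternating sums of normalized
families stay normalized. -/
lemma Fin.exists_succAbove_pair {q : ℕ} (i : Fin (q + 1)) (j : Fin (q + 2)) (h1 : j ≠ i.castSucc)
    (h2 : j ≠ i.succ) :
    ∃ i' : Fin q, j.succAbove i'.castSucc = i.castSucc ∧ j.succAbove i'.succ = i.succ := by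
  rcases lt_or_gt_of_ne h1 with h | h
  · have hi : i ≠ 0 := by
      rintro rfl
      exact absurd h (by simp)
    obtain ⟨i', rfl⟩ := Fin.exists_succ_eq.2 hi
    refine ⟨i', ?_, ?_⟩
    · rw [Fin.succAbove_of_le_castSucc, Fin.succ_castSucc]
      rw [Fin.le_def]
      rw [Fin.lt_def] at h
      simp at h ⊢
      omega
    · rw [Fin.succAbove_of_le_castSucc]
      rw [Fin.le_def]
      rw [Fin.lt_def] at h
      simp at h ⊢
      omega
  · have h3 : i.succ < j := by
      rw [Fin.lt_def] at h ⊢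
      have := fun h' => h2 (Fin.ext h')
      simp at h this ⊢
      omega
    obtain ⟨i', rfl⟩ := Fin.exists_castSucc_eq.2 (show i ≠ Fin.last q by
      rintro rfl
      rw [Fin.lt_def] at h3
      simp at h3
      omega)
    refine ⟨i', ?_, ?_⟩
    · rw [Fin.succAbove_of_castSucc_lt _ _ h]
    · rw [Fin.succAbove_of_castSucc_lt, Fin.succ_castSucc]
      rwa [← Fin.succ_castSucc]

lemma Fin.succAbove_castSucc_eq_of_pair {q : ℕ} {B : Type*} (f : Fin (q + 2) → B) (i : Fin (q + 1))
    (h : f i.castSucc = f i.succ) (j : Fin (q + 1)) :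
    f (i.castSucc.succAbove j) = f (i.succ.succAbove j) := by
  rcases lt_trichotomy i j with hj | rfl | hj
  · rw [Fin.succAbove_of_le_castSucc, Fin.succAbove_of_le_castSucc]
    · rwa [Fin.succ_le_castSucc_iff]
    · exact Fin.castSucc_le_castSucc_iff.2 hj.le
  · rw [Fin.succAbove_castSucc_self, Fin.succAbove_succ_self, h]
  · rw [Fin.succAbove_of_castSucc_lt, Fin.succAbove_of_castSucc_lt]
    · exact (Fin.castSucc_lt_castSucc_iff.2 hj).trans Fin.castSucc_lt_succ
    · exact Fin.castSucc_lt_castSucc_iff.2 hj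

/-- In an alternating sum over the faces of a degenerate simplex all terms cancel. -/
lemma alternating_sum_degenerate {A : Type*} [AddCommGroup A] {q : ℕ} (F : Fin (q + 2) → A)
    (i : Fin (q + 1)) (h : F i.castSucc = F i.succ)
    (h' : ∀ j, j ≠ i.castSucc → j ≠ i.succ → F j = 0) :
    ∑ j : Fin (q + 2), (-1 : ℤ) ^ (j : ℕ) • F j = 0 := by
  rw [Finset.sum_eq_add i.castSucc i.succ Fin.castSucc_lt_succ.ne
    (fun j _ hj => by rw [h' j hj.1 hj.2, smul_zero]) (by simp) (by simp), h, Fin.val_succ, pow_succ]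
  simp

lemma FamNormalized.famDelta {A : CartFam → Type} [∀ T, AddCommGroup (A T)] {q : ℕ}
    {x : GFam A X m q} (hx : FamNormalized x) : FamNormalized (famDelta x) := by
  intro T s θ i h1 h2
  refine alternating_sum_degenerate (fun j => x T (s.act (SimplexCategory.δ j))
    (SimplexCategory.δ j ≫ θ)) i ?_ fun j hj hj' => ?_
  · have e1 : s.act (SimplexCategory.δ i.castSucc) = s.act (SimplexCategory.δ i.succ) :=
      CechSimplex.ext rfl rfl (funext fun j => Fin.succAbove_castSucc_eq_of_pair s.idx i h1 j)
    have e2 : SimplexCategory.δ i.castSucc ≫ θ = SimplexCategory.δ i.succ ≫ θ :=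
      SimplexCategory.Hom.ext _ _ (OrderHom.ext _ _ (funext fun j =>
        Fin.succAbove_castSucc_eq_of_pair θ.toOrderHom i h2 j))
    rw [e1, e2]
  · obtain ⟨i', ha, hb⟩ := Fin.exists_succAbove_pair i j hj hj'
    refine hx _ _ _ i' ?_ ?_
    · change s.idx (j.succAbove i'.castSucc) = s.idx (j.succAbove i'.succ)
      rw [ha, hb, h1]
    · change θ.toOrderHom (j.succAbove i'.castSucc) = θ.toOrderHom (j.succAbove i'.succ)
      rw [ha, hb, h2]

/-- Families of coefficients which are compatible with restriction. -/
def CoeffNatural {q p : ℕ} (x : Fam X m q p) : Prop :=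
  ∀ ⦃S T : CartFam⦄ (f : S ⟶ T) (s : CechSimplex X T ⦋q⦌) (θ : ⦋q⦌ ⟶ ⦋m⦌),
    x S (s.res f) θ = Coeff.pullback f p (x T s θ)

/-- The differential of the coefficients, applied to families. -/
noncomputable def famD {q p : ℕ} (x : Fam X m q p) : Fam X m q (p + 1) :=
  fun T s θ => Coeff.d T p (x T s θ)

lemma CoeffNatural.famD {q p : ℕ} {x : Fam X m q p} (hx : CoeffNatural x) :
    CoeffNatural (famD x) := fun S T f s θ => by
  change Coeff.d S p (x S (s.res f) θ) = _
  rw [hx, Coeff.pullback_d]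
  rfl

lemma CoeffNatural.famDelta {q p : ℕ} {x : Fam X m q p} (hx : CoeffNatural x) :
    CoeffNatural (X := X) (m := m) (famDelta x) := fun S T f s θ => by
  change ∑ i : Fin (q + 2), (-1 : ℤ) ^ (i : ℕ) • x S ((s.act (SimplexCategory.δ i)).res f) _ =
    Coeff.pullback f p (∑ i : Fin (q + 2), (-1 : ℤ) ^ (i : ℕ) •
      x T (s.act (SimplexCategory.δ i)) (SimplexCategory.δ i ≫ θ))
  rw [map_sum]
  refine Finset.sum_congr rfl fun i _ => ?_
  rw [map_zsmul, hx]

lemma famD_famDelta {q p : ℕ} (x : Fam X m q p) : famD (famDelta x) = famDelta (famD x) := by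
  funext T s θ
  refine (map_sum (Coeff.d T p) _ _).trans (Finset.sum_congr rfl fun i _ => ?_)
  rw [map_zsmul]
  rfl

lemma famD_famD {q p : ℕ} (x : Fam X m q p) : famD (famD x) = 0 := by
  funext T s θ
  exact Coeff.d_d T p _

lemma FamNormalized.famD {q p : ℕ} {x : Fam X m q p} (hx : FamNormalized x) :
    FamNormalized (famD x) := fun T s θ i h1 h2 => by
  change Coeff.d T p (x T s θ) = 0
  rw [hx T s θ i h1 h2, map_zero]

lemma FamNormalized.sub {A : CartFam → Type} [∀ T, AddCommGroup (A T)] {q : ℕ}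
    {x y : GFam A X m q} (hx : FamNormalized x) (hy : FamNormalized y) : FamNormalized (x - y) :=
  fun T s θ i h1 h2 => by
    change x T s θ - y T s θ = 0
    rw [hx T s θ i h1 h2, hy T s θ i h1 h2, sub_zero]

/-- Acyclicity for the coefficients of positive form degree. -/
lemma exists_famDelta_eq {q p : ℕ} (w : Fam X m (q + 1) (p + 1)) (hw : CoeffNatural w)
    (hn : FamNormalized w) (hd : famDelta w = 0) :
    ∃ y : Fam X m q (p + 1), CoeffNatural y ∧ FamNormalized y ∧ famDelta y = w :=
  FormFam.acyclic (X := X) (k := p + 1) w (fun f s θ => hw f s θ) hn hd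

lemma IsCocycle.coeffNatural {x : ∀ q p, Fam X m q p} (hx : IsCocycle n k x) (q p : ℕ) :
    CoeffNatural (x q p) := fun _ _ f s θ => hx.nat q p f s θ

lemma IsCocycle.normalized {x : ∀ q p, Fam X m q p} (hx : IsCocycle n k x) (q p : ℕ) :
    FamNormalized (x q p) := by
  cases q with
  | zero => exact fun T s θ i => i.elim0
  | succ q => exact (famNormalized_succ_iff _).2 fun T i s θ => hx.degenerate q p T i s θ

lemma IsCocycle.famDelta_zero {x : ∀ q p, Fam X m q p} (hx : IsCocycle n k x) (q : ℕ) :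
    famDelta (x q 0) = 0 := by
  funext T s θ
  exact (hx.diff q 0 T s θ).symm

lemma IsCocycle.famDelta_succ {x : ∀ q p, Fam X m q p} (hx : IsCocycle n k x) (q p : ℕ)
    (hp : p + 1 ≤ k) : famDelta (x q (p + 1)) = famD (x (q + 1) p) := by
  funext T s θ
  refine (hx.diff q (p + 1) T s θ).symm.trans ?_
  simp only [delDiff, if_pos hp]
  rfl

lemma IsCocycle.of_families {x : ∀ q p, Fam X m q p} (h1 : ∀ q p, CoeffNatural (x q p))
    (h2 : ∀ q p, FamNormalized (x q p)) (h3 : ∀ q p, ¬ (p + q = n + 1 ∧ p ≤ k) → x q p = 0)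
    (h4 : ∀ q, famDelta (x q 0) = 0)
    (h5 : ∀ q p, p + 1 ≤ k → famDelta (x q (p + 1)) = famD (x (q + 1) p)) : IsCocycle n k x where
  nat q p _ _ f s θ := h1 q p f s θ
  degenerate q p T i s θ := (famNormalized_succ_iff _).1 (h2 (q + 1) p) T i s θ
  supp q p T s θ h := by rw [h3 q p h]; rfl
  diff q p T s θ := by
    cases p with
    | zero => exact (congrFun (congrFun (congrFun (h4 q) T) s) θ).symm
    | succ p =>
      by_cases hp : p + 1 ≤ k
      · simp only [delDiff, if_pos hp]
        exact (congrFun (congrFun (congrFun (h5 q p hp) T) s) θ).symm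
      · simp only [delDiff, if_neg hp]
        refine (Finset.sum_eq_zero fun i _ => ?_).symm
        rw [h3 q (p + 1) (fun h => hp h.2)]
        exact smul_zero _

lemma IsCocycle.trunc {x : ∀ q p, Fam X m q p} (hx : IsCocycle n k x) {l : ℕ} (h : l ≤ k) :
    IsCocycle n l (fun q p T s θ => delTrunc l T (fun p => x q p T s θ) p) := by
  have h1 := isCocycle_simplexFam ((mapSpace.post (cech X) (delSSetProj n h)).app (op ⦋m⦌) hx.toMap)
  have h2 : simplexFam ((mapSpace.post (cech X) (delSSetProj n h)).app (op ⦋m⦌) hx.toMap) =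
      fun q p T s θ => delTrunc l T (fun p => x q p T s θ) p := by
    funext q p T s θ
    rw [simplexFam_post, hx.simplexFam_toMap]
  rwa [h2] at h1

/-- A cocycle can be extended by a form of one degree more. -/
lemma IsCocycle.exists_extend {x : ∀ q p, Fam X m q p} (hx : IsCocycle n k x) (hk : k ≤ n) :
    ∃ x' : ∀ q p, Fam X m q p, IsCocycle n (k + 1) x' ∧ ∀ q p, p ≤ k → x' q p = x q p := by
  obtain ⟨r, rfl⟩ : ∃ r, n = r + k := ⟨n - k, by omega⟩
  -- The new component of form degree `k + 1` lies in Čech degree `r` and must solve `δ y = d x`.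
  -- The right side is closed, as `δ d x = d δ x` and `δ x` is zero or again a `d` of something; it
  -- lives in Čech degree `r + 1`, where acyclicity applies.
  have hd : famDelta (famD (x (r + 1) k)) = 0 := by
    rw [← famD_famDelta]
    cases k with
    | zero =>
      rw [hx.famDelta_zero]
      funext T s θ
      exact map_zero (Coeff.d T 0)
    | succ k => rw [hx.famDelta_succ _ _ le_rfl, famD_famD]
  obtain ⟨y, hy1, hy2, hy3⟩ := exists_famDelta_eq _ (CoeffNatural.famD (hx.coeffNatural (r + 1) k))
    (hx.normalized (r + 1) k).famD hd
  let x' : ∀ q p, Fam X m q p := Function.update x r (Function.update (x r) (k + 1) y)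
  have e1 : x' r (k + 1) = y := by simp [x']
  have e2 : ∀ q p, ¬ (q = r ∧ p = k + 1) → x' q p = x q p := fun q p h => by
    by_cases hq : q = r
    · subst hq
      have : p ≠ k + 1 := fun hp => h ⟨rfl, hp⟩
      simp [x', this]
    · simp [x', hq]
  refine ⟨x', IsCocycle.of_families (fun q p => ?_) (fun q p => ?_) (fun q p h => ?_)
    (fun q => ?_) (fun q p hp => ?_), fun q p hp => e2 q p (by omega)⟩
  · by_cases h : q = r ∧ p = k + 1
    · obtain ⟨rfl, rfl⟩ := h
      rw [e1]
      exact hy1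
    · rw [e2 q p h]
      exact hx.coeffNatural q p
  · by_cases h : q = r ∧ p = k + 1
    · obtain ⟨rfl, rfl⟩ := h
      rw [e1]
      exact hy2
    · rw [e2 q p h]
      exact hx.normalized q p
  · rw [e2 q p (by omega)]
    funext T s θ
    exact hx.supp q p T s θ (by omega)
  · rw [e2 q 0 (by omega)]
    exact hx.famDelta_zero q
  · rcases Nat.lt_or_ge p k with hpk | hpk
    · rw [e2 q (p + 1) (by omega), e2 (q + 1) p (by omega)]
      exact hx.famDelta_succ q p hpk
    · obtain rfl : p = k := by omega
      rw [e2 (q + 1) p (by omega)]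
      by_cases hq : q = r
      · subst hq
        rw [e1, hy3]
      · rw [e2 q (p + 1) (by omega)]
        funext T s θ
        change ∑ i : Fin (q + 2), _ = Coeff.d T p (x (q + 1) p T s θ)
        rw [hx.supp (q + 1) p T s θ (by omega), map_zero]
        refine Finset.sum_eq_zero fun i _ => ?_
        rw [hx.supp q (p + 1) T _ _ (by omega), smul_zero]

lemma IsCocycle.exists_lift {l : ℕ} {x : ∀ q p, Fam X m q p} (hx : IsCocycle n l x) (h : l ≤ k)
    (hk : k ≤ n + 1) :
    ∃ x' : ∀ q p, Fam X m q p, IsCocycle n k x' ∧ ∀ q p, p ≤ l → x' q p = x q p := by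
  induction k, h using Nat.le_induction with
  | base => exact ⟨x, hx, fun _ _ _ => rfl⟩
  | succ k hlk ih =>
    obtain ⟨x', h1, h2⟩ := ih (by omega)
    obtain ⟨x'', h3, h4⟩ := h1.exists_extend (by omega)
    exact ⟨x'', h3, fun q p hp => (h4 q p (hp.trans hlk)).trans (h2 q p hp)⟩

/-- The forgetful maps are surjective in each simplicial degree. -/
theorem surjective_post {l : ℕ} (h : l ≤ k) (hk : k ≤ n + 1) (m : ℕ) :
    Function.Surjective ((mapSpace.post (cech X) (delSSetProj n h)).app (op ⦋m⦌)) := by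
  intro f
  obtain ⟨x, hx, hx'⟩ := (isCocycle_simplexFam f).exists_lift h hk
  refine ⟨hx.toMap, simplexFam_injective ?_⟩
  funext q p T s θ
  rw [simplexFam_post, hx.simplexFam_toMap]
  unfold delTrunc
  split_ifs with hp
  · exact congrFun (congrFun (congrFun (hx' q p hp) T) s) θ
  · exact ((isCocycle_simplexFam f).supp q p T s θ fun h' => hp h'.2).symm

/-! ### Coboundaries -/

/-- Cochains of total degree `n`. -/
structure IsCochain (n k : ℕ) (y : ∀ q p, Fam X m q p) : Prop where
  nat : ∀ q p, CoeffNatural (y q p)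
  normalized : ∀ q p, FamNormalized (y q p)
  supp : ∀ q p, ¬ (p + q = n ∧ p ≤ k) → y q p = 0

/-- The total differential of a family of cochains. -/
noncomputable def totD (k : ℕ) (y : ∀ q p, Fam X m q p) (q p : ℕ) : Fam X m q p :=
  -- No signs occur: cocycles satisfy `δ x = d x` between neighbouring bidegrees, and `d` commutes
  -- with `δ`, so `d + δ` takes its values in cocycles.
  match q, p with
  | 0, 0 => 0
  | 0, p + 1 => if p + 1 ≤ k then famD (y 0 p) else 0
  | q + 1, 0 => famDelta (y q 0)
  | q + 1, p + 1 => (if p + 1 ≤ k then famD (y (q + 1) p) else 0) + famDelta (y q (p + 1))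

lemma CoeffNatural.zero {q p : ℕ} : CoeffNatural (0 : Fam X m q p) :=
  fun _ _ f _ _ => (map_zero (Coeff.pullback f p)).symm

lemma FamNormalized.zero {A : CartFam → Type} [∀ T, AddCommGroup (A T)] {q : ℕ} :
    FamNormalized (0 : GFam A X m q) := fun _ _ _ _ _ _ => rfl

lemma CoeffNatural.add {q p : ℕ} {x y : Fam X m q p} (hx : CoeffNatural x) (hy : CoeffNatural y) :
    CoeffNatural (x + y) := fun S T f s θ => by
  change x S (s.res f) θ + y S (s.res f) θ = Coeff.pullback f p (x T s θ + y T s θ)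
  rw [hx, hy, map_add]

lemma CoeffNatural.sub {q p : ℕ} {x y : Fam X m q p} (hx : CoeffNatural x) (hy : CoeffNatural y) :
    CoeffNatural (x - y) := fun S T f s θ => by
  change x S (s.res f) θ - y S (s.res f) θ = Coeff.pullback f p (x T s θ - y T s θ)
  rw [hx, hy, map_sub]

lemma FamNormalized.add {A : CartFam → Type} [∀ T, AddCommGroup (A T)] {q : ℕ}
    {x y : GFam A X m q} (hx : FamNormalized x) (hy : FamNormalized y) : FamNormalized (x + y) :=
  fun T s θ i h1 h2 => by
    change x T s θ + y T s θ = 0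
    rw [hx T s θ i h1 h2, hy T s θ i h1 h2, add_zero]

lemma famD_add {q p : ℕ} (x y : Fam X m q p) : famD (x + y) = famD x + famD y := by
  funext T s θ
  exact map_add (Coeff.d T p) _ _

lemma famD_zero {q p : ℕ} : famD (0 : Fam X m q p) = 0 := by
  funext T s θ
  exact map_zero (Coeff.d T p)

lemma famDelta_zero {A : CartFam → Type} [∀ T, AddCommGroup (A T)] {q : ℕ} :
    famDelta (0 : GFam A X m q) = 0 := by
  funext T s θ
  exact Finset.sum_eq_zero fun i _ => smul_zero _

lemma IsCochain.isCocycle_totD {y : ∀ q p, Fam X m q p} (hy : IsCochain n k y) :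
    IsCocycle n k (totD k y) := by
  have hD : ∀ q p, CoeffNatural (if p + 1 ≤ k then famD (y q p) else 0) := fun q p => by
    split_ifs
    · exact (hy.nat q p).famD
    · exact .zero
  have hD' : ∀ q p, FamNormalized (A := fun T => Coeff T (p + 1))
      (if p + 1 ≤ k then famD (y q p) else 0) := fun q p => by
    split_ifs
    · exact (hy.normalized q p).famD
    · exact .zero
  have hd : ∀ q p, p + 1 ≤ k → famD (totD k y (q + 1) p) = famD (famDelta (y q p)) := fun q p hp => by
    cases p with
    | zero => rfl
    | succ p =>
      simp only [totD]
      rw [if_pos (by omega), famD_add, famD_famD, zero_add]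
  refine IsCocycle.of_families (fun q p => ?_) (fun q p => ?_) (fun q p h => ?_)
    (fun q => ?_) (fun q p hp => ?_)
  · match q, p with
    | 0, 0 => exact .zero
    | 0, p + 1 => exact hD 0 p
    | q + 1, 0 => exact (hy.nat q 0).famDelta
    | q + 1, p + 1 => exact (hD (q + 1) p).add (hy.nat q (p + 1)).famDelta
  · match q, p with
    | 0, 0 => exact .zero
    | 0, p + 1 => exact hD' 0 p
    | q + 1, 0 => exact (hy.normalized q 0).famDelta
    | q + 1, p + 1 => exact (hD' (q + 1) p).add (hy.normalized q (p + 1)).famDelta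
  · match q, p with
    | 0, 0 => rfl
    | 0, p + 1 =>
      simp only [totD]
      split_ifs with hp
      · rw [hy.supp 0 p (by omega), famD_zero]
      · rfl
    | q + 1, 0 =>
      simp only [totD]
      rw [hy.supp q 0 (by omega)]
      exact famDelta_zero
    | q + 1, p + 1 =>
      simp only [totD]
      rw [hy.supp q (p + 1) (by omega)]
      split_ifs with hp
      · rw [hy.supp (q + 1) p (by omega), famD_zero, famDelta_zero, zero_add]
      · rw [famDelta_zero, zero_add]
  · cases q with
    | zero => exact famDelta_zero
    | succ q => exact famDelta_famDelta _
  · rw [hd q p hp, famD_famDelta]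
    cases q with
    | zero => simp only [totD, if_pos hp]
    | succ q =>
      simp only [totD, if_pos hp]
      rw [famDelta_add, famDelta_famDelta, add_zero]

/-- If the component of form degree `0` is a coboundary, then the cocycle is a coboundary. -/
lemma IsCocycle.exists_totD {u : ∀ q p, Fam X m q p} (hu : IsCocycle n k u) (hk : k ≤ n)
    {y₀ : Fam X m n 0} (h1 : CoeffNatural y₀) (h2 : FamNormalized y₀)
    (h3 : u (n + 1) 0 = famDelta y₀) :
    ∃ y : ∀ q p, Fam X m q p, IsCochain n k y ∧ u = totD k y := by
  -- Outside the bidegrees with `p + q = n + 1` and `p ≤ k` both sides vanish.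
  suffices h : ∃ y : ∀ q p, Fam X m q p, IsCochain n k y ∧
      ∀ q p, p + q = n + 1 → p ≤ k → u q p = totD k y q p by
    obtain ⟨y, hy, hy'⟩ := h
    refine ⟨y, hy, ?_⟩
    funext q p
    by_cases hqp : p + q = n + 1 ∧ p ≤ k
    · exact hy' q p hqp.1 hqp.2
    · funext T s θ
      rw [hu.supp q p T s θ hqp, hy.isCocycle_totD.supp q p T s θ hqp]
  induction k generalizing u with
  | zero =>
    let y : ∀ q p, Fam X m q p := Function.update 0 n (Function.update 0 0 y₀)
    have e1 : y n 0 = y₀ := by simp [y]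
    have e2 : ∀ q p, ¬ (q = n ∧ p = 0) → y q p = 0 := fun q p h => by
      by_cases hq : q = n
      · subst hq
        have : p ≠ 0 := fun hp => h ⟨rfl, hp⟩
        simp [y, this]
      · simp [y, hq]
    refine ⟨y, ⟨fun q p => ?_, fun q p => ?_, fun q p h => e2 q p (by omega)⟩, fun q p h h' => ?_⟩
    · by_cases h : q = n ∧ p = 0
      · obtain ⟨rfl, rfl⟩ := h
        rwa [e1]
      · rw [e2 q p h]
        exact .zero
    · by_cases h : q = n ∧ p = 0
      · obtain ⟨rfl, rfl⟩ := h
        rwa [e1]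
      · rw [e2 q p h]
        exact .zero
    · obtain rfl : p = 0 := by omega
      obtain rfl : q = n + 1 := by omega
      simp only [totD]
      rw [e1, h3]
  | succ k ih =>
    obtain ⟨y, hy, hyu⟩ := ih (hu.trunc k.le_succ) (by omega) (by
      rw [← h3]
      funext T s θ
      simp [delTrunc])
    have hyu' : ∀ q p, p + q = n + 1 → p ≤ k → u q p = totD k y q p := fun q p h h' => by
      rw [← hyu q p h h']
      funext T s θ
      simp [delTrunc, h']
    -- The error `u - d y` in form degree `k + 1` is `δ`-closed of Čech degree `r + 1`, so it has a
    -- `δ`-primitive. This is where the bound by `n` enters: in form degree `n + 1` the error would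
    -- sit in Čech degree `0`, where closed families need not vanish.
    obtain ⟨r, rfl⟩ : ∃ r, n = r + (k + 1) := ⟨n - (k + 1), by omega⟩
    have hw : famDelta (u (r + 1) (k + 1) - famD (y (r + 1) k)) = 0 := by
      rw [famDelta_sub, hu.famDelta_succ _ _ le_rfl, hyu' (r + 1 + 1) k (by omega) le_rfl,
        ← famD_famDelta]
      cases k with
      | zero => exact sub_self _
      | succ k =>
        simp only [totD, if_pos le_rfl]
        rw [famD_add, famD_famD, zero_add, sub_self]
    obtain ⟨z, hz1, hz2, hz3⟩ := exists_famDelta_eq _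
      ((hu.coeffNatural (r + 1) (k + 1)).sub (hy.nat (r + 1) k).famD)
      ((hu.normalized (r + 1) (k + 1)).sub (hy.normalized (r + 1) k).famD) hw
    let y' : ∀ q p, Fam X m q p := Function.update y r (Function.update (y r) (k + 1) z)
    have e1 : y' r (k + 1) = z := by simp [y']
    have e2 : ∀ q p, ¬ (q = r ∧ p = k + 1) → y' q p = y q p := fun q p h => by
      by_cases hq : q = r
      · subst hq
        have : p ≠ k + 1 := fun hp => h ⟨rfl, hp⟩
        simp [y', this]
      · simp [y', hq]
    refine ⟨y', ⟨fun q p => ?_, fun q p => ?_, fun q p h => ?_⟩, fun q p h h' => ?_⟩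
    · by_cases h : q = r ∧ p = k + 1
      · obtain ⟨rfl, rfl⟩ := h
        rwa [e1]
      · rw [e2 q p h]
        exact hy.nat q p
    · by_cases h : q = r ∧ p = k + 1
      · obtain ⟨rfl, rfl⟩ := h
        rwa [e1]
      · rw [e2 q p h]
        exact hy.normalized q p
    · rw [e2 q p (by omega)]
      exact hy.supp q p (by omega)
    · rcases Nat.lt_or_ge p (k + 1) with hp | hp
      · rw [hyu' q p h (by omega)]
        match q, p with
        | 0, 0 => rfl
        | 0, p + 1 =>
          simp only [totD]
          rw [if_pos (by omega), if_pos (by omega), e2 _ _ (by omega)]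
        | q + 1, 0 =>
          simp only [totD]
          rw [e2 _ _ (by omega)]
        | q + 1, p + 1 =>
          simp only [totD]
          rw [if_pos (by omega), if_pos (by omega), e2 _ _ (by omega), e2 _ _ (by omega)]
      · obtain rfl : p = k + 1 := by omega
        obtain rfl : q = r + 1 := by omega
        simp only [totD]
        rw [if_pos le_rfl, e1, e2 _ _ (by omega), hz3, add_sub_cancel]

/-- The extension of a cochain to `Δ[1]` by zero outside the vertex `0`. -/
noncomputable def coneFam {q p : ℕ} (y : Fam X 0 q p) : Fam X 1 q p := fun T s θ =>
  if ∀ i, θ.toOrderHom i = 0 then y T s (SimplexCategory.const ⦋q⦌ ⦋0⦌ 0) else 0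

lemma IsCochain.coneFam {y : ∀ q p, Fam X 0 q p} (hy : IsCochain n k y) :
    IsCochain n k (fun q p => coneFam (y q p)) where
  nat q p S T f s θ := by
    unfold HigherGerbe.coneFam
    split_ifs
    · exact hy.nat q p f s _
    · exact (map_zero _).symm
  normalized q p T s θ i h1 h2 := by
    unfold HigherGerbe.coneFam
    split_ifs
    · exact hy.normalized q p T s _ i h1 rfl
    · rfl
  supp q p h := by
    funext T s θ
    unfold HigherGerbe.coneFam
    split_ifs
    · rw [hy.supp q p h]
      rfl
    · rfl

end Total

end HigherGerbe

/-! ### Coboundaries as edges of the mapping space. -/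

namespace HigherGerbe

open Simplicial

section Edges

variable {M : Mfd} {n k m : ℕ} {X : GCov M}

lemma totD_comp {m' : ℕ} (ζ : ⦋m'⦌ ⟶ ⦋m⦌) (y : ∀ q p, Fam X m q p) (q p : ℕ) (T : CartFam)
    (s : CechSimplex X T ⦋q⦌) (θ : ⦋q⦌ ⟶ ⦋m'⦌) :
    totD k (fun q p T s θ => y q p T s (θ ≫ ζ)) q p T s θ = totD k y q p T s (θ ≫ ζ) := by
  match q, p with
  | 0, 0 => rfl
  | 0, p + 1 =>
    simp only [totD]
    split_ifs <;> rfl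
  | q + 1, 0 => rfl
  | q + 1, p + 1 =>
    simp only [totD]
    split_ifs <;> rfl

/-- Under `δ 1` the vertex of `Δ[0]` goes to the vertex `0` of `Δ[1]`, under `δ 0` to the vertex
`1`, where the extension vanishes. -/
lemma coneFam_comp {q p : ℕ} (y : Fam X 0 q p) (i : Fin 2) (T : CartFam)
    (s : CechSimplex X T ⦋q⦌) (θ : ⦋q⦌ ⟶ ⦋0⦌) :
    coneFam y T s (θ ≫ SimplexCategory.δ i) = if i = 1 then y T s θ else 0 := by
  have h : (∀ j, (θ ≫ SimplexCategory.δ i).toOrderHom j = 0) ↔ i = 1 := by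
    have : ∀ j, (θ ≫ SimplexCategory.δ i).toOrderHom j = i.succAbove (0 : Fin 1) := fun j =>
      congrArg i.succAbove (Subsingleton.elim (α := Fin 1) _ _)
    simp only [this]
    fin_cases i <;> simp
  have hθ : SimplexCategory.const ⦋q⦌ ⦋0⦌ 0 = θ := SimplexCategory.Hom.ext _ _
    (OrderHom.ext _ _ (funext fun j => Subsingleton.elim (α := Fin 1) _ _))
  unfold coneFam
  simp only [h, hθ]

/-- Vertices of the mapping space which differ by a coboundary are connected by an edge. -/
lemma π₀_mk_eq_of_totD {f g : (mapSpace (cech X) (delSSet n k)) _⦋0⦌} {y : ∀ q p, Fam X 0 q p}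
    (hy : IsCochain n k y) (h : simplexFam f = simplexFam g + totD k y) :
    SSet.π₀.mk f = SSet.π₀.mk g := by
  -- The edge is the constant one at `g` plus the total differential of the cochain `y` placed at
  -- the vertex `0`. Its end at `0` is `g + D y = f`, its end at `1` is `g`.
  set e : (mapSpace (cech X) (delSSet n k)) _⦋1⦌ :=
    (mapSpace (cech X) (delSSet n k)).σ 0 g + hy.coneFam.isCocycle_totD.toMap with he
  have key : ∀ i : Fin 2, simplexFam ((mapSpace (cech X) (delSSet n k)).δ i e) =
      fun q p T s θ => simplexFam g q p T s θ + if i = 1 then totD k y q p T s θ else 0 := by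
    intro i
    funext q p T s θ
    have h1 := simplexFam_map (SimplexCategory.δ i) e q p T s θ
    refine h1.trans ?_
    have h2 : simplexFam e = simplexFam ((mapSpace (cech X) (delSSet n k)).σ 0 g) +
        simplexFam hy.coneFam.isCocycle_totD.toMap := by
      rw [he, simplexFam_add]
    rw [h2, IsCocycle.simplexFam_toMap]
    change simplexFam g q p T s ((θ ≫ SimplexCategory.δ i) ≫ SimplexCategory.σ 0) + _ = _
    have h3 : (θ ≫ SimplexCategory.δ i) ≫ SimplexCategory.σ (0 : Fin 1) = θ :=
      SimplexCategory.Hom.ext _ _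
        (OrderHom.ext _ _ (funext fun j => Subsingleton.elim (α := Fin 1) _ _))
    rw [h3, ← totD_comp]
    congr 1
    have h4 : (fun q p T s (θ : ⦋q⦌ ⟶ ⦋0⦌) => coneFam (y q p) T s (θ ≫ SimplexCategory.δ i)) =
        if i = 1 then y else 0 := by
      funext q p T s θ
      rw [coneFam_comp]
      split_ifs <;> rfl
    rw [h4]
    split_ifs with hi
    · rfl
    · match q, p with
      | 0, 0 => rfl
      | 0, p + 1 =>
        simp only [totD]
        split_ifs
        · exact map_zero (Coeff.d T p)
        · rfl
      | q + 1, 0 => exact congrFun (congrFun (congrFun (famDelta_zero (A := fun T => Coeff T 0)) T) s) θ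
      | q + 1, p + 1 =>
        simp only [totD]
        have h5 : famDelta (0 : Fam X 0 q (p + 1)) = 0 := famDelta_zero
        have h6 : famD (0 : Fam X 0 (q + 1) p) = 0 := famD_zero
        simp only [Pi.zero_apply] at h5 h6 ⊢
        rw [h5]
        split_ifs
        · rw [h6, add_zero]
          rfl
        · exact add_zero (0 : Coeff T (p + 1))
  have h1 : (mapSpace (cech X) (delSSet n k)).δ 1 e = f := simplexFam_injective (by
    rw [key 1, h]
    rfl)
  have h0 : (mapSpace (cech X) (delSSet n k)).δ 0 e = g := simplexFam_injective (by
    rw [key 0]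
    funext q p T s θ
    simp)
  exact SSet.π₀.sound (SSet.Edge.mk e h1 h0)

end Edges

end HigherGerbe

/-! ### Alexander–Spanier cochains with integer values, and the acyclicity of `ℝᵈ`. -/

namespace HigherGerbe

open Filter Topology

/-! ### Germs of functions of several points -/

section PointDelta

variable {N : Type*} {r : ℕ}

lemma Fin.cons_comp_succ_succAbove {A : Type*} (x : A) (t : Fin (r + 2) → A) (i : Fin (r + 2)) :
    (Fin.cons x t : Fin (r + 3) → A) ∘ i.succ.succAbove =
      (Fin.cons x (t ∘ i.succAbove) : Fin (r + 2) → A) := by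
  funext j
  induction j using Fin.cases with
  | zero => simp
  | succ j => simp [Fin.succ_succAbove_succ]

/-- The alternating sum over the omission of points. -/
def pointDelta (f : (Fin (r + 1) → N) → ℤ) : (Fin (r + 2) → N) → ℤ := fun t =>
  ∑ i : Fin (r + 2), (-1 : ℤ) ^ (i : ℕ) • f (t ∘ i.succAbove)

lemma Fin.succAbove_comp_succAbove {n : ℕ} (i j : Fin (n + 2)) (h : j ≤ i) :
    i.succ.succAbove ∘ j.succAbove = j.castSucc.succAbove ∘ i.succAbove :=
  funext fun a => congrArg (fun θ => SimplexCategory.Hom.toOrderHom θ a)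
    (SimplexCategory.δ_comp_δ (n := n) h)

lemma pointDelta_pointDelta (f : (Fin (r + 1) → N) → ℤ) : pointDelta (pointDelta f) = 0 := by
  funext t
  refine alternating_double_sum_eq_zero (fun i j => f ((t ∘ i.succAbove) ∘ j.succAbove))
    fun i j hij => ?_
  change f (t ∘ (i.succ.succAbove ∘ j.succAbove)) = f (t ∘ (j.castSucc.succAbove ∘ i.succAbove))
  rw [Fin.succAbove_comp_succAbove i j hij]

lemma pointDelta_add (f g : (Fin (r + 1) → N) → ℤ) :
    pointDelta (f + g) = pointDelta f + pointDelta g := by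
  funext t
  refine Eq.trans ?_ Finset.sum_add_distrib
  exact Finset.sum_congr rfl fun i _ => smul_add _ _ _

lemma pointDelta_sub (f g : (Fin (r + 1) → N) → ℤ) :
    pointDelta (f - g) = pointDelta f - pointDelta g := by
  funext t
  refine Eq.trans ?_ (Finset.sum_sub_distrib _ _)
  exact Finset.sum_congr rfl fun i _ => smul_sub _ _ _

/-- Fixing the first point is a contraction up to `f` itself; it yields local exactness in
`exists_local_primitive`. -/
lemma pointDelta_cons (f : (Fin (r + 2) → N) → ℤ) (x : N) (t : Fin (r + 2) → N) :
    pointDelta f (Fin.cons x t) = f t - pointDelta (fun t => f (Fin.cons x t)) t := by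
  unfold pointDelta
  rw [Fin.sum_univ_succ, sub_eq_add_neg, ← Finset.sum_neg_distrib]
  congr 1
  · rw [Fin.val_zero, pow_zero, one_smul]
    rfl
  · refine Finset.sum_congr rfl fun i _ => ?_
    rw [Fin.cons_comp_succ_succAbove, Fin.val_succ, pow_succ, mul_neg_one, neg_smul]

end PointDelta

section Germs

variable {N : Type*} [TopologicalSpace N] {r : ℕ}

/-- The filter of tuples of points which start at `x` and in which each point is near the
preceding one. -/
def nearFilter : ∀ (r : ℕ), N → Filter (Fin (r + 1) → N) := fun r =>
  -- Closeness is asked step by step, so how near a point must be may depend on its predecessors. No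
  -- uniform neighbourhood of the diagonal has to be chosen, which makes gluing along the first
  -- point possible.
  Nat.rec (fun x => pure fun _ => x) (fun _ F x => (𝓝 x).bind fun y => (F y).map (Fin.cons x)) r

lemma eventually_nearFilter_zero {x : N} {P : (Fin 1 → N) → Prop} :
    (∀ᶠ t in nearFilter 0 x, P t) ↔ P fun _ => x := Iff.rfl

lemma eventually_nearFilter_succ {x : N} {P : (Fin (r + 2) → N) → Prop} :
    (∀ᶠ t in nearFilter (r + 1) x, P t) ↔
      ∀ᶠ y in 𝓝 x, ∀ᶠ t in nearFilter r y, P (Fin.cons x t) := Iff.rfl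

lemma eventually_nearFilter_head (x : N) : ∀ᶠ t in nearFilter r x, t 0 = x := by
  cases r with
  | zero => exact eventually_nearFilter_zero.2 rfl
  | succ r => exact eventually_nearFilter_succ.2 (Eventually.of_forall fun y =>
      Eventually.of_forall fun t => rfl)

lemma eventually_nearFilter_delete_zero {x : N} {P : (Fin (r + 1) → N) → Prop}
    (h : ∀ᶠ y in 𝓝 x, ∀ᶠ t in nearFilter r y, P t) :
    ∀ᶠ t in nearFilter (r + 1) x, P (t ∘ (0 : Fin (r + 2)).succAbove) :=
  eventually_nearFilter_succ.2 h

/-- If the second point of the tuple is deleted, its successor is near a point near `x`, and hence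
near `x` by `eventually_eventually_nhds`. Later deletions reduce to this one by dropping the head.
-/
lemma eventually_nearFilter_delete_succ {x : N} {P : (Fin (r + 1) → N) → Prop} (i : Fin (r + 1))
    (h : ∀ᶠ t in nearFilter r x, P t) :
    ∀ᶠ t in nearFilter (r + 1) x, P (t ∘ i.succ.succAbove) := by
  induction r generalizing x with
  | zero =>
    refine eventually_nearFilter_succ.2 (Eventually.of_forall fun y =>
      eventually_nearFilter_zero.2 ?_)
    have : (Fin.cons x (fun _ => y) : Fin 2 → N) ∘ i.succ.succAbove = fun _ => x := by
      funext j
      obtain rfl : i = 0 := Subsingleton.elim (α := Fin 1) _ _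
      obtain rfl : j = 0 := Subsingleton.elim _ _
      rfl
    rw [this]
    exact h
  | succ r ih =>
    rw [eventually_nearFilter_succ] at h ⊢
    simp only [Fin.cons_comp_succ_succAbove]
    induction i using Fin.cases with
    | zero =>
      filter_upwards [eventually_eventually_nhds.2 h] with y hy
      exact eventually_nearFilter_delete_zero (P := fun t => P (Fin.cons x t)) hy
    | succ i =>
      filter_upwards [h] with y hy
      exact ih (P := fun t => P (Fin.cons x t)) i hy

/-- The function has vanishing germs along the diagonal at all points of `U`. -/
def VanOn (U : Set N) (f : (Fin (r + 1) → N) → ℤ) : Prop :=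
  ∀ x ∈ U, ∀ᶠ t in nearFilter r x, f t = 0

lemma VanOn.mono {U V : Set N} {f : (Fin (r + 1) → N) → ℤ} (h : VanOn U f) (hVU : V ⊆ U) :
    VanOn V f := fun x hx => h x (hVU hx)

lemma VanOn.zero (U : Set N) : VanOn U (0 : (Fin (r + 1) → N) → ℤ) :=
  fun _ _ => Eventually.of_forall fun _ => rfl

lemma VanOn.add {U : Set N} {f g : (Fin (r + 1) → N) → ℤ} (hf : VanOn U f) (hg : VanOn U g) :
    VanOn U (f + g) := fun x hx => by
  filter_upwards [hf x hx, hg x hx] with t h1 h2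
  rw [Pi.add_apply, h1, h2, add_zero]

lemma VanOn.neg {U : Set N} {f : (Fin (r + 1) → N) → ℤ} (hf : VanOn U f) :
    VanOn U (-f) := fun x hx => by
  filter_upwards [hf x hx] with t h1
  rw [Pi.neg_apply, h1, neg_zero]

lemma VanOn.sub {U : Set N} {f g : (Fin (r + 1) → N) → ℤ} (hf : VanOn U f) (hg : VanOn U g) :
    VanOn U (f - g) := by
  rw [sub_eq_add_neg]
  exact hf.add hg.neg

lemma VanOn.congr {U : Set N} {f g : (Fin (r + 1) → N) → ℤ} (hf : VanOn U f)
    (h : ∀ t, t 0 ∈ U → f t = g t) : VanOn U g := fun x hx => by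
  filter_upwards [hf x hx, eventually_nearFilter_head x] with t h1 h2
  rw [← h t (h2 ▸ hx), h1]

lemma VanOn.of_forall {U : Set N} {f : (Fin (r + 1) → N) → ℤ} (h : ∀ t, t 0 ∈ U → f t = 0) :
    VanOn U f := (VanOn.zero U).congr fun t ht => (h t ht).symm

/-- Deleting the head moves the base point of the germ to a nearby point, which is why `U` has to be
open. -/
lemma VanOn.pointDelta {U : Set N} (hU : IsOpen U) {f : (Fin (r + 1) → N) → ℤ} (hf : VanOn U f) :
    VanOn U (pointDelta f) := fun x hx => by
  have h : ∀ i : Fin (r + 2), ∀ᶠ t in nearFilter (r + 1) x, f (t ∘ i.succAbove) = 0 := fun i => by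
    induction i using Fin.cases with
    | zero =>
      refine eventually_nearFilter_delete_zero (P := fun t => f t = 0) ?_
      filter_upwards [hU.mem_nhds hx] with y hy using hf y hy
    | succ i => exact eventually_nearFilter_delete_succ (P := fun t => f t = 0) i (hf x hx)
  filter_upwards [eventually_all.2 h] with t ht
  exact Finset.sum_eq_zero fun i _ => by rw [ht i, smul_zero]

/-- Closed functions of `r + 1` points differ on `U` by germs from functions which are closed
everywhere. -/
def Correctable (U : Set N) (r : ℕ) : Prop :=
  ∀ k : (Fin (r + 1) → N) → ℤ, VanOn U (pointDelta k) →
    ∃ h : (Fin (r + 1) → N) → ℤ, pointDelta h = 0 ∧ VanOn U (k - h)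

/-- Closed functions of `r + 2` points are exact on `U`. -/
def ExactOn (U : Set N) (r : ℕ) : Prop :=
  ∀ f : (Fin (r + 2) → N) → ℤ, VanOn U (pointDelta f) →
    ∃ g : (Fin (r + 1) → N) → ℤ, VanOn U (f - pointDelta g)

/-- On `U` the closed function has the germs of some `δ g`, and `δ g` is closed everywhere. -/
lemma ExactOn.correctable {U : Set N} (h : ExactOn U r) : Correctable U (r + 1) := fun k hk => by
  obtain ⟨g, hg⟩ := h k hk
  exact ⟨HigherGerbe.pointDelta g, pointDelta_pointDelta g, hg⟩

lemma vanOn_pointDelta_zero_iff {U : Set N} {k : (Fin 1 → N) → ℤ} :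
    VanOn U (pointDelta k) ↔ ∀ x ∈ U, ∀ᶠ y in 𝓝 x, k (fun _ => y) = k (fun _ => x) := by
  refine forall₂_congr fun x hx => ?_
  rw [eventually_nearFilter_succ]
  refine eventually_congr (Eventually.of_forall fun y => ?_)
  rw [eventually_nearFilter_zero]
  have : pointDelta k (Fin.cons x fun _ => y) = k (fun _ => y) - k (fun _ => x) := by
    unfold pointDelta
    rw [Fin.sum_univ_two]
    have h0 : (Fin.cons x (fun _ => y) : Fin 2 → N) ∘ (0 : Fin 2).succAbove = fun _ => y := rfl
    have h1 : (Fin.cons x (fun _ => y) : Fin 2 → N) ∘ (1 : Fin 2).succAbove = fun _ => x := by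
      funext j
      obtain rfl : j = 0 := Subsingleton.elim _ _
      rfl
    rw [h0, h1]
    simp [sub_eq_add_neg]
  rw [this, sub_eq_zero]

/-- A locally constant function on a connected set is constant, and constants are closed everywhere.
-/
lemma correctable_zero {U : Set N} (hU : IsOpen U) (hc : _root_.IsPreconnected U) :
    Correctable U 0 := fun k hk => by
  rw [vanOn_pointDelta_zero_iff] at hk
  rcases U.eq_empty_or_nonempty with rfl | ⟨x₀, hx₀⟩
  · exact ⟨0, by funext t; simp [pointDelta], fun x hx => hx.elim⟩
  · refine ⟨fun _ => k fun _ => x₀, ?_, fun x hx => ?_⟩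
    · funext t
      unfold pointDelta
      rw [Fin.sum_univ_two]
      simp
    · rw [eventually_nearFilter_zero]
      have hcont : ContinuousOn (fun x => k fun _ => x) U := fun x hx => by
        have : (fun y => k fun _ => y) =ᶠ[𝓝[U] x] fun _ => k fun _ => x :=
          (hk x hx).filter_mono nhdsWithin_le_nhds
        exact (continuousWithinAt_const.congr_of_eventuallyEq this rfl)
      have := hc.constant hcont hx hx₀
      exact sub_eq_zero.2 this

open Classical in
/-- The Mayer-Vietoris argument. -/
lemma glue_primitives {U V : Set N} (hU : IsOpen U) (hV : IsOpen V) (hc : Correctable (U ∩ V) r)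
    {f : (Fin (r + 2) → N) → ℤ} {g₁ g₂ : (Fin (r + 1) → N) → ℤ}
    (h₁ : VanOn U (f - pointDelta g₁)) (h₂ : VanOn V (f - pointDelta g₂)) :
    ∃ g, (∀ t, t 0 ∈ U → g t = g₁ t) ∧ VanOn (U ∪ V) (f - pointDelta g) := by
  -- The difference of the primitives is closed on the overlap, so there it has the germs of a
  -- function `h` closed everywhere. Then `g₂ + h` is another primitive on `V`, with the germs of
  -- `g₁` on the overlap.
  obtain ⟨h, hh, hk⟩ := hc (g₁ - g₂) (by
    have := (h₂.mono (Set.inter_subset_right (s := U))).sub (h₁.mono (Set.inter_subset_left (t := V)))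
    refine this.congr fun t _ => ?_
    rw [pointDelta_sub]
    simp)
  -- Gluing according to the first point keeps `g₁` literally unchanged over `U`; the limit argument
  -- in `exists_primitive_iUnion` relies on this.
  refine ⟨fun t => if t 0 ∈ U then g₁ t else (g₂ + h) t, fun t ht => if_pos ht, ?_⟩
  set g : (Fin (r + 1) → N) → ℤ := fun t => if t 0 ∈ U then g₁ t else (g₂ + h) t with hg
  have e1 : VanOn U (g₁ - g) := VanOn.of_forall fun t ht => by simp [hg, ht]
  have e2 : VanOn V (g₂ + h - g) := by
    intro x hx
    by_cases hxU : x ∈ U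
    · filter_upwards [hk x ⟨hxU, hx⟩, eventually_nearFilter_head x] with t h1 h2
      have : g t = g₁ t := if_pos (h2 ▸ hxU)
      simp only [Pi.sub_apply, Pi.add_apply, this] at h1 ⊢
      linarith
    · filter_upwards [eventually_nearFilter_head x] with t h2
      have : g t = (g₂ + h) t := if_neg (h2 ▸ hxU)
      rw [Pi.sub_apply, this, sub_self]
  intro x hx
  rcases hx with hx | hx
  · filter_upwards [h₁ x hx, e1.pointDelta hU x hx] with t a b
    rw [pointDelta_sub] at b
    simp only [Pi.sub_apply] at a b ⊢
    linarith
  · filter_upwards [h₂ x hx, e2.pointDelta hV x hx] with t a b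
    rw [pointDelta_sub, pointDelta_add, hh] at b
    simp only [Pi.sub_apply, Pi.add_apply, Pi.zero_apply] at a b ⊢
    linarith

/-- Closed functions are locally exact. -/
lemma exists_local_primitive {U : Set N} {f : (Fin (r + 2) → N) → ℤ} (hf : VanOn U (pointDelta f))
    {x : N} (hx : x ∈ U) : ∃ O ∈ 𝓝 x, ∃ g, VanOn O (f - pointDelta g) := by
  -- The primitive is the cone with apex `x`, on the set of points `y` for which the closedness of
  -- `f` at `x` covers the tuples starting near `y`.
  refine ⟨{y | ∀ᶠ t in nearFilter (r + 1) y, pointDelta f (Fin.cons x t) = 0},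
    eventually_nearFilter_succ.1 (hf x hx), fun t => f (Fin.cons x t), fun y hy => ?_⟩
  filter_upwards [hy] with t ht
  rwa [pointDelta_cons] at ht

open Classical in
/-- Exactness on the union of an increasing sequence of open sets. -/
lemma exists_primitive_iUnion {U : ℕ → Set N} (hU : ∀ n, IsOpen (U n)) (hm : Monotone U)
    (hc : ∀ n, Correctable (U n) r) {f : (Fin (r + 2) → N) → ℤ}
    (h : ∀ n, ∃ g, VanOn (U n) (f - pointDelta g)) : ∃ g, VanOn (⋃ n, U n) (f - pointDelta g) := by
  -- The primitive on `U (n + 1)` is corrected so that it extends the given one on `U n` exactly. A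
  -- sequence of such extensions defines a single function, evaluated at the first stage that
  -- contains the head.
  have step : ∀ n (g : {g // VanOn (U n) (f - pointDelta g)}),
      ∃ g' : {g // VanOn (U (n + 1)) (f - pointDelta g)}, ∀ t, t 0 ∈ U n → g'.1 t = g.1 t := by
    intro n g
    obtain ⟨g₂, hg₂⟩ := h (n + 1)
    have hsub : U n ⊆ U (n + 1) := hm n.le_succ
    obtain ⟨g', h1, h2⟩ := glue_primitives (hU n) (hU (n + 1))
      (by rw [Set.inter_eq_left.2 hsub]; exact hc n) g.2 hg₂
    exact ⟨⟨g', h2.mono Set.subset_union_right⟩, h1⟩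
  choose F hF using step
  let G : ∀ n, {g // VanOn (U n) (f - pointDelta g)} := fun n =>
    Nat.rec ⟨(h 0).choose, (h 0).choose_spec⟩ (fun n g => F n g) n
  have hG : ∀ n m, n ≤ m → ∀ t, t 0 ∈ U n → (G m).1 t = (G n).1 t := by
    intro n m hnm
    induction m, hnm using Nat.le_induction with
    | base => exact fun _ _ => rfl
    | succ m hnm ih => exact fun t ht => (hF m (G m) t (hm hnm ht)).trans (ih t ht)
  let g : (Fin (r + 1) → N) → ℤ := fun t =>
    if ht : ∃ n, t 0 ∈ U n then (G (Nat.find ht)).1 t else 0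
  have hg : ∀ n t, t 0 ∈ U n → g t = (G n).1 t := fun n t ht => by
    have ht' : ∃ n, t 0 ∈ U n := ⟨n, ht⟩
    simp only [g, dif_pos ht']
    exact (hG _ n (Nat.find_min' ht' ht) t (Nat.find_spec ht')).symm
  refine ⟨g, fun x hx => ?_⟩
  obtain ⟨n, hn⟩ := Set.mem_iUnion.1 hx
  have e : VanOn (U n) ((G n).1 - g) := VanOn.of_forall fun t ht => by
    rw [Pi.sub_apply, hg n t ht, sub_self]
  filter_upwards [(G n).2 x hn, e.pointDelta (hU n) x hn] with t a b
  rw [pointDelta_sub] at b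
  simp only [Pi.sub_apply] at a b ⊢
  linarith

end Germs

/-! ### Exactness on boxes -/

section Boxes

variable {d : ℕ} {r : ℕ}

/-- An open neighbourhood of a closed box. -/
def openBox (a b : Fin d → ℝ) (ε : ℝ) : Set (Fin d → ℝ) :=
  {x | ∀ i, a i - ε < x i ∧ x i < b i + ε}

lemma openBox_eq_pi (a b : Fin d → ℝ) (ε : ℝ) :
    openBox a b ε = Set.univ.pi fun i => Set.Ioo (a i - ε) (b i + ε) := by
  ext x
  simp [openBox]

lemma isOpen_openBox (a b : Fin d → ℝ) (ε : ℝ) : IsOpen (openBox a b ε) := by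
  rw [openBox_eq_pi]
  exact isOpen_set_pi Set.finite_univ fun i _ => isOpen_Ioo

lemma isPreconnected_openBox (a b : Fin d → ℝ) (ε : ℝ) : _root_.IsPreconnected (openBox a b ε) := by
  rw [openBox_eq_pi]
  exact (convex_pi fun i _ => convex_Ioo _ _).isPreconnected

lemma openBox_mono {a b a' b' : Fin d → ℝ} {ε ε' : ℝ} (ha : ∀ i, a' i - ε' ≤ a i - ε)
    (hb : ∀ i, b i + ε ≤ b' i + ε') : openBox a b ε ⊆ openBox a' b' ε' :=
  fun _ hx i => ⟨(ha i).trans_lt (hx i).1, (hx i).2.trans_le (hb i)⟩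

/-- The function is exact in a neighbourhood of a closed box. -/
def ExactNear (f : (Fin (r + 2) → (Fin d → ℝ)) → ℤ) (a b : Fin d → ℝ) : Prop :=
  ∃ ε > 0, ∃ g, VanOn (openBox a b ε) (f - pointDelta g)

-- Mayer–Vietoris for a box cut at the height `m` of the coordinate `j`. With one `ε` for both
-- halves, their neighbourhoods again meet in an open box, where `Correctable` is available.
open Function in
lemma ExactNear.glue (hc : ∀ (a b : Fin d → ℝ) (ε : ℝ), a ≤ b → 0 < ε → Correctable (openBox a b ε) r)
    {f : (Fin (r + 2) → (Fin d → ℝ)) → ℤ} {a b : Fin d → ℝ} {j : Fin d} {m : ℝ} (hab : a ≤ b)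
    (ham : a j ≤ m) (hmb : m ≤ b j) (h₁ : ExactNear f a (update b j m))
    (h₂ : ExactNear f (update a j m) b) : ExactNear f a b := by
  obtain ⟨ε₁, hε₁, g₁, h₁⟩ := h₁
  obtain ⟨ε₂, hε₂, g₂, h₂⟩ := h₂
  set ε := min ε₁ ε₂
  have hε : 0 < ε := lt_min hε₁ hε₂
  have l1 : ε ≤ ε₁ := min_le_left _ _
  have l2 : ε ≤ ε₂ := min_le_right _ _
  replace h₁ := h₁.mono (openBox_mono (a := a) (b := update b j m) (ε := ε)
    (fun i => by linarith) (fun i => by linarith))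
  replace h₂ := h₂.mono (openBox_mono (a := update a j m) (b := b) (ε := ε)
    (fun i => by linarith) (fun i => by linarith))
  have hint : openBox a (update b j m) ε ∩ openBox (update a j m) b ε =
      openBox (update a j m) (update b j m) ε := by
    ext x
    constructor
    · exact fun h i => ⟨(h.2 i).1, (h.1 i).2⟩
    · intro h
      refine ⟨fun i => ⟨?_, (h i).2⟩, fun i => ⟨(h i).1, ?_⟩⟩
      · rcases eq_or_ne i j with rfl | hi
        · have := (h i).1
          rw [update_self] at this
          linarith
        · have := (h i).1
          rwa [update_of_ne hi] at this
      · rcases eq_or_ne i j with rfl | hi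
        · have := (h i).2
          rw [update_self] at this
          linarith
        · have := (h i).2
          rwa [update_of_ne hi] at this
  obtain ⟨g, -, hg⟩ := glue_primitives (isOpen_openBox _ _ _) (isOpen_openBox _ _ _) (by
    rw [hint]
    exact hc _ _ _ (update_le_update_iff.2 ⟨le_rfl, fun i _ => hab i⟩) hε) h₁ h₂
  refine ⟨ε, hε, g, hg.mono fun x hx => ?_⟩
  rcases lt_or_ge (x j) (m + ε) with h | h
  · left
    intro i
    refine ⟨(hx i).1, ?_⟩
    rcases eq_or_ne i j with rfl | hi
    · rwa [update_self]
    · rw [update_of_ne hi]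
      exact (hx i).2
  · right
    intro i
    refine ⟨?_, (hx i).2⟩
    rcases eq_or_ne i j with rfl | hi
    · rw [update_self]
      linarith
    · rw [update_of_ne hi]
      exact (hx i).1

-- Induction on the set of coordinates in which the box may have positive extent. For a point this
-- is local exactness. A further coordinate is cut into slabs so thin that each lies in the exact
-- neighbourhood of a slice, and the slabs are glued one after the other.
open Function in
lemma exactNear_of_vanOn
    (hc : ∀ (a b : Fin d → ℝ) (ε : ℝ), a ≤ b → 0 < ε → Correctable (openBox a b ε) r)
    {f : (Fin (r + 2) → (Fin d → ℝ)) → ℤ} {U : Set (Fin d → ℝ)} (hf : VanOn U (pointDelta f))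
    (s : Finset (Fin d)) : ∀ (a b : Fin d → ℝ), a ≤ b → (∀ i ∉ s, a i = b i) →
      Set.Icc a b ⊆ U → ExactNear f a b := by
  induction s using Finset.induction_on with
  | empty =>
    intro a b hab h hU
    obtain rfl : a = b := funext fun i => h i (by simp)
    obtain ⟨O, hO, g, hg⟩ := exists_local_primitive hf (hU ⟨le_rfl, le_rfl⟩)
    obtain ⟨ε, hε, hb⟩ := Metric.mem_nhds_iff.1 hO
    refine ⟨ε, hε, g, hg.mono fun x hx => hb ?_⟩
    rw [Metric.mem_ball, dist_pi_lt_iff hε]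
    intro i
    rw [Real.dist_eq, abs_lt]
    have := hx i
    constructor <;> linarith
  | insert j s hj ih =>
    intro a b hab h hU
    have hslice : ∀ t ∈ Set.Icc (a j) (b j), ExactNear f (update a j t) (update b j t) := by
      intro t ht
      refine ih _ _ (update_le_update_iff.2 ⟨le_rfl, fun i _ => hab i⟩) (fun i hi => ?_)
        fun x hx => hU ⟨fun i => ?_, fun i => ?_⟩
      · rcases eq_or_ne i j with rfl | hij
        · rw [update_self, update_self]
        · rw [update_of_ne hij, update_of_ne hij]
          exact h i (by simp [hij, hi])
      · have := hx.1 i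
        rcases eq_or_ne i j with rfl | hij
        · rw [update_self] at this
          exact ht.1.trans this
        · rwa [update_of_ne hij] at this
      · have := hx.2 i
        rcases eq_or_ne i j with rfl | hij
        · rw [update_self] at this
          exact this.trans ht.2
        · rwa [update_of_ne hij] at this
    choose! ε hε g hg using hslice
    -- Half the radius is used: a slab within distance `ε u / 2` of the height `u`, thickened by `ε
    -- u / 2`, stays inside the neighbourhood belonging to the slice at `u`.
    obtain ⟨t, ht0, htm, ⟨m, hm⟩, ht⟩ := exists_monotone_Icc_subset_open_cover_Icc (hab j)
      (c := fun u : Set.Icc (a j) (b j) =>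
        {x : Set.Icc (a j) (b j) | |x.1 - u.1| < ε u / 2})
      (fun u => isOpen_lt (by fun_prop) continuous_const)
      (fun u _ => Set.mem_iUnion.2 ⟨u, by simpa using half_pos (hε u u.2)⟩)
    have key : ∀ n, ExactNear f a (update b j (t n)) := by
      intro n
      induction n with
      | zero =>
        rw [ht0]
        have := (⟨_, hε (a j) ⟨le_rfl, hab j⟩, _, hg (a j) ⟨le_rfl, hab j⟩⟩ :
          ExactNear f (update a j (a j)) (update b j (a j)))
        rwa [update_eq_self] at this
      | succ n ihn =>
        obtain ⟨u, hu⟩ := ht n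
        have htn : t n ≤ t (n + 1) := htm n.le_succ
        have h1 := hu ⟨le_rfl, htn⟩
        have h2 := hu ⟨htn, le_rfl⟩
        simp only [Set.mem_ofPred_eq, abs_lt] at h1 h2
        have hu0 := hε u u.2
        refine ExactNear.glue hc (j := j) (m := t n) ?_ (t n).2.1 ?_ ?_ ?_
        · intro i
          rcases eq_or_ne i j with rfl | hij
          · rw [update_self]
            exact (t (n + 1)).2.1
          · rw [update_of_ne hij]
            exact hab i
        · rw [update_self]
          exact htn
        · rwa [update_idem]
        · refine ⟨ε u / 2, half_pos hu0, g u, (hg u u.2).mono (openBox_mono (fun i => ?_)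
            fun i => ?_)⟩
          · rcases eq_or_ne i j with rfl | hij
            · rw [update_self, update_self]
              linarith
            · rw [update_of_ne hij, update_of_ne hij]
              linarith
          · rcases eq_or_ne i j with rfl | hij
            · rw [update_self, update_self]
              linarith
            · rw [update_of_ne hij, update_of_ne hij]
              linarith
    have := key m
    rw [hm m le_rfl] at this
    rwa [update_eq_self] at this

/-- Two implications alternate: `Correctable` in degree `r` gives exactness in degree `r`, by
exhaustion with closed boxes, and exactness in degree `r` gives `Correctable` in degree `r + 1`.
Connectedness starts the induction. -/
lemma exactOn_openBox (r : ℕ) : ∀ (a b : Fin d → ℝ) (ε : ℝ), a ≤ b → 0 < ε →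
    Correctable (openBox a b ε) r ∧ ExactOn (openBox a b ε) r := by
  have main : ∀ r, (∀ (a b : Fin d → ℝ) (ε : ℝ), a ≤ b → 0 < ε → Correctable (openBox a b ε) r) →
      ∀ (a b : Fin d → ℝ) (ε : ℝ), a ≤ b → 0 < ε → ExactOn (openBox a b ε) r := by
    intro r hc a b ε hab hε f hf
    have hn : ∀ n : ℕ, (0 : ℝ) < n + 2 := fun n => by positivity
    -- An increasing sequence in `(0, ε)` with limit `ε`; the shift by `2` keeps `η 0` positive.
    let η : ℕ → ℝ := fun n => ε - ε / (n + 2)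
    have hη : ∀ n, 0 < η n ∧ η n < ε := fun n => by
      have : ε / (n + 2) < ε := div_lt_self hε (by have := Nat.cast_nonneg (α := ℝ) n; linarith)
      have h2 : 0 < ε / (n + 2) := div_pos hε (hn n)
      constructor <;> simp only [η] <;> linarith
    have hηm : Monotone η := fun n m hnm => by
      simp only [η]
      have : ε / (m + 2) ≤ ε / (n + 2) := div_le_div_of_nonneg_left hε.le (hn n) (by
        have : (n : ℝ) ≤ m := by exact_mod_cast hnm
        linarith)
      linarith
    have hU : (⋃ n, openBox a b (η n)) = openBox a b ε := by
      ext x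
      rw [Set.mem_iUnion]
      constructor
      · rintro ⟨n, hx⟩ i
        have := hx i
        have := (hη n).2
        constructor <;> linarith
      · intro hx
        have ht : Filter.Tendsto η Filter.atTop (𝓝 ε) := by
          have : Filter.Tendsto (fun n : ℕ => ε / ((n : ℝ) + 2)) Filter.atTop (𝓝 0) :=
            Filter.Tendsto.div_atTop tendsto_const_nhds
              (Filter.tendsto_atTop_add_const_right _ _ tendsto_natCast_atTop_atTop)
          simpa [η] using tendsto_const_nhds.sub this
        have : ∀ i, ∀ᶠ n in Filter.atTop, a i - η n < x i ∧ x i < b i + η n := fun i => by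
          filter_upwards [ht.eventually (lt_mem_nhds (show max (a i - x i) (x i - b i) < ε from
            max_lt (by linarith [(hx i).1]) (by linarith [(hx i).2])))] with n hn
          rw [max_lt_iff] at hn
          constructor <;> linarith
        exact (Filter.eventually_all.2 this).exists
    rw [← hU]
    refine exists_primitive_iUnion (fun n => isOpen_openBox _ _ _)
      (fun n m h => openBox_mono (fun i => by linarith [hηm h]) fun i => by linarith [hηm h])
      (fun n => hc a b (η n) hab (hη n).1) fun n => ?_
    have h0 := (hη n).1
    obtain ⟨δ, hδ, g, hg⟩ := exactNear_of_vanOn hc hf Finset.univ (fun i => a i - η n)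
      (fun i => b i + η n) (fun i => by have := hab i; simp only; linarith) (by simp)
      (fun x hx i => ⟨by have := hx.1 i; simp only at this; linarith [(hη n).2],
        by have := hx.2 i; simp only at this; linarith [(hη n).2]⟩)
    exact ⟨g, hg.mono (openBox_mono (fun i => by linarith) fun i => by linarith)⟩
  induction r with
  | zero =>
    have h0 : ∀ (a b : Fin d → ℝ) (ε : ℝ), a ≤ b → 0 < ε → Correctable (openBox a b ε) 0 :=
      fun a b ε _ _ => correctable_zero (isOpen_openBox _ _ _) (isPreconnected_openBox _ _ _)
    exact fun a b ε hab hε => ⟨h0 a b ε hab hε, main 0 h0 a b ε hab hε⟩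
  | succ r ih =>
    have h0 : ∀ (a b : Fin d → ℝ) (ε : ℝ), a ≤ b → 0 < ε → Correctable (openBox a b ε) (r + 1) :=
      fun a b ε hab hε => (ih a b ε hab hε).2.correctable
    exact fun a b ε hab hε => ⟨h0 a b ε hab hε, main _ h0 a b ε hab hε⟩

theorem exactOn_univ (d r : ℕ) : ExactOn (Set.univ : Set (Fin d → ℝ)) r := by
  have hU : (⋃ n : ℕ, openBox (0 : Fin d → ℝ) 0 (n + 1)) = Set.univ := by
    refine Set.eq_univ_of_forall fun x => Set.mem_iUnion.2 ?_
    obtain ⟨n, hn⟩ := exists_nat_gt ‖x‖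
    refine ⟨n, fun i => ?_⟩
    have h1 := norm_le_pi_norm x i
    have h2 := abs_lt.1 (lt_of_le_of_lt h1 (hn.trans (lt_add_one (n : ℝ))))
    simpa using h2
  rw [← hU]
  intro f hf
  have hp : ∀ n : ℕ, (0 : ℝ) < n + 1 := fun n => by positivity
  refine exists_primitive_iUnion (fun n => isOpen_openBox _ _ _) (fun n m h => ?_)
    (fun n => (exactOn_openBox r 0 0 _ le_rfl (hp n)).1) fun n =>
      (exactOn_openBox r 0 0 _ le_rfl (hp n)).2 f (hf.mono (Set.subset_iUnion_of_subset n subset_rfl))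
  have : (n : ℝ) ≤ m := by exact_mod_cast h
  exact openBox_mono (fun i => by linarith) fun i => by linarith

end Boxes

/-! ### Transport of exactness along homeomorphisms. -/

section Transport

variable {N N' : Type*} [TopologicalSpace N] [TopologicalSpace N'] {r : ℕ}

lemma map_nearFilter {e : N' → N} (he : ∀ x, (𝓝 x).map e = 𝓝 (e x)) (r : ℕ) (x : N') :
    (nearFilter r x).map (e ∘ ·) = nearFilter r (e x) := by
  induction r generalizing x with
  | zero => rfl
  | succ r ih =>
    ext P
    change (∀ᶠ t in nearFilter (r + 1) x, e ∘ t ∈ P) ↔ ∀ᶠ t in nearFilter (r + 1) (e x), t ∈ P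
    rw [eventually_nearFilter_succ, eventually_nearFilter_succ, ← he x, eventually_map]
    refine eventually_congr (Eventually.of_forall fun y => ?_)
    rw [← ih y, eventually_map]
    refine eventually_congr (Eventually.of_forall fun t => ?_)
    rw [show e ∘ (Fin.cons x t : Fin (r + 2) → N') = Fin.cons (e x) (e ∘ t) from
      funext fun i => by induction i using Fin.cases <;> rfl]

/-- Exactness on open sets which are homeomorphic to a cartesian space. -/
lemma exactOn_of_homeomorph {U : TopologicalSpace.Opens N} {d : ℕ} (φ : U ≃ₜ (Fin d → ℝ)) (r : ℕ) :
    ExactOn (U : Set N) r := by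
  classical
  intro f hf
  let e : (Fin d → ℝ) → N := fun x => φ.symm x
  have he : IsOpenEmbedding e := U.isOpen.isOpenEmbedding_subtypeVal.comp φ.symm.isOpenEmbedding
  have hm : ∀ x, (𝓝 x).map e = 𝓝 (e x) := he.map_nhds_eq
  let e' : N → (Fin d → ℝ) := fun y => if h : y ∈ U then φ ⟨y, h⟩ else 0
  have he' : ∀ x, e' (e x) = x := fun x => by simp [e', e]
  have key : ∀ {r : ℕ} (F : (Fin (r + 1) → N) → ℤ),
      VanOn (U : Set N) F ↔ VanOn Set.univ fun t => F (e ∘ t) := by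
    intro r F
    constructor
    · intro h x _
      have := h (e x) (φ.symm x).2
      rwa [← map_nearFilter hm, eventually_map] at this
    · intro h y hy
      have hy' : e (φ ⟨y, hy⟩) = y := by simp [e]
      rw [← hy', ← map_nearFilter hm, eventually_map]
      exact h _ trivial
  obtain ⟨g, hg⟩ := exactOn_univ d r (fun t => f (e ∘ t)) ((key _).1 hf)
  refine ⟨fun t => g (e' ∘ t), (key _).2 (hg.congr fun t _ => ?_)⟩
  have : ∀ i : Fin (r + 2), e' ∘ ((e ∘ t) ∘ i.succAbove) = t ∘ i.succAbove := fun i =>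
    funext fun j => he' _
  simp only [Pi.sub_apply, pointDelta, this]

end Transport

end HigherGerbe

/-! ### Comparison of coverings with Alexander–Spanier cohomology. -/

namespace HigherGerbe

/-! ### Double complexes -/

/-- A double complex of abelian groups in the first quadrant, with commuting differentials. -/
structure DoubleComplex where
  obj : ℕ → ℕ → Type
  [grp : ∀ q r, AddCommGroup (obj q r)]
  dh : ∀ {q r}, obj q r →+ obj (q + 1) r
  dv : ∀ {q r}, obj q r →+ obj q (r + 1)
  dh_dh : ∀ {q r} (x : obj q r), dh (dh x) = 0
  dv_dv : ∀ {q r} (x : obj q r), dv (dv x) = 0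
  dv_dh : ∀ {q r} (x : obj q r), dv (dh x) = dh (dv x)

namespace DoubleComplex

attribute [instance] DoubleComplex.grp

/-- Omission of the bottom row. -/
def shift (D : DoubleComplex) : DoubleComplex where
  obj q r := D.obj q (r + 1)
  dh := D.dh
  dv := D.dv
  dh_dh := D.dh_dh
  dv_dv := D.dv_dv
  dv_dh := D.dv_dh

/-- The relation given by a zigzag from the bottom row to the left column. -/
def Link : ∀ (q : ℕ) (D : DoubleComplex), D.obj q 0 → D.obj 0 q → Prop
  | 0, _, z, e => z = e
  | q + 1, D, z, e => ∃ y : D.obj q 0, D.dh y = z ∧ Link q D.shift (D.dv y) e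

/-- Exactness of the rows. -/
def RowExact (D : DoubleComplex) : Prop :=
  ∀ (q r) (y : D.obj (q + 1) r), D.dh y = 0 → ∃ t, D.dh t = y

/-- Exactness of the columns. -/
def ColExact (D : DoubleComplex) : Prop :=
  ∀ (q r) (y : D.obj q (r + 1)), D.dv y = 0 → ∃ t, D.dv t = y

lemma RowExact.shift {D : DoubleComplex} (h : D.RowExact) : D.shift.RowExact :=
  fun q r => h q (r + 1)

lemma ColExact.shift {D : DoubleComplex} (h : D.ColExact) : D.shift.ColExact :=
  fun q r => h q (r + 1)

lemma Link.sub {q : ℕ} : ∀ {D : DoubleComplex} {z z' : D.obj q 0} {e e' : D.obj 0 q},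
    Link q D z e → Link q D z' e' → Link q D (z - z') (e - e') := by
  induction q with
  | zero => rintro D z z' e e' rfl rfl; rfl
  | succ q ih =>
    rintro D z z' e e' ⟨y, hy, h⟩ ⟨y', hy', h'⟩
    refine ⟨y - y', by rw [map_sub, hy, hy'], ?_⟩
    rw [map_sub]
    exact ih h h'

lemma Link.add {q : ℕ} : ∀ {D : DoubleComplex} {z z' : D.obj q 0} {e e' : D.obj 0 q},
    Link q D z e → Link q D z' e' → Link q D (z + z') (e + e') := by
  induction q with
  | zero => rintro D z z' e e' rfl rfl; rfl
  | succ q ih =>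
    rintro D z z' e e' ⟨y, hy, h⟩ ⟨y', hy', h'⟩
    refine ⟨y + y', by rw [map_add, hy, hy'], ?_⟩
    rw [map_add]
    exact ih h h'

/-- Maps of double complexes. -/
structure Map (D D' : DoubleComplex) where
  app : ∀ {q r}, D.obj q r →+ D'.obj q r
  dh : ∀ {q r} (x : D.obj q r), app (D.dh x) = D'.dh (app x)
  dv : ∀ {q r} (x : D.obj q r), app (D.dv x) = D'.dv (app x)

/-- Omission of the bottom row. -/
def Map.shift {D D' : DoubleComplex} (f : Map D D') : Map D.shift D'.shift where
  app := f.app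
  dh := f.dh
  dv := f.dv

lemma Link.map {q : ℕ} : ∀ {D D' : DoubleComplex} (f : Map D D') {z : D.obj q 0} {e : D.obj 0 q},
    Link q D z e → Link q D' (f.app z) (f.app e) := by
  induction q with
  | zero => rintro D D' f z e rfl; rfl
  | succ q ih =>
    rintro D D' f z e ⟨y, hy, h⟩
    refine ⟨f.app y, by rw [← f.dh, hy], ?_⟩
    rw [← f.dv]
    exact ih f.shift h

/-- The element `z` is `dh y` for some `y`, and `dv y` is closed in both directions one row higher,
so the process repeats. -/
lemma RowExact.exists_link {q : ℕ} : ∀ {D : DoubleComplex} (_ : D.RowExact) (z : D.obj q 0),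
    D.dh z = 0 → D.dv z = 0 → ∃ e, Link q D z e ∧ D.dh e = 0 ∧ D.dv e = 0 := by
  induction q with
  | zero => exact fun {D} _ z h1 h2 => ⟨z, rfl, h1, h2⟩
  | succ q ih =>
    intro D hD z h1 h2
    obtain ⟨y, rfl⟩ := hD q 0 z h1
    obtain ⟨e, he, h3, h4⟩ := ih hD.shift (D.dv y) ((D.dv_dh y).symm.trans h2) (D.dv_dv y)
    exact ⟨e, ⟨y, rfl, he⟩, h3, h4⟩

lemma ColExact.exists_link {q : ℕ} : ∀ {D : DoubleComplex} (_ : D.ColExact) (e : D.obj 0 q),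
    D.dh e = 0 → D.dv e = 0 → ∃ z, Link q D z e ∧ D.dh z = 0 ∧ D.dv z = 0 := by
  induction q with
  | zero => exact fun {D} _ z h1 h2 => ⟨z, rfl, h1, h2⟩
  | succ q ih =>
    intro D hD e h1 h2
    obtain ⟨z, hz, h3, h4⟩ := ih hD.shift e h1 h2
    obtain ⟨y, rfl⟩ := hD q 0 z h4
    exact ⟨D.dh y, ⟨y, rfl, hz⟩, D.dh_dh y, (D.dv_dh y).trans h3⟩

/-- A staircase starting at `dh w` with `dv w = 0` may have used some `y` other than `w`. By row
exactness `y - w = dh t`, so `dv y = dh (dv t)` and the situation recurs one row up. At the left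
column `y - w` itself is the required `u`. -/
lemma RowExact.exists_dv_eq {q : ℕ} : ∀ {D : DoubleComplex} (_ : D.RowExact) {w : D.obj q 0}
    {e : D.obj 0 (q + 1)}, Link (q + 1) D (D.dh w) e → D.dv w = 0 →
    ∃ u : D.obj 0 q, D.dh u = 0 ∧ D.dv u = e := by
  induction q with
  | zero =>
    rintro D hD w e ⟨y, hy, he⟩ hw
    exact ⟨y - w, by rw [map_sub, hy, sub_self], by rw [map_sub, hw, sub_zero]; exact he⟩
  | succ q ih =>
    rintro D hD w e ⟨y, hy, he⟩ hw
    obtain ⟨t, ht⟩ := hD q 0 (y - w) (by rw [map_sub, hy, sub_self])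
    have h : D.dv y = D.dh (D.dv t) := by
      rw [← D.dv_dh, ht, map_sub, hw, sub_zero]
    rw [h] at he
    exact ih hD.shift (w := D.dv t) he (D.dv_dv t)

/-- The mirror image of `RowExact.exists_dv_eq`, with columns in place of rows. -/
lemma ColExact.exists_dh_eq {q : ℕ} : ∀ {D : DoubleComplex} (_ : D.ColExact) {z : D.obj (q + 1) 0}
    {u : D.obj 0 q}, Link (q + 1) D z (D.dv u) → D.dh u = 0 →
    ∃ w : D.obj q 0, D.dh w = z ∧ D.dv w = 0 := by
  induction q with
  | zero =>
    rintro D hD z u ⟨y, hy, he⟩ hu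
    refine ⟨y - u, by rw [map_sub, hy, hu, sub_zero], ?_⟩
    rw [map_sub, sub_eq_zero]
    exact he
  | succ q ih =>
    rintro D hD z u ⟨y, hy, he⟩ hu
    obtain ⟨w, hw, hw'⟩ := ih hD.shift (z := D.dv y) (u := u) he hu
    obtain ⟨t, rfl⟩ := hD q 0 w hw'
    refine ⟨y - D.dh t, by rw [map_sub, D.dh_dh, hy, sub_zero], ?_⟩
    rw [map_sub, D.dv_dh, sub_eq_zero]
    exact hw.symm

end DoubleComplex

/-! ### The double complex of an open covering -/

section Leray

open Simplicial Topology TopologicalSpace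

/-- The `q`-simplices of the product of `Δ[m]` with the simplicial set freely generated by the
vertices `ι`. -/
abbrev IdxSimplex (ι : Type) (m q : ℕ) : Type := (Fin (q + 1) → ι) × (⦋q⦌ ⟶ ⦋m⦌)

namespace IdxSimplex

variable {ι ι' : Type} {m m' q : ℕ}

/-- The faces of a simplex. -/
def face (σ : IdxSimplex ι m (q + 1)) (i : Fin (q + 2)) : IdxSimplex ι m q :=
  (σ.1 ∘ i.succAbove, SimplexCategory.δ i ≫ σ.2)

lemma face_face (σ : IdxSimplex ι m (q + 2)) {i j : Fin (q + 2)} (h : j ≤ i) :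
    (σ.face i.succ).face j = (σ.face j.castSucc).face i := by
  refine Prod.ext ?_ ?_
  · change σ.1 ∘ (i.succ.succAbove ∘ j.succAbove) = σ.1 ∘ (j.castSucc.succAbove ∘ i.succAbove)
    rw [Fin.succAbove_comp_succAbove i j h]
  · change SimplexCategory.δ j ≫ SimplexCategory.δ i.succ ≫ σ.2 =
      SimplexCategory.δ i ≫ SimplexCategory.δ j.castSucc ≫ σ.2
    rw [← Category.assoc, SimplexCategory.δ_comp_δ h, Category.assoc]

/-- The cone over a simplex. -/
def cone (σ : IdxSimplex ι m q) (b : ι) : IdxSimplex ι m (q + 1) := (Fin.cons b σ.1, consZero σ.2)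

lemma cone_face_zero (σ : IdxSimplex ι m q) (b : ι) : (σ.cone b).face 0 = σ :=
  Prod.ext rfl (δ_zero_consZero σ.2)

lemma cone_face_succ (σ : IdxSimplex ι m (q + 1)) (b : ι) (i : Fin (q + 2)) :
    (σ.cone b).face i.succ = (σ.face i).cone b :=
  Prod.ext (Fin.cons_comp_succ_succAbove b σ.1 i) (δ_succ_consZero σ.2 i)

/-- Simplices whose vertices `i` and `i + 1` agree. -/
def DegenerateAt (σ : IdxSimplex ι m (q + 1)) (i : Fin (q + 1)) : Prop :=
  σ.1 i.castSucc = σ.1 i.succ ∧ σ.2.toOrderHom i.castSucc = σ.2.toOrderHom i.succ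

lemma DegenerateAt.face_eq {σ : IdxSimplex ι m (q + 1)} {i : Fin (q + 1)}
    (h : σ.DegenerateAt i) : σ.face i.castSucc = σ.face i.succ :=
  Prod.ext (funext fun j => Fin.succAbove_castSucc_eq_of_pair σ.1 i h.1 j)
    (SimplexCategory.Hom.ext _ _ (OrderHom.ext _ _ (funext fun j =>
      Fin.succAbove_castSucc_eq_of_pair σ.2.toOrderHom i h.2 j)))

lemma DegenerateAt.exists_face {σ : IdxSimplex ι m (q + 2)} {i : Fin (q + 2)}
    (h : σ.DegenerateAt i) {j : Fin (q + 3)} (h1 : j ≠ i.castSucc) (h2 : j ≠ i.succ) :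
    ∃ i', (σ.face j).DegenerateAt i' := by
  obtain ⟨i', h3, h4⟩ := Fin.exists_succAbove_pair i j h1 h2
  refine ⟨i', ?_, ?_⟩
  · change σ.1 (j.succAbove _) = σ.1 (j.succAbove _)
    rw [h3, h4]
    exact h.1
  · change σ.2.toOrderHom (j.succAbove _) = σ.2.toOrderHom (j.succAbove _)
    rw [h3, h4]
    exact h.2

/-- Degenerate simplices. -/
def Degenerate (σ : IdxSimplex ι m q) : Prop :=
  match q, σ with
  | 0, _ => False
  | _ + 1, σ => ∃ i, σ.DegenerateAt i

lemma Degenerate.cone {σ : IdxSimplex ι m q} (h : σ.Degenerate) (b : ι) : (σ.cone b).Degenerate := by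
  cases q with
  | zero => exact h.elim
  | succ q =>
    obtain ⟨i, h⟩ := h
    exact ⟨i.succ, h⟩

/-- Functoriality in the vertices. -/
def map (f : ι → ι') (η : ⦋m⦌ ⟶ ⦋m'⦌) (σ : IdxSimplex ι m q) : IdxSimplex ι' m' q :=
  (f ∘ σ.1, σ.2 ≫ η)

lemma Degenerate.map {σ : IdxSimplex ι m q} (h : σ.Degenerate) (f : ι → ι') (η : ⦋m⦌ ⟶ ⦋m'⦌) :
    (σ.map f η).Degenerate := by
  cases q with
  | zero => exact h.elim
  | succ q =>
    obtain ⟨i, h⟩ := h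
    exact ⟨i, congrArg f h.1, congrArg η.toOrderHom h.2⟩

end IdxSimplex

/-- Families of elements indexed by simplices. -/
abbrev IdxFam (ι : Type) (m q : ℕ) (A : Type) : Type := IdxSimplex ι m q → A

namespace IdxFam

variable {ι ι' : Type} {m m' q : ℕ} {A : Type} [AddCommGroup A]

/-- The alternating sum over the faces. -/
def delta (x : IdxFam ι m q A) : IdxFam ι m (q + 1) A := fun σ =>
  ∑ i : Fin (q + 2), (-1 : ℤ) ^ (i : ℕ) • x (σ.face i)

lemma delta_delta (x : IdxFam ι m q A) : delta (delta x) = 0 := by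
  funext σ
  refine alternating_double_sum_eq_zero (fun i j => x ((σ.face i).face j)) fun i j hij => ?_
  rw [IdxSimplex.face_face σ hij]

lemma delta_add (x y : IdxFam ι m q A) : delta (x + y) = delta x + delta y := by
  funext σ
  refine Eq.trans ?_ Finset.sum_add_distrib
  exact Finset.sum_congr rfl fun i _ => smul_add _ _ _

lemma delta_sub (x y : IdxFam ι m q A) : delta (x - y) = delta x - delta y := by
  funext σ
  refine Eq.trans ?_ (Finset.sum_sub_distrib _ _)
  exact Finset.sum_congr rfl fun i _ => smul_sub _ _ _

lemma map_delta {B : Type} [AddCommGroup B] (f : A →+ B) (x : IdxFam ι m q A)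
    (σ : IdxSimplex ι m (q + 1)) : f (delta x σ) = delta (fun τ => f (x τ)) σ := by
  simp only [delta, map_sum, map_zsmul]

lemma delta_cone (x : IdxFam ι m (q + 1) A) (σ : IdxSimplex ι m (q + 1)) (b : ι) :
    delta x (σ.cone b) = x σ - delta (fun τ => x (τ.cone b)) σ := by
  unfold delta
  rw [Fin.sum_univ_succ, sub_eq_add_neg, ← Finset.sum_neg_distrib]
  congr 1
  · rw [Fin.val_zero, pow_zero, one_smul, IdxSimplex.cone_face_zero]
  · refine Finset.sum_congr rfl fun i _ => ?_
    rw [IdxSimplex.cone_face_succ, Fin.val_succ, pow_succ, mul_neg_one, neg_smul]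

/-- Families which vanish on degenerate simplices. -/
def Normalized (x : IdxFam ι m q A) : Prop := ∀ σ : IdxSimplex ι m q, σ.Degenerate → x σ = 0

lemma Normalized.map {B : Type} [AddCommGroup B] {x : IdxFam ι m q A} (hx : Normalized x)
    (f : A →+ B) : Normalized fun σ => f (x σ) :=
  fun σ hσ => (congrArg f (hx σ hσ)).trans f.map_zero

lemma Normalized.delta {x : IdxFam ι m q A} (hx : Normalized x) : Normalized (delta x) := by
  rintro σ ⟨i, h⟩
  refine alternating_sum_degenerate (fun j => x (σ.face j)) i (congrArg x h.face_eq)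
    fun j h1 h2 => hx _ ?_
  cases q with
  | zero =>
    exfalso
    obtain rfl : i = 0 := Subsingleton.elim (α := Fin 1) _ _
    fin_cases j <;> simp_all
  | succ q => exact h.exists_face h1 h2

end IdxFam

variable {N N' : Type} {ι ι' : Type} {m m' q r : ℕ}

/-- The intersection of the open sets indexed by the vertices of a simplex. -/
def interSet (W : ι → Set N) (a : Fin (q + 1) → ι) : Set N := {x | ∀ i, x ∈ W (a i)}

lemma interSet_face (W : ι → Set N) (σ : IdxSimplex ι m (q + 1)) (i : Fin (q + 2)) :
    interSet W σ.1 ⊆ interSet W (σ.face i).1 := fun _ hx j => hx (i.succAbove j)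

lemma isOpen_interSet [TopologicalSpace N] {W : ι → Set N} (hW : ∀ a, IsOpen (W a))
    (a : Fin (q + 1) → ι) : IsOpen (interSet W a) := by
  have : interSet W a = ⋂ i, W (a i) := by ext; simp [interSet]
  rw [this]
  exact isOpen_iInter_of_finite fun i => hW _

/-- The germs of functions of `r + 1` points on the `(q + 1)`-fold intersections. -/
abbrev GermFam (N ι : Type) (m q r : ℕ) : Type := IdxFam ι m q ((Fin (r + 1) → N) → ℤ)

/-- The normalized families, if `nrm` holds. -/
def GermFam.sub (N ι : Type) (nrm : Prop) (m q r : ℕ) : AddSubgroup (GermFam N ι m q r) where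
  -- The proposition `nrm` is a switch: gerbes involve normalized cochains, the Čech cohomology of a
  -- covering all of them, and one double complex serves both.
  carrier := {x | nrm → IdxFam.Normalized x}
  add_mem' := fun {a b} ha hb h σ hσ => by rw [Pi.add_apply, ha h σ hσ, hb h σ hσ, add_zero]
  zero_mem' := fun _ _ _ => rfl
  neg_mem' := fun {a} ha h σ hσ => by rw [Pi.neg_apply, ha h σ hσ, neg_zero]

variable [TopologicalSpace N] [TopologicalSpace N']

/-- The families of vanishing germs. -/
def GermFam.null (W : ι → Set N) (nrm : Prop) (m q r : ℕ) :
    AddSubgroup (GermFam.sub N ι nrm m q r) where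
  carrier := {x | ∀ σ, VanOn (interSet W σ.1) (x.1 σ)}
  add_mem' := by
    intro a b ha hb σ
    exact VanOn.add (ha σ) (hb σ)
  zero_mem' := fun _ => VanOn.zero _
  neg_mem' := by
    intro a ha σ
    exact VanOn.neg (ha σ)

lemma VanOn.smul {U : Set N} {f : (Fin (r + 1) → N) → ℤ} (hf : VanOn U f) (n : ℤ) :
    VanOn U (n • f) := fun x hx => by
  filter_upwards [hf x hx] with t h1
  rw [Pi.smul_apply, h1, smul_zero]

lemma VanOn.sum {U : Set N} {κ : Type} {s : Finset κ} {f : κ → (Fin (r + 1) → N) → ℤ}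
    (hf : ∀ i ∈ s, VanOn U (f i)) : VanOn U (∑ i ∈ s, f i) := by
  classical
  induction s using Finset.induction_on with
  | empty => exact VanOn.zero U
  | insert i s hi ih =>
    rw [Finset.sum_insert hi]
    exact (hf i (by simp)).add (ih fun j hj => hf j (by simp [hj]))

lemma VanOn.idxDelta {W : ι → Set N} {x : GermFam N ι m q r}
    (hx : ∀ σ, VanOn (interSet W σ.1) (x σ)) (σ : IdxSimplex ι m (q + 1)) :
    VanOn (interSet W σ.1) (IdxFam.delta x σ) :=
  VanOn.sum fun i _ => ((hx _).mono (interSet_face W σ i)).smul _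

/-- `pointDelta` as a homomorphism. -/
def pointDeltaHom (N : Type) (r : ℕ) : ((Fin (r + 1) → N) → ℤ) →+ ((Fin (r + 2) → N) → ℤ) :=
  AddMonoidHom.mk' pointDelta pointDelta_add

/-- The double complex of an open covering, with coefficients in germs of functions of several
points. -/
def leray (W : ι → Set N) (hW : ∀ a, IsOpen (W a)) (nrm : Prop) (m : ℕ) : DoubleComplex where
  obj q r := GermFam.sub N ι nrm m q r ⧸ GermFam.null W nrm m q r
  dh {q r} := QuotientAddGroup.map _ _ (AddMonoidHom.mk'
    (fun x => ⟨IdxFam.delta x.1, fun h => (x.2 h).delta⟩ : GermFam.sub N ι nrm m q r →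
      GermFam.sub N ι nrm m (q + 1) r) fun x y => Subtype.ext (IdxFam.delta_add x.1 y.1))
    fun x hx => VanOn.idxDelta hx
  dv {q r} := QuotientAddGroup.map _ _ (AddMonoidHom.mk'
    (fun x => ⟨fun σ => pointDelta (x.1 σ), fun h => (x.2 h).map (pointDeltaHom N r)⟩ : GermFam.sub N ι nrm m q r →
      GermFam.sub N ι nrm m q (r + 1)) fun x y => Subtype.ext (funext fun σ =>
        pointDelta_add (x.1 σ) (y.1 σ)))
    fun x hx σ => (hx σ).pointDelta (isOpen_interSet hW _)
  dh_dh {q r} x := by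
    induction x using QuotientAddGroup.induction_on with
    | H x => exact congrArg QuotientAddGroup.mk (Subtype.ext (IdxFam.delta_delta x.1))
  dv_dv {q r} x := by
    induction x using QuotientAddGroup.induction_on with
    | H x => exact congrArg QuotientAddGroup.mk (Subtype.ext (funext fun σ =>
        pointDelta_pointDelta (x.1 σ)))
  dv_dh {q r} x := by
    induction x using QuotientAddGroup.induction_on with
    | H x => exact congrArg QuotientAddGroup.mk (Subtype.ext (funext fun σ =>
        IdxFam.map_delta (pointDeltaHom N r) x.1 σ))

section

variable {W : ι → Set N} {hW : ∀ a, IsOpen (W a)} {nrm : Prop}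

/-- The class of a family in the double complex. -/
def leray.mk (W : ι → Set N) (hW : ∀ a, IsOpen (W a)) {nrm : Prop} (x : GermFam N ι m q r)
    (hx : nrm → IdxFam.Normalized x) : (leray W hW nrm m).obj q r :=
  QuotientAddGroup.mk (⟨x, hx⟩ : GermFam.sub N ι nrm m q r)

lemma leray.exists_mk (x : (leray W hW nrm m).obj q r) : ∃ y hy, leray.mk W hW y hy = x := by
  obtain ⟨y, rfl⟩ := QuotientAddGroup.mk_surjective x
  exact ⟨y.1, y.2, rfl⟩

lemma leray.mk_eq_iff {x y : GermFam N ι m q r} {hx : nrm → IdxFam.Normalized x}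
    {hy : nrm → IdxFam.Normalized y} : leray.mk W hW x hx = leray.mk W hW y hy ↔
      ∀ σ, VanOn (interSet W σ.1) (x σ - y σ) := by
  refine QuotientAddGroup.eq.trans ⟨fun h σ => ?_, fun h σ => ?_⟩
  · have := (h σ).neg
    refine this.congr fun t _ => ?_
    change -(-x σ t + y σ t) = x σ t - y σ t
    ring
  · refine (h σ).neg.congr fun t _ => ?_
    change -(x σ t - y σ t) = -x σ t + y σ t
    ring

lemma leray.mk_eq_zero_iff {x : GermFam N ι m q r} {hx : nrm → IdxFam.Normalized x} :
    leray.mk W hW x hx = 0 ↔ ∀ σ, VanOn (interSet W σ.1) (x σ) :=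
  QuotientAddGroup.eq_zero_iff _

lemma leray.dh_mk {x : GermFam N ι m q r} {hx : nrm → IdxFam.Normalized x} :
    (leray W hW nrm m).dh (leray.mk W hW x hx) =
      leray.mk W hW (IdxFam.delta x) fun h => (hx h).delta := rfl

lemma leray.dv_mk {x : GermFam N ι m q r} {hx : nrm → IdxFam.Normalized x} :
    (leray W hW nrm m).dv (leray.mk W hW x hx) =
      leray.mk W hW (r := r + 1) (fun σ => pointDelta (x σ))
        fun h => (hx h).map (pointDeltaHom N r) := rfl

open Classical in
lemma leray.rowExact (hc : ∀ x, ∃ a, x ∈ W a) : (leray W hW nrm m).RowExact := by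
  intro q r y hy
  obtain ⟨z, hz, rfl⟩ := leray.exists_mk y
  rw [leray.dh_mk, leray.mk_eq_zero_iff] at hy
  choose b hb using hc
  refine ⟨leray.mk W hW (fun σ t => z (σ.cone (b (t 0))) t) fun h σ hσ => funext fun t =>
    congrFun (hz h _ (hσ.cone _)) t, leray.mk_eq_iff.2 fun σ x hx => ?_⟩
  have := hy (σ.cone (b x)) x fun i => by
    induction i using Fin.cases with
    | zero => exact hb x
    | succ i => exact hx i
  filter_upwards [this, eventually_nearFilter_head x] with t ht h0
  rw [IdxFam.delta_cone, Pi.sub_apply] at ht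
  have e : IdxFam.delta (fun (τ : IdxSimplex ι m q) t => z (τ.cone (b (t 0))) t) σ t =
      IdxFam.delta (fun τ => z (τ.cone (b x))) σ t := by
    simp only [IdxFam.delta, Finset.sum_apply, Pi.smul_apply, h0]
  rw [Pi.sub_apply, e]
  linarith

-- A column is made of the germ complexes of single intersections, which are acyclic by hypothesis.
-- Taking the primitive zero on degenerate simplices preserves normalization.
open Classical in
lemma leray.colExact (hg : ∀ q (a : Fin (q + 1) → ι) r, ExactOn (interSet W a) r) :
    (leray W hW nrm m).ColExact := by
  intro q r y hy
  obtain ⟨z, hz, rfl⟩ := leray.exists_mk y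
  replace hy := leray.mk_eq_zero_iff.1 (leray.dv_mk.symm.trans hy)
  choose g hg using fun σ : IdxSimplex ι m q => hg q σ.1 r (z σ) (hy σ)
  refine ⟨leray.mk W hW (fun σ => if nrm ∧ σ.Degenerate then 0 else g σ)
    fun h σ hσ => if_pos ⟨h, hσ⟩, leray.mk_eq_iff.2 fun σ => ?_⟩
  change VanOn _ (pointDelta (if nrm ∧ σ.Degenerate then 0 else g σ) - z σ)
  split_ifs with h
  · rw [hz h.1 σ h.2, show pointDelta (0 : (Fin (r + 1) → N) → ℤ) = 0 from
      (pointDeltaHom N r).map_zero, sub_zero]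
    exact VanOn.zero _
  · refine (hg σ).neg.congr fun t _ => ?_
    simp

end

end Leray

end HigherGerbe

namespace HigherGerbe

/-! ### Cohomology with germs of functions of several points -/

section

variable {N ι : Type} {m q r : ℕ}

/-- A family of functions as a family of functions of one point. -/
def atHead (z : IdxFam ι m q (N → ℤ)) : GermFam N ι m q 0 := fun σ t => z σ (t 0)

lemma IdxFam.Normalized.atHead {z : IdxFam ι m q (N → ℤ)} (h : z.Normalized) :
    IdxFam.Normalized (atHead z) := fun σ hσ => funext fun t => congrFun (h σ hσ) (t 0)

/-- Constant families of functions on the vertices. -/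
def augFam (ι : Type) (m : ℕ) (e : (Fin (r + 1) → N) → ℤ) : GermFam N ι m 0 r := fun _ => e

lemma augFam_normalized (e : (Fin (r + 1) → N) → ℤ) : IdxFam.Normalized (augFam ι m e) :=
  fun _ h => h.elim

lemma atHead_delta (z : IdxFam ι m q (N → ℤ)) : IdxFam.delta (atHead z) = atHead (IdxFam.delta z) := by
  funext σ t
  simp [IdxFam.delta, atHead]

end

section Godement

open Simplicial Topology TopologicalSpace

variable {N N' N'' : Type} [TopologicalSpace N] [TopologicalSpace N'] [TopologicalSpace N'']
  {q r : ℕ}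

lemma tendsto_nearFilter {f : N' → N} (hf : Continuous f) (r : ℕ) (x : N') :
    Filter.Tendsto (f ∘ · : (Fin (r + 1) → N') → _) (nearFilter r x) (nearFilter r (f x)) := by
  induction r generalizing x with
  | zero =>
    intro P hP
    exact hP
  | succ r ih =>
    intro P hP
    change ∀ᶠ t in nearFilter (r + 1) x, f ∘ t ∈ P
    rw [eventually_nearFilter_succ]
    have : ∀ᶠ y in 𝓝 (f x), ∀ᶠ t in nearFilter r y, Fin.cons (f x) t ∈ P := hP
    filter_upwards [hf.continuousAt.eventually this] with y hy
    filter_upwards [(ih y).eventually hy] with t ht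
    rwa [show f ∘ (Fin.cons x t : Fin (r + 2) → N') = Fin.cons (f x) (f ∘ t) from
      funext fun i => by induction i using Fin.cases <;> rfl]

lemma VanOn.comp {f : N' → N} (hf : Continuous f) {U : Set N} {V : Set N'}
    (h : ∀ y ∈ V, f y ∈ U) {e : (Fin (r + 1) → N) → ℤ} (he : VanOn U e) :
    VanOn V fun t => e (f ∘ t) :=
  fun y hy => (tendsto_nearFilter hf r y).eventually (he _ (h y hy))

/-- Functions with closed germs. -/
def godClosed (N : Type) [TopologicalSpace N] (r : ℕ) : AddSubgroup ((Fin (r + 1) → N) → ℤ) where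
  carrier := {e | VanOn Set.univ (pointDelta e)}
  add_mem' := fun {a b} ha hb => by
    change VanOn _ _
    rw [pointDelta_add]
    exact VanOn.add ha hb
  zero_mem' := by
    change VanOn _ (pointDeltaHom N r 0)
    rw [map_zero]
    exact VanOn.zero _
  neg_mem' := fun {a} ha => by
    change VanOn _ (pointDeltaHom N r (-a))
    rw [map_neg]
    exact VanOn.neg ha

/-- Functions with exact germs. -/
def godExact (N : Type) [TopologicalSpace N] (r : ℕ) : AddSubgroup (godClosed N (r + 1)) where
  carrier := {e | ∃ u, VanOn Set.univ (e.1 - pointDelta u)}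
  add_mem' := by
    rintro a b ⟨u, hu⟩ ⟨v, hv⟩
    refine ⟨u + v, (hu.add hv).congr fun t _ => ?_⟩
    rw [pointDelta_add]
    change a.1 t - pointDelta u t + (b.1 t - pointDelta v t) =
      a.1 t + b.1 t - (pointDelta u t + pointDelta v t)
    ring
  zero_mem' := ⟨0, by
    rw [show pointDelta (0 : (Fin (r + 1) → N) → ℤ) = 0 from (pointDeltaHom N r).map_zero, sub_zero]
    exact VanOn.zero _⟩
  neg_mem' := by
    rintro a ⟨u, hu⟩
    refine ⟨-u, hu.neg.congr fun t _ => ?_⟩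
    rw [show pointDelta (-u) = -pointDelta u from (pointDeltaHom N r).map_neg u]
    change -(a.1 t - pointDelta u t) = -a.1 t - -pointDelta u t
    ring

/-- The cohomology of the complex of germs of functions of several points, in degree `q + 1`. -/
abbrev GodCoh (N : Type) [TopologicalSpace N] (q : ℕ) : Type := godClosed N (q + 1) ⧸ godExact N q

/-- Pullback of closed functions. -/
def godClosed.comap (f : C(N', N)) (r : ℕ) : godClosed N r →+ godClosed N' r :=
  AddMonoidHom.mk' (fun e => ⟨fun t => e.1 (f ∘ t),
    VanOn.comp f.continuous (U := Set.univ) (V := Set.univ) (fun _ _ => trivial)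
      (show VanOn Set.univ (pointDelta e.1) from e.2)⟩) fun _ _ => rfl

/-- Pullback of cohomology classes. -/
def GodCoh.map (f : C(N', N)) (q : ℕ) : GodCoh N q →+ GodCoh N' q :=
  QuotientAddGroup.map _ _ (godClosed.comap f (q + 1)) (by
    rintro e ⟨u, hu⟩
    exact ⟨fun t => u (f ∘ t), VanOn.comp f.continuous (U := Set.univ) (fun _ _ => trivial) hu⟩)

lemma GodCoh.map_id (ξ : GodCoh N q) : GodCoh.map (ContinuousMap.id N) q ξ = ξ := by
  induction ξ using QuotientAddGroup.induction_on with
  | H e => rfl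

lemma GodCoh.map_comp (g : C(N', N)) (f : C(N'', N')) (ξ : GodCoh N q) :
    GodCoh.map (g.comp f) q ξ = GodCoh.map f q (GodCoh.map g q ξ) := by
  induction ξ using QuotientAddGroup.induction_on with
  | H e => rfl

variable {ι ι' : Type} {m m' : ℕ} {W : ι → Set N} {nrm : Prop}

/-- The functions are locally constant on the intersections. -/
def LocConst (W : ι → Set N) (z : IdxFam ι m q (N → ℤ)) : Prop :=
  ∀ σ, ∀ x ∈ interSet W σ.1, ∀ᶠ y in 𝓝 x, z σ y = z σ x

/-- The families agree on the intersections. -/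
def AgreeOn (W : ι → Set N) (z z' : IdxFam ι m q (N → ℤ)) : Prop :=
  ∀ σ, ∀ x ∈ interSet W σ.1, z σ x = z' σ x

lemma leray.mk_atHead_eq_iff {hW : ∀ a, IsOpen (W a)} {z z' : IdxFam ι m q (N → ℤ)} {hz}
    {hz'} : leray.mk W hW (nrm := nrm) (atHead z) hz = leray.mk W hW (atHead z') hz' ↔
      AgreeOn W z z' := by
  rw [leray.mk_eq_iff]
  refine forall_congr' fun σ => forall₂_congr fun x hx => ?_
  rw [eventually_nearFilter_zero]
  exact sub_eq_zero

lemma leray.dv_mk_atHead_eq_zero_iff {hW : ∀ a, IsOpen (W a)} {z : IdxFam ι m q (N → ℤ)} {hz} :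
    (leray W hW nrm m).dv (leray.mk W hW (atHead z) hz) = 0 ↔ LocConst W z := by
  rw [leray.dv_mk]
  refine leray.mk_eq_zero_iff.trans (forall_congr' fun σ => ?_)
  exact vanOn_pointDelta_zero_iff

lemma leray.exists_atHead {hW : ∀ a, IsOpen (W a)} (x : (leray W hW nrm m).obj q 0) :
    ∃ z : IdxFam ι m q (N → ℤ), ∃ hz : nrm → z.Normalized,
      leray.mk W hW (atHead z) (fun h => (hz h).atHead) = x := by
  obtain ⟨y, hy, rfl⟩ := leray.exists_mk x
  refine ⟨fun σ x => y σ fun _ => x, fun h σ hσ => funext fun x => congrFun (hy h σ hσ) _, ?_⟩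
  congr 1
  funext σ t
  exact congrArg (y σ) (funext fun i => congrArg t (Subsingleton.elim (α := Fin 1) _ _))

lemma leray.mk_augFam_eq_zero_iff {hW : ∀ a, IsOpen (W a)} (hc : ∀ x, ∃ a, x ∈ W a)
    {e : (Fin (r + 1) → N) → ℤ} {h} :
    leray.mk W hW (nrm := nrm) (augFam ι m e) h = 0 ↔ VanOn Set.univ e := by
  rw [leray.mk_eq_zero_iff]
  constructor
  · intro h x _
    obtain ⟨a, ha⟩ := hc x
    exact h (fun _ => a, SimplexCategory.const _ _ 0) x fun _ => ha
  · exact fun h σ => h.mono (Set.subset_univ _)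

lemma leray.dh_augFam {hW : ∀ a, IsOpen (W a)} {e : (Fin (r + 1) → N) → ℤ} {h} :
    (leray W hW nrm m).dh (leray.mk W hW (augFam ι m e) h) = 0 := by
  rw [leray.dh_mk, leray.mk_eq_zero_iff]
  intro σ
  have : IdxFam.delta (augFam ι m e) σ = 0 := by
    simp [IdxFam.delta, augFam, Fin.sum_univ_two]
  rw [this]
  exact VanOn.zero _

/-- A family whose germs agree on overlaps comes from one function: at a tuple, use any patch that
contains its first point. -/
lemma leray.exists_augFam {hW : ∀ a, IsOpen (W a)} (hc : ∀ x, ∃ a, x ∈ W a)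
    (y : (leray W hW nrm m).obj 0 r) (hy : (leray W hW nrm m).dh y = 0) :
    ∃ e : (Fin (r + 1) → N) → ℤ, leray.mk W hW (augFam ι m e) (fun _ => augFam_normalized e) = y := by
  obtain ⟨z, hz, rfl⟩ := leray.exists_mk y
  rw [leray.dh_mk, leray.mk_eq_zero_iff] at hy
  choose b hb using hc
  refine ⟨fun t => z (fun _ => b (t 0), SimplexCategory.const _ _ 0) t, leray.mk_eq_iff.2 ?_⟩
  intro σ x hx
  have := hy (σ.cone (b x)) x fun i => by
    induction i using Fin.cases with
    | zero => exact hb x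
    | succ i => exact hx i
  filter_upwards [this, eventually_nearFilter_head x] with t ht h0
  have h1 : (σ.cone (b x)).face 1 = (fun _ => b x, SimplexCategory.const _ _ 0) :=
    Prod.ext (funext fun i => by obtain rfl : i = 0 := Subsingleton.elim (α := Fin 1) _ _; rfl)
      (SimplexCategory.Hom.ext _ _ (OrderHom.ext _ _ (funext fun i => by
        obtain rfl : i = 0 := Subsingleton.elim (α := Fin 1) _ _; rfl)))
  have h2 : IdxFam.delta z (σ.cone (b x)) t = z σ t -
      z (fun _ => b x, SimplexCategory.const _ _ 0) t := by
    unfold IdxFam.delta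
    rw [Fin.sum_univ_two, IdxSimplex.cone_face_zero, h1]
    simp [sub_eq_add_neg]
  rw [h2] at ht
  change z (fun _ => b (t 0), SimplexCategory.const _ _ 0) t - z σ t = 0
  rw [h0]
  linarith

/-- The cocycle `z` of the covering represents the class `ξ`. -/
def Represents (W : ι → Set N) (hW : ∀ a, IsOpen (W a)) (nrm : Prop) (z : IdxFam ι m (q + 1) (N → ℤ))
    (ξ : GodCoh N q) : Prop :=
  ∃ (hz : nrm → z.Normalized) (e : godClosed N (q + 1)), QuotientAddGroup.mk e = ξ ∧
    DoubleComplex.Link (q + 1) (leray W hW nrm m)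
      (leray.mk W hW (atHead z) fun h => (hz h).atHead)
      (leray.mk W hW (augFam ι m e.1) fun _ => augFam_normalized e.1)

variable {hW : ∀ a, IsOpen (W a)}

/-- Climbing the staircase needs exact rows only, so cocycles of arbitrary open coverings have
classes. -/
lemma exists_represents (hc : ∀ x, ∃ a, x ∈ W a) {z : IdxFam ι m (q + 1) (N → ℤ)}
    (hn : nrm → z.Normalized) (hl : LocConst W z) (hd : AgreeOn W (IdxFam.delta z) 0) :
    ∃ ξ, Represents W hW nrm z ξ := by
  obtain ⟨y, hy, h1, h2⟩ := (leray.rowExact (hW := hW) (nrm := nrm) (m := m) hc).exists_link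
    (leray.mk W hW (atHead z) fun h => (hn h).atHead)
    (by
      rw [leray.dh_mk]
      simp only [atHead_delta]
      exact leray.mk_atHead_eq_iff.2 hd)
    (leray.dv_mk_atHead_eq_zero_iff.2 hl)
  obtain ⟨e, rfl⟩ := leray.exists_augFam hc y h1
  have he : VanOn Set.univ (pointDelta e) :=
    (leray.mk_augFam_eq_zero_iff hc (h := fun _ => augFam_normalized _)).1 h2
  exact ⟨_, hn, ⟨e, he⟩, rfl, hy⟩

lemma Represents.congr {z z' : IdxFam ι m (q + 1) (N → ℤ)} {ξ : GodCoh N q}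
    (h : Represents W hW nrm z ξ) (hz : nrm → z'.Normalized) (ha : AgreeOn W z z') :
    Represents W hW nrm z' ξ := by
  obtain ⟨hn, e, he, hl⟩ := h
  refine ⟨hz, e, he, ?_⟩
  rwa [← leray.mk_atHead_eq_iff.2 ha]

lemma Represents.sub {z z' : IdxFam ι m (q + 1) (N → ℤ)} {ξ ξ' : GodCoh N q}
    (h : Represents W hW nrm z ξ) (h' : Represents W hW nrm z' ξ') :
    Represents W hW nrm (z - z') (ξ - ξ') := by
  obtain ⟨hn, e, rfl, hl⟩ := h
  obtain ⟨hn', e', rfl, hl'⟩ := h'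
  exact ⟨fun h σ hσ => by rw [Pi.sub_apply, hn h σ hσ, hn' h σ hσ, sub_zero], e - e', rfl,
    hl.sub hl'⟩

lemma Represents.add {z z' : IdxFam ι m (q + 1) (N → ℤ)} {ξ ξ' : GodCoh N q}
    (h : Represents W hW nrm z ξ) (h' : Represents W hW nrm z' ξ') :
    Represents W hW nrm (z + z') (ξ + ξ') := by
  obtain ⟨hn, e, rfl, hl⟩ := h
  obtain ⟨hn', e', rfl, hl'⟩ := h'
  exact ⟨fun h σ hσ => by rw [Pi.add_apply, hn h σ hσ, hn' h σ hσ, add_zero], e + e', rfl,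
    hl.add hl'⟩

/-- A coboundary in the bottom row forces an exact germ in the left column, by
`RowExact.exists_dv_eq`. -/
lemma Represents.eq_zero (hc : ∀ x, ∃ a, x ∈ W a) {z : IdxFam ι m (q + 1) (N → ℤ)}
    {ξ : GodCoh N q} (h : Represents W hW nrm z ξ) {w : IdxFam ι m q (N → ℤ)}
    (hn : nrm → w.Normalized) (hl : LocConst W w) (ha : AgreeOn W (IdxFam.delta w) z) : ξ = 0 := by
  obtain ⟨hz, e, rfl, he⟩ := h
  have h1 : leray.mk W hW (nrm := nrm) (atHead z) (fun h => (hz h).atHead) =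
      (leray W hW nrm m).dh (leray.mk W hW (atHead w) fun h => (hn h).atHead) := by
    rw [leray.dh_mk]
    simp only [atHead_delta]
    exact (leray.mk_atHead_eq_iff.2 ha).symm
  rw [h1] at he
  obtain ⟨u, hu, hu'⟩ := (leray.rowExact hc).exists_dv_eq he (leray.dv_mk_atHead_eq_zero_iff.2 hl)
  obtain ⟨u, rfl⟩ := leray.exists_augFam hc u hu
  refine (QuotientAddGroup.eq_zero_iff _).2 ⟨u, ?_⟩
  have h3 := sub_eq_zero.2 hu'.symm
  exact (leray.mk_augFam_eq_zero_iff hc (e := e.1 - pointDelta u)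
    (h := fun _ => augFam_normalized _)).1 h3

lemma Represents.unique (hc : ∀ x, ∃ a, x ∈ W a) {z : IdxFam ι m (q + 1) (N → ℤ)}
    {ξ ξ' : GodCoh N q} (h : Represents W hW nrm z ξ) (h' : Represents W hW nrm z ξ') : ξ = ξ' := by
  refine sub_eq_zero.1 ((h.sub h').eq_zero hc (w := 0) (fun _ _ _ => rfl)
    (fun _ _ _ => Filter.Eventually.of_forall fun _ => rfl) fun σ x _ => ?_)
  rw [sub_self]
  simp [IdxFam.delta]

/-- All intersections of the open sets are acyclic. -/
def IsGood (W : ι → Set N) : Prop := ∀ q (a : Fin (q + 1) → ι) r, ExactOn (interSet W a) r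

/-- Descending from the left column to the bottom row needs exact columns, that is, acyclic
intersections. Together with `IsGood.exists_primitive` this makes the comparison bijective for good
coverings. -/
lemma IsGood.exists_represents (hg : IsGood W) (ξ : GodCoh N q) (m : ℕ) :
    ∃ z : IdxFam ι m (q + 1) (N → ℤ), Represents W hW nrm z ξ ∧ LocConst W z ∧
      AgreeOn W (IdxFam.delta z) 0 := by
  induction ξ using QuotientAddGroup.induction_on with
  | H e =>
  have he : (leray W hW nrm m).dv (leray.mk W hW (augFam ι m e.1)
      fun _ => augFam_normalized e.1) = 0 := by
    rw [leray.dv_mk]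
    refine leray.mk_eq_zero_iff.2 fun σ => ?_
    exact VanOn.mono (U := Set.univ) e.2 (Set.subset_univ _)
  obtain ⟨z, hz, h1, h2⟩ := (leray.colExact (hW := hW) (nrm := nrm) (m := m) hg).exists_link
    (leray.mk W hW (augFam ι m e.1) fun _ => augFam_normalized e.1) leray.dh_augFam he
  obtain ⟨z, hn, rfl⟩ := leray.exists_atHead z
  refine ⟨z, ⟨hn, e, rfl, hz⟩, leray.dv_mk_atHead_eq_zero_iff.1 h2, ?_⟩
  rw [leray.dh_mk] at h1
  simp only [atHead_delta] at h1
  exact leray.mk_atHead_eq_iff.1 h1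

lemma IsGood.exists_primitive (hg : IsGood W) {z : IdxFam ι m (q + 1) (N → ℤ)}
    (h : Represents W hW nrm z 0) : ∃ w : IdxFam ι m q (N → ℤ), (nrm → w.Normalized) ∧
      LocConst W w ∧ AgreeOn W (IdxFam.delta w) z := by
  obtain ⟨hn, e, he, hl⟩ := h
  obtain ⟨u, hu⟩ := (QuotientAddGroup.eq_zero_iff _).1 he
  have h1 : leray.mk W hW (nrm := nrm) (augFam ι m e.1) (fun _ => augFam_normalized e.1) =
      (leray W hW nrm m).dv (leray.mk W hW (augFam ι m u) fun _ => augFam_normalized u) := by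
    rw [leray.dv_mk]
    exact leray.mk_eq_iff.2 fun σ => hu.mono (Set.subset_univ _)
  rw [h1] at hl
  obtain ⟨w, hw, hw'⟩ := (leray.colExact hg).exists_dh_eq hl leray.dh_augFam
  obtain ⟨w, hwn, rfl⟩ := leray.exists_atHead w
  refine ⟨w, hwn, leray.dv_mk_atHead_eq_zero_iff.1 hw', ?_⟩
  rw [leray.dh_mk] at hw
  simp only [atHead_delta] at hw
  exact leray.mk_atHead_eq_iff.1 hw

/-- Pullback of families of functions. -/
def pullFam (f : N' → N) (l : ι' → ι) (η : ⦋m'⦌ ⟶ ⦋m⦌) (z : IdxFam ι m q (N → ℤ)) :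
    IdxFam ι' m' q (N' → ℤ) := fun σ y => z (σ.map l η) (f y)

/-- The map of double complexes induced by a map of coverings. -/
def leray.map {W' : ι' → Set N'} (hW : ∀ a, IsOpen (W a)) (hW' : ∀ a, IsOpen (W' a))
    {nrm' : Prop} (hnrm : nrm' → nrm) (f : C(N', N)) (l : ι' → ι) (η : ⦋m'⦌ ⟶ ⦋m⦌)
    (h : ∀ a, ∀ y ∈ W' a, f y ∈ W (l a)) :
    DoubleComplex.Map (leray W hW nrm m) (leray W' hW' nrm' m') where
  app {q r} := QuotientAddGroup.map _ _ (AddMonoidHom.mk'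
    (fun x => ⟨fun σ t => x.1 (σ.map l η) (f ∘ t), fun hn σ hσ => funext fun t =>
      congrFun (x.2 (hnrm hn) _ (hσ.map l η)) _⟩ : GermFam.sub N ι nrm m q r →
      GermFam.sub N' ι' nrm' m' q r) fun x y => rfl)
    fun x hx σ => VanOn.comp f.continuous (U := interSet W (σ.map l η).1) (V := interSet W' σ.1)
      (fun y hy i => h _ y (hy i)) (hx (σ.map l η))
  dh {q r} x := by
    induction x using QuotientAddGroup.induction_on with
    | H x =>
      refine congrArg QuotientAddGroup.mk (Subtype.ext (funext fun σ => funext fun t => ?_))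
      simp only [AddMonoidHom.mk'_apply, IdxFam.delta, Finset.sum_apply, Pi.smul_apply]
      rfl
  dv {q r} x := by
    induction x using QuotientAddGroup.induction_on with
    | H x => rfl

lemma Represents.map {W' : ι' → Set N'} {hW' : ∀ a, IsOpen (W' a)}
    {nrm' : Prop} (hnrm : nrm' → nrm) (f : C(N', N)) (l : ι' → ι) (η : ⦋m'⦌ ⟶ ⦋m⦌)
    (h : ∀ a, ∀ y ∈ W' a, f y ∈ W (l a)) {z : IdxFam ι m (q + 1) (N → ℤ)} {ξ : GodCoh N q}
    (hz : Represents W hW nrm z ξ) :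
    Represents W' hW' nrm' (pullFam f l η z) (GodCoh.map f q ξ) := by
  obtain ⟨hn, e, rfl, hl⟩ := hz
  refine ⟨fun hn' σ hσ => funext fun y => congrFun (hn (hnrm hn') _ (hσ.map l η)) _,
    godClosed.comap f _ e, rfl, ?_⟩
  exact hl.map (leray.map hW hW' hnrm f l η h)

end Godement

end HigherGerbe

namespace HigherGerbe

/-! ### Čech cohomology -/

section

variable {N : Type} {q : ℕ}

lemma AgreeOn.symm {ι : Type} {m : ℕ} {W : ι → Set N} {z z' : IdxFam ι m q (N → ℤ)}
    (h : AgreeOn W z z') : AgreeOn W z' z := fun σ x hx => (h σ x hx).symm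

lemma AgreeOn.trans {ι : Type} {m : ℕ} {W : ι → Set N} {z z' z'' : IdxFam ι m q (N → ℤ)}
    (h : AgreeOn W z z') (h' : AgreeOn W z' z'') : AgreeOn W z z'' :=
  fun σ x hx => (h σ x hx).trans (h' σ x hx)

lemma AgreeOn.delta {ι : Type} {m : ℕ} {W : ι → Set N} {z z' : IdxFam ι m q (N → ℤ)}
    (h : AgreeOn W z z') : AgreeOn W (IdxFam.delta z) (IdxFam.delta z') := fun σ x hx => by
  simp only [IdxFam.delta, Finset.sum_apply, Pi.smul_apply]
  exact Finset.sum_congr rfl fun i _ => by rw [h _ x (interSet_face W σ i hx)]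

end

section Cech

open Simplicial Topology TopologicalSpace

variable {N N' : Type} [TopologicalSpace N] [TopologicalSpace N'] {q : ℕ}

namespace OpenCover

/-- The underlying family of sets of an open covering. -/
def sets (W : OpenCover N) (a : W.ι) : Set N := W.U a

lemma isOpen_sets (W : OpenCover N) (a : W.ι) : IsOpen (W.sets a) := (W.U a).isOpen

open Classical in
/-- Extension of cochains by zero. -/
noncomputable def extFam (W : OpenCover N) (x : W.Cochain q) : IdxFam W.ι 0 q (N → ℤ) := fun σ y =>
  if h : ∀ i, y ∈ W.U (σ.1 i) then x σ.1 ⟨y, h⟩ else 0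

lemma extFam_apply (W : OpenCover N) (x : W.Cochain q) (σ : IdxSimplex W.ι 0 q) (y : N)
    (h : ∀ i, y ∈ W.U (σ.1 i)) : W.extFam x σ y = x σ.1 ⟨y, h⟩ := dif_pos h

lemma extFam_add (W : OpenCover N) (x y : W.Cochain q) :
    W.extFam (x + y) = W.extFam x + W.extFam y := by
  funext σ p
  by_cases h : ∀ i, p ∈ W.U (σ.1 i)
  · simp only [Pi.add_apply, extFam_apply _ _ _ _ h]
    rfl
  · simp [extFam, h]

lemma locConst_extFam (W : OpenCover N) (x : W.Cochain q) : LocConst W.sets (W.extFam x) := by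
  intro σ y hy
  have hy' : ∀ i, y ∈ W.U (σ.1 i) := hy
  have h1 : ∀ᶠ p in 𝓝 (⟨y, hy'⟩ : W.Inter σ.1), x σ.1 p = x σ.1 ⟨y, hy'⟩ :=
    (x σ.1).isLocallyConstant.eventually_eq _
  have h2 : ∀ᶠ p in 𝓝 y, ∀ i, p ∈ W.U (σ.1 i) :=
    (isOpen_interSet W.isOpen_sets σ.1).mem_nhds hy
  rw [← map_nhds_subtype_coe_eq_nhds hy' h2, Filter.eventually_map]
  filter_upwards [h1] with p hp
  rw [extFam_apply _ _ _ _ p.2, extFam_apply _ _ _ _ hy']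
  exact hp

lemma delta_apply (W : OpenCover N) (x : W.Cochain q) (a : Fin (q + 2) → W.ι) (p : W.Inter a) :
    W.delta q x a p = ∑ i : Fin (q + 2), (-1 : ℤ) ^ (i : ℕ) •
      x (a ∘ i.succAbove) (W.restrict a i.succAbove p) := by
  simp only [delta, AddMonoidHom.mk'_apply]
  rw [← LocallyConstant.evalAddMonoidHom_apply, map_sum]
  rfl

lemma delta_extFam (W : OpenCover N) (x : W.Cochain q) :
    AgreeOn W.sets (IdxFam.delta (W.extFam x)) (W.extFam (W.delta q x)) := by
  intro σ y hy
  rw [extFam_apply _ _ _ _ hy, delta_apply, IdxFam.delta, Finset.sum_apply]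
  refine Finset.sum_congr rfl fun i _ => ?_
  rw [Pi.smul_apply, extFam_apply _ _ _ _ (interSet_face W.sets σ i hy)]
  rfl

/-- Restriction of locally constant families to cochains. -/
def toCochain (W : OpenCover N) (z : IdxFam W.ι 0 q (N → ℤ)) (hz : LocConst W.sets z) :
    W.Cochain q := fun a => ⟨fun y => z (a, SimplexCategory.const _ _ 0) y.1, by
  refine (IsLocallyConstant.iff_eventually_eq _).2 fun y => ?_
  exact continuous_subtype_val.continuousAt.eventually
    (hz (a, SimplexCategory.const _ _ 0) y.1 fun i => y.2 i)⟩

lemma idxSimplex_zero_ext {ι : Type} (σ : IdxSimplex ι 0 q) :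
    (σ.1, SimplexCategory.const _ _ 0) = σ :=
  Prod.ext rfl (SimplexCategory.Hom.ext _ _ (OrderHom.ext _ _ (funext fun _ =>
    Subsingleton.elim (α := Fin 1) _ _)))

lemma extFam_toCochain (W : OpenCover N) (z : IdxFam W.ι 0 q (N → ℤ)) (hz : LocConst W.sets z) :
    AgreeOn W.sets (W.extFam (W.toCochain z hz)) z := by
  intro σ y hy
  rw [extFam_apply _ _ _ _ hy]
  change z (σ.1, SimplexCategory.const _ _ 0) y = z σ y
  rw [idxSimplex_zero_ext]

lemma eq_of_agreeOn {W : OpenCover N} {x y : W.Cochain q}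
    (h : AgreeOn W.sets (W.extFam x) (W.extFam y)) : x = y := by
  funext a
  ext p
  have := h (a, SimplexCategory.const _ _ 0) p.1 fun i => p.2 i
  rwa [extFam_apply _ _ _ _ p.2, extFam_apply _ _ _ _ p.2] at this

end OpenCover

namespace OpenCover

lemma extFam_zero (W : OpenCover N) : W.extFam (0 : W.Cochain q) = 0 := by
  funext σ p
  by_cases h : ∀ i, p ∈ W.U (σ.1 i)
  · rw [extFam_apply _ _ _ _ h]
    rfl
  · simp [extFam, h]

/-- The class of a cocycle on an open covering is represented by the cocycle. -/
def CocycleRepresents {W : OpenCover N} (x : W.Cocycle (q + 1)) (ξ : GodCoh N q) : Prop :=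
  Represents W.sets W.isOpen_sets False (W.extFam x.1) ξ

lemma exists_cocycleRepresents {W : OpenCover N} (x : W.Cocycle (q + 1)) :
    ∃ ξ, CocycleRepresents x ξ := by
  refine exists_represents W.cover (fun h => h.elim) (W.locConst_extFam x.1) ?_
  refine (W.delta_extFam x.1).trans ?_
  rw [show W.delta (q + 1) x.1 = 0 from x.2, extFam_zero]
  exact fun _ _ _ => rfl

lemma CocycleRepresents.add {W : OpenCover N} {x y : W.Cocycle (q + 1)} {ξ η : GodCoh N q}
    (hx : CocycleRepresents x ξ) (hy : CocycleRepresents y η) :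
    CocycleRepresents (x + y) (ξ + η) := by
  have := Represents.add hx hy
  rwa [← extFam_add] at this

lemma CocycleRepresents.unique {W : OpenCover N} {x : W.Cocycle (q + 1)} {ξ η : GodCoh N q}
    (hx : CocycleRepresents x ξ) (hy : CocycleRepresents x η) : ξ = η :=
  Represents.unique W.cover hx hy

lemma CocycleRepresents.eq_zero {W : OpenCover N} {x : W.Cocycle (q + 1)} {ξ : GodCoh N q}
    (hx : CocycleRepresents x ξ) {w : W.Cochain q} (hw : W.delta q w = x.1) : ξ = 0 := by
  refine Represents.eq_zero W.cover hx (w := W.extFam w) (fun h => h.elim) (W.locConst_extFam w) ?_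
  rw [← hw]
  exact W.delta_extFam w

/-- The homomorphism from the Čech cohomology of a covering. -/
noncomputable def toGodCoh (W : OpenCover N) (q : ℕ) : W.HSucc q →+ GodCoh N q :=
  QuotientAddGroup.lift _ (AddMonoidHom.mk' (fun x => (exists_cocycleRepresents x).choose)
    fun x y => (exists_cocycleRepresents (x + y)).choose_spec.unique
      ((exists_cocycleRepresents x).choose_spec.add (exists_cocycleRepresents y).choose_spec)) (by
    rintro x ⟨w, hw⟩
    exact (exists_cocycleRepresents x).choose_spec.eq_zero hw)

lemma CocycleRepresents.toGodCoh_eq {W : OpenCover N} {x : W.Cocycle (q + 1)} {ξ : GodCoh N q}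
    (hx : CocycleRepresents x ξ) : W.toGodCoh q (QuotientAddGroup.mk x) = ξ :=
  (exists_cocycleRepresents x).choose_spec.unique hx

lemma CocycleRepresents.map {W : OpenCover N} {W' : OpenCover N'} (f : Map W' W)
    {x : W.Cocycle (q + 1)} {ξ : GodCoh N q} (hx : CocycleRepresents x ξ) :
    CocycleRepresents (f.cocycle (q + 1) x) (GodCoh.map f.map q ξ) := by
  have := Represents.map (hW := W.isOpen_sets) (hW' := W'.isOpen_sets) (nrm := False)
    (nrm' := False) id f.map f.idx (𝟙 ⦋0⦌) f.mem hx
  refine this.congr (fun h => h.elim) fun σ y hy => ?_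
  rw [extFam_apply _ _ _ _ hy]
  exact W.extFam_apply _ _ _ fun i => f.mem _ _ (hy i)

lemma toGodCoh_coh {W : OpenCover N} {W' : OpenCover N'} (f : Map W' W) (x : W.HSucc q) :
    W'.toGodCoh q (f.coh q x) = GodCoh.map f.map q (W.toGodCoh q x) := by
  induction x using QuotientAddGroup.induction_on with
  | H x =>
    obtain ⟨ξ, hx⟩ := exists_cocycleRepresents x
    rw [hx.toGodCoh_eq]
    exact (hx.map f).toGodCoh_eq

lemma toGodCoh_injective {W : OpenCover N} (hW : IsGood W.sets) :
    Function.Injective (W.toGodCoh q) := by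
  refine (injective_iff_map_eq_zero _).2 fun x hx => ?_
  induction x using QuotientAddGroup.induction_on with
  | H x =>
    obtain ⟨ξ, h⟩ := exists_cocycleRepresents x
    obtain rfl : ξ = 0 := h.toGodCoh_eq.symm.trans hx
    obtain ⟨w, -, hl, ha⟩ := hW.exists_primitive h
    refine (QuotientAddGroup.eq_zero_iff _).2 ⟨W.toCochain w hl, ?_⟩
    exact eq_of_agreeOn ((W.delta_extFam _).symm.trans ((W.extFam_toCochain w hl).delta.trans ha))

lemma toGodCoh_surjective {W : OpenCover N} (hW : IsGood W.sets) :
    Function.Surjective (W.toGodCoh q) := by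
  intro ξ
  obtain ⟨z, hz, hl, hd⟩ := hW.exists_represents (hW := W.isOpen_sets) (nrm := False) ξ 0
  have h0 : W.delta (q + 1) (W.toCochain z hl) = 0 := by
    refine eq_of_agreeOn ((W.delta_extFam _).symm.trans ((W.extFam_toCochain z hl).delta.trans ?_))
    rw [extFam_zero]
    exact hd
  refine ⟨QuotientAddGroup.mk ⟨W.toCochain z hl, h0⟩, CocycleRepresents.toGodCoh_eq ?_⟩
  exact hz.congr (fun h => h.elim) (W.extFam_toCochain z hl).symm

end OpenCover

open Limits

variable (N q) in
/-- The cocone of the comparison maps of open coverings. -/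
noncomputable def cechCocone : Cocone (OpenCover.HSuccFunctor N q ⋙
    AddCommGrpCat.uliftFunctor.{1, 0}) where
  pt := AddCommGrpCat.uliftFunctor.{1, 0}.obj (AddCommGrpCat.of (GodCoh N q))
  ι :=
    { app := fun W => AddCommGrpCat.uliftFunctor.{1, 0}.map (AddCommGrpCat.ofHom (W.unop.toGodCoh q))
      naturality := fun W W' f => by
        refine AddCommGrpCat.hom_ext (AddMonoidHom.ext fun x => ULift.ext _ _ ?_)
        exact (OpenCover.toGodCoh_coh (OpenCover.Refine.toMap f.unop) x.down).trans
          (GodCoh.map_id _) }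

variable (N q) in
/-- The comparison of Čech cohomology with the cohomology of germs of functions of several
points. -/
noncomputable def cechToGod : cechHSucc N q →+ GodCoh N q :=
  AddMonoidHom.mk' (fun ξ => ((colimit.desc _ (cechCocone N q)).hom ξ).down) fun ξ η =>
    congrArg ULift.down ((colimit.desc _ (cechCocone N q)).hom.map_add ξ η)

lemma cechToGod_cechClass (W : OpenCover N) (x : W.Cocycle (q + 1)) :
    cechToGod N q (cechClass W x) = W.toGodCoh q (QuotientAddGroup.mk x) :=
  congrArg ULift.down (ConcreteCategory.congr_hom (colimit.ι_desc (cechCocone N q) (op W))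
    (ULift.up (QuotientAddGroup.mk x)))

lemma cechClass_refine {W W' : OpenCover N} (f : W' ⟶ W) (x : W.Cocycle (q + 1)) :
    cechClass W' ((OpenCover.Refine.toMap f).cocycle (q + 1) x) = cechClass W x :=
  ConcreteCategory.congr_hom (colimit.w
    (OpenCover.HSuccFunctor N q ⋙ AddCommGrpCat.uliftFunctor.{1, 0}) f.op)
    (ULift.up (QuotientAddGroup.mk x))

lemma cechClass_add (W : OpenCover N) (x y : W.Cocycle (q + 1)) :
    cechClass W (x + y) = cechClass W x + cechClass W y :=
  (colimit.ι (OpenCover.HSuccFunctor N q ⋙ AddCommGrpCat.uliftFunctor.{1, 0}) (op W)).hom.map_add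
    (ULift.up (QuotientAddGroup.mk x)) (ULift.up (QuotientAddGroup.mk y))

lemma cechClass_neg (W : OpenCover N) (x : W.Cocycle (q + 1)) :
    cechClass W (-x) = -cechClass W x :=
  (colimit.ι (OpenCover.HSuccFunctor N q ⋙ AddCommGrpCat.uliftFunctor.{1, 0}) (op W)).hom.map_neg
    (ULift.up (QuotientAddGroup.mk x))

lemma cechPullback_cechClass (f : C(N', N)) (W : OpenCover N) (x : W.Cocycle (q + 1)) :
    cechPullback f q (cechClass W x) =
      cechClass (W.preimage f) ((W.preimageMap f).cocycle (q + 1) x) := by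
  have h : colimit.ι (OpenCover.HSuccFunctor N q ⋙ AddCommGrpCat.uliftFunctor.{1, 0}) (op W) ≫
      cechPullback f q = (Functor.whiskerRight (OpenCover.preimageNatTrans f q)
        AddCommGrpCat.uliftFunctor.{1, 0}).app (op W) ≫
      colimit.ι (OpenCover.HSuccFunctor N' q ⋙ AddCommGrpCat.uliftFunctor.{1, 0})
        (op (W.preimage f)) := by
    refine (ι_colimMap_assoc _ _ _).trans ?_
    refine congrArg (fun t => (Functor.whiskerRight (OpenCover.preimageNatTrans f q)
      AddCommGrpCat.uliftFunctor.{1, 0}).app (op W) ≫ t) ?_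
    exact colimit.ι_pre (OpenCover.HSuccFunctor N' q ⋙ AddCommGrpCat.uliftFunctor.{1, 0})
      (OpenCover.preimageFunctor f).op (op W)
  exact ConcreteCategory.congr_hom h (ULift.up (QuotientAddGroup.mk x))

/-- The common refinement of two open coverings. -/
def OpenCover.inf (W W' : OpenCover N) : OpenCover N :=
  ⟨W.ι × W'.ι, fun a => W.U a.1 ⊓ W'.U a.2, fun y => by
    obtain ⟨a, ha⟩ := W.cover y
    obtain ⟨b, hb⟩ := W'.cover y
    exact ⟨(a, b), ha, hb⟩⟩

/-- The colimit is formed in abelian groups. Classes of cocycles form a subgroup, by common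
refinements; the projection to the quotient kills the contribution of every covering, hence is zero
by the universal property. -/
lemma exists_cechClass (ξ : cechHSucc N q) : ∃ (W : OpenCover N) (x : W.Cocycle (q + 1)),
    cechClass W x = ξ := by
  let W₀ : OpenCover N := ⟨Unit, fun _ => ⊤, fun _ => ⟨(), trivial⟩⟩
  have hz : ∀ W : OpenCover N, cechClass W (0 : W.Cocycle (q + 1)) = 0 := fun W =>
    (colimit.ι (OpenCover.HSuccFunctor N q ⋙ AddCommGrpCat.uliftFunctor.{1, 0}) (op W)).hom.map_zero
  let S : AddSubgroup (cechHSucc N q) :=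
    { carrier := {ξ | ∃ (W : OpenCover N) (x : W.Cocycle (q + 1)), cechClass W x = ξ}
      zero_mem' := ⟨W₀, 0, hz W₀⟩
      add_mem' := by
        rintro _ _ ⟨W, x, rfl⟩ ⟨W', x', rfl⟩
        have f : W.inf W' ⟶ W := (⟨Prod.fst, fun _ => inf_le_left⟩ : OpenCover.Refine _ _)
        have f' : W.inf W' ⟶ W' := (⟨Prod.snd, fun _ => inf_le_right⟩ : OpenCover.Refine _ _)
        refine ⟨W.inf W', (OpenCover.Refine.toMap f).cocycle (q + 1) x +
          (OpenCover.Refine.toMap f').cocycle (q + 1) x', ?_⟩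
        rw [cechClass_add, cechClass_refine, cechClass_refine]
      neg_mem' := by
        rintro _ ⟨W, x, rfl⟩
        exact ⟨W, -x, cechClass_neg W x⟩ }
  have h : AddCommGrpCat.ofHom (QuotientAddGroup.mk' S) = 0 := by
    refine colimit.hom_ext fun W => AddCommGrpCat.hom_ext (AddMonoidHom.ext fun y => ?_)
    obtain ⟨x, hx⟩ := QuotientAddGroup.mk_surjective y.down
    refine (QuotientAddGroup.eq_zero_iff _).2 ⟨W.unop, x, ?_⟩
    change _ = colimit.ι (OpenCover.HSuccFunctor N q ⋙ AddCommGrpCat.uliftFunctor.{1, 0}) W y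
    rw [show y = ULift.up (QuotientAddGroup.mk x) from ULift.ext _ _ hx.symm]
    rfl
  exact (QuotientAddGroup.eq_zero_iff ξ).1 (ConcreteCategory.congr_hom h ξ)

lemma cechToGod_cechPullback (f : C(N', N)) (ξ : cechHSucc N q) :
    cechToGod N' q (cechPullback f q ξ) = GodCoh.map f q (cechToGod N q ξ) := by
  obtain ⟨W, x, rfl⟩ := exists_cechClass ξ
  rw [cechPullback_cechClass, cechToGod_cechClass, cechToGod_cechClass]
  exact OpenCover.toGodCoh_coh (W.preimageMap f) (QuotientAddGroup.mk x)

/-- Every open covering of the space has an acyclic refinement. -/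
def HasGoodCovers (N : Type) [TopologicalSpace N] : Prop :=
  ∀ V : OpenCover N, ∃ W : OpenCover N, IsGood W.sets ∧ Nonempty (W ⟶ V)

/-- Good coverings are cofinal, and for each of them the comparison is bijective. -/
lemma HasGoodCovers.bijective (h : HasGoodCovers N) : Function.Bijective (cechToGod N q) := by
  constructor
  · refine (injective_iff_map_eq_zero _).2 fun ξ hξ => ?_
    obtain ⟨V, x, rfl⟩ := exists_cechClass ξ
    obtain ⟨W, hW, ⟨f⟩⟩ := h V
    rw [← cechClass_refine f, cechToGod_cechClass] at hξ
    rw [← cechClass_refine f]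
    have h0 := (injective_iff_map_eq_zero _).1 (OpenCover.toGodCoh_injective hW) _ hξ
    unfold cechClass
    rw [h0]
    exact (colimit.ι (OpenCover.HSuccFunctor N q ⋙ AddCommGrpCat.uliftFunctor.{1, 0})
      (op W)).hom.map_zero
  · intro ξ
    obtain ⟨W, hW, -⟩ := h ⟨Unit, fun _ => ⊤, fun _ => ⟨(), trivial⟩⟩
    obtain ⟨x, rfl⟩ := OpenCover.toGodCoh_surjective hW ξ
    obtain ⟨x, rfl⟩ := QuotientAddGroup.mk_surjective x
    exact ⟨cechClass W x, cechToGod_cechClass W x⟩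

end Cech

end HigherGerbe

/-! ### Existence of good coverings by convexity in charts. -/

namespace HigherGerbe

/-! ### Convex open sets with barrier functions -/

section Barrier

open Metric Topology

variable {V : Type*} [NormedAddCommGroup V] [InnerProductSpace ℝ V]

/-- A smooth convex exhaustion of a convex open set. -/
structure IsBarrier (U : Set V) (F : V → ℝ) : Prop where
  isOpen : IsOpen U
  contDiffOn : ContDiffOn ℝ ∞ F U
  convexOn : ConvexOn ℝ U F
  nonneg : ∀ x ∈ U, 0 ≤ F x
  isCompact : ∀ t, IsCompact {x | x ∈ U ∧ F x ≤ t}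

/-- The sum of two barriers stays convex with compact sublevel sets on the intersection, which is
how finite intersections inherit a barrier. -/
lemma IsBarrier.inter {U U' : Set V} {F F' : V → ℝ} (h : IsBarrier U F) (h' : IsBarrier U' F') :
    IsBarrier (U ∩ U') (F + F') where
  isOpen := h.isOpen.inter h'.isOpen
  contDiffOn := (h.contDiffOn.mono Set.inter_subset_left).add
    (h'.contDiffOn.mono Set.inter_subset_right)
  convexOn := (h.convexOn.subset Set.inter_subset_left (h.convexOn.1.inter h'.convexOn.1)).add
    (h'.convexOn.subset Set.inter_subset_right (h.convexOn.1.inter h'.convexOn.1))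
  nonneg x hx := add_nonneg (h.nonneg x hx.1) (h'.nonneg x hx.2)
  isCompact t := by
    have hK := (h.isCompact t).inter_right (h'.isCompact t).isClosed
    have hc : ContinuousOn (F + F') ({x | x ∈ U ∧ F x ≤ t} ∩ {x | x ∈ U' ∧ F' x ≤ t}) :=
      (h.contDiffOn.continuousOn.mono fun x hx => hx.1.1).add
        (h'.contDiffOn.continuousOn.mono fun x hx => hx.2.1)
    have := hc.preimage_isClosed_of_isClosed hK.isClosed (isClosed_Iic (a := t))
    convert hK.of_isClosed_subset this Set.inter_subset_left using 1
    ext x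
    constructor
    · rintro ⟨⟨h1, h2⟩, h3⟩
      have h3' : F x + F' x ≤ t := h3
      have h4 := h.nonneg x h1
      have h5 := h'.nonneg x h2
      exact ⟨⟨⟨h1, by linarith⟩, ⟨h2, by linarith⟩⟩, h3⟩
    · exact fun hx => ⟨⟨hx.1.1.1, hx.1.2.1⟩, hx.2⟩

/-- The function `(s - g)⁻¹` blows up where `g` approaches `s`. It is convex because `s - g` is
concave and positive, while inversion is convex and decreasing. -/
lemma isBarrier_of_convexOn {B : Set V} {g : V → ℝ} {s : ℝ} (hB : IsOpen B)
    (hg : ContDiffOn ℝ ∞ g B) (hc : ConvexOn ℝ B g)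
    (hK : ∀ t < s, IsCompact {x | x ∈ B ∧ g x ≤ t}) :
    IsBarrier {x | x ∈ B ∧ g x < s} fun x => (s - g x)⁻¹ where
  isOpen := hg.continuousOn.isOpen_inter_preimage hB isOpen_Iio
  contDiffOn := (contDiffOn_const.sub (hg.mono fun x hx => hx.1)).inv fun x hx =>
    (sub_pos.2 hx.2).ne'
  convexOn := by
    refine ⟨hc.convex_lt s, fun x hx y hy a b ha hb hab => ?_⟩
    have hx' := sub_pos.2 hx.2
    have hy' := sub_pos.2 hy.2
    have h1 := hc.2 hx.1 hy.1 ha hb hab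
    have h2 := (convexOn_zpow (𝕜 := ℝ) (-1)).2 (Set.mem_Ioi.2 hx') (Set.mem_Ioi.2 hy') ha hb hab
    simp only [zpow_neg_one] at h2
    refine le_trans (inv_anti₀ ?_ ?_) h2
    · rcases ha.eq_or_lt with rfl | ha
      · obtain rfl : b = 1 := by linarith
        simpa using hy'
      · have := mul_pos ha hx'
        have := mul_nonneg hb hy'.le
        simp only [smul_eq_mul]
        linarith
    · simp only [smul_eq_mul] at h1 ⊢
      have : a * s + b * s = s := by rw [← add_mul, hab, one_mul]
      linarith
  nonneg x hx := inv_nonneg.2 (sub_pos.2 hx.2).le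
  isCompact t := by
    rcases le_or_gt t 0 with ht | ht
    · convert isCompact_empty (X := V)
      refine Set.eq_empty_of_forall_notMem fun x hx => ?_
      have := inv_pos.2 (sub_pos.2 hx.1.2)
      linarith [hx.2]
    · convert hK (s - t⁻¹) (by linarith [inv_pos.2 ht]) using 1
      ext x
      constructor
      · rintro ⟨⟨h1, h2⟩, h3⟩
        refine ⟨h1, ?_⟩
        have := (inv_le_comm₀ (sub_pos.2 h2) ht).1 h3
        linarith
      · rintro ⟨h1, h2⟩
        have h3 : g x < s := by linarith [inv_pos.2 ht]
        exact ⟨⟨h1, h3⟩, (inv_le_comm₀ (sub_pos.2 h3) ht).2 (by linarith)⟩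

lemma ContDiffAt.exists_localInverse [FiniteDimensional ℝ V] {R : V → V} {x : V} {R' : V →L[ℝ] V}
    (hR : ContDiffAt ℝ ∞ R x) (hR' : HasFDerivAt R R' x) (hi : Function.Injective R') :
    ∃ S : V → V, ContDiffAt ℝ ∞ S (R x) ∧ S (R x) = x ∧ ∀ᶠ y in 𝓝 (R x), R (S y) = y := by
  let e : V ≃L[ℝ] V := (LinearEquiv.ofInjectiveEndo R'.toLinearMap hi).toContinuousLinearEquiv
  have he : HasFDerivAt R (e : V →L[ℝ] V) x := by
    convert hR' using 1
    ext v
    rfl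
  have : CompleteSpace V := FiniteDimensional.complete ℝ V
  refine ⟨hR.localInverse he (by simp), hR.to_localInverse he (by simp),
    HasStrictFDerivAt.localInverse_apply_image _, HasStrictFDerivAt.eventually_right_inverse _⟩

/-- Let `x₀` minimize `F`, and stretch the rays from `x₀` by `R x = (1 + F x - F x₀) • (x - x₀)`. By
convexity `R` is injective with injective derivative; its image is open by the inverse function
theorem and closed by compactness of the sublevel sets, hence everything. -/
theorem IsBarrier.exists_diffeo [FiniteDimensional ℝ V] {U : Set V} {F : V → ℝ}
    (h : IsBarrier U F) (hU : U.Nonempty) : ∃ R S : V → V, ContDiffOn ℝ ∞ R U ∧ ContDiff ℝ ∞ S ∧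
      (∀ y, S y ∈ U ∧ R (S y) = y) ∧ ∀ x ∈ U, S (R x) = x := by
  obtain ⟨x₀, hx₀, hmin⟩ : ∃ x₀ ∈ U, ∀ x ∈ U, F x₀ ≤ F x := by
    obtain ⟨u, hu⟩ := hU
    obtain ⟨x₀, h1, h2⟩ := (h.isCompact (F u)).exists_isMinOn ⟨u, hu, le_rfl⟩
      (h.contDiffOn.continuousOn.mono fun x hx => hx.1)
    refine ⟨x₀, h1.1, fun x hx => ?_⟩
    rcases le_total (F x) (F u) with h3 | h3
    · exact h2 ⟨hx, h3⟩
    · exact h1.2.trans h3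
  let R : V → V := fun x => (1 + F x - F x₀) • (x - x₀)
  have hpos : ∀ x ∈ U, 1 ≤ 1 + F x - F x₀ := fun x hx => by linarith [hmin x hx]
  have hR : ContDiffOn ℝ ∞ R U :=
    ((contDiffOn_const.add h.contDiffOn).sub contDiffOn_const).smul
      (contDiffOn_id.sub contDiffOn_const)
  have hRat : ∀ x ∈ U, ContDiffAt ℝ ∞ R x := fun x hx => hR.contDiffAt (h.isOpen.mem_nhds hx)
  have hseg : ∀ x ∈ U, ∀ z ∈ segment ℝ x x₀, F z ≤ F x := fun x hx z hz => by
    have := h.convexOn.le_on_segment hx hx₀ hz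
    rwa [max_eq_left (hmin x hx)] at this
  have hinv : ∀ x ∈ U, ∃ R' : V →L[ℝ] V, HasFDerivAt R R' x ∧ Function.Injective R' := by
    intro x hx
    have hF : HasFDerivAt F (fderiv ℝ F x) x :=
      ((h.contDiffOn.contDiffAt (h.isOpen.mem_nhds hx)).differentiableAt (by simp)).hasFDerivAt
    -- On the segment from `x` to `x₀` the function does not exceed `F x`, so its derivative in the
    -- outward direction is nonnegative.
    have hd : 0 ≤ fderiv ℝ F x (x - x₀) := by
      have hm : IsLocalMaxOn F (segment ℝ x x₀) x := by
        filter_upwards [self_mem_nhdsWithin] with z hz using hseg x hx z hz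
      have := hm.hasFDerivWithinAt_nonpos hF.hasFDerivWithinAt
        (sub_mem_posTangentConeAt_of_segment_subset subset_rfl)
      rw [← neg_sub, map_neg]
      linarith
    refine ⟨_, ((hF.const_add 1).sub_const (F x₀)).smul ((hasFDerivAt_id x).sub_const x₀), ?_⟩
    refine (injective_iff_map_eq_zero _).2 fun v hv => ?_
    set c := 1 + F x - F x₀ with hc
    have hc1 : 1 ≤ c := hpos x hx
    set d := fderiv ℝ F x (x - x₀)
    have hv' : c • v + fderiv ℝ F x v • (x - x₀) = 0 := hv
    -- Applying `dF` to the kernel equation gives `dF(v) (c + d) = 0` with `c ≥ 1` and `d ≥ 0`.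
    have h2 := congrArg (fderiv ℝ F x) hv'
    rw [map_add, map_smul, map_smul, map_zero, smul_eq_mul, smul_eq_mul] at h2
    have h3 : fderiv ℝ F x v = 0 := by
      have : fderiv ℝ F x v * (c + d) = 0 := by linarith
      rcases mul_eq_zero.1 this with h | h
      · exact h
      · linarith
    rw [h3, zero_smul, add_zero] at hv'
    exact (smul_eq_zero.1 hv').resolve_left (by linarith)
  -- Points with the same image lie on one ray from `x₀`. The one with the larger `F` is no farther
  -- from `x₀`, so its `F` is at most that of the other; the scaling factors then agree.
  have hinj : Set.InjOn R U := by
    have key : ∀ x ∈ U, ∀ y ∈ U, R x = R y → F x ≤ F y → x = y := by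
      intro x hx y hy hxy hle
      have hx1 := hpos x hx
      have hy1 := hpos y hy
      set a := 1 + F x - F x₀ with ha
      set b := 1 + F y - F x₀ with hb
      have hab : a ≤ b := by linarith
      have e1 : y - x₀ = (a / b) • (x - x₀) := by
        have : a • (x - x₀) = b • (y - x₀) := hxy
        rw [div_eq_inv_mul, mul_smul, this, smul_smul, inv_mul_cancel₀ (by linarith), one_smul]
      have e2 : y ∈ segment ℝ x x₀ := by
        refine ⟨a / b, 1 - a / b, by positivity, sub_nonneg.2 ((div_le_one (by linarith)).2 hab),
          by ring, ?_⟩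
        have : y = (a / b) • (x - x₀) + x₀ := by rw [← e1]; abel
        rw [this, smul_sub, sub_smul, one_smul]
        abel
      have e3 : F x = F y := le_antisymm hle (hseg x hx y e2)
      have e4 : a / b = 1 := by rw [ha, hb, e3]; exact div_self (by linarith)
      rw [e4, one_smul] at e1
      exact (sub_left_injective e1).symm
    intro x hx y hy hxy
    rcases le_total (F x) (F y) with hle | hle
    · exact key x hx y hy hxy hle
    · exact (key y hy x hx hxy.symm hle).symm
  choose! R' hR' hi using hinv
  have hloc := fun x (hx : x ∈ U) => ContDiffAt.exists_localInverse (hRat x hx) (hR' x hx) (hi x hx)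
  choose! L hL1 hL2 hL3 using hloc
  have hLU : ∀ x ∈ U, ∀ᶠ y in 𝓝 (R x), L x y ∈ U := fun x hx =>
    (hL1 x hx).continuousAt.eventually (h.isOpen.mem_nhds (by rw [hL2 x hx]; exact hx))
  have hopen : IsOpen (R '' U) := by
    rw [isOpen_iff_mem_nhds]
    rintro _ ⟨x, hx, rfl⟩
    filter_upwards [hL3 x hx, hLU x hx] with y h1 h2
    exact ⟨_, h2, h1⟩
  -- Near a limit point the norm of `R x` is bounded. Outside the ball of radius `δ` around `x₀`
  -- this bounds `F x`, so that part of the image comes from a compact sublevel set.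
  have hclosed : IsClosed (R '' U) := by
    refine isClosed_of_closure_subset fun y hy => ?_
    obtain ⟨δ, hδ, hδ'⟩ : ∃ δ > 0, ∀ x ∈ ball x₀ δ, F x < F x₀ + 1 :=
      Metric.eventually_nhds_iff_ball.1 ((h.contDiffOn.continuousOn.continuousAt
        (h.isOpen.mem_nhds hx₀)).eventually (gt_mem_nhds (lt_add_one _)))
    set ρ := ‖y‖ + 1
    set t := max (F x₀ + 1) (F x₀ + ρ / δ)
    have hsub : R '' U ∩ ball 0 ρ ⊆ R '' {x | x ∈ U ∧ F x ≤ t} := by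
      rintro _ ⟨⟨x, hx, rfl⟩, hxρ⟩
      refine ⟨x, ⟨hx, ?_⟩, rfl⟩
      by_cases hxδ : x ∈ ball x₀ δ
      · exact (hδ' x hxδ).le.trans (le_max_left _ _)
      · refine le_trans ?_ (le_max_right _ _)
        rw [mem_ball_zero_iff, norm_smul, Real.norm_of_nonneg (by linarith [hpos x hx])] at hxρ
        rw [mem_ball, dist_eq_norm, not_lt] at hxδ
        have h1 := hpos x hx
        have h2 : (1 + F x - F x₀) * δ ≤ ρ :=
          (mul_le_mul_of_nonneg_left hxδ (by linarith)).trans hxρ.le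
        have := (le_div_iff₀ hδ).2 h2
        linarith
    have hK : IsClosed (R '' {x | x ∈ U ∧ F x ≤ t}) :=
      ((h.isCompact t).image_of_continuousOn (hR.continuousOn.mono fun x hx => hx.1)).isClosed
    have hy' : y ∈ closure (R '' U ∩ ball 0 ρ) := by
      rw [Set.inter_comm]
      exact isOpen_ball.inter_closure ⟨by simp [ρ], hy⟩
    obtain ⟨x, hx, rfl⟩ := hK.closure_subset_iff.2 hsub hy'
    exact ⟨x, hx.1, rfl⟩
  have huniv : R '' U = Set.univ := IsClopen.eq_univ ⟨hclosed, hopen⟩ ⟨_, x₀, hx₀, rfl⟩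
  have hsurj : ∀ y, ∃ x ∈ U, R x = y := fun y => by
    have : y ∈ R '' U := huniv ▸ Set.mem_univ y
    exact this
  choose S hS hRS using hsurj
  have hSR : ∀ x ∈ U, S (R x) = x := fun x hx => hinj (hS _) hx (hRS _)
  refine ⟨R, S, hR, contDiff_iff_contDiffAt.2 fun y => ?_, fun y => ⟨hS y, hRS y⟩, hSR⟩
  have hx := hS y
  have := hL1 (S y) hx
  rw [hRS] at this
  refine this.congr_of_eventuallyEq ?_
  have h3 := hL3 (S y) hx
  have h4 := hLU (S y) hx
  rw [hRS] at h3 h4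
  filter_upwards [h3, h4] with z h5 h6
  rw [← hSR _ h6, h5]

/-- The squared distance in a chart is convex near its centre. -/
lemma exists_convexOn_sq_norm [FiniteDimensional ℝ V] {ψ : V → V} {p : V} {A : V →L[ℝ] V}
    (hψ : ContDiffAt ℝ ∞ ψ p) (hA : HasFDerivAt ψ A p) (hi : Function.Injective A) :
    ∃ ρ > 0, ConvexOn ℝ (ball p ρ) fun x => ‖ψ x - ψ p‖ ^ 2 := by
  obtain ⟨a, ha, haA⟩ : ∃ a > 0, ∀ v, a * ‖v‖ ≤ ‖A v‖ := by
    obtain ⟨K, hK, h⟩ := A.toLinearMap.exists_antilipschitzWith (LinearMap.ker_eq_bot.2 hi)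
    refine ⟨(K : ℝ)⁻¹, by positivity, fun v => ?_⟩
    have := h.le_mul_dist v 0
    simp only [dist_zero_right, map_zero] at this
    rw [inv_mul_le_iff₀ (by positivity)]
    exact this
  let G : V → V →L[ℝ] ℝ := fun x => (2 : ℝ) • (innerSL ℝ (ψ x - ψ p)).comp (fderiv ℝ ψ x)
  have hdψ : ∀ᶠ x in 𝓝 p, ContDiffAt ℝ 1 ψ x :=
    (hψ.of_le (by exact WithTop.coe_le_coe.2 le_top)).eventually (by simp)
  have hG : ∀ᶠ x in 𝓝 p, HasFDerivAt (fun x => ‖ψ x - ψ p‖ ^ 2) (G x) x := by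
    filter_upwards [hdψ] with x hx
    have := (((hx.differentiableAt (by simp)).hasFDerivAt).sub_const (ψ p)).norm_sq
    rwa [← Nat.cast_smul_eq_nsmul ℝ] at this
  have hGsm : ContDiffAt ℝ 1 G p := by
    have h1 : ContDiffAt ℝ 1 (fderiv ℝ ψ) p := hψ.fderiv_right (m := 1) (by
      exact WithTop.coe_le_coe.2 (le_top (a := ((1 + 1 : ℕ) : ℕ∞))))
    have h2 : ContDiffAt ℝ 1 ψ p := hψ.of_le (by exact WithTop.coe_le_coe.2 le_top)
    exact (((innerSL ℝ (E := V)).contDiff.contDiffAt.comp p (h2.sub contDiffAt_const)).clm_comp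
      h1).const_smul (2 : ℝ)
  -- At `p` the factor `ψ x - ψ p` vanishes, so the second derivative of `ψ` does not contribute.
  -- The Hessian is `2 ⟨A v, A w⟩`, which is at least `2 a² ‖v‖²` on the diagonal.
  have hG' : ∀ v w, fderiv ℝ G p v w = 2 * inner ℝ (A v) (A w) := by
    intro v w
    have h1 : HasFDerivAt (fderiv ℝ ψ) (fderiv ℝ (fderiv ℝ ψ) p) p :=
      ((hψ.fderiv_right (m := 1) (by
        exact WithTop.coe_le_coe.2 (le_top (a := ((1 + 1 : ℕ) : ℕ∞))))).differentiableAt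
        (by simp)).hasFDerivAt
    have h2 : HasFDerivAt (fun x => innerSL ℝ (ψ x - ψ p)) ((innerSL ℝ (E := V)).comp A) p :=
      (innerSL ℝ (E := V)).hasFDerivAt.comp p (hA.sub_const (ψ p))
    have h3 := (h2.clm_comp h1).const_smul (2 : ℝ)
    have h4 : fderiv ℝ G p = _ := h3.fderiv
    rw [h4, hA.fderiv]
    simp
  -- Strict differentiability compares increments of the gradient near `p` with the Hessian at `p`
  -- alone; an error of relative size `2 a²` still leaves the gradient monotone.
  have hstrict : HasStrictFDerivAt G (fderiv ℝ G p) p := hGsm.hasStrictFDerivAt (by simp)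
  have hbound := hstrict.isLittleO.def (c := 2 * a ^ 2) (by positivity)
  have hmono : ∀ᶠ x in 𝓝 (p, p), 0 ≤ (G x.1 - G x.2) (x.1 - x.2) := by
    filter_upwards [hbound] with x hx
    have h1 : |(G x.1 - G x.2 - fderiv ℝ G p (x.1 - x.2)) (x.1 - x.2)| ≤
        2 * a ^ 2 * ‖x.1 - x.2‖ * ‖x.1 - x.2‖ :=
      (ContinuousLinearMap.le_opNorm _ _).trans (mul_le_mul_of_nonneg_right hx (norm_nonneg _))
    rw [sub_apply, hG', real_inner_self_eq_norm_sq] at h1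
    have h2 := haA (x.1 - x.2)
    have h3 : (a * ‖x.1 - x.2‖) ^ 2 ≤ ‖A (x.1 - x.2)‖ ^ 2 := by gcongr
    have h4 := (abs_le.1 h1).1
    nlinarith
  obtain ⟨O, hO, hO'⟩ := (Filter.eventually_prod_self_iff
    (r := fun x y => 0 ≤ (G x - G y) (x - y))).1 (by rwa [nhds_prod_eq] at hmono)
  obtain ⟨ρ, hρ, hball⟩ := Metric.mem_nhds_iff.1 (Filter.inter_mem hO hG)
  refine ⟨ρ, hρ, convex_ball _ _, fun x hx y hy a b ha hb hab => ?_⟩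
  -- Convexity is checked on a segment, where the monotone gradient gives a monotone derivative.
  let z : ℝ → V := fun t => x + t • (y - x)
  have hz : ∀ t ∈ Set.Icc (0 : ℝ) 1, z t ∈ ball p ρ := fun t ht =>
    (convex_ball p ρ).add_smul_sub_mem hx hy ht
  have hd : ∀ t ∈ Set.Icc (0 : ℝ) 1, HasDerivAt (fun t => ‖ψ (z t) - ψ p‖ ^ 2) (G (z t) (y - x)) t :=
    fun t ht => by
      have h1 : HasDerivAt z (y - x) t := by
        have := ((hasDerivAt_id t).smul_const (y - x)).const_add x
        rwa [one_smul] at this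
      exact (hball (hz t ht)).2.comp_hasDerivAt t h1
  have hconv : ConvexOn ℝ (Set.Icc (0 : ℝ) 1) fun t => ‖ψ (z t) - ψ p‖ ^ 2 := by
    refine MonotoneOn.convexOn_of_deriv (convex_Icc _ _)
      (fun t ht => (hd t ht).continuousAt.continuousWithinAt)
      (fun t ht => (hd t (interior_subset ht)).differentiableAt.differentiableWithinAt)
      fun s hs t ht hst => ?_
    rw [(hd s (interior_subset hs)).deriv, (hd t (interior_subset ht)).deriv]
    rcases hst.eq_or_lt with rfl | hst
    · exact le_rfl
    have h1 := hO' _ (hball (hz t (interior_subset ht))).1 _ (hball (hz s (interior_subset hs))).1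
    have h2 : z t - z s = (t - s) • (y - x) := by
      simp only [z, sub_smul]
      abel
    rw [h2, map_smul, smul_eq_mul] at h1
    have h3 := nonneg_of_mul_nonneg_right h1 (sub_pos.2 hst)
    rw [sub_apply] at h3
    linarith
  have := hconv.2 (Set.left_mem_Icc.2 zero_le_one) (Set.right_mem_Icc.2 zero_le_one) ha hb hab
  have e : x + b • (y - x) = a • x + b • y := by
    rw [eq_sub_of_add_eq hab, sub_smul, one_smul, smul_sub]
    abel
  simpa [z, e] using this

end Barrier

end HigherGerbe

namespace HigherGerbe

open TopologicalSpace

/-! ### Good bases of manifolds -/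

section GoodBasis

open Metric Topology

variable {M : Mfd}

/-- The set is given in the chart at `c` by a convex set with a barrier function. -/
def ChartBarrier (c : M) (V : Set M) : Prop :=
  V ⊆ (chartAt (E M.dim) c).source ∧ ∃ F, IsBarrier (chartAt (E M.dim) c '' V) F

lemma ChartBarrier.inter {c : M} {V V' : Set M} (h : ChartBarrier c V) (h' : ChartBarrier c V') :
    ChartBarrier c (V ∩ V') := by
  obtain ⟨h1, F, hF⟩ := h
  obtain ⟨h1', F', hF'⟩ := h'
  refine ⟨fun x hx => h1 hx.1, F + F', ?_⟩
  rw [((chartAt (E M.dim) c).injOn.image_inter h1 h1')]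
  exact hF.inter hF'

lemma ChartBarrier.diffeomorph {c : M} {V : Opens M} (h : ChartBarrier c (V : Set M))
    (hV : V ≠ ⊥) : Nonempty (Diffeomorph (𝓡 M.dim) (𝓡 M.dim) V (E M.dim) ∞) := by
  obtain ⟨hs, F, hF⟩ := h
  obtain ⟨R, S, hR, hS, hSU, hSR⟩ := hF.exists_diffeo
    (((Opens.ne_bot_iff_nonempty V).1 hV).image _)
  set φ := chartAt (E M.dim) c
  have hsymm : ∀ y, φ.symm (S y) ∈ V := fun y => by
    obtain ⟨x, hx, hxy⟩ := (hSU y).1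
    rw [← hxy, φ.left_inv (hs hx)]
    exact hx
  have hsource : ∀ y, S y ∈ φ.target := fun y => by
    obtain ⟨x, hx, hxy⟩ := (hSU y).1
    rw [← hxy]
    exact φ.map_source (hs hx)
  refine ⟨⟨⟨fun z => R (φ z), fun y => ⟨φ.symm (S y), hsymm y⟩, fun z => ?_, fun y => ?_⟩, ?_, ?_⟩⟩
  · refine Subtype.ext ?_
    change φ.symm (S (R (φ z))) = z
    rw [hSR _ ⟨z, z.2, rfl⟩, φ.left_inv (hs z.2)]
  · change R (φ (φ.symm (S y))) = y
    rw [φ.right_inv (hsource y), (hSU y).2]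
  · have h1 : ContMDiffOn (𝓡 M.dim) (𝓡 M.dim) ∞ (R ∘ φ) V :=
      hR.contMDiffOn.comp ((contMDiffOn_chart (x := c)).mono hs) fun z hz => ⟨z, hz, rfl⟩
    exact h1.comp_contMDiff contMDiff_subtype_val fun z => z.2
  · rw [← ContMDiff.subtypeVal_comp_iff]
    exact (contMDiffOn_chart_symm (x := c)).comp_contMDiff hS.contMDiff hsource

/-- Small balls in the chart at their centre. -/
def chartBall (p : M) (r : ℝ) : Set M :=
  (chartAt (E M.dim) p).source ∩ chartAt (E M.dim) p ⁻¹' ball (chartAt (E M.dim) p p) r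

lemma isOpen_chartBall (p : M) (r : ℝ) : IsOpen (chartBall p r) :=
  (chartAt (E M.dim) p).isOpen_inter_preimage isOpen_ball

lemma mem_chartBall (p : M) {r : ℝ} (hr : 0 < r) : p ∈ chartBall p r :=
  ⟨mem_chart_source _ p, mem_ball_self hr⟩

lemma eventually_chartBall_subset {p : M} {O : Set M} (hO : O ∈ 𝓝 p) :
    ∀ᶠ r in 𝓝[>] (0 : ℝ), chartBall p r ⊆ O := by
  set φ := chartAt (E M.dim) p
  have h : φ.symm ⁻¹' O ∈ 𝓝 (φ p) := by
    refine (φ.continuousAt_symm (mem_chart_target _ p)).preimage_mem_nhds ?_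
    rwa [φ.left_inv (mem_chart_source _ p)]
  obtain ⟨ε, hε, h⟩ := Metric.mem_nhds_iff.1 h
  filter_upwards [Ioo_mem_nhdsGT hε] with r hr z hz
  have := h (ball_subset_ball hr.2.le hz.2)
  rwa [Set.mem_preimage, φ.left_inv hz.1] at this

/-- In another chart `χ`, a small ball of the chart `φ` at `p` is a sublevel set of `‖ψ x - ψ (χ
p)‖²`, where `ψ` is the transition map, and this function is convex near the centre. Its closed
sublevel sets are images of closed balls, hence compact. -/
lemma eventually_chartBarrier {p c : M} (hp : p ∈ (chartAt (E M.dim) c).source) :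
    ∀ᶠ r in 𝓝[>] (0 : ℝ), ChartBarrier c (chartBall p r) := by
  set φ := chartAt (E M.dim) p with hφ
  set χ := chartAt (E M.dim) c with hχ
  have hpφ : p ∈ φ.source := mem_chart_source _ p
  set D := (χ.symm.trans φ).source with hD
  have hDo : IsOpen D := (χ.symm.trans φ).open_source
  have hpD : χ p ∈ D := by
    rw [hD, OpenPartialHomeomorph.trans_source, OpenPartialHomeomorph.symm_source]
    exact ⟨χ.map_source hp, by rw [Set.mem_preimage, χ.left_inv hp]; exact hpφ⟩
  have hDmem : ∀ x ∈ D, x ∈ χ.target ∧ χ.symm x ∈ φ.source := fun x hx => by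
    rwa [hD, OpenPartialHomeomorph.trans_source, OpenPartialHomeomorph.symm_source] at hx
  let ψ : E M.dim → E M.dim := fun x => φ (χ.symm x)
  let ψ' : E M.dim → E M.dim := fun y => χ (φ.symm y)
  have hψ : ContDiffOn ℝ ∞ ψ D := by
    rw [← contMDiffOn_iff_contDiffOn]
    exact (contMDiffOn_chart (x := p)).comp
      ((contMDiffOn_chart_symm (x := c)).mono fun x hx => (hDmem x hx).1) fun x hx => (hDmem x hx).2
  have hψp : ψ (χ p) = φ p := by simp only [ψ, χ.left_inv hp]
  have hψ'at : ContDiffAt ℝ ∞ ψ' (φ p) := by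
    rw [← contMDiffAt_iff_contDiffAt]
    have h1 : ContMDiffAt (𝓡 M.dim) (𝓡 M.dim) ∞ φ.symm (φ p) :=
      (contMDiffOn_chart_symm (x := p)).contMDiffAt (φ.open_target.mem_nhds (φ.map_source hpφ))
    have h2 : ContMDiffAt (𝓡 M.dim) (𝓡 M.dim) ∞ χ (φ.symm (φ p)) := by
      rw [φ.left_inv hpφ]
      exact (contMDiffOn_chart (x := c)).contMDiffAt (χ.open_source.mem_nhds hp)
    exact h2.comp _ h1
  have hψat : ContDiffAt ℝ ∞ ψ (χ p) := hψ.contDiffAt (hDo.mem_nhds hpD)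
  have hA := (hψat.differentiableAt (by simp)).hasFDerivAt
  have hinv : ∀ x ∈ D, ψ' (ψ x) = x := fun x hx => by
    simp only [ψ, ψ', φ.left_inv (hDmem x hx).2, χ.right_inv (hDmem x hx).1]
  have hi : Function.Injective (fderiv ℝ ψ (χ p)) := by
    have h1 : HasFDerivAt ψ' (fderiv ℝ ψ' (φ p)) (ψ (χ p)) := by
      rw [hψp]
      exact (hψ'at.differentiableAt (by simp)).hasFDerivAt
    have h2 : ψ' ∘ ψ =ᶠ[𝓝 (χ p)] id := by
      filter_upwards [hDo.mem_nhds hpD] with x hx using hinv x hx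
    have h3 := (h1.comp _ hA).unique ((hasFDerivAt_id _).congr_of_eventuallyEq h2)
    exact Function.LeftInverse.injective (g := fderiv ℝ ψ' (φ p)) fun v => DFunLike.congr_fun h3 v
  obtain ⟨ρ₁, hρ₁, hconv⟩ := exists_convexOn_sq_norm hψat hA hi
  obtain ⟨ρ₂, hρ₂, hball⟩ := Metric.isOpen_iff.1 hDo _ hpD
  set B := ball (χ p) (min ρ₁ ρ₂) with hB
  have hBD : B ⊆ D := (ball_subset_ball (min_le_right _ _)).trans hball
  have hO : χ.source ∩ χ ⁻¹' B ∈ 𝓝 p :=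
    (χ.isOpen_inter_preimage isOpen_ball).mem_nhds ⟨hp, mem_ball_self (lt_min hρ₁ hρ₂)⟩
  have htarget : ∀ᶠ r in 𝓝[>] (0 : ℝ), ball (φ p) r ⊆ φ.target := by
    obtain ⟨ε, hε, h⟩ := Metric.isOpen_iff.1 φ.open_target _ (φ.map_source hpφ)
    filter_upwards [Ioo_mem_nhdsGT hε] with r hr
    exact (ball_subset_ball hr.2.le).trans h
  filter_upwards [eventually_chartBall_subset hO, htarget, self_mem_nhdsWithin] with r h1 h2 hr
  have hr : 0 < r := hr
  refine ⟨fun z hz => (h1 hz).1, fun x => (r ^ 2 - ‖ψ x - ψ (χ p)‖ ^ 2)⁻¹, ?_⟩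
  have himage : χ '' chartBall p r = {x | x ∈ B ∧ ‖ψ x - ψ (χ p)‖ ^ 2 < r ^ 2} := by
    ext x
    constructor
    · rintro ⟨z, hz, rfl⟩
      refine ⟨(h1 hz).2, ?_⟩
      have := hz.2
      rw [Set.mem_preimage, mem_ball, dist_eq_norm] at this
      simp only [ψ, χ.left_inv (h1 hz).1, χ.left_inv hp]
      gcongr
    · rintro ⟨hx, hx'⟩
      have hxD := hDmem x (hBD hx)
      refine ⟨χ.symm x, ⟨hxD.2, ?_⟩, χ.right_inv hxD.1⟩
      rw [hψp] at hx'
      rw [Set.mem_preimage, mem_ball, dist_eq_norm]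
      exact lt_of_pow_lt_pow_left₀ 2 hr.le hx'
  rw [himage]
  refine isBarrier_of_convexOn isOpen_ball ?_
    (hconv.subset (ball_subset_ball (min_le_left _ _)) (convex_ball _ _)) fun t ht => ?_
  · exact ((hψ.mono hBD).sub contDiffOn_const).norm_sq ℝ
  rcases lt_or_ge t 0 with ht0 | ht0
  · refine Eq.subst (motive := fun s : Set (E M.dim) => IsCompact s)
      (Set.eq_empty_of_forall_notMem fun x hx => ?_).symm isCompact_empty
    have := sq_nonneg ‖ψ x - ψ (χ p)‖
    linarith [hx.2]
  have hsq : √t < r := (Real.sqrt_lt' hr).2 ht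
  have hmem : ∀ y ∈ closedBall (φ p) (√t), y ∈ φ.target ∧ φ.symm y ∈ chartBall p r := fun y hy => by
    have hy' : y ∈ ball (φ p) r := closedBall_subset_ball hsq hy
    refine ⟨h2 hy', φ.map_target (h2 hy'), ?_⟩
    rw [Set.mem_preimage, φ.right_inv (h2 hy')]
    exact hy'
  have hcompact : IsCompact (ψ' '' closedBall (φ p) (√t)) := by
    refine (isCompact_closedBall _ _).image_of_continuousOn ?_
    exact χ.continuousOn.comp (φ.continuousOn_symm.mono fun y hy => (hmem y hy).1)
      fun y hy => (h1 (hmem y hy).2).1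
  refine Eq.subst (motive := fun s : Set (E M.dim) => IsCompact s) (Set.ext fun x => ?_) hcompact
  symm
  constructor
  · rintro ⟨hx, hx'⟩
    refine ⟨ψ x, ?_, hinv x (hBD hx)⟩
    rw [mem_closedBall, dist_eq_norm, ← hψp]
    exact Real.le_sqrt_of_sq_le hx'
  · rintro ⟨y, hy, rfl⟩
    obtain ⟨hy1, hy2⟩ := hmem y hy
    refine ⟨(h1 hy2).2, ?_⟩
    have : ψ (ψ' y) = y := by
      simp only [ψ, ψ', χ.left_inv (h1 hy2).1, φ.right_inv hy1]
    rw [this, hψp, ← dist_eq_norm]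
    exact (Real.le_sqrt dist_nonneg ht0).1 hy

/-- A basis of the topology whose finite intersections are empty or diffeomorphic to a cartesian
space. -/
structure IsGoodBasis (𝒱 : Set (Opens M)) : Prop where
  basis : ∀ z, ∀ O ∈ 𝓝 z, ∃ V ∈ 𝒱, z ∈ V ∧ (V : Set M) ⊆ O
  inf : ∀ {ι : Type} (s : Finset ι) (f : ι → Opens M), s.Nonempty → (∀ i ∈ s, f i ∈ 𝒱) →
    s.inf f = ⊥ ∨ Nonempty (Diffeomorph (𝓡 M.dim) (𝓡 M.dim) (s.inf f : Opens M) (E M.dim) ∞)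

variable (M) in
theorem Mfd.exists_isGoodBasis : ∃ 𝒱 : Set (Opens M), IsGoodBasis 𝒱 := by
  obtain ⟨κ, b, -⟩ := SmoothBumpCovering.exists_isSubordinate (𝓡 M.dim) (M := M) (s := Set.univ)
    (U := fun _ => Set.univ) isClosed_univ fun _ _ => Filter.univ_mem
  let K : κ → Set M := fun i => tsupport (b i)
  have hK : LocallyFinite K := b.locallyFinite.closure
  have hKc : ∀ i, IsClosed (K i) := fun i => isClosed_tsupport _
  refine ⟨{V | ∀ i, ((V : Set M) ∩ K i).Nonempty → ChartBarrier (b.c i) (V : Set M)},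
    fun z O hO => ?_, fun s f hs hf => ?_⟩
  -- By local finiteness, small balls at `z` only meet the finitely many `K i` through `z`.
  · have h1 : ∀ᶠ r in 𝓝[>] (0 : ℝ), ∀ i ∈ {i | z ∈ K i}, ChartBarrier (b.c i) (chartBall z r) :=
      (Filter.eventually_all_finite (hK.point_finite z)).2 fun i hi =>
        eventually_chartBarrier ((b i).tsupport_subset_chartAt_source hi)
    obtain ⟨r, hr1, hr2, hr3⟩ := (h1.and ((eventually_chartBall_subset
      (Filter.inter_mem hO (hK.iInter_compl_mem_nhds hKc z))).and self_mem_nhdsWithin)).exists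
    refine ⟨⟨chartBall z r, isOpen_chartBall z r⟩, fun i => ?_, mem_chartBall z hr3,
      fun x hx => (hr2 hx).1⟩
    rintro ⟨x, hx, hxi⟩
    refine hr1 i (not_not.1 fun hz => ?_)
    have := (hr2 hx).2
    simp only [Set.mem_iInter] at this
    exact this i hz hxi
  · refine or_iff_not_imp_left.2 fun hne => ?_
    obtain ⟨z, hz⟩ := (Opens.ne_bot_iff_nonempty _).1 hne
    have hzi : z ∈ K (b.ind z trivial) := subset_closure (b.mem_support_ind z trivial)
    set i := b.ind z trivial
    have key : ∀ s : Finset _, s.Nonempty → (∀ j ∈ s, ChartBarrier (b.c i) (f j : Set M)) →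
        ChartBarrier (b.c i) ((s.inf f : Opens M) : Set M) := by
      classical
      intro s hs
      induction hs using Finset.Nonempty.cons_induction with
      | singleton a => exact fun h => by simpa using h a (by simp)
      | cons a s ha hs ih =>
        intro h
        rw [Finset.inf_cons, Opens.coe_inf]
        exact (h a (by simp)).inter (ih fun j hj => h j (by simp [hj]))
    refine (key s hs fun j hj => hf j hj i ⟨z, ?_, hzi⟩).diffeomorph hne
    exact (Finset.inf_le hj : s.inf f ≤ f j) hz

end GoodBasis

end HigherGerbe

namespace HigherGerbe

open TopologicalSpace

/-! ### Refinements by families of good open coverings -/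

section Refinement

open Topology Simplicial

variable {M : Mfd}

lemma mem_finsetInf {Y ι : Type} [TopologicalSpace Y] (s : Finset ι) (f : ι → Opens Y) (y : Y) :
    y ∈ s.inf f ↔ ∀ i ∈ s, y ∈ f i := by
  classical
  induction s using Finset.induction_on with
  | empty => simp
  | insert i s hi ih => simp [ih]

/-- The product of two open sets. -/
def prodOpens {Y Y' : Type} [TopologicalSpace Y] [TopologicalSpace Y'] (B : Opens Y)
    (V : Opens Y') : Opens (Y × Y') := ⟨(B : Set Y) ×ˢ (V : Set Y'), B.isOpen.prod V.isOpen⟩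

lemma mem_prodOpens {Y Y' : Type} [TopologicalSpace Y] [TopologicalSpace Y'] {B : Opens Y}
    {V : Opens Y'} {p : Y × Y'} : p ∈ prodOpens B V ↔ p.1 ∈ B ∧ p.2 ∈ V := Iff.rfl

lemma isCartFam_prod {c : Cart} {B : Opens c} {V : Opens M} (hB : IsCartesian B)
    (hV : Nonempty (Diffeomorph (𝓡 M.dim) (𝓡 M.dim) V (E M.dim) ∞)) : IsCartFam (prodOpens B V) B := by
  obtain ⟨β⟩ := hB
  obtain ⟨ν⟩ := hV
  refine ⟨fun p hp => hp.1, M.dim, ⟨⟨fun p => (β ⟨p.1.1, p.2.1⟩, ν ⟨p.1.2, p.2.2⟩),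
    fun y => ⟨(β.symm y.1, ν.symm y.2), (β.symm y.1).2, (ν.symm y.2).2⟩, fun p => ?_, fun y => ?_⟩,
    ?_, ?_⟩, β, fun p hp => rfl⟩
  · simp
  · simp
  · have h1 : ContMDiff (prodModel c M) (𝓡 c.dim) ∞
        fun p : (prodOpens B V : Opens (c × M)) => (⟨p.1.1, p.2.1⟩ : B) := by
      rw [← ContMDiff.subtypeVal_comp_iff]
      exact contMDiff_fst.comp contMDiff_subtype_val
    have h2 : ContMDiff (prodModel c M) (𝓡 M.dim) ∞
        fun p : (prodOpens B V : Opens (c × M)) => (⟨p.1.2, p.2.2⟩ : V) := by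
      rw [← ContMDiff.subtypeVal_comp_iff]
      exact contMDiff_snd.comp contMDiff_subtype_val
    exact (β.contMDiff.comp h1).prodMk_space (ν.contMDiff.comp h2)
  · rw [← ContMDiff.subtypeVal_comp_iff]
    exact (contMDiff_subtype_val.comp (β.symm.contMDiff.comp contDiff_fst.contMDiff)).prodMk
      (contMDiff_subtype_val.comp (ν.symm.contMDiff.comp contDiff_snd.contMDiff))

/-- The fibres are copies of some `ℝʲ`, hence nonempty. So conditions on the patches of `c` follow
from those on the patches of `c × M`. -/
lemma GCov.exists_mem_total (X : GCov M) {a : X.Λ} {x : X.base.cart} (hx : x ∈ X.down a) :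
    ∃ z, (x, z) ∈ X.total a := by
  obtain ⟨h, j, Φ, φ, hΦ⟩ := X.isCartFam a
  have hp := (Φ.symm (φ ⟨x, hx⟩, 0)).2
  refine ⟨(Φ.symm (φ ⟨x, hx⟩, 0)).1.2, ?_⟩
  have h1 := hΦ (Φ.symm (φ ⟨x, hx⟩, 0)) (h _ hp)
  rw [Φ.apply_symm_apply] at h1
  have h2 := congrArg Subtype.val (φ.injective h1)
  have h3 : x = (Φ.symm (φ ⟨x, hx⟩, 0)).1.1 := h2
  have h4 : (x, (Φ.symm (φ ⟨x, hx⟩, 0)).1.2) = (Φ.symm (φ ⟨x, hx⟩, 0)).1 := Prod.ext h3 rfl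
  rw [h4]
  exact hp

/-- A morphism of coverings is determined by its effect on the patches of `c × M`. -/
def GCov.homMk {Z X : GCov M} (f : Z.base ⟶ X.base) (l : Z.Λ → X.Λ)
    (h : ∀ a, ∀ p ∈ Z.total a, BD.Hom.total f p ∈ X.total (l a)) : Z ⟶ X :=
  (⟨f, l, h, fun a x hx => by
    obtain ⟨z, hz⟩ := Z.exists_mem_total hx
    exact (X.isCartFam (l a)).1 _ (h a _ hz)⟩ : GCov.Hom Z X)

/-- A chosen good basis. -/
noncomputable def Mfd.goodBasis (M : Mfd) : Set (Opens M) := (Mfd.exists_isGoodBasis M).choose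

lemma Mfd.isGoodBasis_goodBasis (M : Mfd) : IsGoodBasis M.goodBasis :=
  (Mfd.exists_isGoodBasis M).choose_spec

lemma IsGoodBasis.diffeomorph {𝒱 : Set (Opens M)} (h : IsGoodBasis 𝒱) {V : Opens M} (hV : V ∈ 𝒱)
    (hne : V ≠ ⊥) : Nonempty (Diffeomorph (𝓡 M.dim) (𝓡 M.dim) V (E M.dim) ∞) := by
  have := (h.inf {()} (fun _ => V) (Finset.singleton_nonempty _) fun _ _ => hV)
  rw [Finset.inf_singleton] at this
  exact this.resolve_left hne

/-- A family of good open coverings over `c` which refines an open covering of `c × M`. -/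
noncomputable def refineCov [Nonempty M] (c : BD M) (W : OpenCover (c.cart × M)) : GCov M where
  base := c
  -- An index remembers a member of `W` that contains the box, so that refinement maps exist as
  -- functions. Empty boxes are excluded because every patch has to be cartesian.
  Λ := {t : W.ι × Opens c.cart × Opens M // t.2.1 ∈ c.cart.toMfd.goodBasis ∧ t.2.2 ∈ M.goodBasis ∧
    t.2.1 ≠ ⊥ ∧ t.2.2 ≠ ⊥ ∧ prodOpens t.2.1 t.2.2 ≤ W.U t.1}
  total t := prodOpens t.1.2.1 t.1.2.2
  down t := t.1.2.1
  total_cover p := by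
    obtain ⟨i, hi⟩ := W.cover p
    obtain ⟨O, hO, O', hO', h⟩ := mem_nhds_prod_iff.1 ((W.U i).isOpen.mem_nhds hi)
    obtain ⟨B, hB, hpB, hBO⟩ := c.cart.toMfd.isGoodBasis_goodBasis.basis p.1 O hO
    obtain ⟨V, hV, hpV, hVO⟩ := M.isGoodBasis_goodBasis.basis p.2 O' hO'
    exact ⟨⟨(i, B, V), hB, hV, (Opens.ne_bot_iff_nonempty _).2 ⟨_, hpB⟩,
      (Opens.ne_bot_iff_nonempty _).2 ⟨_, hpV⟩, fun y hy => h ⟨hBO hy.1, hVO hy.2⟩⟩, hpB, hpV⟩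
  -- Covering `c` requires a point of `M`; this is where nonemptiness enters.
  down_cover x := by
    have p : c.cart × M := (x, Classical.arbitrary M)
    obtain ⟨i, hi⟩ := W.cover (x, Classical.arbitrary M)
    obtain ⟨O, hO, O', hO', h⟩ := mem_nhds_prod_iff.1 ((W.U i).isOpen.mem_nhds hi)
    obtain ⟨B, hB, hpB, hBO⟩ := c.cart.toMfd.isGoodBasis_goodBasis.basis x O hO
    obtain ⟨V, hV, hpV, hVO⟩ := M.isGoodBasis_goodBasis.basis _ O' hO'
    exact ⟨⟨(i, B, V), hB, hV, (Opens.ne_bot_iff_nonempty _).2 ⟨_, hpB⟩,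
      (Opens.ne_bot_iff_nonempty _).2 ⟨_, hpV⟩, fun y hy => h ⟨hBO hy.1, hVO hy.2⟩⟩, hpB⟩
  isCartFam t := isCartFam_prod (c.cart.toMfd.isGoodBasis_goodBasis.diffeomorph t.2.1 t.2.2.2.1)
    (M.isGoodBasis_goodBasis.diffeomorph t.2.2.1 t.2.2.2.2.1)
  inter_total s hs := by
    have e : (s.inf fun t => prodOpens t.1.2.1 t.1.2.2) =
        prodOpens (s.inf fun t => t.1.2.1 : Opens c.cart) (s.inf fun t => t.1.2.2) := by
      ext p
      simp only [SetLike.mem_coe, mem_finsetInf, mem_prodOpens]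
      exact ⟨fun h => ⟨fun i hi => (h i hi).1, fun i hi => (h i hi).2⟩,
        fun h i hi => ⟨h.1 i hi, h.2 i hi⟩⟩
    rw [e]
    rcases c.cart.toMfd.isGoodBasis_goodBasis.inf s (fun t => t.1.2.1) hs fun t _ => t.2.1 with h | h
    · left
      rw [h]
      ext p
      exact ⟨fun hp => hp.1, fun hp => hp.elim⟩
    rcases M.isGoodBasis_goodBasis.inf s (fun t => t.1.2.2) hs fun t _ => t.2.2.1 with h' | h'
    · left
      rw [h']
      ext p
      exact ⟨fun hp => hp.2, fun hp => hp.elim⟩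
    · exact Or.inr (isCartFam_prod h h')
  inter_down s hs := c.cart.toMfd.isGoodBasis_goodBasis.inf s _ hs fun t _ => t.2.1

/-- Two presentations over the same cartesian space have a common refinement. -/
lemma GCov.exists_common_refinement [Nonempty M] {c : BD M} {X Y : GCov M} (f : c ⟶ X.base)
    (g : c ⟶ Y.base) : ∃ (W : OpenCover (c.cart × M)) (P : refineCov c W ⟶ X)
      (Q : refineCov c W ⟶ Y), (GCov.forgetCover M).map P = f ∧ (GCov.forgetCover M).map Q = g := by
  let F : C(c.cart × M, X.base.cart × M) := ⟨BD.Hom.total f, f.contMDiff_total.continuous⟩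
  let G : C(c.cart × M, Y.base.cart × M) := ⟨BD.Hom.total g, g.contMDiff_total.continuous⟩
  let W := (X.openCover.preimage F).inf (Y.openCover.preimage G)
  exact ⟨W, GCov.homMk f (fun a => a.1.1.1) fun a p hp => (a.2.2.2.2.2 hp).1,
    GCov.homMk g (fun a => a.1.1.2) fun a p hp => (a.2.2.2.2.2 hp).2, rfl, rfl⟩

end Refinement

/-! ### Homotopy invariance -/

section Homotopy

open Topology Simplicial

variable {M : Mfd} {q : ℕ}

lemma exactOn_of_homeomorph_module {N V : Type} [TopologicalSpace N] [NormedAddCommGroup V]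
    [NormedSpace ℝ V] [FiniteDimensional ℝ V] {U : Opens N} (φ : U ≃ₜ V) (r : ℕ) :
    ExactOn (U : Set N) r :=
  exactOn_of_homeomorph (φ.trans (ContinuousLinearEquiv.ofFinrankEq (𝕜 := ℝ) (E := V)
    (F := Fin (Module.finrank ℝ V) → ℝ) (by simp)).toHomeomorph) r

lemma exactOn_empty {N : Type} [TopologicalSpace N] (r : ℕ) : ExactOn (∅ : Set N) r :=
  fun _ _ => ⟨0, fun _ hx => hx.elim⟩

lemma interSet_eq_inf {N ι : Type} [TopologicalSpace N] [DecidableEq ι] (U : ι → Opens N)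
    {q : ℕ} (a : Fin (q + 1) → ι) :
    interSet (fun i => (U i : Set N)) a = ((Finset.univ.image a).inf U : Opens N) := by
  ext y
  rw [SetLike.mem_coe, mem_finsetInf]
  simp [interSet]

open Classical in
lemma GCov.isGood (X : GCov M) : IsGood X.openCover.sets := by
  have key : ∀ (q : ℕ) (a : Fin (q + 1) → X.Λ) (r : ℕ),
      ExactOn (interSet (fun i => (X.total i : Set (X.base.cart × M))) a) r := by
    intro q a r
    rw [interSet_eq_inf]
    rcases X.inter_total (Finset.univ.image a) (Finset.univ_nonempty.image a) with h | h
    · rw [h]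
      exact exactOn_empty r
    · obtain ⟨-, j, Φ, -⟩ := h
      exact exactOn_of_homeomorph_module Φ.toHomeomorph r
  exact key

lemma hasGoodCovers_prod [Nonempty M] (c : Cart) : HasGoodCovers (c × M) := fun V =>
  ⟨(refineCov ⟨c⟩ V).openCover, (refineCov ⟨c⟩ V).isGood,
    ⟨(⟨fun a => a.1.1, fun a => a.2.2.2.2.2⟩ :
      OpenCover.Refine (refineCov ⟨c⟩ V).openCover V)⟩⟩

/-- A covering by members of the good basis. -/
noncomputable def goodCover (M : Mfd) (W : OpenCover M) : OpenCover M where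
  ι := {t : W.ι × Opens M // t.2 ∈ M.goodBasis ∧ t.2 ≤ W.U t.1}
  U t := t.1.2
  cover z := by
    obtain ⟨i, hi⟩ := W.cover z
    obtain ⟨V, hV, hz, hVW⟩ := M.isGoodBasis_goodBasis.basis z _ ((W.U i).isOpen.mem_nhds hi)
    exact ⟨⟨(i, V), hV, hVW⟩, hz⟩

open Classical in
lemma goodCover_inter (W : OpenCover M) {q : ℕ} (a : Fin (q + 1) → (goodCover M W).ι) :
    interSet (goodCover M W).sets a = ∅ ∨ ∃ U : Opens M, interSet (goodCover M W).sets a = U ∧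
      Nonempty (U ≃ₜ E M.dim) := by
  have h := interSet_eq_inf (goodCover M W).U a
  rcases M.isGoodBasis_goodBasis.inf (Finset.univ.image a) (goodCover M W).U
    (Finset.univ_nonempty.image a) fun t _ => t.2.1 with h' | ⟨⟨Φ⟩⟩
  · left
    rw [h'] at h
    exact h
  · exact Or.inr ⟨_, h, ⟨Φ.toHomeomorph⟩⟩

lemma hasGoodCovers (M : Mfd) : HasGoodCovers M := fun V =>
  ⟨goodCover M V, fun q a r => by
    rcases goodCover_inter V a with h | ⟨U, h, ⟨Φ⟩⟩
    · rw [h]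
      exact exactOn_empty r
    · rw [h]
      exact exactOn_of_homeomorph_module Φ r,
    ⟨(⟨fun t => t.1.1, fun t => t.2.2⟩ : OpenCover.Refine (goodCover M V) V)⟩⟩

/-- The homeomorphism of a cartesian space with `ℝᵐ`. -/
noncomputable def Cart.homeomorph (c : Cart) : c ≃ₜ E c.dim := c.cartesian.some.toHomeomorph

instance (c : Cart) : PreconnectedSpace c := c.homeomorph.symm.surjective.denseRange.preconnectedSpace
  c.homeomorph.symm.continuous

instance (c : Cart) : Nonempty c := ⟨c.homeomorph.symm 0⟩

/-- The preimage of a good covering of `M` in `c × M`. -/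
lemma isGood_preimage_goodCover (c : Cart) (W : OpenCover M) :
    IsGood ((goodCover M W).preimage (projM c M)).sets := by
  intro q a r
  have e : interSet ((goodCover M W).preimage (projM c M)).sets a =
      Prod.snd ⁻¹' interSet (goodCover M W).sets a := rfl
  rw [e]
  rcases goodCover_inter W a with h | ⟨U, h, ⟨Φ⟩⟩
  · rw [h]
    exact exactOn_empty r
  · rw [h]
    let U' : Opens (c × M) := U.comap (projM c M)
    let Ψ : U' ≃ₜ E c.dim × E M.dim :=
      { toFun := fun p => (c.homeomorph p.1.1, Φ ⟨p.1.2, p.2⟩)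
        invFun := fun y => ⟨(c.homeomorph.symm y.1, Φ.symm y.2), (Φ.symm y.2).2⟩
        left_inv := fun p => by simp
        right_inv := fun y => Prod.ext (by simp) (Φ.apply_symm_apply y.2)
        continuous_toFun := by fun_prop
        continuous_invFun := by fun_prop }
    exact exactOn_of_homeomorph_module Ψ r

/-- The inclusion of the fibre over a point. -/
def sliceMap (c : Cart) (M : Mfd) (x : c) : C(M, c × M) := ⟨fun z => (x, z), by fun_prop⟩

lemma GodCoh.map_slice_map_proj (c : Cart) (x : c) (ξ : GodCoh M q) :
    GodCoh.map (sliceMap c M x) q (GodCoh.map (projM c M) q ξ) = ξ := by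
  rw [← GodCoh.map_comp]
  exact GodCoh.map_id ξ

/-- The covering of `c × M` by products of `c` with good sets of `M` is good, so the class has a
cocycle on it. The cocycle is locally constant along the connected space `c`, so it equals the
pullback of its restriction to one slice. -/
lemma GodCoh.map_proj_surjective (c : Cart) (M : Mfd) (q : ℕ) :
    Function.Surjective (GodCoh.map (projM c M) q) := by
  intro ξ
  let W : OpenCover M := goodCover M ⟨Unit, fun _ => ⊤, fun _ => ⟨(), Set.mem_univ _⟩⟩
  let W' := W.preimage (projM c M)
  obtain ⟨z, hz, hl, hd⟩ := (isGood_preimage_goodCover (M := M) c _).exists_represents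
    (hW := W'.isOpen_sets) (nrm := False) ξ 0
  let x : c := Classical.arbitrary c
  let z' : IdxFam W.ι 0 (q + 1) (M → ℤ) := fun σ y => z σ (x, y)
  obtain ⟨η, hη⟩ := exists_represents (hW := W.isOpen_sets) (nrm := False) W.cover (z := z')
    (fun h => h.elim)
    (fun σ y hy => (sliceMap c M x).continuous.continuousAt.eventually (hl σ (x, y) hy))
    (fun σ y hy => by
      have := hd σ (x, y) hy
      simp only [IdxFam.delta, Finset.sum_apply, Pi.smul_apply] at this ⊢
      exact this)
  refine ⟨η, ?_⟩
  have h1 := hη.map (W' := W'.sets) (hW' := W'.isOpen_sets) (nrm' := False) id (projM c M) id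
    (𝟙 ⦋0⦌) (fun a y hy => hy)
  refine (h1.congr (fun h => h.elim) fun σ p hp => ?_).unique W'.cover hz
  have h2 : IsLocallyConstant fun x' => z σ (x', p.2) := by
    refine (IsLocallyConstant.iff_eventually_eq _).2 fun x' => ?_
    exact (show ContinuousAt (fun x'' : c => (x'', p.2)) x' by fun_prop).eventually
      (hl σ (x', p.2) hp)
  have e : σ.map id (𝟙 ⦋0⦌) = σ := Prod.ext rfl (Category.comp_id _)
  change z (σ.map id (𝟙 ⦋0⦌)) (x, p.2) = z σ (p.1, p.2)
  rw [e]
  exact h2.apply_eq_of_preconnectedSpace x p.1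

lemma GodCoh.map_proj_map_slice (c : Cart) (x : c) (ξ : GodCoh (c × M) q) :
    GodCoh.map (projM c M) q (GodCoh.map (sliceMap c M x) q ξ) = ξ := by
  obtain ⟨η, rfl⟩ := GodCoh.map_proj_surjective c M q ξ
  rw [GodCoh.map_slice_map_proj]

lemma GodCoh.map_slice_bijective (c : Cart) (x : c) :
    Function.Bijective (GodCoh.map (sliceMap c M x) q) :=
  ⟨fun ξ η h => by rw [← GodCoh.map_proj_map_slice c x ξ, h, GodCoh.map_proj_map_slice],
    fun ξ => ⟨_, GodCoh.map_slice_map_proj c x ξ⟩⟩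

end Homotopy

end HigherGerbe

/-! ### The left Kan extension as a presheaf of simplicial abelian groups. -/

namespace HigherGerbe

/-! ### The left Kan extension -/

section KanExtension

open Limits Simplicial

variable {M : Mfd} {n k : ℕ}

/-- The simplices of the left Kan extension are a colimit. -/
noncomputable def grbIsColimit (M : Mfd) (n k : ℕ) (c : BD M) (Δ : SimplexCategoryᵒᵖ) :
    IsColimit (((evaluation SimplexCategoryᵒᵖ (Type 1)).obj Δ).mapCocone
      ((Functor.LeftExtension.mk _ ((GCov.forgetCover M).op.lanUnit.app
        (grbCov M n k ⋙ SSet.uliftFunctor.{1, 0}))).coconeAt (op c))) :=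
  isColimitOfPreserves _ (by
    exact Functor.isPointwiseLeftKanExtensionLeftKanExtensionUnit (GCov.forgetCover M).op
      (grbCov M n k ⋙ SSet.uliftFunctor.{1, 0}) (op c))

/-- A simplex in a larger universe. -/
def upSimplex {A : SSet.{0}} {Δ : SimplexCategoryᵒᵖ} (v : A.obj Δ) :
    (SSet.uliftFunctor.{1, 0}.obj A).obj Δ := ULift.up v

/-- The simplex of gerbes over `c` given by a simplex of gerbes presented over `X` and a morphism
from `c` to the base of `X`. -/
noncomputable def grbMk {c : BD M} (X : GCov M) (f : c ⟶ X.base) {Δ : SimplexCategoryᵒᵖ}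
    (v : ((grbCov M n k).obj (op X)).obj Δ) : ((grb M n k).obj (op c)).obj Δ :=
  ((grb M n k).map f.op).app Δ ((grbUnit n k X).app Δ (upSimplex v))

lemma grbMk_id (X : GCov M) {Δ : SimplexCategoryᵒᵖ} (v : ((grbCov M n k).obj (op X)).obj Δ) :
    grbMk X (𝟙 X.base) v = (grbUnit n k X).app Δ (upSimplex v) := by
  unfold grbMk
  rw [op_id, (grb M n k).map_id]
  rfl

lemma map_grbMk {c : BD M} (X : GCov M) (f : c ⟶ X.base) {Δ Δ' : SimplexCategoryᵒᵖ} (θ : Δ ⟶ Δ')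
    (v : ((grbCov M n k).obj (op X)).obj Δ) :
    ((grb M n k).obj (op c)).map θ (grbMk X f v) =
      grbMk X f (((grbCov M n k).obj (op X)).map θ v) := by
  unfold grbMk
  have h1 := ConcreteCategory.congr_hom ((grbUnit n k X).naturality θ) (upSimplex v)
  have h2 := ConcreteCategory.congr_hom (((grb M n k).map f.op).naturality θ)
    ((grbUnit n k X).app Δ (upSimplex v))
  exact h2.symm.trans (congrArg _ h1.symm)

lemma grbMk_pre {c : BD M} {X Y : GCov M} (P : X ⟶ Y) (f : c ⟶ X.base) {g : c ⟶ Y.base}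
    (hg : f ≫ (GCov.forgetCover M).map P = g) {Δ : SimplexCategoryᵒᵖ}
    (v : ((grbCov M n k).obj (op Y)).obj Δ) :
    grbMk X f (((grbCov M n k).map P.op).app Δ v) = grbMk Y g v := by
  subst hg
  have h1 := ConcreteCategory.congr_hom (NatTrans.congr_app
    (((GCov.forgetCover M).op.lanUnit.app (grbCov M n k ⋙ SSet.uliftFunctor.{1, 0})).naturality
      P.op) Δ) (upSimplex v)
  have h2 : (grbUnit n k X).app Δ (upSimplex (((grbCov M n k).map P.op).app Δ v)) =
      ((grb M n k).map ((GCov.forgetCover M).map P).op).app Δ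
        ((grbUnit n k Y).app Δ (upSimplex v)) := h1
  exact (congrArg (((grb M n k).map f.op).app Δ) h2).trans (ConcreteCategory.congr_hom
    (NatTrans.congr_app ((grb M n k).map_comp ((GCov.forgetCover M).map P).op f.op) Δ)
      ((grbUnit n k Y).app Δ (upSimplex v))).symm

lemma exists_grbMk {c : BD M} {Δ : SimplexCategoryᵒᵖ} (s : ((grb M n k).obj (op c)).obj Δ) :
    ∃ (X : GCov M) (f : c ⟶ X.base) (v : ((grbCov M n k).obj (op X)).obj Δ), grbMk X f v = s := by
  obtain ⟨j, y, hy⟩ := Types.jointly_surjective_of_isColimit (grbIsColimit M n k c Δ) s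
  exact ⟨j.left.unop, j.hom.unop, y.down, hy⟩

/-- Functions on simplices of the Kan extension are compatible functions of presentations `(X, f,
v)`. Sums, negatives, classes and flatness of gerbes are all defined in this way. -/
lemma exists_grbDesc {c : BD M} {Δ : SimplexCategoryᵒᵖ} {A : Type 1}
    (φ : ∀ (X : GCov M) (_ : c ⟶ X.base), ((grbCov M n k).obj (op X)).obj Δ → A)
    (h : ∀ (X Y : GCov M) (P : X ⟶ Y) (f : c ⟶ X.base) (v : ((grbCov M n k).obj (op Y)).obj Δ),
      φ X f (((grbCov M n k).map P.op).app Δ v) = φ Y (f ≫ (GCov.forgetCover M).map P) v) :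
    ∃ ψ : ((grb M n k).obj (op c)).obj Δ → A, ∀ X f v, ψ (grbMk X f v) = φ X f v := by
  let t : Cocone ((CostructuredArrow.proj (GCov.forgetCover M).op (op c) ⋙
      (grbCov M n k ⋙ SSet.uliftFunctor.{1, 0})) ⋙
        (evaluation SimplexCategoryᵒᵖ (Type 1)).obj Δ) :=
    { pt := A
      ι := { app := fun j => ↾(fun y => φ j.left.unop j.hom.unop y.down)
             naturality := fun i j g => by
              refine ConcreteCategory.hom_ext _ _ fun y => ?_
              have e := CostructuredArrow.w g
              have e' : j.hom.unop ≫ (GCov.forgetCover M).map g.left.unop = i.hom.unop :=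
                congrArg Quiver.Hom.unop e
              exact (h _ _ g.left.unop j.hom.unop y.down).trans
                (congrArg (fun F => φ i.left.unop F y.down) e') } }
  refine ⟨(grbIsColimit M n k c Δ).desc t, fun X f v => ?_⟩
  exact ConcreteCategory.congr_hom ((grbIsColimit M n k c Δ).fac t
    (CostructuredArrow.mk (S := (GCov.forgetCover M).op) (Y := op X) f.op)) (upSimplex v)

lemma grbProj_grbMk {l : ℕ} (h : l ≤ k) {c : BD M} (X : GCov M) (f : c ⟶ X.base)
    {Δ : SimplexCategoryᵒᵖ} (v : ((grbCov M n k).obj (op X)).obj Δ) :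
    ((grbProj M n h).app (op c)).app Δ (grbMk X f v) =
      grbMk X f (((grbCovProj M n h).app (op X)).app Δ v) := by
  have h1 := ConcreteCategory.congr_hom (NatTrans.congr_app (NatTrans.congr_app
    ((GCov.forgetCover M).op.lanUnit.naturality
      (Functor.whiskerRight (grbCovProj M n h) SSet.uliftFunctor.{1, 0})) (op X)) Δ) (upSimplex v)
  have h2 : (grbUnit n l X).app Δ (upSimplex (((grbCovProj M n h).app (op X)).app Δ v)) =
      ((grbProj M n h).app (op X.base)).app Δ ((grbUnit n k X).app Δ (upSimplex v)) := h1
  unfold grbMk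
  rw [h2]
  exact ConcreteCategory.congr_hom (NatTrans.congr_app ((grbProj M n h).naturality f.op) Δ)
    ((grbUnit n k X).app Δ (upSimplex v))

end KanExtension

/-! ### Common refinements and addition of gerbes -/

section Addition

open Simplicial

variable {M : Mfd} {n k : ℕ}

open Classical in
/-- The family of coverings in which every patch is repeated twice. -/
noncomputable def GCov.double (W : GCov M) : GCov M where
  base := W.base
  -- Doubling changes no intersection, but leaves room for two different index maps over the same
  -- map of spaces.
  Λ := W.Λ × Bool
  total a := W.total a.1
  down a := W.down a.1
  total_cover p := let ⟨a, ha⟩ := W.total_cover p; ⟨(a, true), ha⟩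
  down_cover x := let ⟨a, ha⟩ := W.down_cover x; ⟨(a, true), ha⟩
  isCartFam a := W.isCartFam a.1
  inter_total s hs := by
    have h := W.inter_total (s.image Prod.fst) (hs.image _)
    rwa [Finset.inf_image, Finset.inf_image] at h
  inter_down s hs := by
    have h := W.inter_down (s.image Prod.fst) (hs.image _)
    rwa [Finset.inf_image] at h

/-- The two inclusions of a family of coverings in its double. -/
noncomputable def GCov.toDouble (W : GCov M) (b : Bool) : W ⟶ W.double :=
  (⟨𝟙 W.base, fun a => (a, b), fun _ _ hp => hp, fun _ _ hx => hx⟩ : GCov.Hom W W.double)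

/-- Two morphisms over the same morphism of `BD M` combine to a morphism from the double. -/
noncomputable def GCov.ofDouble {W X : GCov M} (P Q : W ⟶ X)
    (h : (GCov.forgetCover M).map P = (GCov.forgetCover M).map Q) : W.double ⟶ X :=
  (⟨GCov.Hom.hom (X := W) P, fun a =>
    bif a.2 then GCov.Hom.idx (X := W) P a.1 else GCov.Hom.idx (X := W) Q a.1,
    fun a p hp => by
      rcases a with ⟨a, _ | _⟩
      · have h' : GCov.Hom.hom P = GCov.Hom.hom Q := h
        rw [h']
        exact GCov.Hom.total_mem Q a p hp
      · exact GCov.Hom.total_mem P a p hp,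
    fun a p hp => by
      rcases a with ⟨a, _ | _⟩
      · have h' : GCov.Hom.hom P = GCov.Hom.hom Q := h
        rw [h']
        exact GCov.Hom.down_mem Q a p hp
      · exact GCov.Hom.down_mem P a p hp⟩ : GCov.Hom W.double X)

lemma GCov.toDouble_false_ofDouble {W X : GCov M} (P Q : W ⟶ X)
    (h : (GCov.forgetCover M).map P = (GCov.forgetCover M).map Q) :
    W.toDouble false ≫ GCov.ofDouble P Q h = Q :=
  GCov.Hom.ext h rfl

noncomputable instance (X : GCov M) (n k : ℕ) : AddStr ((grbCov M n k).obj (op X)) :=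
  mapSpaceAddStr X n k

lemma grbCov_map_add {X Y : GCov M} (P : X ⟶ Y) {m : ℕ}
    (v w : ((grbCov M n k).obj (op Y)).obj (op ⦋m⦌)) :
    ((grbCov M n k).map P.op).app (op ⦋m⦌) (v + w) =
      ((grbCov M n k).map P.op).app (op ⦋m⦌) v + ((grbCov M n k).map P.op).app (op ⦋m⦌) w := by
  refine simplexFam_injective ?_
  funext q p T s η
  refine (simplexFam_pre P (v + w) q p T s η).trans ?_
  exact (congrFun (congrFun (congrFun (congrFun (congrFun (simplexFam_add v w) q) p) T)
    (s.push P)) η).trans (congrFun (congrFun (congrFun (congrFun (congrFun (simplexFam_add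
      (((grbCov M n k).map P.op).app (op ⦋m⦌) v) (((grbCov M n k).map P.op).app (op ⦋m⦌) w)) q) p)
        T) s) η).symm

lemma grbCovProj_add {l : ℕ} (h : l ≤ k) (X : GCov M) {m : ℕ}
    (v w : ((grbCov M n k).obj (op X)).obj (op ⦋m⦌)) :
    ((grbCovProj M n h).app (op X)).app (op ⦋m⦌) (v + w) =
      ((grbCovProj M n h).app (op X)).app (op ⦋m⦌) v +
        ((grbCovProj M n h).app (op X)).app (op ⦋m⦌) w := by
  refine simplexFam_injective ?_
  funext q p T s η
  refine (simplexFam_post h (v + w) q p T s η).trans ?_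
  refine Eq.trans ?_ (congrFun (congrFun (congrFun (congrFun (congrFun (simplexFam_add
      (((grbCovProj M n h).app (op X)).app (op ⦋m⦌) v)
        (((grbCovProj M n h).app (op X)).app (op ⦋m⦌) w)) q) p) T) s) η).symm
  refine Eq.trans ?_ (congrArg₂ (· + ·) (simplexFam_post h v q p T s η)
    (simplexFam_post h w q p T s η)).symm
  have e : (fun p => simplexFam (v + w) q p T s η) =
      (fun p => simplexFam v q p T s η) + fun p => simplexFam w q p T s η :=
    funext fun p => congrFun (congrFun (congrFun (congrFun (congrFun (simplexFam_add v w) q) p) T)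
      s) η
  rw [e]
  simp only [delTrunc, Pi.add_apply]
  split_ifs
  · rfl
  · exact (add_zero _).symm

variable [Nonempty M]

lemma exists_grbMk₂ {c : BD M} {Δ Δ' : SimplexCategoryᵒᵖ} {k k' : ℕ}
    (s : ((grb M n k).obj (op c)).obj Δ) (t : ((grb M n k').obj (op c)).obj Δ') :
    ∃ (X : GCov M) (f : c ⟶ X.base) (v : ((grbCov M n k).obj (op X)).obj Δ)
      (w : ((grbCov M n k').obj (op X)).obj Δ'), grbMk X f v = s ∧ grbMk X f w = t := by
  obtain ⟨X, f, v, rfl⟩ := exists_grbMk s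
  obtain ⟨Y, g, w, rfl⟩ := exists_grbMk t
  obtain ⟨W, P, Q, hP, hQ⟩ := GCov.exists_common_refinement f g
  exact ⟨refineCov c W, 𝟙 c, _, _, grbMk_pre P (𝟙 c) ((Category.id_comp _).trans hP) v,
    grbMk_pre Q (𝟙 c) ((Category.id_comp _).trans hQ) w⟩

/-- The sum of two presented gerbes does not depend on the choice of a common refinement. -/
lemma grbMk_add_congr {c : BD M} {X Y Z Z' : GCov M} {f : c ⟶ X.base} {g : c ⟶ Y.base}
    (P : Z ⟶ X) (Q : Z ⟶ Y) (h : c ⟶ Z.base) (P' : Z' ⟶ X) (Q' : Z' ⟶ Y) (h' : c ⟶ Z'.base)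
    (hP : h ≫ (GCov.forgetCover M).map P = f) (hQ : h ≫ (GCov.forgetCover M).map Q = g)
    (hP' : h' ≫ (GCov.forgetCover M).map P' = f) (hQ' : h' ≫ (GCov.forgetCover M).map Q' = g)
    {m : ℕ} (v : ((grbCov M n k).obj (op X)).obj (op ⦋m⦌))
    (w : ((grbCov M n k).obj (op Y)).obj (op ⦋m⦌)) :
    grbMk Z h (((grbCov M n k).map P.op).app _ v + ((grbCov M n k).map Q.op).app _ w) =
      grbMk Z' h' (((grbCov M n k).map P'.op).app _ v + ((grbCov M n k).map Q'.op).app _ w) := by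
  obtain ⟨W, R, R', hR, hR'⟩ := GCov.exists_common_refinement h h'
  have e1 : (GCov.forgetCover M).map (R ≫ P) = (GCov.forgetCover M).map (R' ≫ P') := by
    rw [Functor.map_comp, Functor.map_comp]
    refine (congrArg (· ≫ (GCov.forgetCover M).map P) hR).trans (hP.trans (hP'.symm.trans ?_))
    exact (congrArg (· ≫ (GCov.forgetCover M).map P') hR').symm
  have e2 : (GCov.forgetCover M).map (R ≫ Q) = (GCov.forgetCover M).map (R' ≫ Q') := by
    rw [Functor.map_comp, Functor.map_comp]
    refine (congrArg (· ≫ (GCov.forgetCover M).map Q) hR).trans (hQ.trans (hQ'.symm.trans ?_))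
    exact (congrArg (· ≫ (GCov.forgetCover M).map Q') hR').symm
  -- The two refinements induce the same map of spaces but possibly different index maps. Both are
  -- restrictions of one morphism from the double, along its two inclusions, so both sums are
  -- restrictions of the single simplex `u`.
  let u : ((grbCov M n k).obj (op (refineCov c W).double)).obj (op ⦋m⦌) :=
    ((grbCov M n k).map (GCov.ofDouble _ _ e1).op).app _ v +
      ((grbCov M n k).map (GCov.ofDouble _ _ e2).op).app _ w
  have i1 : ((grbCov M n k).map ((refineCov c W).toDouble true).op).app _ u =
      ((grbCov M n k).map R.op).app _
        (((grbCov M n k).map P.op).app _ v + ((grbCov M n k).map Q.op).app _ w) := by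
    rw [grbCov_map_add, grbCov_map_add]
    rfl
  have i2 : ((grbCov M n k).map ((refineCov c W).toDouble false).op).app _ u =
      ((grbCov M n k).map R'.op).app _
        (((grbCov M n k).map P'.op).app _ v + ((grbCov M n k).map Q'.op).app _ w) := by
    rw [grbCov_map_add, grbCov_map_add]
    have j1 := GCov.toDouble_false_ofDouble _ _ e1
    have j2 := GCov.toDouble_false_ofDouble _ _ e2
    have k1 := congrArg (fun F : refineCov c W ⟶ X => ((grbCov M n k).map F.op).app (op ⦋m⦌) v) j1
    have k2 := congrArg (fun F : refineCov c W ⟶ Y => ((grbCov M n k).map F.op).app (op ⦋m⦌) w) j2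
    exact congrArg₂ (· + ·) k1 k2
  rw [← grbMk_pre R (𝟙 c) ((Category.id_comp _).trans hR),
    ← grbMk_pre R' (𝟙 c) ((Category.id_comp _).trans hR'), ← i1, ← i2,
    grbMk_pre ((refineCov c W).toDouble true) (𝟙 c) (g := 𝟙 c) (Category.id_comp _),
    grbMk_pre ((refineCov c W).toDouble false) (𝟙 c) (g := 𝟙 c) (Category.id_comp _)]

/-- The sum of two presentations is formed on a chosen common refinement. `grbMk_add_congr` makes it
independent of the choice, and `exists_grbDesc` is then applied to one variable at a time. -/
lemma exists_grbAdd (M : Mfd) [Nonempty M] (n k : ℕ) (c : BD M) (m : ℕ) :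
    ∃ ψ : ((grb M n k).obj (op c)).obj (op ⦋m⦌) → ((grb M n k).obj (op c)).obj (op ⦋m⦌) →
      ((grb M n k).obj (op c)).obj (op ⦋m⦌), ∀ (X : GCov M) (f : c ⟶ X.base)
        (v w : ((grbCov M n k).obj (op X)).obj (op ⦋m⦌)),
        ψ (grbMk X f v) (grbMk X f w) = grbMk X f (v + w) := by
  choose W P Q hP hQ using fun (X Y : GCov M) (f : c ⟶ X.base) (g : c ⟶ Y.base) =>
    GCov.exists_common_refinement f g
  let φ : ∀ (X : GCov M) (_ : c ⟶ X.base) (Y : GCov M) (_ : c ⟶ Y.base),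
      ((grbCov M n k).obj (op X)).obj (op ⦋m⦌) → ((grbCov M n k).obj (op Y)).obj (op ⦋m⦌) →
      ((grb M n k).obj (op c)).obj (op ⦋m⦌) := fun X f Y g v w =>
    grbMk (refineCov c (W X Y f g)) (𝟙 c) (((grbCov M n k).map (P X Y f g).op).app _ v +
      ((grbCov M n k).map (Q X Y f g).op).app _ w)
  have hφ : ∀ {X Y Z : GCov M} {f : c ⟶ X.base} {g : c ⟶ Y.base} (R : Z ⟶ X) (S : Z ⟶ Y)
      (h : c ⟶ Z.base) (_ : h ≫ (GCov.forgetCover M).map R = f)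
      (_ : h ≫ (GCov.forgetCover M).map S = g) (v : ((grbCov M n k).obj (op X)).obj (op ⦋m⦌))
      (w : ((grbCov M n k).obj (op Y)).obj (op ⦋m⦌)), φ X f Y g v w =
        grbMk Z h (((grbCov M n k).map R.op).app _ v + ((grbCov M n k).map S.op).app _ w) :=
    fun R S h hR hS v w => grbMk_add_congr _ _ _ _ _ _ ((Category.id_comp _).trans (hP _ _ _ _))
      ((Category.id_comp _).trans (hQ _ _ _ _)) hR hS v w
  have key : ∀ (X : GCov M) (f : c ⟶ X.base) (v : ((grbCov M n k).obj (op X)).obj (op ⦋m⦌)),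
      ∃ ψ : ((grb M n k).obj (op c)).obj (op ⦋m⦌) → ((grb M n k).obj (op c)).obj (op ⦋m⦌),
        ∀ Y g w, ψ (grbMk Y g w) = φ X f Y g v w := by
    intro X f v
    refine exists_grbDesc (fun Y g w => φ X f Y g v w) fun Y Y' R g w => ?_
    exact (hφ (P X Y f g) (Q X Y f g ≫ R) (𝟙 c) ((Category.id_comp _).trans (hP _ _ _ _))
      ((Category.id_comp _).trans ((Functor.map_comp _ _ _).trans
        (congrArg (· ≫ (GCov.forgetCover M).map R) (hQ X Y f g)))) v w).symm
  choose ψ hψ using key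
  obtain ⟨Ψ, hΨ⟩ := exists_grbDesc ψ fun X X' R f v => by
    funext t
    obtain ⟨Y, g, w, rfl⟩ := exists_grbMk t
    rw [hψ, hψ]
    exact (hφ (P X Y f g ≫ R) (Q X Y f g) (𝟙 c) ((Category.id_comp _).trans
      ((Functor.map_comp _ _ _).trans (congrArg (· ≫ (GCov.forgetCover M).map R) (hP X Y f g))))
      ((Category.id_comp _).trans (hQ _ _ _ _)) v w).symm
  refine ⟨Ψ, fun X f v w => ?_⟩
  rw [hΨ, hψ, hφ (𝟙 X) (𝟙 X) f (Category.comp_id _) (Category.comp_id _)]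
  have e : ∀ v : ((grbCov M n k).obj (op X)).obj (op ⦋m⦌),
      ((grbCov M n k).map (𝟙 X : X ⟶ X).op).app _ v = v := fun v => by
    rw [op_id, (grbCov M n k).map_id]
    rfl
  rw [e, e]

/-- Addition of gerbes. -/
noncomputable def grbAdd (c : BD M) (m : ℕ) (s t : ((grb M n k).obj (op c)).obj (op ⦋m⦌)) :
    ((grb M n k).obj (op c)).obj (op ⦋m⦌) := (exists_grbAdd M n k c m).choose s t

lemma grbAdd_grbMk {c : BD M} {m : ℕ} (X : GCov M) (f : c ⟶ X.base)
    (v w : ((grbCov M n k).obj (op X)).obj (op ⦋m⦌)) :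
    grbAdd c m (grbMk X f v) (grbMk X f w) = grbMk X f (v + w) :=
  (exists_grbAdd M n k c m).choose_spec X f v w

end Addition

end HigherGerbe

namespace HigherGerbe

/-! ### Fibrancy -/

section Fibrancy

open Simplicial

variable {M : Mfd} {n k : ℕ}

lemma grbCov_map_zero {X Y : GCov M} (P : X ⟶ Y) {m : ℕ} :
    ((grbCov M n k).map P.op).app (op ⦋m⦌) (0 : ((grbCov M n k).obj (op Y)).obj (op ⦋m⦌)) = 0 :=
  (AddMonoidHom.mk' (fun v : ((grbCov M n k).obj (op Y)).obj (op ⦋m⦌) =>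
    ((grbCov M n k).map P.op).app (op ⦋m⦌) v) (grbCov_map_add P)).map_zero

lemma grbCov_map_neg {X Y : GCov M} (P : X ⟶ Y) {m : ℕ}
    (v : ((grbCov M n k).obj (op Y)).obj (op ⦋m⦌)) :
    ((grbCov M n k).map P.op).app (op ⦋m⦌) (-v) = -((grbCov M n k).map P.op).app (op ⦋m⦌) v :=
  (AddMonoidHom.mk' (fun v : ((grbCov M n k).obj (op Y)).obj (op ⦋m⦌) =>
    ((grbCov M n k).map P.op).app (op ⦋m⦌) v) (grbCov_map_add P)).map_neg v

lemma exists_grbNeg (M : Mfd) (n k : ℕ) (c : BD M) (m : ℕ) :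
    ∃ ψ : ((grb M n k).obj (op c)).obj (op ⦋m⦌) → ((grb M n k).obj (op c)).obj (op ⦋m⦌),
      ∀ (X : GCov M) (f : c ⟶ X.base) (v : ((grbCov M n k).obj (op X)).obj (op ⦋m⦌)),
        ψ (grbMk X f v) = grbMk X f (-v) :=
  exists_grbDesc (fun X f v => grbMk X f (-v)) fun X _ P f v =>
    (congrArg (grbMk X f) (grbCov_map_neg P v).symm).trans (grbMk_pre P f rfl (-v))

section Nonempty

variable [Nonempty M]

lemma exists_grbMk₃ {c : BD M} {Δ : SimplexCategoryᵒᵖ} (s t u : ((grb M n k).obj (op c)).obj Δ) :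
    ∃ (X : GCov M) (f : c ⟶ X.base) (x y z : ((grbCov M n k).obj (op X)).obj Δ),
      grbMk X f x = s ∧ grbMk X f y = t ∧ grbMk X f z = u := by
  obtain ⟨X, f, v, w, rfl, rfl⟩ := exists_grbMk₂ s t
  obtain ⟨Y, g, z, rfl⟩ := exists_grbMk u
  obtain ⟨W, P, Q, hP, hQ⟩ := GCov.exists_common_refinement f g
  exact ⟨refineCov c W, 𝟙 c, _, _, _, grbMk_pre P (𝟙 c) ((Category.id_comp _).trans hP) v,
    grbMk_pre P (𝟙 c) ((Category.id_comp _).trans hP) w,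
    grbMk_pre Q (𝟙 c) ((Category.id_comp _).trans hQ) z⟩

lemma grbMk_zero_congr {c : BD M} {X Y : GCov M} (f : c ⟶ X.base) (g : c ⟶ Y.base) (m : ℕ) :
    grbMk X f (0 : ((grbCov M n k).obj (op X)).obj (op ⦋m⦌)) = grbMk Y g 0 := by
  obtain ⟨W, P, Q, hP, hQ⟩ := GCov.exists_common_refinement f g
  rw [← grbMk_pre P (𝟙 c) ((Category.id_comp _).trans hP),
    ← grbMk_pre Q (𝟙 c) ((Category.id_comp _).trans hQ), grbCov_map_zero, grbCov_map_zero]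

/-- The open covering with the whole space as its only member. -/
def trivialCover (Y : Type) [TopologicalSpace Y] : OpenCover Y :=
  ⟨Unit, fun _ => ⊤, fun _ => ⟨(), Set.mem_univ _⟩⟩

variable (n k) in
/-- The trivial gerbe. -/
noncomputable def grbZero (c : BD M) (m : ℕ) : ((grb M n k).obj (op c)).obj (op ⦋m⦌) :=
  grbMk (refineCov c (trivialCover _)) (𝟙 c) 0

lemma grbZero_eq {c : BD M} {X : GCov M} (f : c ⟶ X.base) (m : ℕ) :
    grbZero n k c m = grbMk X f 0 :=
  grbMk_zero_congr (X := refineCov c (trivialCover _)) (𝟙 c) f m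

/-- The abelian group of simplices of gerbes. -/
@[reducible]
noncomputable def grbGroup (n k : ℕ) (c : BD M) (m : ℕ) :
    AddCommGroup (((grb M n k).obj (op c)).obj (op ⦋m⦌)) where
  add := grbAdd c m
  zero := grbZero n k c m
  neg := (exists_grbNeg M n k c m).choose
  nsmul := @nsmulRec _ ⟨grbZero n k c m⟩
    ⟨grbAdd c m⟩
  zsmul := @zsmulRec _ ⟨grbZero n k c m⟩
    ⟨grbAdd c m⟩ ⟨(exists_grbNeg M n k c m).choose⟩
    (@nsmulRec _ ⟨grbZero n k c m⟩
      ⟨grbAdd c m⟩)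
  add_assoc s t u := by
    obtain ⟨X, f, x, y, z, rfl, rfl, rfl⟩ := exists_grbMk₃ s t u
    change grbAdd c m (grbAdd c m _ _) _ = grbAdd c m _ (grbAdd c m _ _)
    rw [grbAdd_grbMk, grbAdd_grbMk, grbAdd_grbMk, grbAdd_grbMk, add_assoc]
  zero_add s := by
    obtain ⟨X, f, x, rfl⟩ := exists_grbMk s
    change grbAdd c m (grbZero n k c m) _ = _
    rw [grbZero_eq f, grbAdd_grbMk, zero_add]
  add_zero s := by
    obtain ⟨X, f, x, rfl⟩ := exists_grbMk s
    change grbAdd c m _ (grbZero n k c m) = _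
    rw [grbZero_eq f, grbAdd_grbMk, add_zero]
  neg_add_cancel s := by
    obtain ⟨X, f, x, rfl⟩ := exists_grbMk s
    change grbAdd c m ((exists_grbNeg M n k c m).choose _) _ = grbZero n k c m
    rw [(exists_grbNeg M n k c m).choose_spec, grbZero_eq f, grbAdd_grbMk,
      neg_add_cancel]
  add_comm s t := by
    obtain ⟨X, f, x, y, rfl, rfl⟩ := exists_grbMk₂ s t
    change grbAdd c m _ _ = grbAdd c m _ _
    rw [grbAdd_grbMk, grbAdd_grbMk, add_comm]

noncomputable instance (n k : ℕ) (c : BD M) : AddStr ((grb M n k).obj (op c)) where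
  grp Δ := grbGroup n k c Δ.unop.len
  map_add {Δ Δ'} θ s t := by
    obtain ⟨X, f, x, y, rfl, rfl⟩ := exists_grbMk₂ s t
    have h1 : ((grb M n k).obj (op c)).map θ (grbAdd c Δ.unop.len (grbMk X f x) (grbMk X f y)) =
        grbAdd c Δ'.unop.len (((grb M n k).obj (op c)).map θ (grbMk X f x))
          (((grb M n k).obj (op c)).map θ (grbMk X f y)) := by
      rw [map_grbMk, map_grbMk]
      refine (congrArg _ (grbAdd_grbMk (m := Δ.unop.len) X f x y)).trans ?_
      refine (map_grbMk X f θ _).trans (Eq.trans ?_ (grbAdd_grbMk (m := Δ'.unop.len) X f _ _).symm)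
      exact congrArg (grbMk X f) (AddStr.map_add (Y := (grbCov M n k).obj (op X)) θ x y)
    exact h1

lemma grbProj_add {l : ℕ} (h : l ≤ k) (c : BD M) (m : ℕ)
    (s t : ((grb M n k).obj (op c)).obj (op ⦋m⦌)) :
    ((grbProj M n h).app (op c)).app (op ⦋m⦌) (s + t) =
      ((grbProj M n h).app (op c)).app (op ⦋m⦌) s +
        ((grbProj M n h).app (op c)).app (op ⦋m⦌) t := by
  obtain ⟨X, f, x, y, rfl, rfl⟩ := exists_grbMk₂ s t
  refine (congrArg _ (grbAdd_grbMk X f x y)).trans ?_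
  rw [grbProj_grbMk, grbProj_grbMk, grbProj_grbMk, grbCovProj_add]
  exact (grbAdd_grbMk X f _ _).symm

end Nonempty

lemma grbProj_surjective {l : ℕ} (h : l ≤ k) (hk : k ≤ n + 1) (c : BD M) (m : ℕ) :
    Function.Surjective (((grbProj M n h).app (op c)).app (op ⦋m⦌)) := by
  intro s
  obtain ⟨X, f, x, rfl⟩ := exists_grbMk s
  obtain ⟨y, rfl⟩ := surjective_post (X := X) h hk m x
  exact ⟨grbMk X f y, grbProj_grbMk h X f y⟩

/-- The nonempty space `c` is covered by patches over which the fibres are nonempty. So for empty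
`M` there are no coverings, and the Kan extension has no simplices; this case is treated apart. -/
lemma GCov.nonempty (X : GCov M) : Nonempty M := by
  let x : X.base.cart := Classical.arbitrary _
  obtain ⟨a, ha⟩ := X.down_cover x
  obtain ⟨z, -⟩ := X.exists_mem_total ha
  exact ⟨z⟩

lemma nonempty_of_grb {c : BD M} {Δ : SimplexCategoryᵒᵖ} (s : ((grb M n k).obj (op c)).obj Δ) :
    Nonempty M := (exists_grbMk s).choose.nonempty

-- A horn has at least one face, so it admits no map to a simplicial set without simplices, and
-- there is no lifting problem to solve.
open SSet.modelCategoryQuillen in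
lemma fibration_of_isEmpty {Z W : SSet.{1}} (p : Z ⟶ W) (h : ∀ n : ℕ, IsEmpty (Z _⦋n⦌)) :
    HomotopicalAlgebra.Fibration p := by
  rw [fibration_iff]
  intro A B g hf
  simp only [J, MorphismProperty.iSup_iff] at hf
  obtain ⟨n, ⟨k⟩⟩ := hf
  refine ⟨fun {t b} sq => ?_⟩
  obtain ⟨j, hj⟩ := exists_ne k
  exact ((h n).false (SSet.yonedaEquiv (SSet.horn.ι k j hj ≫ t))).elim

theorem isProjFibrant_grb (M : Mfd) (n k : ℕ) : IsProjFibrant (grb M n k) := by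
  intro c
  by_cases h : Nonempty M
  · exact AddStr.kanComplex _
  · rw [SSet.KanComplex]
    refine fibration_of_isEmpty _ fun m => ⟨fun s => h (nonempty_of_grb s)⟩

theorem isProjFibration_grbProj (M : Mfd) (n : ℕ) {l k : ℕ} (h : l ≤ k) (hk : k ≤ n + 1) :
    IsProjFibration (grbProj M n h) := by
  intro c
  by_cases h' : Nonempty M
  · exact AddStr.fibration _ (grbProj_add h c) (grbProj_surjective h hk c)
  · exact fibration_of_isEmpty _ fun m => ⟨fun s => h' (nonempty_of_grb s)⟩

end Fibrancy

end HigherGerbe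

/-! ### Classification by the exponential sequence. -/

namespace HigherGerbe

/-! ### Values of families at points -/

section Points

open Simplicial Topology

variable {M : Mfd} {n k m q : ℕ} {X : GCov M}

/-- The patches of a family of coverings. -/
def GCov.patch (X : GCov M) (a : X.Λ) : Set (X.base.cart × M) := X.total a

lemma GCov.isOpen_patch (X : GCov M) (a : X.Λ) : IsOpen (X.patch a) := (X.total a).isOpen

lemma GCov.exists_mem_patch (X : GCov M) : ∀ p, ∃ a, p ∈ X.patch a := X.total_cover

lemma GCov.isGood_patch (X : GCov M) : IsGood X.patch := X.isGood

/-- A point of an intersection of patches as a simplex of the Čech nerve. -/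
def pointOf (a : Fin (q + 1) → X.Λ) (p : X.base.cart × M) (hp : p ∈ interSet X.patch a) :
    CechSimplex X ⟨0, 0⟩ ⦋q⦌ := pointSimplex a ⟨p, hp⟩

/-- The inclusion of a point. -/
noncomputable def CartFam.point (T : CartFam) (t : T.Total) : (⟨0, 0⟩ : CartFam) ⟶ T :=
  (⟨fun _ => t, fun _ => t.1, contDiff_const, contDiff_const, fun _ => rfl⟩ : CartFam.Hom _ _)

lemma CechSimplex.mem_interSet {T : CartFam} (s : CechSimplex X T ⦋q⦌) (t : T.Total) :
    s.total t ∈ interSet X.patch s.idx := fun i => s.total_mem i t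

lemma CechSimplex.res_point {T : CartFam} (s : CechSimplex X T ⦋q⦌) (t : T.Total) :
    s.res (T.point t) = pointOf s.idx (s.total t) (s.mem_interSet t) :=
  CechSimplex.ext rfl (funext fun _ => (s.comm t).symm) rfl

variable {A : CartFam → Type} [∀ T, AddCommGroup (A T)] {B : Type} [AddCommGroup B]

open Classical in
/-- The values of a family at the points of the intersections of the patches. -/
noncomputable def pointFam (ev : A ⟨0, 0⟩ →+ B) (w : GFam A X m q) :
    IdxFam X.Λ m q (X.base.cart × M → B) := fun σ p =>
  if hp : p ∈ interSet X.patch σ.1 then ev (w _ (pointOf σ.1 p hp) σ.2) else 0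

lemma pointFam_apply (ev : A ⟨0, 0⟩ →+ B) (w : GFam A X m q) (σ : IdxSimplex X.Λ m q)
    {p : X.base.cart × M} (hp : p ∈ interSet X.patch σ.1) :
    pointFam ev w σ p = ev (w _ (pointOf σ.1 p hp) σ.2) := dif_pos hp

lemma pointFam_delta (ev : A ⟨0, 0⟩ →+ B) (w : GFam A X m q) (σ : IdxSimplex X.Λ m (q + 1))
    {p : X.base.cart × M} (hp : p ∈ interSet X.patch σ.1) :
    IdxFam.delta (pointFam ev w) σ p = pointFam ev (famDelta w) σ p := by
  rw [pointFam_apply _ _ _ hp, famDelta, map_sum, IdxFam.delta, Finset.sum_apply]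
  refine Finset.sum_congr rfl fun i _ => ?_
  rw [Pi.smul_apply, map_zsmul, pointFam_apply _ _ _ (interSet_face X.patch σ i hp)]
  rfl

lemma pointFam_add (ev : A ⟨0, 0⟩ →+ B) (w w' : GFam A X m q) :
    pointFam ev (w + w') = pointFam ev w + pointFam ev w' := by
  funext σ p
  by_cases hp : p ∈ interSet X.patch σ.1
  · simp only [Pi.add_apply, pointFam_apply _ _ _ hp, map_add]
  · simp [pointFam, hp]

lemma pointFam_degenerate (ev : A ⟨0, 0⟩ →+ B) {w : GFam A X m q} (hw : FamNormalized w)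
    {σ : IdxSimplex X.Λ m q} (hσ : σ.Degenerate) : pointFam ev w σ = 0 := by
  cases q with
  | zero => exact hσ.elim
  | succ q =>
    obtain ⟨i, h1, h2⟩ := hσ
    funext p
    by_cases hp : p ∈ interSet X.patch σ.1
    · rw [pointFam_apply _ _ _ hp, hw _ _ _ i h1 h2, map_zero]
      rfl
    · simp [pointFam, hp]

/-- Evaluation of circle valued functions on a point. -/
noncomputable def evalCircle : Coeff ⟨0, 0⟩ 0 →+ Additive Circle :=
  AddMonoidHom.mk' (fun g => Additive.ofMul
    ((Additive.toMul (show Additive (u1Fun ⟨0, 0⟩) from g)).1 (0, 0))) fun _ _ => rfl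

/-- The transition functions of a family. -/
noncomputable def circFam (g : Fam X m q 0) :
    IdxFam X.Λ m q (X.base.cart × M → Additive Circle) :=
  pointFam (A := fun T => Coeff T 0) evalCircle g

/-- The underlying function of a section of the coefficients of form degree zero. -/
noncomputable def coeffFun {T : CartFam} (g : Coeff T 0) (t : T.Total) : Circle :=
  (Additive.toMul (show Additive (u1Fun T) from g)).1 t

lemma coeffFun_ext {T : CartFam} {g g' : Coeff T 0} (h : ∀ t, coeffFun g t = coeffFun g' t) :
    g = g' :=
  Additive.toMul.injective (Subtype.ext (funext h))

lemma contDiff_coeffFun {T : CartFam} (g : Coeff T 0) :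
    ContDiff ℝ ∞ fun t => (coeffFun g t : ℂ) :=
  (Additive.toMul (show Additive (u1Fun T) from g)).2

/-- Naturality along inclusions of points recovers a family from its values at points. This connects
sheaf data on the Čech nerve with cochains made of functions on `c × M`. -/
lemma CoeffNatural.circFam_apply {g : Fam X m q 0} (hg : CoeffNatural g) {T : CartFam}
    (s : CechSimplex X T ⦋q⦌) (θ : ⦋q⦌ ⟶ ⦋m⦌) (t : T.Total) :
    circFam g (s.idx, θ) (s.total t) = Additive.ofMul (coeffFun (g T s θ) t) := by
  have h := hg (T.point t) s θ
  rw [s.res_point] at h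
  rw [circFam, pointFam_apply _ _ _ (s.mem_interSet t), h]
  rfl

/-- The normalized exponential map. -/
noncomputable def expHom : ℝ →+ Additive Circle :=
  AddMonoidHom.mk' (fun r => Additive.ofMul (Circle.exp (2 * Real.pi * r))) fun r r' => by
    rw [mul_add, Circle.exp_add]
    rfl

lemma expHom_eq_zero_iff {r : ℝ} : expHom r = 0 ↔ ∃ z : ℤ, (z : ℝ) = r := by
  have h : expHom r = 0 ↔ Circle.exp (2 * Real.pi * r) = 1 := Iff.rfl
  rw [h, Circle.exp_eq_one]
  refine exists_congr fun z => ?_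
  have := Real.pi_pos
  constructor
  · intro h
    have h2 : 2 * Real.pi * ((z : ℝ) - r) = 0 := by linarith
    have := (mul_eq_zero.1 h2).resolve_left (by positivity)
    linarith
  · rintro rfl
    ring

/-- Near `x`, continuity keeps `2π (f - f x)` inside `(-π, π)`, so `f` is `f x` plus a multiple of
the imaginary part of a principal logarithm of the smooth exponential. -/
lemma contDiff_of_exp {F : Type} [NormedAddCommGroup F] [NormedSpace ℝ F] {f : F → ℝ}
    (hf : Continuous f)
    (hg : ContDiff ℝ ∞ fun t => (Circle.exp (2 * Real.pi * f t) : ℂ)) : ContDiff ℝ ∞ f := by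
  rw [contDiff_iff_contDiffAt]
  intro x
  have hlog : ContDiffAt ℝ ∞ Complex.log
      ((Circle.exp (2 * Real.pi * f x) : ℂ) * (Circle.exp (2 * Real.pi * f x) : ℂ)⁻¹) := by
    rw [mul_inv_cancel₀ (Circle.coe_ne_zero _)]
    exact (Complex.contDiffAt_log (n := ∞) Complex.one_mem_slitPlane).restrict_scalars ℝ
  have h1 : ContDiffAt ℝ ∞ (fun t => f x + (2 * Real.pi)⁻¹ * (Complex.log
      ((Circle.exp (2 * Real.pi * f t) : ℂ) * (Circle.exp (2 * Real.pi * f x) : ℂ)⁻¹)).im) x :=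
    contDiffAt_const.add (contDiffAt_const.mul (Complex.imCLM.contDiff.contDiffAt.comp x
      (ContDiffAt.comp (f := fun t => (Circle.exp (2 * Real.pi * f t) : ℂ) *
        (Circle.exp (2 * Real.pi * f x) : ℂ)⁻¹) x hlog (hg.contDiffAt.mul contDiffAt_const))))
  refine h1.congr_of_eventuallyEq ?_
  have hev : ∀ᶠ t in 𝓝 x, abs (2 * Real.pi * (f t - f x)) < Real.pi := by
    have hc : Continuous fun t => abs (2 * Real.pi * (f t - f x)) := by fun_prop
    refine hc.continuousAt.eventually (Iio_mem_nhds ?_)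
    simpa using Real.pi_pos
  filter_upwards [hev] with t ht
  have e : (Circle.exp (2 * Real.pi * f t) : ℂ) * (Circle.exp (2 * Real.pi * f x) : ℂ)⁻¹ =
      Complex.exp ((2 * Real.pi * (f t - f x) : ℝ) * Complex.I) := by
    rw [← Circle.coe_inv, ← Circle.coe_mul, ← Circle.exp_neg, ← Circle.exp_add, Circle.coe_exp]
    congr 3
    ring
  rw [e, Complex.log_exp (by simpa using (abs_lt.1 ht).1) (by simpa using (abs_lt.1 ht).2.le)]
  have := Real.pi_pos
  simp only [Complex.mul_im, Complex.ofReal_re, Complex.I_im, Complex.ofReal_im, Complex.I_re,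
    mul_one, mul_zero, add_zero]
  field_simp
  ring

lemma isSimplyConnected_univ (F : Type) [TopologicalSpace F] [ContractibleSpace F] :
    IsSimplyConnected (Set.univ : Set F) := by
  have : ContractibleSpace (Set.univ : Set F) := (Homeomorph.Set.univ F).contractibleSpace
  exact inferInstanceAs (SimplyConnectedSpace (Set.univ : Set F))

/-- A circle valued function on a vector space has a logarithm. -/
lemma exists_continuous_log {F : Type} [NormedAddCommGroup F] [NormedSpace ℝ F] {g : F → Circle}
    (hg : Continuous g) : ∃ f : F → ℝ, Continuous f ∧ ∀ t, Circle.exp (2 * Real.pi * f t) = g t := by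
  obtain ⟨f, hf, hfg⟩ := Complex.exists_continuousOn_eqOn_exp_comp (X := F) (U := Set.univ)
    (isSimplyConnected_univ F) isOpen_univ (g := fun t => (g t : ℂ))
    (continuous_subtype_val.comp hg).continuousOn (by
      rintro ⟨t, -, ht⟩
      exact Circle.coe_ne_zero _ ht)
  have hf' : Continuous f := continuousOn_univ.1 hf
  refine ⟨fun t => (2 * Real.pi)⁻¹ * (f t).im, by fun_prop, fun t => ?_⟩
  have h1 : Complex.exp (f t) = g t := hfg (Set.mem_univ t)
  have h2 : Real.exp (f t).re = 1 := by
    rw [← Complex.norm_exp, h1, Circle.norm_coe]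
  have h3 : (f t).re = 0 := by simpa using h2
  have := Real.pi_pos
  apply Circle.ext
  rw [Circle.coe_exp, ← h1]
  congr 1
  rw [mul_inv_cancel_left₀ (by positivity)]
  apply Complex.ext <;> simp [h3]

open Classical in
/-- The intersections of the patches are empty or simplices of the Čech nerve. -/
lemma GCov.exists_universal (X : GCov M) (a : Fin (q + 1) → X.Λ) :
    interSet X.patch a = ∅ ∨ ∃ (T : CartFam) (u : CechSimplex X T ⦋q⦌)
      (κ : interSet X.patch a → T.Total), u.idx = a ∧ Continuous κ ∧
        ∀ p, u.total (κ p) = p.1 := by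
  have e : interSet X.patch a = ((Finset.univ.image a).inf X.total : _) :=
    interSet_eq_inf X.total a
  rcases X.inter_total (Finset.univ.image a) (Finset.univ_nonempty.image a) with h | h
  · left
    rw [e, h]
    rfl
  · right
    obtain ⟨h0, j, Φ, φ, hΦ⟩ := h
    refine ⟨⟨X.base.cart.dim, j⟩,
      { total := fun t => (Φ.symm t).1
        down := fun x => (φ.symm x).1
        contMDiff_total := contMDiff_subtype_val.comp Φ.symm.contMDiff
        contMDiff_down := contMDiff_subtype_val.comp φ.symm.contMDiff
        comm := fun t => ?_
        idx := a
        total_mem := fun i t => (mem_finsetInf _ _ _).1 (Φ.symm t).2 _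
          (Finset.mem_image_of_mem a (Finset.mem_univ i))
        down_mem := fun i x => (mem_finsetInf _ _ _).1 (φ.symm x).2 _
          (Finset.mem_image_of_mem a (Finset.mem_univ i)) },
      fun p => Φ ⟨p.1, e.le p.2⟩, rfl, ?_, fun p => ?_⟩
    · have h1 := hΦ (Φ.symm t) (h0 _ (Φ.symm t).2)
      rw [Φ.apply_symm_apply] at h1
      rw [h1, φ.symm_apply_apply]
    · exact Φ.continuous.comp (by fun_prop)
    · change (Φ.symm (Φ _)).1 = p.1
      rw [Φ.symm_apply_apply]

/-- A nonempty intersection is a copy of some `ℝᵐ × ℝʲ`, where circle-valued functions have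
logarithms; the coordinates `κ` transport the logarithm to the intersection. -/
lemma CoeffNatural.exists_log {g : Fam X m q 0} (hg : CoeffNatural g) (σ : IdxSimplex X.Λ m q) :
    ∃ h : X.base.cart × M → ℝ, ContinuousOn h (interSet X.patch σ.1) ∧
      ∀ p ∈ interSet X.patch σ.1, expHom (h p) = circFam g σ p := by
  classical
  obtain ⟨a, θ⟩ := σ
  rcases X.exists_universal a with h | ⟨T, u, κ, rfl, hκ, hu⟩
  · exact ⟨0, by rw [h]; exact continuousOn_empty _, fun p hp => (h ▸ hp : p ∈ (∅ : Set _)).elim⟩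
  · obtain ⟨f, hf, hfg⟩ := exists_continuous_log (g := coeffFun (g T u θ))
      (Topology.IsInducing.subtypeVal.continuous_iff.2 (contDiff_coeffFun _).continuous)
    refine ⟨fun p => if hp : p ∈ interSet X.patch u.idx then f (κ ⟨p, hp⟩) else 0, ?_,
      fun p hp => ?_⟩
    · rw [continuousOn_iff_continuous_domRestrict]
      refine (hf.comp hκ).congr fun p => ?_
      exact (dif_pos (c := p.1 ∈ interSet X.patch u.idx) (t := fun hp => f (κ ⟨p.1, hp⟩))
        (e := fun _ => 0) p.2).symm
    · refine (congrArg expHom (dif_pos (c := p ∈ interSet X.patch u.idx) hp)).trans ?_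
      have h1 := hg.circFam_apply u θ (κ ⟨p, hp⟩)
      rw [hu] at h1
      rw [h1, ← hfg]
      rfl

end Points

end HigherGerbe

namespace HigherGerbe

/-! ### The Bockstein class -/

section Bockstein

open Simplicial Topology

variable {M : Mfd} {n k m m' q : ℕ} {X X' : GCov M}

/-- Continuous logarithms of the transition functions of a family. -/
structure IsLog (g : Fam X m q 0) (h : IdxFam X.Λ m q (X.base.cart × M → ℝ)) : Prop where
  continuousOn : ∀ σ, ContinuousOn (h σ) (interSet X.patch σ.1)
  exp_eq : ∀ σ, ∀ p ∈ interSet X.patch σ.1, expHom (h σ p) = circFam g σ p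

lemma exists_isLog {g : Fam X m q 0} (hg : CoeffNatural g) (hn : FamNormalized g) :
    ∃ h, IsLog g h ∧ h.Normalized := by
  classical
  choose h hh he using hg.exists_log
  -- On degenerate simplices the transition functions are trivial, so zero is a logarithm there and
  -- the choice can be normalized.
  refine ⟨fun σ => if σ.Degenerate then 0 else h σ, ⟨fun σ => ?_, fun σ p hp => ?_⟩,
    fun σ hσ => if_pos hσ⟩
  · split_ifs
    · exact continuousOn_const
    · exact hh σ
  · split_ifs with hσ
    · rw [circFam, pointFam_degenerate (A := fun T => Coeff T 0) evalCircle hn hσ]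
      exact expHom.map_zero
    · exact he σ p hp

lemma IsLog.add {g g' : Fam X m q 0} {h h' : IdxFam X.Λ m q (X.base.cart × M → ℝ)}
    (hg : IsLog g h) (hg' : IsLog g' h') : IsLog (g + g') (h + h') where
  continuousOn σ := (hg.continuousOn σ).add (hg'.continuousOn σ)
  exp_eq σ p hp := by
    rw [circFam, pointFam_add (A := fun T => Coeff T 0)]
    change expHom (h σ p + h' σ p) = circFam g σ p + circFam g' σ p
    rw [map_add, hg.exp_eq σ p hp, hg'.exp_eq σ p hp]

lemma IdxFam.continuousOn_delta {h : IdxFam X.Λ m q (X.base.cart × M → ℝ)}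
    (hc : ∀ σ, ContinuousOn (h σ) (interSet X.patch σ.1)) (σ : IdxSimplex X.Λ m (q + 1)) :
    ContinuousOn (IdxFam.delta h σ) (interSet X.patch σ.1) := by
  have : IdxFam.delta h σ = fun p => ∑ i : Fin (q + 2), (-1 : ℤ) ^ (i : ℕ) • h (σ.face i) p := by
    funext p
    simp [IdxFam.delta]
  rw [this]
  refine continuousOn_finsetSum _ fun i _ => ?_
  have h1 := (hc (σ.face i)).mono (interSet_face X.patch σ i)
  simp only [zsmul_eq_mul]
  exact continuousOn_const.mul h1

lemma IsLog.expHom_delta {g : Fam X m q 0} {h : IdxFam X.Λ m q (X.base.cart × M → ℝ)}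
    (hg : IsLog g h) (hd : famDelta g = 0) (σ : IdxSimplex X.Λ m (q + 1))
    {p : X.base.cart × M} (hp : p ∈ interSet X.patch σ.1) : expHom (IdxFam.delta h σ p) = 0 := by
  have h1 := pointFam_delta (A := fun T => Coeff T 0) evalCircle g σ hp
  rw [hd, pointFam_apply _ _ _ hp] at h1
  refine Eq.trans ?_ (h1.trans (map_zero _))
  simp only [IdxFam.delta, Finset.sum_apply, Pi.smul_apply, map_sum, map_zsmul]
  exact Finset.sum_congr rfl fun i _ => congrArg _
    (hg.exp_eq _ p (interSet_face X.patch σ i hp))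

/-- The integral family `z` agrees with the real family `r`. -/
def IsRounding (z : IdxFam X.Λ m q (X.base.cart × M → ℤ))
    (r : IdxFam X.Λ m q (X.base.cart × M → ℝ)) : Prop :=
  ∀ σ, ∀ p ∈ interSet X.patch σ.1, (z σ p : ℝ) = r σ p

/-- Continuous functions with integral values are locally constant. Rounding merely turns them into
integer-valued functions; its values off the intersections are irrelevant. -/
lemma exists_isRounding {r : IdxFam X.Λ m q (X.base.cart × M → ℝ)}
    (hc : ∀ σ, ContinuousOn (r σ) (interSet X.patch σ.1))
    (hr : ∀ σ, ∀ p ∈ interSet X.patch σ.1, expHom (r σ p) = 0) :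
    ∃ z, LocConst X.patch z ∧ IsRounding z r ∧ (r.Normalized → z.Normalized) := by
  have hz : ∀ σ, ∀ p ∈ interSet X.patch σ.1, ((round (r σ p) : ℤ) : ℝ) = r σ p := fun σ p hp => by
    obtain ⟨z, hz⟩ := expHom_eq_zero_iff.1 (hr σ p hp)
    rw [← hz, round_intCast]
  refine ⟨fun σ p => round (r σ p), fun σ p hp => ?_, hz, fun hn σ hσ => ?_⟩
  · have h1 := (hc σ).continuousAt ((isOpen_interSet X.isOpen_patch σ.1).mem_nhds hp)
    have h2 := Metric.continuousAt_iff'.1 h1 1 one_pos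
    filter_upwards [h2, (isOpen_interSet X.isOpen_patch σ.1).mem_nhds hp] with y hy hy'
    rw [Real.dist_eq, ← hz σ y hy', ← hz σ p hp] at hy
    have h3 : ((round (r σ y) - round (r σ p) : ℤ) : ℝ) = (round (r σ y) : ℝ) - round (r σ p) := by
      push_cast
      rfl
    rw [← h3, ← Int.cast_abs, ← Int.cast_one, Int.cast_lt, Int.abs_lt_one_iff] at hy
    exact sub_eq_zero.1 hy
  · funext p
    change round (r σ p) = 0
    rw [hn σ hσ]
    exact round_zero

lemma IsRounding.sub {z z' : IdxFam X.Λ m q (X.base.cart × M → ℤ)}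
    {r r' : IdxFam X.Λ m q (X.base.cart × M → ℝ)} (h : IsRounding z r) (h' : IsRounding z' r') :
    IsRounding (z - z') (r - r') := fun σ p hp => by
  simp only [Pi.sub_apply, Int.cast_sub, h σ p hp, h' σ p hp]

lemma IsRounding.add {z z' : IdxFam X.Λ m q (X.base.cart × M → ℤ)}
    {r r' : IdxFam X.Λ m q (X.base.cart × M → ℝ)} (h : IsRounding z r) (h' : IsRounding z' r') :
    IsRounding (z + z') (r + r') := fun σ p hp => by
  simp only [Pi.add_apply, Int.cast_add, h σ p hp, h' σ p hp]

lemma IsRounding.delta {z : IdxFam X.Λ m q (X.base.cart × M → ℤ)}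
    {r : IdxFam X.Λ m q (X.base.cart × M → ℝ)} (h : IsRounding z r) :
    IsRounding z.delta r.delta := fun σ p hp => by
  simp only [IdxFam.delta, Finset.sum_apply, Pi.smul_apply, Int.cast_sum]
  refine Finset.sum_congr rfl fun i _ => ?_
  rw [← h _ p (interSet_face X.patch σ i hp)]
  simp

lemma IsRounding.agreeOn {z z' : IdxFam X.Λ m q (X.base.cart × M → ℤ)}
    {r r' : IdxFam X.Λ m q (X.base.cart × M → ℝ)} (h : IsRounding z r) (h' : IsRounding z' r')
    (hr : r = r') : AgreeOn X.patch z z' := fun σ p hp => by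
  have := (h σ p hp).trans ((congrFun (congrFun hr σ) p).trans (h' σ p hp).symm)
  exact_mod_cast this

/-- Čech cocycles of a covering need not be normalized, so classes are compared after the
normalization has been forgotten. -/
lemma Represents.forget {ι N : Type} [TopologicalSpace N] {W : ι → Set N} {hW : ∀ a, IsOpen (W a)}
    {nrm : Prop} {z : IdxFam ι m (q + 1) (N → ℤ)} {ξ : GodCoh N q}
    (h : Represents W hW nrm z ξ) : Represents W hW False z ξ := by
  have h1 := h.map (W' := W) (hW' := hW) (nrm' := False) False.elim (ContinuousMap.id N) id
    (𝟙 ⦋m⦌) (fun _ _ hy => hy)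
  rw [GodCoh.map_id] at h1
  refine h1.congr False.elim fun σ p _ => ?_
  have e : σ.map id (𝟙 ⦋m⦌) = σ := Prod.ext rfl (Category.comp_id _)
  change z (σ.map id (𝟙 ⦋m⦌)) p = _
  rw [e]

/-- The class of a family of transition functions. -/
def HasClass (g : Fam X m q 0) (ξ : GodCoh (X.base.cart × M) q) : Prop :=
  ∃ h z, IsLog g h ∧ IsRounding z h.delta ∧ Represents X.patch X.isOpen_patch False z ξ

lemma exists_normalized_class {g : Fam X m q 0} (hg : CoeffNatural g) (hn : FamNormalized g)
    (hd : famDelta g = 0) : ∃ (h : IdxFam X.Λ m q (X.base.cart × M → ℝ))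
      (z : IdxFam X.Λ m (q + 1) (X.base.cart × M → ℤ)) (ξ : GodCoh (X.base.cart × M) q),
      IsLog g h ∧ h.Normalized ∧ IsRounding z h.delta ∧
        Represents X.patch X.isOpen_patch True z ξ := by
  obtain ⟨h, hh, hhn⟩ := exists_isLog hg hn
  obtain ⟨z, hl, hz, hzn⟩ := exists_isRounding (IdxFam.continuousOn_delta hh.continuousOn)
    fun σ p hp => hh.expHom_delta hd σ hp
  obtain ⟨ξ, hξ⟩ := exists_represents (hW := X.isOpen_patch) (nrm := True) X.exists_mem_patch
    (fun _ => hzn hhn.delta) hl (hz.delta.agreeOn (z' := 0) (r' := 0) (fun σ p _ => by simp)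
      (IdxFam.delta_delta h))
  exact ⟨h, z, ξ, hh, hhn, hz, hξ⟩

/-- Two systems of logarithms differ by integers `w`, and the two integral cocycles differ by `δ w`.
-/
lemma HasClass.unique {g : Fam X m q 0} {ξ ξ' : GodCoh (X.base.cart × M) q} (h : HasClass g ξ)
    (h' : HasClass g ξ') : ξ = ξ' := by
  obtain ⟨h, z, hh, hz, hξ⟩ := h
  obtain ⟨h', z', hh', hz', hξ'⟩ := h'
  obtain ⟨w, hl, hw, -⟩ := exists_isRounding (r := h - h')
    (fun σ => (hh.continuousOn σ).sub (hh'.continuousOn σ)) fun σ p hp => by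
      change expHom (h σ p - h' σ p) = 0
      rw [map_sub, hh.exp_eq σ p hp, hh'.exp_eq σ p hp, sub_self]
  exact sub_eq_zero.1 ((hξ.sub hξ').eq_zero X.exists_mem_patch False.elim hl
    (hw.delta.agreeOn (hz.sub hz') (IdxFam.delta_sub h h')))

lemma HasClass.add {g g' : Fam X m q 0} {ξ ξ' : GodCoh (X.base.cart × M) q} (h : HasClass g ξ)
    (h' : HasClass g' ξ') : HasClass (g + g') (ξ + ξ') := by
  obtain ⟨h, z, hh, hz, hξ⟩ := h
  obtain ⟨h', z', hh', hz', hξ'⟩ := h'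
  exact ⟨_, _, hh.add hh', by rw [IdxFam.delta_add]; exact hz.add hz', hξ.add hξ'⟩

/-- The continuous map `c × M → d × M` of a morphism in `BD M`. -/
def BD.Hom.totalMap {c d : BD M} (f : c ⟶ d) : C(c.cart × M, d.cart × M) :=
  ⟨BD.Hom.total f, (BD.Hom.contMDiff_total f).continuous⟩

/-- The operator `η` is admitted so that the ends of an edge acquire the class of the edge. -/
lemma HasClass.pull (P : X' ⟶ X) (η : ⦋m'⦌ ⟶ ⦋m⦌) {g : Fam X m q 0} {g' : Fam X' m' q 0}
    (hg : ∀ T (s : CechSimplex X' T ⦋q⦌) θ, g' T s θ = g T (s.push P) (θ ≫ η))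
    {ξ : GodCoh (X.base.cart × M) q} (h : HasClass g ξ) :
    HasClass g' (GodCoh.map (BD.Hom.totalMap (GCov.Hom.hom P)) q ξ) := by
  obtain ⟨h, z, hh, hz, hξ⟩ := h
  have hmem : ∀ a, ∀ p ∈ X'.patch a, BD.Hom.totalMap (GCov.Hom.hom P) p ∈ X.patch (GCov.Hom.idx P a) :=
    GCov.Hom.total_mem P
  refine ⟨fun σ p => h (σ.map (GCov.Hom.idx P) η) (BD.Hom.totalMap (GCov.Hom.hom P) p),
    pullFam (BD.Hom.totalMap (GCov.Hom.hom P)) (GCov.Hom.idx P) η z,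
    ⟨fun σ => ?_, fun σ p hp => ?_⟩, fun σ p hp => ?_, hξ.map id _ _ η hmem⟩
  · exact (hh.continuousOn _).comp (BD.Hom.totalMap (GCov.Hom.hom P)).continuous.continuousOn
      fun p hp i => hmem _ p (hp i)
  · have hp' : BD.Hom.totalMap (GCov.Hom.hom P) p ∈
      interSet X.patch (σ.map (GCov.Hom.idx P) η).1 := fun i => hmem _ p (hp i)
    refine (hh.exp_eq _ _ hp').trans ?_
    rw [circFam, circFam, pointFam_apply _ _ _ hp, pointFam_apply _ _ _ hp', hg]
    rfl
  · refine (hz _ _ fun i => hmem _ p (hp i)).trans ?_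
    simp only [IdxFam.delta, Finset.sum_apply, Pi.smul_apply]
    rfl

end Bockstein

end HigherGerbe

namespace HigherGerbe

/-! ### Classification of gerbes presented over a family of coverings -/

section Classification

open Simplicial Topology

variable {M : Mfd} {n k m q : ℕ} {X : GCov M}

/-- Smooth functions as forms of degree zero. -/
noncomputable def toForm {T : CartFam} (f : T.Total → ℝ) (hf : ContDiff ℝ ∞ f) : vForm T 0 :=
  ⟨fun t => ContinuousAlternatingMap.constOfIsEmpty ℝ (E T.fibDim) (Fin 0) (f t),
    (ContinuousAlternatingMap.constOfIsEmptyLIE ℝ (E T.fibDim) ℝ (Fin 0)).contDiff.comp hf⟩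

/-- The underlying function of a form of degree zero. -/
def formFun {T : CartFam} (w : vForm T 0) (t : T.Total) : ℝ := w.1 t 0

lemma formFun_ext {T : CartFam} {w w' : vForm T 0} (h : ∀ t, formFun w t = formFun w' t) :
    w = w' := by
  ext t v
  rw [Subsingleton.elim v 0]
  exact h t

lemma contDiff_formFun {T : CartFam} (w : vForm T 0) : ContDiff ℝ ∞ (formFun w) :=
  (ContinuousAlternatingMap.constOfIsEmptyLIE ℝ (E T.fibDim) ℝ (Fin 0)).symm.contDiff.comp
    (vForm.contDiff w)

/-- Evaluation of forms of degree zero on a point. -/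
def evalForm : vForm ⟨0, 0⟩ 0 →+ ℝ := AddMonoidHom.mk' (fun w => formFun w (0, 0)) fun _ _ => rfl

/-- The values of a family of forms of degree zero. -/
noncomputable def realFam (w : FormFam X m q 0) : IdxFam X.Λ m q (X.base.cart × M → ℝ) :=
  pointFam (A := fun T => vForm T 0) evalForm w

lemma FormFam.Natural.realFam_apply {w : FormFam X m q 0} (hw : w.Natural) {T : CartFam}
    (s : CechSimplex X T ⦋q⦌) (θ : ⦋q⦌ ⟶ ⦋m⦌) (t : T.Total) :
    realFam w (s.idx, θ) (s.total t) = formFun (w T s θ) t := by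
  have h := hw (T.point t) s θ
  rw [s.res_point] at h
  rw [realFam, pointFam_apply _ _ _ (s.mem_interSet t), h]
  change (w T s θ).1 t _ = (w T s θ).1 t 0
  congr 1
  exact Subsingleton.elim _ _

lemma FormFam.Natural.continuousOn_realFam {w : FormFam X m q 0} (hw : w.Natural)
    (σ : IdxSimplex X.Λ m q) : ContinuousOn (realFam w σ) (interSet X.patch σ.1) := by
  obtain ⟨a, θ⟩ := σ
  rcases X.exists_universal a with h | ⟨T, u, κ, rfl, hκ, hu⟩
  · exact h ▸ continuousOn_empty _
  · rw [continuousOn_iff_continuous_domRestrict]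
    refine ((contDiff_formFun (w T u θ)).continuous.comp hκ).congr fun p => ?_
    have h1 := hw.realFam_apply u θ (κ p)
    rw [hu] at h1
    exact h1.symm

/-- The family of forms of degree zero given by a family of functions. -/
noncomputable def funFam (r : IdxFam X.Λ m q (X.base.cart × M → ℝ))
    (hr : ∀ (T : CartFam) (s : CechSimplex X T ⦋q⦌) (θ : ⦋q⦌ ⟶ ⦋m⦌),
      ContDiff ℝ ∞ fun t => r (s.idx, θ) (s.total t)) : FormFam X m q 0 :=
  fun T s θ => toForm _ (hr T s θ)

variable {r : IdxFam X.Λ m q (X.base.cart × M → ℝ)}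
    {hr : ∀ (T : CartFam) (s : CechSimplex X T ⦋q⦌) (θ : ⦋q⦌ ⟶ ⦋m⦌),
      ContDiff ℝ ∞ fun t => r (s.idx, θ) (s.total t)}

lemma funFam_natural : (funFam r hr).Natural := fun _ _ _ => formFun_ext fun _ => rfl

lemma funFam_normalized (hn : r.Normalized) : FamNormalized (funFam r hr) := by
  intro T s θ i h1 h2
  refine formFun_ext fun t => ?_
  cases q with
  | zero => exact i.elim0
  | succ q => exact congrFun (hn (s.idx, θ) ⟨i, h1, h2⟩) (s.total t)

lemma funFam_delta (h0 : ∀ σ, ∀ p ∈ interSet X.patch σ.1, IdxFam.delta r σ p = 0) :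
    famDelta (funFam r hr) = 0 := by
  funext T s θ
  refine formFun_ext fun t => ?_
  have h := h0 (s.idx, θ) (s.total t) (s.mem_interSet t)
  refine Eq.trans ?_ h
  simp only [famDelta, formFun, AddSubgroup.val_finsetSum, Finset.sum_apply, IdxFam.delta,
    Pi.smul_apply, ContinuousAlternatingMap.sum_apply]
  rfl

/-- The exponential map from forms of degree zero to circle valued functions. -/
noncomputable def expForm (T : CartFam) : vForm T 0 →+ Coeff T 0 :=
  AddMonoidHom.mk' (fun w => show Additive (u1Fun T) from Additive.ofMul
    ⟨fun t => Circle.exp (2 * Real.pi * formFun w t), by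
      change ContDiff ℝ ∞ fun t => (Circle.exp (2 * Real.pi * formFun w t) : ℂ)
      simp only [Circle.coe_exp]
      exact Complex.contDiff_exp.comp ((Complex.ofRealCLM.contDiff.comp
        (contDiff_const.mul (contDiff_formFun w))).mul contDiff_const)⟩) fun w w' =>
    coeffFun_ext fun t => congrArg Additive.toMul (expHom.map_add (formFun w t) (formFun w' t))

/-- The exponential of a family of forms of degree zero. -/
noncomputable def expFam (w : FormFam X m q 0) : Fam X m q 0 := fun T s θ => expForm T (w T s θ)

lemma FormFam.Natural.expFam {w : FormFam X m q 0} (hw : w.Natural) : CoeffNatural (expFam w) :=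
  fun S T f s θ => coeffFun_ext fun t => by
    change (expHom (formFun (w S (s.res f) θ) t)).toMul =
      (expHom (formFun (w T s θ) (CartFam.Hom.total f t))).toMul
    rw [hw f s θ]
    congr 2
    change (w T s θ).1 (CartFam.Hom.total f t) _ = (w T s θ).1 (CartFam.Hom.total f t) 0
    congr 1
    exact Subsingleton.elim _ _

lemma expFam_normalized {w : FormFam X m q 0} (hw : FamNormalized w) : FamNormalized (expFam w) :=
  fun T s θ i h1 h2 => by
    change expForm T (w T s θ) = 0
    rw [hw T s θ i h1 h2, map_zero]

lemma famDelta_expFam (w : FormFam X m q 0) : famDelta (expFam w) = expFam (famDelta w) := by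
  funext T s θ
  refine Eq.symm ((map_sum (expForm T) _ _).trans (Finset.sum_congr rfl fun i _ => ?_))
  rw [map_zsmul]
  rfl

lemma isLog_realFam {w : FormFam X m q 0} (hw : w.Natural) : IsLog (expFam w) (realFam w) where
  continuousOn := hw.continuousOn_realFam
  exp_eq σ p hp := by
    rw [circFam, realFam, pointFam_apply _ _ _ hp, pointFam_apply _ _ _ hp]
    rfl

/-- Every class is the class of transition functions. -/
lemma exists_fam_hasClass (ξ : GodCoh (X.base.cart × M) q) :
    ∃ g : Fam X 0 q 0, CoeffNatural g ∧ FamNormalized g ∧ famDelta g = 0 ∧ HasClass g ξ := by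
  obtain ⟨z, hz, hl, hd⟩ := X.isGood_patch.exists_represents (hW := X.isOpen_patch) (nrm := True) ξ 0
  let r : IdxFam X.Λ 0 (q + 1) (X.base.cart × M → ℝ) := fun σ p => z σ p
  have hzr : IsRounding z r := fun _ _ _ => rfl
  have hr : ∀ (T : CartFam) (s : CechSimplex X T ⦋q + 1⦌) (θ : ⦋q + 1⦌ ⟶ ⦋0⦌),
      ContDiff ℝ ∞ fun t => r (s.idx, θ) (s.total t) := fun T s θ => by
    rw [contDiff_iff_contDiffAt]
    intro t
    refine (contDiffAt_const (c := r (s.idx, θ) (s.total t))).congr_of_eventuallyEq ?_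
    filter_upwards [s.contMDiff_total.continuous.continuousAt.eventually
      (hl (s.idx, θ) (s.total t) (s.mem_interSet t))] with t' ht'
    exact congrArg Int.cast ht'
  have hzn : True → z.Normalized := hz.choose
  have hrn : r.Normalized := fun σ hσ => funext fun p => by
    change ((z σ p : ℤ) : ℝ) = 0
    rw [hzn trivial σ hσ]
    exact Int.cast_zero
  -- The integral cocycle, regarded as a smooth real one, is `δ y` by acyclicity of forms of degree
  -- zero. Then `exp y` is a cocycle, and `y` is a logarithm of it with `δ y = z`.
  obtain ⟨y, hy1, hy2, hy3⟩ := (funFam r hr).acyclic funFam_natural (funFam_normalized hrn)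
    (funFam_delta fun σ p hp => by rw [← hzr.delta σ p hp, hd σ p hp]; exact Int.cast_zero)
  refine ⟨expFam y, hy1.expFam, expFam_normalized hy2, ?_, realFam y, z, isLog_realFam hy1,
    fun σ p hp => ?_, hz.forget⟩
  · rw [famDelta_expFam, hy3]
    funext T s θ
    refine coeffFun_ext fun t => ?_
    exact congrArg Additive.toMul (expHom_eq_zero_iff.2 ⟨z (s.idx, θ) (s.total t), rfl⟩)
  · rw [realFam, pointFam_delta _ _ _ hp, hy3, pointFam_apply _ _ _ hp]
    rfl

/-- Transition functions of trivial class are coboundaries. -/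
lemma HasClass.exists_famDelta {g : Fam X 0 (q + 1) 0} (hg : CoeffNatural g) (hn : FamNormalized g)
    (hd : famDelta g = 0) (h : HasClass g 0) :
    ∃ y : Fam X 0 q 0, CoeffNatural y ∧ FamNormalized y ∧ g = famDelta y := by
  obtain ⟨h', z, ξ, hh, hhn, hz, hξ⟩ := exists_normalized_class hg hn hd
  obtain rfl : ξ = 0 := HasClass.unique ⟨h', z, hh, hz, hξ.forget⟩ h
  obtain ⟨w, hwn, hwl, hwz⟩ := X.isGood_patch.exists_primitive hξ
  let r₀ : IdxFam X.Λ 0 (q + 1) (X.base.cart × M → ℝ) := fun σ p => w σ p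
  have hw0 : IsRounding w r₀ := fun _ _ _ => rfl
  -- Subtracting the integral primitive `w` leaves logarithms `r` of `g` with `δ r = 0`. A smooth
  -- primitive of `r` exponentiates to a primitive of `g`.
  let r : IdxFam X.Λ 0 (q + 1) (X.base.cart × M → ℝ) := h' - r₀
  have hexp : ∀ σ, ∀ p ∈ interSet X.patch σ.1, expHom (r σ p) = circFam g σ p := fun σ p hp => by
    change expHom (h' σ p - w σ p) = _
    rw [map_sub, hh.exp_eq σ p hp, expHom_eq_zero_iff.2 ⟨w σ p, rfl⟩, sub_zero]
  have hexp' : ∀ (T : CartFam) (s : CechSimplex X T ⦋q + 1⦌) (θ : ⦋q + 1⦌ ⟶ ⦋0⦌) (t : T.Total),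
      Circle.exp (2 * Real.pi * r (s.idx, θ) (s.total t)) = coeffFun (g T s θ) t :=
    fun T s θ t => congrArg Additive.toMul ((hexp (s.idx, θ) _ (s.mem_interSet t)).trans
      (hg.circFam_apply s θ t))
  have hr : ∀ (T : CartFam) (s : CechSimplex X T ⦋q + 1⦌) (θ : ⦋q + 1⦌ ⟶ ⦋0⦌),
      ContDiff ℝ ∞ fun t => r (s.idx, θ) (s.total t) := fun T s θ => by
    refine contDiff_of_exp ?_ ?_
    · refine ContinuousOn.comp_continuous (s := interSet X.patch s.idx) ?_
        s.contMDiff_total.continuous s.mem_interSet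
      refine (hh.continuousOn (s.idx, θ)).sub fun p hp => ContinuousAt.continuousWithinAt ?_
      refine (continuousAt_const (y := r₀ (s.idx, θ) p)).congr ?_
      filter_upwards [hwl (s.idx, θ) p hp] with p' hp'
      exact (congrArg Int.cast hp').symm
    · simp only [hexp']
      exact contDiff_coeffFun _
  have hrn : r.Normalized := fun σ hσ => funext fun p => by
    change h' σ p - ((w σ p : ℤ) : ℝ) = 0
    rw [hhn σ hσ, hwn trivial σ hσ]
    simp
  obtain ⟨y, hy1, hy2, hy3⟩ := (funFam r hr).acyclic funFam_natural (funFam_normalized hrn)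
    (funFam_delta fun σ p hp => by
      rw [IdxFam.delta_sub]
      change IdxFam.delta h' σ p - IdxFam.delta r₀ σ p = 0
      rw [← hz σ p hp, ← hw0.delta σ p hp, hwz σ p hp, sub_self])
  refine ⟨expFam y, hy1.expFam, expFam_normalized hy2, ?_⟩
  rw [famDelta_expFam, hy3]
  funext T s θ
  exact coeffFun_ext fun t => (hexp' T s θ t).symm

/-! ### Simplices of gerbes -/

/-- The class of a simplex of gerbes presented over a family of coverings. -/
def SimplexHasClass (v : ((grbCov M n k).obj (op X)).obj (op ⦋m⦌))
    (ξ : GodCoh (X.base.cart × M) (n + 1)) : Prop := HasClass (simplexFam v (n + 1) 0) ξ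

lemma exists_simplexHasClass (v : ((grbCov M n k).obj (op X)).obj (op ⦋m⦌)) :
    ∃ ξ, SimplexHasClass v ξ := by
  obtain ⟨h, z, ξ, hh, -, hz, hξ⟩ := exists_normalized_class
    ((isCocycle_simplexFam v).coeffNatural (n + 1) 0) ((isCocycle_simplexFam v).normalized _ _)
    ((isCocycle_simplexFam v).famDelta_zero _)
  exact ⟨ξ, h, z, hh, hz, hξ.forget⟩

lemma SimplexHasClass.add {v w : ((grbCov M n k).obj (op X)).obj (op ⦋m⦌)}
    {ξ η : GodCoh (X.base.cart × M) (n + 1)} (hv : SimplexHasClass v ξ) (hw : SimplexHasClass w η) :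
    SimplexHasClass (v + w) (ξ + η) := by
  have := HasClass.add hv hw
  have e : simplexFam v (n + 1) 0 + simplexFam w (n + 1) 0 = simplexFam (v + w) (n + 1) 0 :=
    (congrFun (congrFun (simplexFam_add v w) (n + 1)) 0).symm
  rwa [e] at this

lemma SimplexHasClass.pre {Y : GCov M} (P : X ⟶ Y) {v : ((grbCov M n k).obj (op Y)).obj (op ⦋m⦌)}
    {ξ : GodCoh (Y.base.cart × M) (n + 1)} (hv : SimplexHasClass v ξ) :
    SimplexHasClass (((grbCov M n k).map P.op).app _ v)
      (GodCoh.map (BD.Hom.totalMap (GCov.Hom.hom P)) (n + 1) ξ) :=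
  HasClass.pull P (𝟙 ⦋m⦌) (fun T s θ => by
    rw [Category.comp_id]
    exact simplexFam_pre P v (n + 1) 0 T s θ) hv

lemma SimplexHasClass.map {m' : ℕ} (θ : ⦋m'⦌ ⟶ ⦋m⦌)
    {v : ((grbCov M n k).obj (op X)).obj (op ⦋m⦌)} {ξ : GodCoh (X.base.cart × M) (n + 1)}
    (hv : SimplexHasClass v ξ) :
    SimplexHasClass (((grbCov M n k).obj (op X)).map θ.op v) ξ := by
  have h := HasClass.pull (𝟙 X) θ (g' := simplexFam (((grbCov M n k).obj (op X)).map θ.op v) (n + 1) 0)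
    (fun T s η => simplexFam_map θ v (n + 1) 0 T s η) hv
  rwa [show BD.Hom.totalMap (GCov.Hom.hom (𝟙 X)) = ContinuousMap.id _ from rfl,
    GodCoh.map_id] at h

lemma SimplexHasClass.proj {l : ℕ} (h : l ≤ k) {v : ((grbCov M n k).obj (op X)).obj (op ⦋m⦌)}
    {ξ : GodCoh (X.base.cart × M) (n + 1)} (hv : SimplexHasClass v ξ) :
    SimplexHasClass (((grbCovProj M n h).app (op X)).app _ v) ξ := by
  have e : simplexFam (((grbCovProj M n h).app (op X)).app (op ⦋m⦌) v) (n + 1) 0 =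
      simplexFam v (n + 1) 0 := by
    funext T s θ
    exact (simplexFam_post h v (n + 1) 0 T s θ).trans (if_pos (Nat.zero_le l))
  unfold SimplexHasClass
  rwa [e]

/-- Transition functions of the given class form a cocycle for `k = 0`. Forms are then added degree
by degree, which is possible up to degree `n + 1`. -/
lemma exists_vertex_hasClass (hk : k ≤ n + 1) (ξ : GodCoh (X.base.cart × M) (n + 1)) :
    ∃ v : ((grbCov M n k).obj (op X)).obj (op ⦋0⦌), SimplexHasClass v ξ := by
  obtain ⟨g, h1, h2, h3, h4⟩ := exists_fam_hasClass ξ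
  let x : ∀ q p, Fam X 0 q p := Function.update 0 (n + 1) (Function.update 0 0 g)
  have e1 : x (n + 1) 0 = g := by simp [x]
  have e2 : ∀ q p, ¬ (q = n + 1 ∧ p = 0) → x q p = 0 := fun q p h => by
    by_cases hq : q = n + 1
    · subst hq
      have : p ≠ 0 := fun hp => h ⟨rfl, hp⟩
      simp [x, this]
    · simp [x, hq]
  have hx : IsCocycle n 0 x := by
    refine IsCocycle.of_families (fun q p => ?_) (fun q p => ?_) (fun q p h => e2 q p (by omega))
      (fun q => ?_) fun q p h => by omega
    · by_cases h : q = n + 1 ∧ p = 0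
      · obtain ⟨rfl, rfl⟩ := h
        rwa [e1]
      · rw [e2 q p h]
        exact .zero
    · by_cases h : q = n + 1 ∧ p = 0
      · obtain ⟨rfl, rfl⟩ := h
        rwa [e1]
      · rw [e2 q p h]
        exact .zero
    · by_cases h : q = n + 1
      · subst h
        rwa [e1]
      · rw [e2 q 0 (by omega)]
        exact famDelta_zero
  obtain ⟨x', hx', hxx'⟩ := hx.exists_lift (Nat.zero_le k) hk
  refine ⟨hx'.toMap, ?_⟩
  have e : simplexFam hx'.toMap (n + 1) 0 = g := by
    rw [hx'.simplexFam_toMap, hxx' _ _ le_rfl, e1]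
  unfold SimplexHasClass
  rwa [e]

/-- The difference has class zero, so its transition functions are a coboundary; for `k ≤ n` the
whole cocycle then is one, by `IsCocycle.exists_totD`. -/
lemma π₀_mk_eq_of_hasClass (hk : k ≤ n) {v w : ((grbCov M n k).obj (op X)).obj (op ⦋0⦌)}
    {ξ : GodCoh (X.base.cart × M) (n + 1)} (hv : SimplexHasClass v ξ) (hw : SimplexHasClass w ξ) :
    SSet.π₀.mk v = SSet.π₀.mk w := by
  obtain ⟨η, hη⟩ := exists_simplexHasClass (v - w)
  have h1 := hη.add hw
  rw [sub_add_cancel] at h1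
  have h2 : η + ξ = ξ := HasClass.unique h1 hv
  obtain rfl : η = 0 := add_eq_right.1 h2
  have hc := isCocycle_simplexFam (v - w)
  obtain ⟨y₀, hy1, hy2, hy3⟩ := HasClass.exists_famDelta (hc.coeffNatural (n + 1) 0)
    (hc.normalized _ _) (hc.famDelta_zero _) hη
  obtain ⟨y, hy, hy'⟩ := hc.exists_totD hk hy1 hy2 hy3
  refine π₀_mk_eq_of_totD hy ?_
  rw [← hy']
  have e : simplexFam (v - w) = simplexFam v - simplexFam w := simplexFam_sub v w
  rw [e, add_sub_cancel]

end Classification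

end HigherGerbe

namespace HigherGerbe

/-! ### The class of the Bockstein cocycles -/

section BocksteinCocycles

open Simplicial Topology

variable {M : Mfd} {n k : ℕ} {X : GCov M}

lemma ofMul_transition (v : ((grbCov M n k).obj (op X)).obj (op ⦋0⦌)) (a : Fin (n + 2) → X.Λ)
    (p : X.openCover.Inter a) : Additive.ofMul (transition v a p) =
      circFam (simplexFam v (n + 1) 0) (a, SimplexCategory.const ⦋n + 1⦌ ⦋0⦌ 0) p.1 := by
  rw [circFam, pointFam_apply (X := X) (A := fun T => Coeff T 0) _ _ (a, _) p.2]
  rfl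

lemma toZero_eq_const {q : ℕ} (θ : ⦋q⦌ ⟶ ⦋0⦌) : θ = SimplexCategory.const ⦋q⦌ ⦋0⦌ 0 :=
  SimplexCategory.isTerminalZero.hom_ext _ _

/-- The given logarithms, extended by zero, are admissible in `HasClass`, and the class does not
depend on the admissible choice. -/
lemma IsBockstein.cocycleRepresents {v : ((grbCov M n k).obj (op X)).obj (op ⦋0⦌)}
    {x : X.openCover.Cocycle (n + 2)} (hx : IsBockstein v x) {ξ : GodCoh (X.base.cart × M) (n + 1)}
    (hv : SimplexHasClass v ξ) : OpenCover.CocycleRepresents x ξ := by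
  classical
  obtain ⟨h, hexp, hδ⟩ := hx
  let h' : IdxFam X.Λ 0 (n + 1) (X.base.cart × M → ℝ) := fun σ p =>
    if hp : p ∈ interSet X.patch σ.1 then h σ.1 ⟨p, hp⟩ else 0
  have h'_apply : ∀ (σ : IdxSimplex X.Λ 0 (n + 1)) p (hp : p ∈ interSet X.patch σ.1),
      h' σ p = h σ.1 ⟨p, hp⟩ := fun σ p hp => dif_pos hp
  have hlog : IsLog (simplexFam v (n + 1) 0) h' := by
    refine ⟨fun σ => ?_, fun σ p hp => ?_⟩
    · rw [continuousOn_iff_continuous_domRestrict]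
      exact (h σ.1).continuous.congr fun p => (h'_apply σ p.1 p.2).symm
    · obtain ⟨a, θ⟩ := σ
      obtain rfl := toZero_eq_const θ
      rw [h'_apply _ p hp]
      exact (congrArg Additive.ofMul (hexp a ⟨p, hp⟩)).trans (ofMul_transition v a ⟨p, hp⟩)
  have hz : IsRounding (X := X) (X.openCover.extFam x.1) h'.delta := fun σ p hp => by
    rw [X.openCover.extFam_apply x.1 σ p hp, hδ, IdxFam.delta, Finset.sum_apply]
    refine Finset.sum_congr rfl fun i _ => ?_
    rw [Pi.smul_apply, h'_apply _ _ (interSet_face X.patch σ i hp), zsmul_eq_mul]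
    push_cast
    rfl
  obtain ⟨ξ', hξ'⟩ := OpenCover.exists_cocycleRepresents x
  have : ξ' = ξ := HasClass.unique ⟨h', _, hlog, hz, hξ'⟩ hv
  exact this ▸ hξ'

lemma exists_isBockstein (v : ((grbCov M n k).obj (op X)).obj (op ⦋0⦌)) :
    ∃ x, IsBockstein v x := by
  obtain ⟨h, hh, -⟩ := exists_isLog ((isCocycle_simplexFam v).coeffNatural (n + 1) 0)
    ((isCocycle_simplexFam v).normalized _ _)
  obtain ⟨z, hl, hz, -⟩ := exists_isRounding (IdxFam.continuousOn_delta hh.continuousOn)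
    fun σ p hp => hh.expHom_delta ((isCocycle_simplexFam v).famDelta_zero _) σ hp
  have hzd : AgreeOn X.patch (IdxFam.delta z) 0 :=
    hz.delta.agreeOn (z' := 0) (r' := 0) (fun σ p _ => by simp) (IdxFam.delta_delta h)
  have h0 : X.openCover.delta (n + 2) (X.openCover.toCochain z hl) = 0 := by
    refine OpenCover.eq_of_agreeOn ((X.openCover.delta_extFam _).symm.trans
      ((X.openCover.extFam_toCochain z hl).delta.trans ?_))
    rw [OpenCover.extFam_zero]
    exact hzd
  let θ : ∀ q, ⦋q⦌ ⟶ ⦋0⦌ := fun q => SimplexCategory.const _ _ 0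
  refine ⟨⟨X.openCover.toCochain z hl, h0⟩, fun a => ⟨fun p => h (a, θ _) p.1, ?_⟩,
    fun a p => ?_, fun a p => ?_⟩
  · exact continuousOn_iff_continuous_domRestrict.1 (hh.continuousOn (a, θ _))
  · exact congrArg Additive.toMul ((hh.exp_eq (a, θ _) p.1 p.2).trans (ofMul_transition v a p).symm)
  · have h1 := X.openCover.extFam_toCochain z hl (a, θ _) p.1 p.2
    rw [X.openCover.extFam_apply _ (a, θ _) p.1 p.2] at h1
    refine (congrArg Int.cast h1).trans ((hz (a, θ _) p.1 p.2).trans ?_)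
    rw [IdxFam.delta, Finset.sum_apply]
    refine Finset.sum_congr rfl fun i _ => ?_
    refine (zsmul_eq_mul _ _).trans ?_
    push_cast
    exact congrArg (fun r => (-1 : ℝ) ^ (i : ℕ) * r)
      (congrFun (congrArg h (Prod.ext rfl (toZero_eq_const _))) p.1)

lemma IsVertexSum.eq_add {u v w : ((grbCov M n k).obj (op X)).obj (op ⦋0⦌)}
    (h : IsVertexSum u v w) : w = u + v := by
  refine simplexFam_injective ?_
  refine Eq.trans ?_ (simplexFam_add u v).symm
  funext q p T s θ
  obtain rfl := toZero_eq_const θ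
  refine Eq.trans (congrArg (fun e => (delTop n k T q e).1 p) (h T ⦋q⦌ s)) ?_
  rw [map_add]
  rfl

end BocksteinCocycles

/-! ### The classification of gerbes -/

section GerbeClass

open Simplicial Topology

variable {M : Mfd} {n k : ℕ}

lemma totalMap_id (c : BD M) : BD.Hom.totalMap (𝟙 c) = ContinuousMap.id _ := rfl

/-- Classes are natural under morphisms of coverings, so they descend to the Kan extension. -/
lemma exists_vertexClass (M : Mfd) (n k : ℕ) (c : BD M) :
    ∃ ψ : ((grb M n k).obj (op c)).obj (op ⦋0⦌) → GodCoh (c.cart × M) (n + 1),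
      ∀ (X : GCov M) (f : c ⟶ X.base) v ξ, SimplexHasClass (X := X) v ξ →
        ψ (grbMk X f v) = GodCoh.map (BD.Hom.totalMap f) (n + 1) ξ := by
  choose cl hcl using fun (X : GCov M) (v : ((grbCov M n k).obj (op X)).obj (op ⦋0⦌)) =>
    exists_simplexHasClass v
  obtain ⟨ψ, hψ⟩ := exists_grbDesc (n := n) (k := k) (c := c) (Δ := op ⦋0⦌)
    (A := ULift.{1} (GodCoh (c.cart × M) (n + 1)))
    (fun X f v => ULift.up (GodCoh.map (BD.Hom.totalMap f) (n + 1) (cl X v))) fun X Y P f v => by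
      rw [HasClass.unique (hcl X _) ((hcl Y v).pre P)]
      exact congrArg ULift.up (GodCoh.map_comp _ _ _).symm
  refine ⟨fun s => (ψ s).down, fun X f v ξ h => ?_⟩
  refine (congrArg ULift.down (hψ X f v)).trans ?_
  rw [HasClass.unique (hcl X v) h]

/-- The class of a gerbe in the cohomology of `c × M`. -/
noncomputable def grbClass (n k : ℕ) (c : BD M) :
    SSet.π₀ ((grb M n k).obj (op c)) → GodCoh (c.cart × M) (n + 1) :=
  SSet.π₀.lift (exists_vertexClass M n k c).choose fun x₀ x₁ e => by
    have hψ := (exists_vertexClass M n k c).choose_spec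
    -- An edge is presented on one covering and has a class itself, which both of its ends inherit.
    obtain ⟨X, f, v, hv⟩ := exists_grbMk e.edge
    obtain ⟨ξ, hξ⟩ := exists_simplexHasClass v
    have h (i : Fin 2) : ((grb M n k).obj (op c)).δ i e.edge =
        grbMk X f (((grbCov M n k).obj (op X)).map (SimplexCategory.δ i).op v) := by
      rw [← hv]
      exact map_grbMk X f _ v
    have h' (i : Fin 2) : (exists_vertexClass M n k c).choose
        (((grb M n k).obj (op c)).δ i e.edge) = GodCoh.map (BD.Hom.totalMap f) (n + 1) ξ :=
      (congrArg _ (h i)).trans (hψ _ _ _ _ (hξ.map _))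
    exact ((congrArg _ e.src_eq).symm.trans (h' 1)).trans
      ((h' 0).symm.trans (congrArg _ e.tgt_eq))

lemma grbClass_grbMk {c : BD M} {X : GCov M} (f : c ⟶ X.base)
    {v : ((grbCov M n k).obj (op X)).obj (op ⦋0⦌)} {ξ : GodCoh (X.base.cart × M) (n + 1)}
    (h : SimplexHasClass v ξ) : grbClass n k c (SSet.π₀.mk (grbMk X f v)) =
      GodCoh.map (BD.Hom.totalMap f) (n + 1) ξ :=
  (exists_vertexClass M n k c).choose_spec X f v ξ h

lemma gerbeClass_eq_mk {X : GCov M} (v : ((grbCov M n k).obj (op X)).obj (op ⦋0⦌)) :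
    gerbeClass v = SSet.π₀.mk (grbMk X (𝟙 X.base) v) := by
  rw [grbMk_id]
  rfl

lemma grbClass_gerbeClass {X : GCov M} {v : ((grbCov M n k).obj (op X)).obj (op ⦋0⦌)}
    {ξ : GodCoh (X.base.cart × M) (n + 1)} (h : SimplexHasClass v ξ) :
    grbClass n k X.base (gerbeClass v) = ξ := by
  rw [gerbeClass_eq_mk, grbClass_grbMk _ h, totalMap_id, GodCoh.map_id]

lemma grbClass_mapπ₀_grbProj {l : ℕ} (h : l ≤ k) (c : BD M)
    (ζ : SSet.π₀ ((grb M n k).obj (op c))) :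
    grbClass n l c (SSet.mapπ₀ ((grbProj M n h).app (op c)) ζ) = grbClass n k c ζ := by
  obtain ⟨s, rfl⟩ := SSet.π₀.mk_surjective ζ
  obtain ⟨X, f, v, rfl⟩ := exists_grbMk s
  obtain ⟨ξ, hξ⟩ := exists_simplexHasClass v
  rw [SSet.mapπ₀_mk, grbProj_grbMk, grbClass_grbMk f hξ, grbClass_grbMk f (hξ.proj h)]

/-- Components of gerbes presented over a family of coverings give components of gerbes. -/
lemma gerbeClass_congr {X : GCov M} {v w : ((grbCov M n k).obj (op X)).obj (op ⦋0⦌)}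
    (h : SSet.π₀.mk v = SSet.π₀.mk w) :
    SSet.π₀.mk (X := SSet.uliftFunctor.{1, 0}.obj ((grbCov M n k).obj (op X))) (ULift.up v) =
      SSet.π₀.mk (ULift.up w) := by
  let F : SSet.π₀ ((grbCov M n k).obj (op X)) →
      SSet.π₀ (SSet.uliftFunctor.{1, 0}.obj ((grbCov M n k).obj (op X))) :=
    SSet.π₀.lift (fun v => SSet.π₀.mk (ULift.up v)) fun x₀ x₁ e => SSet.π₀.sound
      (SSet.Edge.mk (ULift.up e.edge) (ULift.ext _ _ e.src_eq) (ULift.ext _ _ e.tgt_eq))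
  exact congrArg F h

/-- The intersections of the patches of any `X` are empty or cartesian, so a single covering already
sees all of the cohomology and no refinement is needed. -/
lemma bijective_grbUnit (hk : k ≤ n) (X : GCov M) : Function.Bijective fun ζ =>
    grbClass n k X.base (SSet.mapπ₀ (grbUnit n k X) ζ) := by
  constructor
  · intro ζ ζ' h
    obtain ⟨⟨v⟩, rfl⟩ := SSet.π₀.mk_surjective ζ
    obtain ⟨⟨w⟩, rfl⟩ := SSet.π₀.mk_surjective ζ'
    obtain ⟨ξ, hv⟩ := exists_simplexHasClass v
    obtain ⟨η, hw⟩ := exists_simplexHasClass w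
    obtain rfl : ξ = η :=
      (grbClass_gerbeClass hv).symm.trans (h.trans (grbClass_gerbeClass hw))
    exact gerbeClass_congr (π₀_mk_eq_of_hasClass hk hv hw)
  · intro ξ
    obtain ⟨v, hv⟩ := exists_vertex_hasClass (n := n) (X := X) (Nat.le_succ_of_le hk) ξ
    exact ⟨SSet.π₀.mk (ULift.up v), grbClass_gerbeClass hv⟩

section Nonempty

variable [Nonempty M]

/-- Two gerbes are compared on a common refinement, where equal classes give equal components. -/
lemma grbClass_injective (hk : k ≤ n) (c : BD M) : Function.Injective (grbClass n k c) := by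
  intro ζ ζ' h
  obtain ⟨s, rfl⟩ := SSet.π₀.mk_surjective ζ
  obtain ⟨t, rfl⟩ := SSet.π₀.mk_surjective ζ'
  obtain ⟨X₁, f, v₁, rfl⟩ := exists_grbMk s
  obtain ⟨X₂, g, v₂, rfl⟩ := exists_grbMk t
  obtain ⟨W, P, Q, hP, hQ⟩ := GCov.exists_common_refinement f g
  rw [← grbMk_pre P (𝟙 c) ((Category.id_comp _).trans hP) v₁,
    ← grbMk_pre Q (𝟙 c) ((Category.id_comp _).trans hQ) v₂] at h ⊢
  generalize ((grbCov M n k).map P.op).app (op ⦋0⦌) v₁ = v at *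
  generalize ((grbCov M n k).map Q.op).app (op ⦋0⦌) v₂ = w at *
  obtain ⟨ξ, hv⟩ := exists_simplexHasClass v
  obtain ⟨η, hw⟩ := exists_simplexHasClass w
  have h' : grbClass n k (refineCov c W).base (gerbeClass v) =
      grbClass n k (refineCov c W).base (gerbeClass w) := by
    rw [gerbeClass_eq_mk, gerbeClass_eq_mk]
    exact h
  obtain rfl : ξ = η := (grbClass_gerbeClass hv).symm.trans (h'.trans (grbClass_gerbeClass hw))
  have e := congrArg (SSet.mapπ₀ (grbUnit n k (refineCov c W)))
    (gerbeClass_congr (π₀_mk_eq_of_hasClass hk hv hw))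
  exact (gerbeClass_eq_mk v).symm.trans (e.trans (gerbeClass_eq_mk w))

lemma grbClass_surjective (hk : k ≤ n + 1) (c : BD M) : Function.Surjective (grbClass n k c) := by
  intro ξ
  obtain ⟨v, hv⟩ := exists_vertex_hasClass (n := n) (X := refineCov c (trivialCover (c.cart × M))) hk ξ
  exact ⟨gerbeClass v, grbClass_gerbeClass (X := refineCov c (trivialCover (c.cart × M))) hv⟩

lemma grbClass_bijective (hk : k ≤ n) (c : BD M) : Function.Bijective (grbClass n k c) :=
  ⟨grbClass_injective hk c, grbClass_surjective (Nat.le_succ_of_le hk) c⟩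

/-- The comparison of the Čech cohomology of `M` with the cohomology of `c × M`. -/
noncomputable def cechProdEquiv (M : Mfd) [Nonempty M] (q : ℕ) (c : Cart) :
    cechHSucc M q ≃+ GodCoh (c × M) q :=
  (AddEquiv.ofBijective (cechToGod M q) (hasGoodCovers M).bijective).trans
    (AddEquiv.ofBijective (GodCoh.map (sliceMap c M (Classical.arbitrary c)) q)
      (GodCoh.map_slice_bijective c _)).symm

/-- The equivalence was built from restriction to one slice. This identifies it with pullback along
the projection, which does not involve the chosen point. -/
lemma cechToGod_cechPullback_projM (c : Cart) {q : ℕ} (ξ : cechHSucc M q) :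
    cechToGod (c × M) q (cechPullback (projM c M) q ξ) = cechProdEquiv M q c ξ := by
  rw [cechToGod_cechPullback]
  have h : GodCoh.map (sliceMap c M (Classical.arbitrary c)) q (cechProdEquiv M q c ξ) =
      cechToGod M q ξ :=
    AddEquiv.apply_symm_apply (AddEquiv.ofBijective (GodCoh.map (sliceMap c M
      (Classical.arbitrary c)) q) (GodCoh.map_slice_bijective c _)) _
  rw [← h, GodCoh.map_proj_map_slice]

/-- The identification of the components of gerbes with cohomology. -/
noncomputable def grbCech (n k : ℕ) (c : BD M) (ζ : SSet.π₀ ((grb M n k).obj (op c))) :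
    cechHSucc M (n + 1) := (cechProdEquiv M (n + 1) c.cart).symm (grbClass n k c ζ)

lemma grbCech_add {X : GCov M} {u v w : ((grbCov M n k).obj (op X)).obj (op ⦋0⦌)}
    (h : IsVertexSum u v w) : grbCech n k X.base (gerbeClass w) =
      grbCech n k X.base (gerbeClass u) + grbCech n k X.base (gerbeClass v) := by
  obtain ⟨ξ, hu⟩ := exists_simplexHasClass u
  obtain ⟨η, hv⟩ := exists_simplexHasClass v
  have hw := hu.add hv
  rw [← h.eq_add] at hw
  rw [grbCech, grbCech, grbCech, grbClass_gerbeClass hu, grbClass_gerbeClass hv,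
    grbClass_gerbeClass hw, map_add]

lemma cechPullback_grbCech {X : GCov M} {v : ((grbCov M n k).obj (op X)).obj (op ⦋0⦌)}
    {x : X.openCover.Cocycle (n + 2)} (hx : IsBockstein v x) :
    cechPullback (projM X.base.cart M) (n + 1) (grbCech n k X.base (gerbeClass v)) =
      cechClass X.openCover x := by
  obtain ⟨ξ, hv⟩ := exists_simplexHasClass v
  refine (hasGoodCovers_prod X.base.cart).bijective.1 ?_
  rw [cechToGod_cechPullback_projM, grbCech, AddEquiv.apply_symm_apply, grbClass_gerbeClass hv,
    cechToGod_cechClass, (hx.cocycleRepresents hv).toGodCoh_eq]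

end Nonempty

/-- Both sets of components are identified with the same cohomology group, compatibly with
forgetting forms, since the class only involves the transition functions. For empty `M` both are
empty. -/
lemma isZeroConnected_grbProj (M : Mfd) (n : ℕ) {l k : ℕ} (h : l ≤ k) (hk : k ≤ n) :
    IsZeroConnected (grbProj M n h) := by
  intro c
  rcases isEmpty_or_nonempty M with hM | hM
  · have hE : ∀ k', IsEmpty (SSet.π₀ ((grb M n k').obj (op c))) := fun k' => ⟨fun ζ => by
      obtain ⟨s, rfl⟩ := SSet.π₀.mk_surjective ζ
      exact hM.elim (nonempty_of_grb s).some⟩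
    have := hE k
    have := hE l
    exact ⟨fun a => isEmptyElim a, fun a => isEmptyElim a⟩
  · refine (Function.Bijective.of_comp_iff' (grbClass_bijective (h.trans hk) c) _).1 ?_
    rw [show grbClass n l c ∘ SSet.mapπ₀ ((grbProj M n h).app (op c)) = grbClass n k c from
      funext (grbClass_mapπ₀_grbProj h c)]
    exact grbClass_bijective hk c

end GerbeClass

end HigherGerbe

/-! ### Failure in the top form degree: curvature as an invariant of components. -/

namespace HigherGerbe

/-! ### Curvature -/

section Curvature

open Simplicial Topology

variable {M : Mfd} {n k m p : ℕ} {X Y : GCov M} {c : BD M}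

lemma CechSimplex.ext_total {T : CartFam} {Δ : SimplexCategory} {s s' : CechSimplex X T Δ}
    (h : s.total = s'.total) (h' : s.idx = s'.idx) : s = s' := by
  refine CechSimplex.ext h (funext fun x => ?_) h'
  exact (s.comm (x, 0)).symm.trans ((congrArg Prod.fst (congrFun h (x, 0))).trans (s'.comm (x, 0)))

/-- A closed family of sections on single patches depends only on the underlying map. -/
lemma eq_of_famDelta_eq_zero {F : Fam X m 0 p} (hF : famDelta F = 0) {T : CartFam}
    {s s' : CechSimplex X T ⦋0⦌} (h : s.total = s'.total) (θ θ' : ⦋0⦌ ⟶ ⦋m⦌) :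
    F T s θ = F T s' θ' := by
  have key : ∀ {s s' : CechSimplex X T ⦋0⦌} (_ : s.total = s'.total) (i j : Fin (m + 1)), i ≤ j →
      F T s (SimplexCategory.const _ _ i) = F T s' (SimplexCategory.const _ _ j) := by
    intro s s' h i j hij
    -- The common map together with both patch indices is an edge of the Čech nerve; closedness on
    -- this edge, paired with the edge from `i` to `j` in `Δ[m]`, identifies the two values.
    let S : CechSimplex X T ⦋1⦌ :=
      { s with
        idx := ![s.idx 0, s'.idx 0]
        total_mem := fun i p => by
          fin_cases i
          · exact s.total_mem 0 p
          · exact (congrFun h p) ▸ s'.total_mem 0 p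
        down_mem := fun i x => by
          fin_cases i
          · exact s.down_mem 0 x
          · have h1 := (X.isCartFam _).1 _ (s'.total_mem 0 (x, 0))
            rw [← h, s.comm] at h1
            exact h1 }
    let θ : ⦋1⦌ ⟶ ⦋m⦌ := SimplexCategory.mkOfLe i j hij
    have h0 := congrFun (congrFun (congrFun hF T) S) θ
    have e0 : S.act (SimplexCategory.δ 0) = s' := CechSimplex.ext_total h (funext fun i => by
      obtain rfl : i = (0 : Fin 1) := Subsingleton.elim (α := Fin 1) _ _
      rfl)
    have e1 : S.act (SimplexCategory.δ 1) = s := CechSimplex.ext_total rfl (funext fun i => by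
      obtain rfl : i = (0 : Fin 1) := Subsingleton.elim (α := Fin 1) _ _
      rfl)
    have d0 : SimplexCategory.δ 0 ≫ θ = SimplexCategory.const _ _ j :=
      SimplexCategory.Hom.ext _ _ (OrderHom.ext _ _ (funext fun i => by
        obtain rfl : i = (0 : Fin 1) := Subsingleton.elim (α := Fin 1) _ _
        rfl))
    have d1 : SimplexCategory.δ 1 ≫ θ = SimplexCategory.const _ _ i :=
      SimplexCategory.Hom.ext _ _ (OrderHom.ext _ _ (funext fun i => by
        obtain rfl : i = (0 : Fin 1) := Subsingleton.elim (α := Fin 1) _ _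
        rfl))
    have h1 : famDelta F T S θ = F T (S.act (SimplexCategory.δ 0)) (SimplexCategory.δ 0 ≫ θ) -
        F T (S.act (SimplexCategory.δ 1)) (SimplexCategory.δ 1 ≫ θ) := by
      change ∑ i : Fin 2, _ = _
      rw [Fin.sum_univ_two]
      simp [sub_eq_add_neg]
    rw [h1, e0, e1, d0, d1] at h0
    exact (sub_eq_zero.1 h0).symm
  have hc : ∀ θ : ⦋0⦌ ⟶ ⦋m⦌, ∃ i, θ = SimplexCategory.const _ _ i := fun θ =>
    ⟨θ.toOrderHom 0, SimplexCategory.eq_const_of_zero θ⟩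
  obtain ⟨i, rfl⟩ := hc θ
  obtain ⟨j, rfl⟩ := hc θ'
  rcases le_total i j with hij | hij
  · exact key h i j hij
  · exact (key h.symm j i hij).symm

/-- The family vanishes on the image of a morphism. -/
def VanishesAlong (F : Fam X m 0 p) (f : c ⟶ X.base) : Prop :=
  -- Only maps through `c × M` are tested, because a presentation over `X` enters through a morphism
  -- `f` from `c` to its base.
  ∀ (S : CartFam) (s : CechSimplex X S ⦋0⦌) (θ : ⦋0⦌ ⟶ ⦋m⦌) (t : S.Total → c.cart × M)
    (d : E S.baseDim → c.cart), ContMDiff 𝓘(ℝ, S.Total) (prodModel c.cart M) ∞ t →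
    ContMDiff (𝓡 S.baseDim) (𝓡 c.cart.dim) ∞ d → (∀ x, (t x).1 = d x.1) →
    s.total = BD.Hom.total f ∘ t → F S s θ = 0

lemma exists_cechSimplex_box (X : GCov M) {S : CartFam} {t : S.Total → X.base.cart × M}
    {d : E S.baseDim → X.base.cart} (ht : ContMDiff 𝓘(ℝ, S.Total) (prodModel X.base.cart M) ∞ t)
    (hd : ContMDiff (𝓡 S.baseDim) (𝓡 X.base.cart.dim) ∞ d) (hc : ∀ x, (t x).1 = d x.1)
    (x : S.Total) : ∃ r > 0, ∃ s : CechSimplex X S ⦋0⦌,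
      s.total = t ∘ CartFam.Hom.total (S.box x r) := by
  obtain ⟨a, ha⟩ := X.exists_mem_patch (t x)
  obtain ⟨r, hr, hb⟩ := CartFam.exists_box ((X.isOpen_patch a).preimage ht.continuous) ha
  refine ⟨r, hr, ⟨t ∘ CartFam.Hom.total (S.box x r), d ∘ CartFam.Hom.base (S.box x r),
    ht.comp (S.box x r).contDiff_total.contMDiff, hd.comp (S.box x r).contDiff_base.contMDiff,
    fun y => hc _, fun _ => a, fun _ y => hb y, fun _ y => ?_⟩, rfl⟩
  have h1 := (X.isCartFam a).1 _ (hb (y, 0))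
  rwa [hc] at h1

lemma VanishesAlong.pre {F : Fam Y m 0 p} {F' : Fam X m 0 p} (P : X ⟶ Y)
    (h : ∀ S (s : CechSimplex X S ⦋0⦌) θ, F' S s θ = F S (s.push P) θ) (f : c ⟶ X.base)
    (hF : VanishesAlong F (f ≫ (GCov.forgetCover M).map P)) : VanishesAlong F' f := by
  intro S s θ t d ht hd hc hs
  rw [h]
  refine hF S (s.push P) θ t d ht hd hc ?_
  change BD.Hom.total (GCov.Hom.hom P) ∘ s.total = _
  rw [hs]
  rfl

/-- Vanishing is local: near any point the map, composed into the total space of `X`, lands in one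
patch of `X`. Since the family is closed, the patch used to evaluate it may be exchanged. -/
lemma VanishesAlong.of_pre {F : Fam Y m 0 (p + 1)} {F' : Fam X m 0 (p + 1)} (P : X ⟶ Y)
    (h : ∀ S (s : CechSimplex X S ⦋0⦌) θ, F' S s θ = F S (s.push P) θ) (f : c ⟶ X.base)
    (hn : CoeffNatural F) (hd : famDelta F = 0)
    (hF : VanishesAlong F' f) : VanishesAlong F (f ≫ (GCov.forgetCover M).map P) := by
  intro S s θ t d ht hd' hc hs
  refine Subtype.ext (funext fun x => ?_)
  obtain ⟨r, hr, s', hs'⟩ := exists_cechSimplex_box X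
    ((BD.Hom.contMDiff_total f).comp ht) ((BD.Hom.smooth_base f).comp hd')
    (fun y => congrArg (BD.Hom.base f) (hc y)) x
  have h1 : F' S s' θ = 0 := hF S s' θ (t ∘ CartFam.Hom.total (S.box x r))
    (d ∘ CartFam.Hom.base (S.box x r)) (ht.comp (S.box x r).contDiff_total.contMDiff)
    (hd'.comp (S.box x r).contDiff_base.contMDiff) (fun y => hc _) hs'
  rw [h] at h1
  have h2 : F S (s.res (S.box x r)) θ = 0 := by
    refine (eq_of_famDelta_eq_zero hd ?_ θ θ).trans h1
    change s.total ∘ _ = BD.Hom.total (GCov.Hom.hom P) ∘ s'.total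
    rw [hs, hs']
    rfl
  rw [hn] at h2
  refine eq_of_box (c := x) hr ?_
  have h3 := congrFun (congrArg Subtype.val h2) 0
  have h4 : (vForm.pullback (S.box x r) (p + 1) (F S s θ)).1 0 =
    ((F S s θ : vForm S (p + 1)).1 (CartFam.Hom.total (S.box x r) 0)).compContinuousLinearMap
      (fderiv ℝ (CartFam.Hom.fib (S.box x r) 0) 0) := rfl
  rw [S.box_zero] at h4
  exact h4.symm.trans h3

/-- The curvature of a simplex of gerbes. -/
noncomputable def curv (v : ((grbCov M n (n + 1)).obj (op X)).obj (op ⦋m⦌)) : Fam X m 0 (n + 2) :=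
  famD (simplexFam v 0 (n + 1))

lemma coeffNatural_curv (v : ((grbCov M n (n + 1)).obj (op X)).obj (op ⦋m⦌)) :
    CoeffNatural (curv v) := ((isCocycle_simplexFam v).coeffNatural 0 (n + 1)).famD

lemma famDelta_curv (v : ((grbCov M n (n + 1)).obj (op X)).obj (op ⦋m⦌)) :
    famDelta (curv v) = 0 := by
  rw [curv, ← famD_famDelta, (isCocycle_simplexFam v).famDelta_succ 0 n le_rfl, famD_famD]

/-- Vanishing of the curvature passes to refinements and back, so it is a property of the vertex of
the Kan extension and not of its presentation. -/
lemma exists_flatness (M : Mfd) (n : ℕ) (c : BD M) :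
    ∃ ψ : ((grb M n (n + 1)).obj (op c)).obj (op ⦋0⦌) → Prop,
      ∀ (X : GCov M) (f : c ⟶ X.base) v, ψ (grbMk X f v) ↔ VanishesAlong (curv v) f := by
  obtain ⟨ψ, hψ⟩ := exists_grbDesc (n := n) (k := n + 1) (c := c) (Δ := op ⦋0⦌)
    (A := ULift.{1} Prop) (fun X f v => ULift.up (VanishesAlong (curv v) f))
    fun X Y P f v => congrArg ULift.up (propext
      ⟨fun h => VanishesAlong.of_pre P (fun _ _ _ => rfl) f (coeffNatural_curv v) (famDelta_curv v) h,
        fun h => VanishesAlong.pre P (fun _ _ _ => rfl) f h⟩)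
  exact ⟨fun s => (ψ s).down, fun X f v => Eq.to_iff (congrArg ULift.down (hψ X f v))⟩

/-- Flatness of the components of gerbes with connection data in all degrees. -/
def IsFlat (n : ℕ) (c : BD M) : SSet.π₀ ((grb M n (n + 1)).obj (op c)) → Prop :=
  SSet.π₀.lift (exists_flatness M n c).choose fun x₀ x₁ e => by
    have hψ := (exists_flatness M n c).choose_spec
    obtain ⟨X, f, v, hv⟩ := exists_grbMk e.edge
    have h (i : Fin 2) : ((grb M n (n + 1)).obj (op c)).δ i e.edge =
        grbMk X f (((grbCov M n (n + 1)).obj (op X)).map (SimplexCategory.δ i).op v) := by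
      rw [← hv]
      exact map_grbMk X f _ v
    -- The curvature of an edge is closed and therefore does not depend on the position in `Δ[1]`:
    -- either end is flat exactly when the curvature of the edge vanishes.
    have h' (i : Fin 2) : (exists_flatness M n c).choose
        (((grb M n (n + 1)).obj (op c)).δ i e.edge) ↔ VanishesAlong (curv v) f := by
      refine (Eq.to_iff (congrArg _ (h i))).trans ((hψ _ _ _).trans ?_)
      constructor
      · intro hF S s θ t d ht hd hc hs
        exact (eq_of_famDelta_eq_zero (famDelta_curv v) rfl _ _).trans
          (hF S s (𝟙 _) t d ht hd hc hs)
      · intro hF S s θ t d ht hd hc hs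
        exact hF S s (θ ≫ SimplexCategory.δ i) t d ht hd hc hs
    exact propext ((Eq.to_iff (congrArg _ e.src_eq)).symm.trans ((h' 1).trans
      ((h' 0).symm.trans (Eq.to_iff (congrArg _ e.tgt_eq)))))

lemma isFlat_gerbeClass (v : ((grbCov M n (n + 1)).obj (op X)).obj (op ⦋0⦌)) :
    IsFlat n X.base (gerbeClass v) ↔ VanishesAlong (curv v) (𝟙 X.base) := by
  rw [gerbeClass_eq_mk]
  exact (exists_flatness M n X.base).choose_spec X (𝟙 X.base) v

end Curvature

/-! ### Gerbes on `ℝⁿ⁺²` -/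

section Euclidean

open Simplicial Topology

variable {n : ℕ} {X : GCov (Mfd.euclidean (n + 2))}

/-- The map to `ℝⁿ⁺²` underlying a simplex of the Čech nerve. -/
def CechSimplex.toEuclidean {T : CartFam} {Δ : SimplexCategory} (s : CechSimplex X T Δ) :
    T ⟶ (⟨0, n + 2⟩ : CartFam) :=
  (⟨fun t => (0, (show E (n + 2) from (s.total t).2)), fun _ => 0,
    contDiff_const.prodMk (contMDiff_iff_contDiff.1 (contMDiff_snd.comp s.contMDiff_total)),
    contDiff_const, fun _ => rfl⟩ : CartFam.Hom T ⟨0, n + 2⟩)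

/-- The family of the restrictions of a form on `ℝⁿ⁺²`. -/
noncomputable def euclideanFam (β : Coeff ⟨0, n + 2⟩ (n + 1)) : ∀ q p, Fam X 0 q p :=
  Function.update 0 0 (Function.update 0 (n + 1) fun _ s _ =>
    Coeff.pullback s.toEuclidean (n + 1) β)

variable (β : Coeff ⟨0, n + 2⟩ (n + 1))

lemma euclideanFam_apply {T : CartFam} (s : CechSimplex X T ⦋0⦌) (θ : ⦋0⦌ ⟶ ⦋0⦌) :
    euclideanFam β 0 (n + 1) T s θ = Coeff.pullback s.toEuclidean (n + 1) β := by
  simp [euclideanFam]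

lemma euclideanFam_eq_zero {q p : ℕ} (h : ¬ (q = 0 ∧ p = n + 1)) :
    euclideanFam (X := X) β q p = 0 := by
  by_cases hq : q = 0
  · subst hq
    have : p ≠ n + 1 := fun hp => h ⟨rfl, hp⟩
    simp [euclideanFam, this]
  · simp [euclideanFam, hq]

lemma isCocycle_euclideanFam : IsCocycle n (n + 1) (euclideanFam (X := X) β) := by
  have h0 : famDelta (euclideanFam (X := X) β 0 (n + 1)) = 0 := by
    funext T s θ
    change ∑ i : Fin 2, _ = _
    rw [Fin.sum_univ_two, euclideanFam_apply, euclideanFam_apply]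
    simp only [Fin.val_zero, pow_zero, one_smul, Fin.val_one, pow_one, neg_smul]
    exact add_neg_cancel (Coeff.pullback s.toEuclidean (n + 1) β)
  refine IsCocycle.of_families (fun q p => ?_) (fun q p => ?_)
    (fun q p h => euclideanFam_eq_zero β (by omega)) (fun q => ?_) fun q p hp => ?_
  · by_cases h : q = 0 ∧ p = n + 1
    · obtain ⟨rfl, rfl⟩ := h
      intro S T f s θ
      rw [euclideanFam_apply, euclideanFam_apply]
      exact Coeff.pullback_comp f s.toEuclidean (n + 1) β
    · rw [euclideanFam_eq_zero β h]
      exact .zero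
  · by_cases h : q = 0 ∧ p = n + 1
    · obtain ⟨rfl, rfl⟩ := h
      exact fun T s θ i => i.elim0
    · rw [euclideanFam_eq_zero β h]
      exact .zero
  · rw [euclideanFam_eq_zero β (by omega)]
    exact famDelta_zero
  · rw [euclideanFam_eq_zero β (q := q + 1) (p := p) (by omega)]
    have h1 : famD (0 : Fam X 0 (q + 1) p) = 0 := by
      funext T s θ
      exact map_zero (Coeff.d T p)
    rw [h1]
    by_cases h : q = 0 ∧ p = n
    · obtain ⟨rfl, rfl⟩ := h
      exact h0
    · rw [euclideanFam_eq_zero β (by omega)]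
      exact famDelta_zero

variable (X) in
/-- The topologically trivial gerbe with a globally defined form as top degree connection. -/
noncomputable def euclideanVertex :
    ((grbCov (Mfd.euclidean (n + 2)) n (n + 1)).obj (op X)).obj (op ⦋0⦌) :=
  (isCocycle_euclideanFam β).toMap

lemma simplexFam_euclideanVertex : simplexFam (euclideanVertex X β) = euclideanFam β :=
  (isCocycle_euclideanFam β).simplexFam_toMap

/-- The curvature of the gerbe given by a form is the differential of the form. -/
lemma d_eq_zero_of_isFlat (h : IsFlat n X.base (gerbeClass (euclideanVertex X β))) :
    (Coeff.d ⟨0, n + 2⟩ (n + 1) β : vForm ⟨0, n + 2⟩ (n + 2)).1 0 = 0 := by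
  rw [isFlat_gerbeClass] at h
  let x₀ : X.base.cart := Classical.arbitrary _
  -- The test family is the slice over `x₀`, later shrunk to a box around the origin that fits into
  -- one patch.
  let t : (⟨0, n + 2⟩ : CartFam).Total → X.base.cart × Mfd.euclidean (n + 2) := fun y => (x₀, y.2)
  have ht : ContMDiff 𝓘(ℝ, (⟨0, n + 2⟩ : CartFam).Total)
      (prodModel X.base.cart (Mfd.euclidean (n + 2))) ∞ t :=
    contMDiff_const.prodMk (contMDiff_iff_contDiff.2 contDiff_snd)
  have hd : ContMDiff (𝓡 0) (𝓡 X.base.cart.dim) ∞ fun _ : E 0 => x₀ := contMDiff_const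
  obtain ⟨r, hr, s, hs⟩ := exists_cechSimplex_box X ht hd (fun _ => rfl) 0
  have h1 := h _ s (𝟙 _) _ _
    (ht.comp (CartFam.box ⟨0, n + 2⟩ 0 r).contDiff_total.contMDiff) hd (fun _ => rfl) hs
  have e : s.toEuclidean = CartFam.box ⟨0, n + 2⟩ 0 r := by
    refine CartFam.Hom.ext (funext fun y => Prod.ext (Subsingleton.elim _ _) ?_)
      (funext fun y => Subsingleton.elim _ _)
    change (s.total y).2 = _
    rw [hs]
    rfl
  have h2 : curv (euclideanVertex X β) _ s (𝟙 _) =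
      Coeff.d _ (n + 1) (Coeff.pullback s.toEuclidean (n + 1) β) := by
    rw [← euclideanFam_apply β s (𝟙 _), ← simplexFam_euclideanVertex]
    rfl
  rw [h2, Coeff.pullback_d, e] at h1
  refine eq_of_box (c := (0 : (⟨0, n + 2⟩ : CartFam).Total)) hr ?_
  have h3 := congrFun (congrArg Subtype.val h1) 0
  have h4 : (vForm.pullback (CartFam.box ⟨0, n + 2⟩ 0 r) (n + 2)
      (Coeff.d ⟨0, n + 2⟩ (n + 1) β)).1 0 =
    ((Coeff.d ⟨0, n + 2⟩ (n + 1) β : vForm ⟨0, n + 2⟩ (n + 2)).1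
      (CartFam.Hom.total (CartFam.box ⟨0, n + 2⟩ 0 r) 0)).compContinuousLinearMap
        (fderiv ℝ (CartFam.Hom.fib (CartFam.box ⟨0, n + 2⟩ 0 r) 0) 0) := rfl
  rw [CartFam.box_zero] at h4
  exact h4.symm.trans h3

lemma isFlat_euclideanVertex_zero : IsFlat n X.base (gerbeClass (euclideanVertex X 0)) := by
  rw [isFlat_gerbeClass]
  intro S s θ t d _ _ _ _
  have h : curv (euclideanVertex X 0) S s θ =
      Coeff.d S (n + 1) (Coeff.pullback s.toEuclidean (n + 1) 0) := by
    rw [← euclideanFam_apply 0 s θ, ← simplexFam_euclideanVertex]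
    rfl
  rw [h, map_zero, map_zero]

/-- The determinant as a continuous alternating map. -/
noncomputable def detForm (m : ℕ) : E m [⋀^Fin m]→L[ℝ] ℝ :=
  { (Matrix.detRowAlternating (n := Fin m) (R := ℝ)).compLinearMap
      (WithLp.linearEquiv 2 ℝ (Fin m → ℝ)).toLinearMap with
    cont := by
      change Continuous fun v : Fin m → E m => Matrix.det fun i j => v i j
      exact Continuous.matrix_det (by fun_prop) }

lemma detForm_ne_zero (m : ℕ) : detForm m ≠ 0 := by
  intro h
  have h1 : Matrix.det (fun i j : Fin m => (EuclideanSpace.single i (1 : ℝ) : E m) j) = 0 :=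
    DFunLike.congr_fun h fun i => EuclideanSpace.single i (1 : ℝ)
  have h2 : (fun i j : Fin m => (EuclideanSpace.single i (1 : ℝ) : E m) j) =
      (1 : Matrix (Fin m) (Fin m) ℝ) := by
    ext i j
    simp [Matrix.one_apply, eq_comm]
  rw [h2, Matrix.det_one] at h1
  exact one_ne_zero h1

/-- The form is the volume form contracted with the radial vector field; its differential is `n + 2`
times the volume form. -/
lemma exists_d_ne_zero (n : ℕ) : ∃ β : Coeff ⟨0, n + 2⟩ (n + 1),
    (Coeff.d ⟨0, n + 2⟩ (n + 1) β : vForm ⟨0, n + 2⟩ (n + 2)).1 0 ≠ 0 := by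
  refine ⟨(⟨fun t => (detForm (n + 2)).curryLeft t.2,
    show ContDiff ℝ ∞ _ from (detForm (n + 2)).curryLeft.contDiff.comp contDiff_snd⟩ : vForm ⟨0, n + 2⟩ (n + 1)), ?_⟩
  change extDeriv (fun y => (detForm (n + 2)).curryLeft y) (0 : E (n + 2)) ≠ 0
  rw [extDeriv, ContinuousLinearMap.fderiv,
    ContinuousAlternatingMap.alternatizeUncurryFin_curryLeft]
  intro h
  refine detForm_ne_zero (n + 2) (ContinuousAlternatingMap.ext fun v => ?_)
  have h1 := DFunLike.congr_fun h v
  rw [ContinuousAlternatingMap.smul_apply] at h1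
  exact (smul_eq_zero.1 h1).resolve_left (by omega)

instance (m : ℕ) : Nonempty (Mfd.euclidean m) := ⟨(0 : E m)⟩

/-- The gerbes with trivial transition functions and top form `β`, respectively zero, have the same
class, hence the same image for `l ≤ n`. Their components differ, since flatness of the former would
force `dβ` to vanish at the origin. -/
theorem not_bijective_grbProj_euclidean {n l : ℕ} (h : l ≤ n) (c : BD (Mfd.euclidean (n + 2))) :
    ¬ Function.Bijective (SSet.mapπ₀
      ((grbProj (Mfd.euclidean (n + 2)) n (h.trans n.le_succ)).app (op c))) := by
  intro hb
  obtain ⟨β, hβ⟩ := exists_d_ne_zero n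
  let X := refineCov c (trivialCover (c.cart × Mfd.euclidean (n + 2)))
  obtain ⟨ξ, hξ⟩ := exists_simplexHasClass (euclideanVertex X β)
  have hξ' : SimplexHasClass (euclideanVertex X 0) ξ := by
    unfold SimplexHasClass at hξ ⊢
    rw [simplexFam_euclideanVertex, euclideanFam_eq_zero _ (by omega)] at hξ ⊢
    exact hξ
  have e : gerbeClass (euclideanVertex X β) = gerbeClass (euclideanVertex X 0) := by
    refine hb.1 (grbClass_injective h c ?_)
    exact ((grbClass_mapπ₀_grbProj _ c _).trans (grbClass_gerbeClass hξ)).trans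
      ((grbClass_mapπ₀_grbProj _ c _).trans (grbClass_gerbeClass hξ')).symm
  refine hβ (d_eq_zero_of_isFlat (X := X) β ?_)
  rw [e]
  exact isFlat_euclideanVertex_zero

end Euclidean

end HigherGerbe

theorem mainTheorem8 :
    -- the forgetful maps between the presheaves of gerbes with `k`- and `l`-connection data
    (∀ (M : Mfd) (n l k : ℕ) (h : l ≤ k), k ≤ n →
      IsProjFibrant (grb M n k) ∧ IsProjFibrant (grb M n l) ∧
      IsProjFibration (grbProj M n h) ∧ IsZeroConnected (grbProj M n h)) ∧
    -- the identification of the components with `H^{n+2}(M; ℤ)`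
    (∀ (M : Mfd) [Nonempty M] (n : ℕ),
      ∃ θ : ∀ (k : ℕ) (c : BD M),
          SSet.π₀ ((grb M n k).obj (op c)) → cechHSucc M (n + 1),
        (∀ k ≤ n, ∀ c : BD M, Function.Bijective (θ k c)) ∧
        (∀ (l k : ℕ) (h : l ≤ k), k ≤ n → ∀ (c : BD M) (ξ : SSet.π₀ ((grb M n k).obj (op c))),
          θ l c (SSet.mapπ₀ ((grbProj M n h).app (op c)) ξ) = θ k c ξ) ∧
        ∀ k ≤ n, ∀ X : GCov M,
          Function.Bijective (fun ξ => θ k X.base (SSet.mapπ₀ (grbUnit n k X) ξ)) ∧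
          (∀ u v w, IsVertexSum u v w → θ k X.base (gerbeClass w) =
            θ k X.base (gerbeClass (n := n) u) + θ k X.base (gerbeClass v)) ∧
          ∀ v, (∃ x, IsBockstein v x) ∧ ∀ x, IsBockstein v x →
            cechPullback (projM X.base.cart M) (n + 1) (θ k X.base (gerbeClass v)) =
              cechClass X.openCover x) ∧
    -- the failure for `k = n + 1`
    (∀ (n l : ℕ) (h : l ≤ n), ∀ c : BD (Mfd.euclidean (n + 2)),
      ¬ Function.Bijective (SSet.mapπ₀
        ((grbProj (Mfd.euclidean (n + 2)) n (h.trans n.le_succ)).app (op c)))) := by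
  refine ⟨fun M n l k h hk => ⟨isProjFibrant_grb M n k, isProjFibrant_grb M n l,
    isProjFibration_grbProj M n h (Nat.le_succ_of_le hk), isZeroConnected_grbProj M n h hk⟩,
    fun M _ n => ⟨fun k c => grbCech n k c, fun k hk c => ?_, fun l k h hk c ξ => ?_,
      fun k hk X => ⟨?_, fun u v w h => grbCech_add h, fun v => ⟨exists_isBockstein v, fun x hx =>
        cechPullback_grbCech hx⟩⟩⟩,
    fun n l h c => not_bijective_grbProj_euclidean h c⟩
  · exact (cechProdEquiv M (n + 1) c.cart).symm.bijective.comp (grbClass_bijective hk c)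
  · exact congrArg (cechProdEquiv M (n + 1) c.cart).symm (grbClass_mapπ₀_grbProj h c ξ)
  · exact (cechProdEquiv M (n + 1) X.base.cart).symm.bijective.comp (bijective_grbUnit hk X)
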